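/- **Definitions.** All digraphs are finite, without loops and without multiple arcs. The *directed co-graphs* form the smallest class of digraphs that contains every digraph $(\{v\},\emptyset)$ with a single vertex and that contains, with any two vertex-disjoint digraphs $G_1=(V_1,E_1)$ and $G_2=(V_2,E_2)$, also their disjoint union $(V_1\cup V_2,E_1\cup E_2)$, their order composition (the disjoint union plus all arcs from vertices of $G_1$ to vertices of $G_2$) and their series composition (the disjoint union plus all arcs in both directions between vertices of $G_1$ and vertices of $G_2$). An instance of the *subset sum problem with weak digraph constraint* (SSGW) consists of a set $A$ of $n$ items, a digraph $G=(A,E)$ with $m$ arcs, a size $s_a$ for every item $a\in A$, and a capacity $c$; here $n$, $c$ and all sizes are positive integers. For $y\in A$ let $N^-(y)=\{x\in A : (x,y)\in E\}$ be the set of predecessors of $y$. A set $A'\subseteq A$ is *feasible* if $\sum_{a\in A'}s_a\le c$ and, for every $y\in A$, if $N^-(y)\ne\emptyset$ and $N^-(y)\subseteq A'$, then $y\in A'$. The task is to find a feasible set $A'$ for which $\sum_{a\in A'}s_a$ is maximum. **Theorem.** SSGW on directed co-graphs with $n$ vertices and $m$ arcs can be solved in $O(n\cdot c^4+m)$ time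 and $O(n\cdot c^2)$ space. Precisely: there is one program for a unit-cost random access machine and one constant $K$ such that, for every SSGW instance whose digraph $G$ is a directed co-graph, given as a read-only, randomly accessible input consisting of $n$, $c$, the sizes, and for every vertex the list of its successors and the list of its predecessors in arbitrary order, the program halts after at most $K\,(n c^4+m)$ steps, uses (besides a fixed number of registers) at most $K\,n c^2$ cells of working memory and only numbers smaller than $\bigl(n+c+\sum_{a\in A}s_a\bigr)^K$, and leaves in its memory the characteristic vector of an optimal solution $A'$. -/

import Mathlib

namespace SSGW

/-! ### Digraphs and directed co-graphs -/

/-- A finite digraph `(V, E)` whose vertices are taken from the type `α`: a finite vertex set and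
a finite set of ordered pairs of distinct vertices. -/
@[ext]
structure FinDigraph (α : Type) [DecidableEq α] where
  verts : Finset α
  arcs : Finset (α × α)
  mem_verts : ∀ e ∈ arcs, e.1 ∈ verts ∧ e.2 ∈ verts
  ne_of_mem : ∀ e ∈ arcs, e.1 ≠ e.2

namespace FinDigraph

variable {α : Type} [DecidableEq α]

/-- The set `N⁻(y)` of all predecessors of `y`. -/
def preds (G : FinDigraph α) (y : α) : Finset α :=
  G.verts.filter fun x => (x, y) ∈ G.arcs

/-- The digraph `({v}, ∅)`. -/
def single (v : α) : FinDigraph α where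
  verts := {v}
  arcs := ∅
  mem_verts := by simp
  ne_of_mem := by simp

/-- The disjoint union `G₁ ⊕ G₂` of vertex-disjoint digraphs. -/
def disjointUnion (G₁ G₂ : FinDigraph α) : FinDigraph α where
  verts := G₁.verts ∪ G₂.verts
  arcs := G₁.arcs ∪ G₂.arcs
  mem_verts := by
    intro e he
    rcases Finset.mem_union.1 he with h | h
    · exact ⟨Finset.mem_union_left _ (G₁.mem_verts e h).1,
        Finset.mem_union_left _ (G₁.mem_verts e h).2⟩
    · exact ⟨Finset.mem_union_right _ (G₂.mem_verts e h).1,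
        Finset.mem_union_right _ (G₂.mem_verts e h).2⟩
  ne_of_mem := by
    intro e he
    rcases Finset.mem_union.1 he with h | h
    · exact G₁.ne_of_mem e h
    · exact G₂.ne_of_mem e h

/-- The order composition `G₁ ⊘ G₂` of vertex-disjoint digraphs: the disjoint union plus all arcs
from vertices of `G₁` to vertices of `G₂`. -/
def order (G₁ G₂ : FinDigraph α) (hd : Disjoint G₁.verts G₂.verts) : FinDigraph α where
  verts := G₁.verts ∪ G₂.verts
  arcs := (G₁.arcs ∪ G₂.arcs) ∪ G₁.verts ×ˢ G₂.verts
  mem_verts := by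
    intro e he
    rcases Finset.mem_union.1 he with h | h
    · exact (disjointUnion G₁ G₂).mem_verts e h
    · exact ⟨Finset.mem_union_left _ (Finset.mem_product.1 h).1,
        Finset.mem_union_right _ (Finset.mem_product.1 h).2⟩
  ne_of_mem := by
    intro e he
    rcases Finset.mem_union.1 he with h | h
    · exact (disjointUnion G₁ G₂).ne_of_mem e h
    · exact Finset.disjoint_iff_ne.1 hd _ (Finset.mem_product.1 h).1 _ (Finset.mem_product.1 h).2

/-- The series composition `G₁ ⊗ G₂` of vertex-disjoint digraphs: the disjoint union plus all arcs,
in both directions, between vertices of `G₁` and vertices of `G₂`. -/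
def series (G₁ G₂ : FinDigraph α) (hd : Disjoint G₁.verts G₂.verts) : FinDigraph α where
  verts := G₁.verts ∪ G₂.verts
  arcs := (G₁.arcs ∪ G₂.arcs ∪ G₁.verts ×ˢ G₂.verts) ∪ G₂.verts ×ˢ G₁.verts
  mem_verts := by
    intro e he
    rcases Finset.mem_union.1 he with h | h
    · exact (order G₁ G₂ hd).mem_verts e h
    · exact ⟨Finset.mem_union_right _ (Finset.mem_product.1 h).1,
        Finset.mem_union_left _ (Finset.mem_product.1 h).2⟩
  ne_of_mem := by
    intro e he
    rcases Finset.mem_union.1 he with h | h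
    · exact (order G₁ G₂ hd).ne_of_mem e h
    · exact (Finset.disjoint_iff_ne.1 hd _ (Finset.mem_product.1 h).2 _
        (Finset.mem_product.1 h).1).symm

/-- The class of directed co-graphs: generated from the single-vertex digraphs by disjoint union,
series composition and order composition of vertex-disjoint digraphs. -/
inductive IsDirectedCograph : FinDigraph α → Prop
  | single (v : α) : IsDirectedCograph (single v)
  | disjointUnion (G₁ G₂ : FinDigraph α) (hd : Disjoint G₁.verts G₂.verts) :
      IsDirectedCograph G₁ → IsDirectedCograph G₂ → IsDirectedCograph (disjointUnion G₁ G₂)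
  | series (G₁ G₂ : FinDigraph α) (hd : Disjoint G₁.verts G₂.verts) :
      IsDirectedCograph G₁ → IsDirectedCograph G₂ → IsDirectedCograph (series G₁ G₂ hd)
  | order (G₁ G₂ : FinDigraph α) (hd : Disjoint G₁.verts G₂.verts) :
      IsDirectedCograph G₁ → IsDirectedCograph G₂ → IsDirectedCograph (order G₁ G₂ hd)

end FinDigraph

/-! ### The subset sum problem with weak digraph constraint -/

/-- An instance: items `0, …, n - 1`, a digraph whose vertices are the items, a size for every item
and a capacity; `n`, the sizes and the capacity are positive. -/
structure Instance where
  n : ℕ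
  graph : FinDigraph (Fin n)
  size : Fin n → ℕ
  cap : ℕ
  verts_eq : graph.verts = Finset.univ
  n_pos : 0 < n
  size_pos : ∀ v, 0 < size v
  cap_pos : 0 < cap

namespace Instance

/-- The number of arcs. -/
def m (I : Instance) : ℕ := I.graph.arcs.card

/-- The total size `s(A')`. -/
def total (I : Instance) (A' : Finset (Fin I.n)) : ℕ := ∑ v ∈ A', I.size v

/-- The capacity constraint. -/
def Capacity (I : Instance) (A' : Finset (Fin I.n)) : Prop := I.total A' ≤ I.cap

/-- The weak digraph constraint: an item is chosen if its set of predecessors is nonempty and all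
of its predecessors are chosen. -/
def WeakDigraph (I : Instance) (A' : Finset (Fin I.n)) : Prop :=
  ∀ y, I.graph.preds y ⊆ A' ∧ (I.graph.preds y).Nonempty → y ∈ A'

/-- The feasible solutions. -/
def Feasible (I : Instance) (A' : Finset (Fin I.n)) : Prop := I.Capacity A' ∧ I.WeakDigraph A'

/-- The optimal solutions: feasible solutions of maximum total size. -/
def Optimal (I : Instance) (A' : Finset (Fin I.n)) : Prop :=
  I.Feasible A' ∧ ∀ B, I.Feasible B → I.total B ≤ I.total A'

/-- `succ v` lists the successors of `v`, and `pred v` lists its predecessors, each exactly once and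
in an arbitrary order: an adjacency-list representation of the digraph. -/
structure AdjacencyLists (I : Instance) (succ pred : Fin I.n → List (Fin I.n)) : Prop where
  succ_nodup : ∀ v, (succ v).Nodup
  mem_succ : ∀ v u, u ∈ succ v ↔ (v, u) ∈ I.graph.arcs
  pred_nodup : ∀ v, (pred v).Nodup
  mem_pred : ∀ v u, u ∈ pred v ↔ (u, v) ∈ I.graph.arcs

/-- The input of the algorithm, a list of read-only arrays: row `0` is `[n, c]`, row `1` is the list
of the sizes, row `2 + v` is the list of successors of `v`, row `2 + n + v` is the list of
predecessors of `v`. -/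
def encode (I : Instance) (succ pred : Fin I.n → List (Fin I.n)) : List (List ℕ) :=
  [I.n, I.cap] :: List.ofFn I.size ::
    ((List.ofFn fun v => (succ v).map Fin.val) ++ (List.ofFn fun v => (pred v).map Fin.val))

end Instance

/-! ### The machine model

A random access machine with unit costs. It has a read-only input (a list of arrays, with random
access), a working memory of `cells` many cells `0, …, cells - 1`, and registers, of which every
program uses a fixed finite number. All numbers the machine handles are smaller than `range`.
Programs are written with structured control flow (sequence, branch, loop). -/

/-- The resources of a machine and its input. -/
structure Machine where
  input : List (List ℕ)
  cells : ℕ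
  range : ℕ

/-- The contents of the registers and of the working memory. -/
@[ext]
structure Store where
  reg : ℕ → ℕ
  mem : ℕ → ℕ

/-- Initially everything is `0`. -/
def Store.init : Store := ⟨fun _ => 0, fun _ => 0⟩

/-- The arithmetical operations (`sub` is truncated at `0`, comparisons give `1` or `0`). -/
inductive BinOp
  | add | sub | mul | div | mod | lt | eq

def BinOp.apply : BinOp → ℕ → ℕ → ℕ
  | add, a, b => a + b
  | sub, a, b => a - b
  | mul, a, b => a * b
  | div, a, b => a / b
  | mod, a, b => a % b
  | lt, a, b => if a < b then 1 else 0
  | eq, a, b => if a = b then 1 else 0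

/-- Expressions: constants, registers, the memory cell with a computed address, the entry of the
input in a computed row and column, the length of a computed input row, and operations. -/
inductive Expr
  | lit (k : ℕ)
  | reg (i : ℕ)
  | mem (a : Expr)
  | inp (i j : Expr)
  | len (i : Expr)
  | bin (o : BinOp) (a b : Expr)

/-- A number, if it fits into a machine word. -/
def Machine.word (M : Machine) (v : ℕ) : Option ℕ := if v < M.range then some v else none

/-- The value of an expression; `none` if a number does not fit into a machine word or a memory
address is out of range. Rows and columns that the input does not have read as empty and as `0`. -/
def Expr.eval (M : Machine) (σ : Store) : Expr → Option ℕ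
  | lit k => M.word k
  | reg i => some (σ.reg i)
  | mem a => (a.eval M σ).bind fun x => if x < M.cells then some (σ.mem x) else none
  | inp i j => (i.eval M σ).bind fun x => (j.eval M σ).bind fun y =>
      M.word ((M.input.getD x []).getD y 0)
  | len i => (i.eval M σ).bind fun x => M.word (M.input.getD x []).length
  | bin o a b => (a.eval M σ).bind fun x => (b.eval M σ).bind fun y => M.word (o.apply x y)

/-- The number of elementary operations in the evaluation of an expression. -/
def Expr.cost : Expr → ℕ
  | lit _ => 1
  | reg _ => 1
  | mem a => a.cost + 1
  | inp i j => i.cost + j.cost + 1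
  | len i => i.cost + 1
  | bin _ a b => a.cost + b.cost + 1

/-- Programs. -/
inductive Program
  | skip
  | assign (i : ℕ) (e : Expr)
  | store (a e : Expr)
  | seq (p q : Program)
  | branch (e : Expr) (p q : Program)
  | loop (e : Expr) (p : Program)

/-- `Runs M p σ τ t`: on the machine `M`, the program `p` started with the contents `σ` halts after
`t` elementary steps with the contents `τ`, without leaving the working memory of `M` and without
exceeding its word range. A test succeeds if its value is not `0`. -/
inductive Runs (M : Machine) : Program → Store → Store → ℕ → Prop
  | skip (σ : Store) : Runs M .skip σ σ 1
  | assign {i : ℕ} {e : Expr} {σ : Store} {v : ℕ} (he : e.eval M σ = some v) :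
      Runs M (.assign i e) σ ⟨Function.update σ.reg i v, σ.mem⟩ (e.cost + 1)
  | store {a e : Expr} {σ : Store} {x v : ℕ} (ha : a.eval M σ = some x)
      (hx : x < M.cells) (he : e.eval M σ = some v) :
      Runs M (.store a e) σ ⟨σ.reg, Function.update σ.mem x v⟩ (a.cost + e.cost + 1)
  | seq {p q : Program} {σ τ ρ : Store} {t u : ℕ} (hp : Runs M p σ τ t) (hq : Runs M q τ ρ u) :
      Runs M (.seq p q) σ ρ (t + u)
  | branch_true {e : Expr} {p q : Program} {σ τ : Store} {v t : ℕ} (he : e.eval M σ = some v)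
      (hv : v ≠ 0) (hp : Runs M p σ τ t) : Runs M (.branch e p q) σ τ (e.cost + 1 + t)
  | branch_false {e : Expr} {p q : Program} {σ τ : Store} {t : ℕ} (he : e.eval M σ = some 0)
      (hq : Runs M q σ τ t) : Runs M (.branch e p q) σ τ (e.cost + 1 + t)
  | loop_true {e : Expr} {p : Program} {σ τ ρ : Store} {v t u : ℕ} (he : e.eval M σ = some v)
      (hv : v ≠ 0) (hp : Runs M p σ τ t) (hl : Runs M (.loop e p) τ ρ u) :
      Runs M (.loop e p) σ ρ (e.cost + 1 + t + u)
  | loop_false {e : Expr} {p : Program} {σ : Store} (he : e.eval M σ = some 0) :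
      Runs M (.loop e p) σ σ (e.cost + 1)

/-- Programs are deterministic, so that the result and the running time are well defined. -/
theorem Runs.deterministic {M : Machine} {p : Program} {σ τ τ' : Store} {t t' : ℕ}
    (h : Runs M p σ τ t) (h' : Runs M p σ τ' t') : τ = τ' ∧ t = t' := by
  induction h generalizing τ' t' with
  | skip => cases h'; simp
  | assign he => cases h' with
    | assign he' => simp_all
  | store ha hx he => cases h' with
    | store ha' hx' he' => simp_all
  | seq _ _ ih₁ ih₂ => cases h' with
    | seq hp hq =>
      obtain ⟨rfl, rfl⟩ := ih₁ hp
      obtain ⟨rfl, rfl⟩ := ih₂ hq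
      simp
  | branch_true he hv _ ih => cases h' with
    | branch_true _ _ hp => obtain ⟨rfl, rfl⟩ := ih hp; simp
    | branch_false he' _ => simp_all
  | branch_false he _ ih => cases h' with
    | branch_true he' _ _ => simp_all
    | branch_false _ hq => obtain ⟨rfl, rfl⟩ := ih hq; simp
  | loop_true he hv _ _ ih₁ ih₂ => cases h' with
    | loop_true _ _ hp hl =>
      obtain ⟨rfl, rfl⟩ := ih₁ hp
      obtain ⟨rfl, rfl⟩ := ih₂ hl
      simp
    | loop_false he' => simp_all
  | loop_false he => cases h' with
    | loop_true he' _ _ _ => simp_all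
    | loop_false _ => simp

/-- The set of items that the memory encodes: item `v` is chosen if cell `v` contains `1`. -/
def output (I : Instance) (σ : Store) : Finset (Fin I.n) :=
  Finset.univ.filter fun v => σ.mem v = 1

end SSGW

/-!
# The subset sum problem with weak digraph constraint on directed co-graphs

The input is a digraph without a decomposition, so that the program has to find one in time
`O(n + m)` and then run a dynamic program along it.

*The tree.* Colour a pair of vertices by the number of arcs between them (`0`, `1` or `2`). In a
directed co-graph no triangle has three colours and no two colours form two complementary paths on
four vertices (`no_rainbow`, `no_path`). Such a colouring is represented by a rooted tree with the
vertices as leaves: the colour of two leaves is the label of their lowest common ancestor, and a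
node and its parent have different labels (`IsTree`). The tree is built by inserting one vertex `x`
after the other. A node is mixed if `x` has several colours with the leaves below it. The mixed
nodes form a path from the root, and the siblings of the nodes on it have the colours prescribed by
the labels (`sibling_of_mixed`); hence `x` has to be inserted at the lowest mixed node, whose
children have only two colours, one of which is the label (`lowest_mixed`). If the children of the
other colour are several, they are first separated from the rest by a new node (`target_split`).
All this can be decided from the nodes whose leaves have the same *nonzero* colour with `x`, and
there are only `O(deg x)` of them, as every inner node has at least two children. They are found by
propagating marks upwards from the neighbours of `x` (`propagate`), with time stamps in place of
cleared fields. A mixed node of label `0` without marked children is invisible, but two such nodes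
are not adjacent, so that flagging parents and grandparents leaves exactly the lowest mixed node
(`lowest_of_unflagged`). An extra leaf, which has the colour `3` with everything, keeps the root in
its place.

*The order of the children.* The label `1` does not tell the directions of the arcs. But whenever
there is an arc only from `a` to `b`, then out-degree minus in-degree is larger at `a` than at `b`
(`bal_lt`), so that a counting sort by the degrees sorts the children of all such nodes at once. The
vertices are treated in sorted order, and a node is folded into its parent once all its leaves have
been treated; this turns the tree into a sequence of at most `n` binary disjoint unions, order
compositions and series compositions (`Line`, `climb_spec`).

*The dynamic program.* For every part `S` of the decomposition, every size `s ≤ c` and three modes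
it is recorded whether `S` has a subset of total size `s` that is good in this mode: without any
requirement, with the weak constraint in the digraph induced by `S`, or such that moreover every
vertex without predecessors in `S` is chosen (`Good`). If there are arcs from a part `T` to a part
`S`, the constraint on `S` is void unless `T` is chosen completely, and then it is the one of the
third mode (`good_half`). Whether `T` is chosen completely can be read off from the total size,
because the sizes are positive (`sum_eq_iff`). So a table entry is computed from `c + 1` pairs of
entries (`feas_union`), which takes `O(n c ^ 2)` steps altogether, and going back from the root of
the decomposition to the single vertices yields an optimal solution (`Line.realize`).

*The running time.* The programs are verified with a predicate transformer `wp` that keeps track of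
the elapsed time.
-/

namespace SSGW

open Finset

/-! ### Colours of pairs of vertices in a directed co-graph -/

namespace FinDigraph

variable {α : Type} [DecidableEq α]

/-- The number of arcs between two vertices: `0` (none), `1` (one direction) or `2` (both). -/
def col (G : FinDigraph α) (x y : α) : ℕ :=
  (if (x, y) ∈ G.arcs then 1 else 0) + (if (y, x) ∈ G.arcs then 1 else 0)

/-- `G` is a composition of `G₁` and `G₂` on disjoint vertex sets; all arcs from `G₁` to `G₂` are
present if `f` holds, and all arcs from `G₂` to `G₁` if `b` holds. -/
structure IsComp (G G₁ G₂ : FinDigraph α) (f b : Prop) : Prop where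
  disj : Disjoint G₁.verts G₂.verts
  verts : G.verts = G₁.verts ∪ G₂.verts
  arcs : ∀ x y, (x, y) ∈ G.arcs ↔ (x, y) ∈ G₁.arcs ∨ (x, y) ∈ G₂.arcs ∨
    (f ∧ x ∈ G₁.verts ∧ y ∈ G₂.verts) ∨ (b ∧ x ∈ G₂.verts ∧ y ∈ G₁.verts)
  imp : b → f

/-- The three compositions treated uniformly. -/
@[elab_as_elim]
theorem IsDirectedCograph.induction' {P : FinDigraph α → Prop} (h₁ : ∀ v, P (FinDigraph.single v))
    (h₂ : ∀ G G₁ G₂ f b, IsComp G G₁ G₂ f b → P G₁ → P G₂ → P G) {G : FinDigraph α}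
    (hG : IsDirectedCograph G) : P G := by
  induction hG with
  | single v => exact h₁ v
  | disjointUnion G₁ G₂ hd _ _ i₁ i₂ =>
    exact h₂ _ G₁ G₂ False False ⟨hd, rfl, by simp [FinDigraph.disjointUnion], id⟩ i₁ i₂
  | series G₁ G₂ hd _ _ i₁ i₂ =>
    exact h₂ _ G₁ G₂ True True ⟨hd, rfl, by
      intro x y; simp only [FinDigraph.series, mem_union, mem_product]; tauto, id⟩
      i₁ i₂
  | order G₁ G₂ hd _ _ i₁ i₂ =>
    exact h₂ _ G₁ G₂ True False ⟨hd, rfl, by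
      intro x y; simp only [FinDigraph.order, mem_union, mem_product]; tauto,
      fun h => h.elim⟩ i₁ i₂

theorem col_comm (G : FinDigraph α) (x y : α) : G.col x y = G.col y x := by
  simp only [col]; omega

namespace IsComp

variable {G G₁ G₂ : FinDigraph α} {f b : Prop} (h : IsComp G G₁ G₂ f b)
include h

theorem arc_left {x y : α} (hx : x ∈ G₁.verts) (hy : y ∈ G₁.verts) :
    (x, y) ∈ G.arcs ↔ (x, y) ∈ G₁.arcs := by
  have hx' := disjoint_left.1 h.disj hx
  have hy' := disjoint_left.1 h.disj hy
  have : (x, y) ∉ G₂.arcs := fun hh => hx' (G₂.mem_verts _ hh).1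
  rw [h.arcs]; tauto

theorem arc_right {x y : α} (hx : x ∈ G₂.verts) (hy : y ∈ G₂.verts) :
    (x, y) ∈ G.arcs ↔ (x, y) ∈ G₂.arcs := by
  have hx' := disjoint_right.1 h.disj hx
  have hy' := disjoint_right.1 h.disj hy
  have : (x, y) ∉ G₁.arcs := fun hh => hx' (G₁.mem_verts _ hh).1
  rw [h.arcs]; tauto

theorem arc_left_right {x y : α} (hx : x ∈ G₁.verts) (hy : y ∈ G₂.verts) :
    (x, y) ∈ G.arcs ↔ f := by
  have hx' := disjoint_left.1 h.disj hx
  have hy' := disjoint_right.1 h.disj hy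
  have h1 : (x, y) ∉ G₁.arcs := fun hh => hy' (G₁.mem_verts _ hh).2
  have h2 : (x, y) ∉ G₂.arcs := fun hh => hx' (G₂.mem_verts _ hh).1
  rw [h.arcs]; tauto

theorem arc_right_left {x y : α} (hx : x ∈ G₁.verts) (hy : y ∈ G₂.verts) :
    (y, x) ∈ G.arcs ↔ b := by
  have hx' := disjoint_left.1 h.disj hx
  have hy' := disjoint_right.1 h.disj hy
  have h1 : (y, x) ∉ G₁.arcs := fun hh => hy' (G₁.mem_verts _ hh).1
  have h2 : (y, x) ∉ G₂.arcs := fun hh => hx' (G₂.mem_verts _ hh).2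
  rw [h.arcs]; tauto

theorem col_left {x y : α} (hx : x ∈ G₁.verts) (hy : y ∈ G₁.verts) : G.col x y = G₁.col x y := by
  simp only [col, h.arc_left hx hy, h.arc_left hy hx]

theorem col_right {x y : α} (hx : x ∈ G₂.verts) (hy : y ∈ G₂.verts) :
    G.col x y = G₂.col x y := by
  simp only [col, h.arc_right hx hy, h.arc_right hy hx]

open Classical in
theorem col_cross {x y : α} (hx : x ∈ G₁.verts) (hy : y ∈ G₂.verts) :
    G.col x y = (if f then 1 else 0) + (if b then 1 else 0) := by
  simp only [col, h.arc_left_right hx hy, h.arc_right_left hx hy]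

theorem exists_col_cross : ∃ k, ∀ x ∈ G₁.verts, ∀ y ∈ G₂.verts, G.col x y = k ∧ G.col y x = k :=
  by classical exact ⟨_, fun x hx y hy => ⟨h.col_cross hx hy, by rw [col_comm, h.col_cross hx hy]⟩⟩

theorem mem_or {x : α} (hx : x ∈ G.verts) : x ∈ G₁.verts ∨ x ∈ G₂.verts := by
  rw [h.verts] at hx; exact mem_union.1 hx

end IsComp

/-- No triangle has three different colours. -/
theorem IsDirectedCograph.no_rainbow {G : FinDigraph α} (hG : IsDirectedCograph G) :
    ∀ x ∈ G.verts, ∀ y ∈ G.verts, ∀ z ∈ G.verts, x ≠ y → y ≠ z → x ≠ z →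
      G.col x y = G.col y z ∨ G.col y z = G.col x z ∨ G.col x y = G.col x z := by
  refine IsDirectedCograph.induction' (fun v => ?_) (fun G G₁ G₂ f b h i₁ i₂ => ?_) hG
  · intro x hx y hy _ _ hxy
    simp only [FinDigraph.single, mem_singleton] at hx hy
    exact absurd (hx.trans hy.symm) hxy
  · obtain ⟨k, hk⟩ := h.exists_col_cross
    intro x hx y hy z hz hxy hyz hxz
    rcases h.mem_or hx with hx | hx <;> rcases h.mem_or hy with hy | hy <;>
      rcases h.mem_or hz with hz | hz
    · rw [h.col_left hx hy, h.col_left hy hz, h.col_left hx hz]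
      exact i₁ x hx y hy z hz hxy hyz hxz
    · simp [hk x hx z hz, hk y hy z hz]
    · simp [hk x hx y hy, hk z hz y hy]
    · simp [hk x hx y hy, hk x hx z hz]
    · simp [hk y hy x hx, hk z hz x hx]
    · simp [hk y hy x hx, hk y hy z hz]
    · simp [hk z hz x hx, hk z hz y hy]
    · rw [h.col_right hx hy, h.col_right hy hz, h.col_right hx hz]
      exact i₂ x hx y hy z hz hxy hyz hxz

/-- No colour class is, on four vertices, a path whose complement has a single colour. -/
theorem IsDirectedCograph.no_path {G : FinDigraph α} (hG : IsDirectedCograph G) :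
    ∀ a ∈ G.verts, ∀ b ∈ G.verts, ∀ c ∈ G.verts, ∀ d ∈ G.verts, ∀ s t : ℕ,
      a ≠ b → a ≠ c → a ≠ d → b ≠ c → b ≠ d → c ≠ d →
      G.col a b = s → G.col b c = s → G.col c d = s →
      G.col a c = t → G.col b d = t → G.col a d = t → s = t := by
  refine IsDirectedCograph.induction' (fun v => ?_) (fun G G₁ G₂ f b h i₁ i₂ => ?_) hG
  · intro x hx y hy _ _ _ _ _ _ hxy
    simp only [FinDigraph.single, mem_singleton] at hx hy
    exact absurd (hx.trans hy.symm) hxy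
  · obtain ⟨k, hk⟩ := h.exists_col_cross
    intro a ha b hb c hc d hd s t n1 n2 n3 n4 n5 n6 e1 e2 e3 e4 e5 e6
    rcases h.mem_or ha with ha | ha <;> rcases h.mem_or hb with hb | hb <;>
      rcases h.mem_or hc with hc | hc <;> rcases h.mem_or hd with hd | hd
    · rw [h.col_left ‹_› ‹_›] at e1 e2 e3 e4 e5 e6
      exact i₁ a ha b hb c hc d hd s t n1 n2 n3 n4 n5 n6 e1 e2 e3 e4 e5 e6
    all_goals first
      | (rw [h.col_right ‹_› ‹_›] at e1 e2 e3 e4 e5 e6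
         exact i₂ a ha b hb c hc d hd s t n1 n2 n3 n4 n5 n6 e1 e2 e3 e4 e5 e6)
      | grind

theorem not_arc_self (G : FinDigraph α) (x : α) : (x, x) ∉ G.arcs :=
  fun h => G.ne_of_mem _ h rfl

/-- The one-directional arcs of a directed co-graph form a transitive relation. -/
theorem IsDirectedCograph.asym_trans {G : FinDigraph α} (hG : IsDirectedCograph G) :
    ∀ x ∈ G.verts, ∀ y ∈ G.verts, ∀ z ∈ G.verts, (x, y) ∈ G.arcs → (y, x) ∉ G.arcs →
      (y, z) ∈ G.arcs → (z, y) ∉ G.arcs → (x, z) ∈ G.arcs ∧ (z, x) ∉ G.arcs := by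
  refine IsDirectedCograph.induction' (fun v => ?_) (fun G G₁ G₂ f b h i₁ i₂ => ?_) hG
  · simp [FinDigraph.single]
  · intro x hx y hy z hz
    have hi := h.imp
    rcases h.mem_or hx with hx | hx <;> rcases h.mem_or hy with hy | hy <;>
      rcases h.mem_or hz with hz | hz
    · simp only [h.arc_left hx hy, h.arc_left hy hx, h.arc_left hy hz, h.arc_left hz hy,
        h.arc_left hx hz, h.arc_left hz hx]
      exact i₁ x hx y hy z hz
    · simp only [h.arc_left_right hx hz, h.arc_right_left hx hz, h.arc_left_right hy hz,
        h.arc_right_left hy hz]; tauto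
    · simp only [h.arc_left_right hx hy, h.arc_right_left hx hy, h.arc_left_right hz hy,
        h.arc_right_left hz hy]; tauto
    · simp only [h.arc_left_right hx hy, h.arc_right_left hx hy, h.arc_left_right hx hz,
        h.arc_right_left hx hz]; tauto
    · simp only [h.arc_left_right hy hx, h.arc_right_left hy hx, h.arc_left_right hz hx,
        h.arc_right_left hz hx]; tauto
    · simp only [h.arc_left_right hy hx, h.arc_right_left hy hx, h.arc_left_right hy hz,
        h.arc_right_left hy hz]; tauto
    · simp only [h.arc_left_right hz hx, h.arc_right_left hz hx, h.arc_left_right hz hy,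
        h.arc_right_left hz hy]; tauto
    · simp only [h.arc_right hx hy, h.arc_right hy hx, h.arc_right hy hz, h.arc_right hz hy,
        h.arc_right hx hz, h.arc_right hz hx]
      exact i₂ x hx y hy z hz

/-- Out-degree minus in-degree. -/
def bal (G : FinDigraph α) (x : α) : ℤ :=
  ∑ y ∈ G.verts, ((if (x, y) ∈ G.arcs then 1 else 0) - (if (y, x) ∈ G.arcs then 1 else 0))

theorem abs_bal_lt (G : FinDigraph α) {x : α} (hx : x ∈ G.verts) : |G.bal x| < G.verts.card := by
  rw [bal, ← add_sum_erase _ _ hx]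
  simp only [not_arc_self, if_false, sub_self, zero_add]
  refine (abs_sum_le_sum_abs _ _).trans_lt ?_
  refine (sum_le_card_nsmul _ _ 1 fun y _ => ?_).trans_lt ?_
  · split_ifs <;> simp
  · rw [card_erase_of_mem hx]
    have := card_pos.2 ⟨x, hx⟩
    simp only [nsmul_eq_mul, mul_one]; omega

open Classical in
theorem IsComp.bal_left {G G₁ G₂ : FinDigraph α} {f b : Prop} (h : IsComp G G₁ G₂ f b) {x : α}
    (hx : x ∈ G₁.verts) : G.bal x = G₁.bal x +
      G₂.verts.card * ((if f then 1 else 0) - (if b then 1 else 0)) := by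
  rw [bal, h.verts, sum_union h.disj, bal]
  congr 1
  · exact sum_congr rfl fun y hy => by simp only [h.arc_left hx hy, h.arc_left hy hx]
  · rw [sum_congr rfl (g := fun _ => (if f then (1 : ℤ) else 0) - (if b then 1 else 0))
      fun y hy => by simp only [h.arc_left_right hx hy, h.arc_right_left hx hy]]
    simp only [sum_const, nsmul_eq_mul]

open Classical in
theorem IsComp.bal_right {G G₁ G₂ : FinDigraph α} {f b : Prop} (h : IsComp G G₁ G₂ f b) {x : α}
    (hx : x ∈ G₂.verts) : G.bal x = G₂.bal x -
      G₁.verts.card * ((if f then 1 else 0) - (if b then 1 else 0)) := by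
  rw [bal, h.verts, sum_union h.disj, bal, add_comm, sub_eq_add_neg]
  congr 1
  · exact sum_congr rfl fun y hy => by simp only [h.arc_right hx hy, h.arc_right hy hx]
  · rw [sum_congr rfl (g := fun _ => (if b then (1 : ℤ) else 0) - (if f then 1 else 0))
      fun y hy => by simp only [h.arc_left_right hy hx, h.arc_right_left hy hx]]
    simp only [sum_const, nsmul_eq_mul]
    ring

/-- A one-directional arc leads to a vertex of smaller balance, so that sorting by the balance
recovers the order of the parts of an order composition. -/
theorem IsDirectedCograph.bal_lt {G : FinDigraph α} (hG : IsDirectedCograph G) :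
    ∀ x ∈ G.verts, ∀ y ∈ G.verts, (x, y) ∈ G.arcs → (y, x) ∉ G.arcs → G.bal y < G.bal x := by
  classical
  refine IsDirectedCograph.induction' (fun v => ?_) (fun G G₁ G₂ f b h i₁ i₂ => ?_) hG
  · simp [FinDigraph.single]
  · intro x hx y hy
    have hi := h.imp
    rcases h.mem_or hx with hx | hx <;> rcases h.mem_or hy with hy | hy
    · rw [h.arc_left hx hy, h.arc_left hy hx, h.bal_left hx, h.bal_left hy]
      intro h1 h2; have := i₁ x hx y hy h1 h2; omega
    · rw [h.arc_left_right hx hy, h.arc_right_left hx hy, h.bal_left hx, h.bal_right hy]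
      intro h1 h2
      have := (abs_lt.1 (G₁.abs_bal_lt hx)).1
      have := (abs_lt.1 (G₂.abs_bal_lt hy)).2
      simp only [h1, h2, if_true, if_false]; omega
    · rw [h.arc_left_right hy hx, h.arc_right_left hy hx]; tauto
    · rw [h.arc_right hx hy, h.arc_right hy hx, h.bal_right hx, h.bal_right hy]
      intro h1 h2; have := i₂ x hx y hy h1 h2; omega

end FinDigraph


/-! ### Trees of coloured pairs -/

/-- A symmetric colouring of pairs without three-coloured triangles and without four vertices on
which two colours both form a path: the colourings that are represented by a labelled tree. -/
structure IsUltra (δ : ℕ → ℕ → ℕ) (W : Finset ℕ) : Prop where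
  comm : ∀ a b, δ a b = δ b a
  tri : ∀ a ∈ W, ∀ b ∈ W, ∀ c ∈ W, a ≠ b → b ≠ c → a ≠ c →
    δ a b = δ b c ∨ δ b c = δ a c ∨ δ a b = δ a c
  path : ∀ a ∈ W, ∀ b ∈ W, ∀ c ∈ W, ∀ d ∈ W, ∀ s t : ℕ,
    a ≠ b → a ≠ c → a ≠ d → b ≠ c → b ≠ d → c ≠ d →
    δ a b = s → δ b c = s → δ c d = s → δ a c = t → δ b d = t → δ a d = t → s = t

/-- A rooted tree with nodes `N`, root `r`, leaves `V`, parents `par` and labels `lab`, given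
together with the set `C u` of the leaves below every node `u`. The colour of two leaves below
different children of `u` is `lab u`. Except possibly at the node `e`, no node has the label of its
parent; `e = r` means that there is no exception, since the root has no parent. -/
structure IsTree (δ : ℕ → ℕ → ℕ) (V N : Finset ℕ) (C : ℕ → Finset ℕ) (par lab : ℕ → ℕ)
    (r e : ℕ) : Prop where
  root_mem : r ∈ N
  root_eq : C r = V
  leaf_mem : V ⊆ N
  leaf_eq : ∀ v ∈ V, C v = {v}
  nonempty : ∀ u ∈ N, (C u).Nonempty
  sub : ∀ u ∈ N, C u ⊆ V
  par_mem : ∀ w ∈ N, w ≠ r → par w ∈ N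
  ssub : ∀ w ∈ N, w ≠ r → C w ⊂ C (par w)
  sib : ∀ w ∈ N, w ≠ r → ∀ w' ∈ N, w' ≠ r → par w = par w' → w ≠ w' →
    ∀ a ∈ C w, ∀ b ∈ C w', a ≠ b ∧ δ a b = lab (par w)
  cover : ∀ u ∈ N, u ∉ V → ∀ a ∈ C u, ∃ w ∈ N, w ≠ r ∧ par w = u ∧ a ∈ C w
  canon : ∀ w ∈ N, w ≠ r → w ≠ e → lab w ≠ lab (par w)

/-- The children of a node. -/
def kids (N : Finset ℕ) (par : ℕ → ℕ) (r u : ℕ) : Finset ℕ :=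
  N.filter fun w => w ≠ r ∧ par w = u

theorem mem_kids {N : Finset ℕ} {par : ℕ → ℕ} {r u w : ℕ} :
    w ∈ kids N par r u ↔ w ∈ N ∧ w ≠ r ∧ par w = u := by simp [kids]

namespace IsTree

variable {δ : ℕ → ℕ → ℕ} {V N : Finset ℕ} {C : ℕ → Finset ℕ} {par lab : ℕ → ℕ} {r e : ℕ}
  (h : IsTree δ V N C par lab r e)
include h

theorem par_notMem {w : ℕ} (hw : w ∈ N) (hr : w ≠ r) : par w ∉ V := by
  intro hp
  have h1 := h.ssub w hw hr
  rw [h.leaf_eq _ hp, ssubset_singleton_iff] at h1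
  exact (h.nonempty w hw).ne_empty h1

theorem par_ne {w : ℕ} (hw : w ∈ N) (hr : w ≠ r) : par w ≠ w := by
  intro hp
  have h1 := h.ssub w hw hr
  rw [hp] at h1
  exact h1.ne rfl

/-- One step upwards in the tree. -/
theorem chain {a u : ℕ} (hu : u ∈ N) (ha : a ∈ C u) :
    Relation.ReflTransGen (fun w p => w ∈ N ∧ w ≠ r ∧ par w = p) a u := by
  induction hk : (C u).card using Nat.strong_induction_on generalizing u with
  | _ k ih =>
    by_cases hv : u ∈ V
    · rw [h.leaf_eq u hv, mem_singleton] at ha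
      subst ha; exact .refl
    · obtain ⟨w, hw, hr, rfl, haw⟩ := h.cover u hu hv a ha
      exact (ih _ (hk ▸ card_lt_card (h.ssub w hw hr)) hw haw rfl).tail ⟨hw, hr, rfl⟩

theorem chain_mono {u w : ℕ}
    (hc : Relation.ReflTransGen (fun w p => w ∈ N ∧ w ≠ r ∧ par w = p) u w) : C u ⊆ C w := by
  induction hc with
  | refl => exact subset_rfl
  | tail _ hs ih => obtain ⟨hw, hr, rfl⟩ := hs; exact ih.trans (h.ssub _ hw hr).subset

/-- Two nodes with a common leaf are nested; moreover the larger one contains the parent of the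
smaller one. -/
theorem nested {a u w : ℕ} (hw : w ∈ N) (hu : u ∈ N) (haw : a ∈ C w)
    (hau : a ∈ C u) : C u ⊆ C w ∨ (w ≠ r ∧ C (par w) ⊆ C u) := by
  rcases Relation.ReflTransGen.total_of_right_unique
    (fun a b c (h₁ : a ∈ N ∧ a ≠ r ∧ par a = b) (h₂ : a ∈ N ∧ a ≠ r ∧ par a = c) =>
      h₁.2.2.symm.trans h₂.2.2) (h.chain hw haw) (h.chain hu hau) with h1 | h1
  · rcases h1.cases_head with rfl | ⟨p, ⟨_, hr, rfl⟩, h3⟩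
    · exact Or.inl subset_rfl
    · exact Or.inr ⟨hr, h.chain_mono h3⟩
  · exact Or.inl (h.chain_mono h1)

theorem inj {u w : ℕ} (hu : u ∈ N) (hw : w ∈ N) (huw : C u = C w) : u = w := by
  obtain ⟨a, ha⟩ := h.nonempty u hu
  rcases Relation.ReflTransGen.total_of_right_unique
    (fun a b c (h₁ : a ∈ N ∧ a ≠ r ∧ par a = b) (h₂ : a ∈ N ∧ a ≠ r ∧ par a = c) =>
      h₁.2.2.symm.trans h₂.2.2) (h.chain hw (huw ▸ ha)) (h.chain hu ha) with h1 | h1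
  · rcases h1.cases_head with rfl | ⟨p, ⟨_, hr, rfl⟩, h3⟩
    · rfl
    · exact absurd (huw ▸ h.chain_mono h3) (h.ssub w hw hr).not_subset
  · rcases h1.cases_head with rfl | ⟨p, ⟨_, hr, rfl⟩, h3⟩
    · rfl
    · exact absurd (huw ▸ h.chain_mono h3) (h.ssub u hu hr).not_subset

theorem eq_of_sib {a w w' : ℕ} (hw : w ∈ N) (hr : w ≠ r) (hw' : w' ∈ N) (hr' : w' ≠ r)
    (hp : par w = par w') (ha : a ∈ C w) (ha' : a ∈ C w') : w = w' := by
  by_contra hne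
  exact (h.sib w hw hr w' hw' hr' hp hne a ha a ha').1 rfl

/-- Every inner node has a child that avoids a given child. -/
theorem exists_other {w : ℕ} (hw : w ∈ N) (hr : w ≠ r) :
    ∃ w' ∈ N, w' ≠ r ∧ par w' = par w ∧ w' ≠ w := by
  obtain ⟨a, ha, hna⟩ := exists_of_ssubset (h.ssub w hw hr)
  obtain ⟨w', hw', hr', hp, haw⟩ := h.cover _ (h.par_mem w hw hr) (h.par_notMem hw hr) a ha
  exact ⟨w', hw', hr', hp, fun he => hna (he ▸ haw)⟩

theorem two_le_card_kids {u : ℕ} (hu : u ∈ N) (hV : u ∉ V) : 2 ≤ (kids N par r u).card := by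
  obtain ⟨a, ha⟩ := h.nonempty u hu
  obtain ⟨w, hw, hr, rfl, -⟩ := h.cover u hu hV a ha
  obtain ⟨w', hw', hr', hp, hne⟩ := h.exists_other hw hr
  exact one_lt_card.2 ⟨w', mem_kids.2 ⟨hw', hr', hp⟩, w, mem_kids.2 ⟨hw, hr, rfl⟩, hne⟩

end IsTree

/-- The new vertex `x` has colour `t` with all leaves below `u`. -/
def Uni (δ : ℕ → ℕ → ℕ) (C : ℕ → Finset ℕ) (x u t : ℕ) : Prop := ∀ a ∈ C u, δ x a = t

/-- The new vertex `x` has at least two colours with the leaves below `u`. -/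
def Mixed (δ : ℕ → ℕ → ℕ) (C : ℕ → Finset ℕ) (x u : ℕ) : Prop := ∀ t, ¬ Uni δ C x u t

namespace IsTree

variable {δ : ℕ → ℕ → ℕ} {V N : Finset ℕ} {C : ℕ → Finset ℕ} {par lab : ℕ → ℕ} {r x : ℕ}

theorem uni_unique {e u s t : ℕ} (h : IsTree δ V N C par lab r e) (hu : u ∈ N)
    (h₁ : Uni δ C x u s) (h₂ : Uni δ C x u t) : s = t := by
  obtain ⟨a, ha⟩ := h.nonempty u hu
  rw [← h₁ a ha, h₂ a ha]

theorem mixed_mono {u w : ℕ} (hsub : C u ⊆ C w) (hm : Mixed δ C x u) : Mixed δ C x w :=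
  fun t ht => hm t fun a ha => ht a (hsub ha)

theorem mixed_notMem {e u : ℕ} (h : IsTree δ V N C par lab r e) (hm : Mixed δ C x u) : u ∉ V := by
  intro hu
  refine hm (δ x u) fun a ha => ?_
  rw [h.leaf_eq u hu, mem_singleton] at ha
  rw [ha]

variable (h : IsTree δ V N C par lab r r) (hx : x ∉ V) (hδ : IsUltra δ (insert x V))
include h hx hδ

omit hδ in
theorem ne_new {u a : ℕ} (hu : u ∈ N) (ha : a ∈ C u) : x ≠ a :=
  fun he => hx (he ▸ h.sub u hu ha)

/-- A triangle formed by the new vertex and leaves below different children. -/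
theorem tri_new {w w' a b : ℕ} (hw : w ∈ N) (hr : w ≠ r) (hw' : w' ∈ N) (hr' : w' ≠ r)
    (hp : par w = par w') (hne : w ≠ w') (ha : a ∈ C w) (hb : b ∈ C w') :
    δ x a = lab (par w) ∨ δ x b = lab (par w) ∨ δ x a = δ x b := by
  have h1 := h.sib w hw hr w' hw' hr' hp hne a ha b hb
  rcases hδ.tri x (mem_insert_self _ _) a (mem_insert_of_mem (h.sub w hw ha)) b
    (mem_insert_of_mem (h.sub w' hw' hb)) (h.ne_new hx hw ha) h1.1
    (h.ne_new hx hw' hb) with h2 | h2 | h2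
  · exact Or.inl (h2.trans h1.2)
  · exact Or.inr (Or.inl (h2.symm.trans h1.2))
  · exact Or.inr (Or.inr h2)

/-- Below a mixed node there are a leaf whose colour with `x` is the label and a leaf for which it
is not, below different children. -/
theorem exists_mixed_pair {u : ℕ} (hu : u ∈ N) (hm : Mixed δ C x u) :
    ∃ w ∈ N, w ≠ r ∧ par w = u ∧ ∃ w' ∈ N, w' ≠ r ∧ par w' = u ∧ w ≠ w' ∧ ∃ a ∈ C w, ∃ b ∈ C w',
      δ x a = lab u ∧ δ x b ≠ lab u := by
  have hV := h.mixed_notMem hm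
  have key : ∃ w ∈ N, w ≠ r ∧ par w = u ∧ ∃ w' ∈ N, w' ≠ r ∧ par w' = u ∧ w ≠ w' ∧
      ∃ a ∈ C w, ∃ b ∈ C w', δ x a ≠ δ x b := by
    obtain ⟨a, ha⟩ := h.nonempty u hu
    have : ∃ b ∈ C u, δ x b ≠ δ x a := by
      by_contra! hc; exact hm _ hc
    obtain ⟨b, hb, hab⟩ := this
    obtain ⟨w, hw, hr, hp, haw⟩ := h.cover u hu hV a ha
    obtain ⟨w', hw', hr', hp', hbw⟩ := h.cover u hu hV b hb
    by_cases hww : w = w'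
    · subst hww
      obtain ⟨w₂, hw₂, hr₂, hp₂, hne⟩ := h.exists_other hw hr
      obtain ⟨c, hc⟩ := h.nonempty w₂ hw₂
      by_cases hca : δ x c = δ x a
      · exact ⟨w₂, hw₂, hr₂, hp₂.trans hp, w, hw, hr, hp, hne, c, hc, b, hbw,
          fun he => hab (he ▸ hca)⟩
      · exact ⟨w₂, hw₂, hr₂, hp₂.trans hp, w, hw, hr, hp, hne, c, hc, a, haw, hca⟩
    · exact ⟨w, hw, hr, hp, w', hw', hr', hp', hww, a, haw, b, hbw, hab.symm⟩
  obtain ⟨w, hw, hr, hp, w', hw', hr', hp', hne, a, ha, b, hb, hab⟩ := key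
  rcases h.tri_new hx hδ hw hr hw' hr' (hp.trans hp'.symm) hne ha hb with h1 | h1 | h1
  · rw [hp] at h1
    exact ⟨w, hw, hr, hp, w', hw', hr', hp', hne, a, ha, b, hb, h1, fun h2 => hab (h1.trans h2.symm)⟩
  · rw [hp] at h1
    exact ⟨w', hw', hr', hp', w, hw, hr, hp, hne.symm, b, hb, a, ha, h1,
      fun h2 => hab (h2.trans h1.symm)⟩
  · exact absurd h1 hab

/-- The siblings of a mixed node have the colour prescribed by the label of the parent: otherwise
the new vertex completes a forbidden path. -/
theorem sibling_of_mixed {w w' b : ℕ} (hw : w ∈ N) (hr : w ≠ r) (hw' : w' ∈ N) (hr' : w' ≠ r)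
    (hp : par w' = par w) (hne : w' ≠ w) (hm : Mixed δ C x w) (hb : b ∈ C w') :
    δ x b = lab (par w) := by
  obtain ⟨w₁, hw₁, hr₁, hp₁, w₂, hw₂, hr₂, hp₂, hne₂, a₁, ha₁, a₂, ha₂, e₁, e₂⟩ :=
    h.exists_mixed_pair hx hδ hw hm
  have hs₁ : a₁ ∈ C w := hp₁ ▸ (h.ssub w₁ hw₁ hr₁).subset ha₁
  have hs₂ : a₂ ∈ C w := hp₂ ▸ (h.ssub w₂ hw₂ hr₂).subset ha₂
  obtain ⟨n12, e12⟩ := h.sib w₁ hw₁ hr₁ w₂ hw₂ hr₂ (hp₁.trans hp₂.symm) hne₂ a₁ ha₁ a₂ ha₂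
  obtain ⟨n1b, e1b⟩ := h.sib w hw hr w' hw' hr' hp.symm hne.symm a₁ hs₁ b hb
  obtain ⟨n2b, e2b⟩ := h.sib w hw hr w' hw' hr' hp.symm hne.symm a₂ hs₂ b hb
  have hc := h.canon w hw hr hr
  rw [hp₁] at e12
  by_contra hτ
  have t1 := h.tri_new hx hδ hw hr hw' hr' hp.symm hne.symm hs₁ hb
  have t2 := h.tri_new hx hδ hw hr hw' hr' hp.symm hne.symm hs₂ hb
  have hb' : δ x b = lab w := by
    rcases t1 with t | t | t
    · exact absurd (e₁.symm.trans t) hc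
    · exact absurd t hτ
    · exact t.symm.trans e₁
  have h2 : δ x a₂ = lab (par w) := by
    rcases t2 with t | t | t
    · exact t
    · exact absurd t hτ
    · exact absurd (t.trans hb') e₂
  have m : ∀ {u a}, u ∈ N → a ∈ C u → a ∈ insert x V := fun hu ha =>
    mem_insert_of_mem (h.sub _ hu ha)
  exact hc (hδ.path a₂ (m hw hs₂) a₁ (m hw hs₁) x (mem_insert_self _ _) b (m hw' hb)
    (lab w) (lab (par w)) n12.symm (h.ne_new hx hw hs₂).symm n2b
    (h.ne_new hx hw hs₁).symm n1b (h.ne_new hx hw' hb)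
    (by rw [hδ.comm, e12]) (by rw [hδ.comm, e₁]) hb' (by rw [hδ.comm, h2]) e1b e2b)

/-- At a lowest mixed node, the children have exactly two colours, one of which is the label. -/
theorem lowest_mixed {u : ℕ} (hu : u ∈ N) (hm : Mixed δ C x u)
    (hk : ∀ w ∈ N, w ≠ r → par w = u → ∃ t, Uni δ C x w t) :
    ∃ τ ≠ lab u, (∀ w ∈ N, w ≠ r → par w = u → Uni δ C x w (lab u) ∨ Uni δ C x w τ) ∧
      (∃ w ∈ N, w ≠ r ∧ par w = u ∧ Uni δ C x w (lab u)) ∧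
      (∃ w ∈ N, w ≠ r ∧ par w = u ∧ Uni δ C x w τ) := by
  obtain ⟨w, hw, hr, hp, w', hw', hr', hp', hne, a, ha, b, hb, e₁, e₂⟩ :=
    h.exists_mixed_pair hx hδ hu hm
  have hun : ∀ v ∈ N, v ≠ r → par v = u → ∀ c ∈ C v, Uni δ C x v (δ x c) := by
    intro v hv hvr hvp c hc
    obtain ⟨t, ht⟩ := hk v hv hvr hvp
    rw [ht c hc]; exact ht
  refine ⟨δ x b, e₂, fun v hv hvr hvp => ?_, ⟨w, hw, hr, hp, e₁ ▸ hun w hw hr hp a ha⟩,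
    ⟨w', hw', hr', hp', hun w' hw' hr' hp' b hb⟩⟩
  obtain ⟨c, hc⟩ := h.nonempty v hv
  have hv' := hun v hv hvr hvp c hc
  by_cases hvw : v = w'
  · subst hvw
    exact Or.inr (hun v hv hvr hvp b hb)
  · rcases h.tri_new hx hδ hv hvr hw' hr' (hvp.trans hp'.symm) hvw hc hb with t | t | t
    · rw [hvp] at t; rw [t] at hv'; exact Or.inl hv'
    · rw [hvp] at t; exact absurd t e₂
    · rw [t] at hv'; exact Or.inr hv'

/-- Mixed nodes that have a child of nonzero colour. -/
def Cand (δ : ℕ → ℕ → ℕ) (N : Finset ℕ) (C : ℕ → Finset ℕ) (par : ℕ → ℕ) (r x p : ℕ) : Prop :=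
  p ∈ N ∧ Mixed δ C x p ∧ ∃ w ∈ N, w ≠ r ∧ par w = p ∧ ∃ t ≠ 0, Uni δ C x w t

theorem cand_of_lowest {u : ℕ} (hu : u ∈ N) (hm : Mixed δ C x u)
    (hk : ∀ w ∈ N, w ≠ r → par w = u → ∃ t, Uni δ C x w t) : Cand δ N C par r x u := by
  obtain ⟨τ, hτ, -, ⟨w, hw, hr, hp, h1⟩, ⟨w', hw', hr', hp', h2⟩⟩ := h.lowest_mixed hx hδ hu hm hk
  by_cases h0 : lab u = 0
  · exact ⟨hu, hm, w', hw', hr', hp', τ, h0 ▸ hτ, h2⟩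
  · exact ⟨hu, hm, w, hw, hr, hp, _, h0, h1⟩

theorem cand_of_mixed_child {w : ℕ} (hw : w ∈ N) (hr : w ≠ r) (hm : Mixed δ C x w)
    (h0 : lab (par w) ≠ 0) : Cand δ N C par r x (par w) := by
  obtain ⟨w', hw', hr', hp, hne⟩ := h.exists_other hw hr
  exact ⟨h.par_mem w hw hr, mixed_mono (h.ssub w hw hr).subset hm, w', hw', hr', hp, _, h0,
    fun b hb => h.sibling_of_mixed hx hδ hw hr hw' hr' hp hne hm hb⟩

omit hx hδ in
theorem exists_lowest {u : ℕ} (hu : u ∈ N) (hm : Mixed δ C x u) :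
    ∃ v ∈ N, C v ⊆ C u ∧ Mixed δ C x v ∧ ∀ w ∈ N, w ≠ r → par w = v → ∃ t, Uni δ C x w t := by
  induction hk : (C u).card using Nat.strong_induction_on generalizing u with
  | _ k ih =>
    by_cases hall : ∀ w ∈ N, w ≠ r → par w = u → ∃ t, Uni δ C x w t
    · exact ⟨u, hu, subset_rfl, hm, hall⟩
    · push Not at hall
      obtain ⟨w, hw, hr, rfl, hwm⟩ := hall
      obtain ⟨v, hv, hs, h1, h2⟩ := ih _ (hk ▸ card_lt_card (h.ssub w hw hr)) hw hwm rfl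
      exact ⟨v, hv, hs.trans (h.ssub w hw hr).subset, h1, h2⟩

/-- A candidate that is neither the parent nor the grandparent of a candidate is a lowest mixed
node: along the path of mixed nodes, the label `0` does not occur twice in a row. -/
theorem lowest_of_unflagged {u : ℕ} (hu : Cand δ N C par r x u)
    (hf : ∀ p, Cand δ N C par r x p → u ≠ par p ∧ u ≠ par (par p)) :
    ∀ w ∈ N, w ≠ r → par w = u → ∃ t, Uni δ C x w t := by
  classical
  by_contra hcon
  push Not at hcon
  obtain ⟨w, hw, hr, hp, hm⟩ := hcon
  obtain ⟨v, hv, hvs, hvm, hvk⟩ := h.exists_lowest hw hm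
  have hvu : C v ⊂ C u := lt_of_le_of_lt hvs (hp ▸ h.ssub w hw hr)
  have hne : (N.filter fun p => Cand δ N C par r x p ∧ C p ⊂ C u).Nonempty :=
    ⟨v, mem_filter.2 ⟨hv, h.cand_of_lowest hx hδ hv hvm hvk, hvu⟩⟩
  obtain ⟨p, hpm, hmax⟩ := exists_max_image _ (fun p => (C p).card) hne
  obtain ⟨hpN, hpc, hpu⟩ := mem_filter.1 hpm
  have up : ∀ q ∈ N, Mixed δ C x q → C p ⊆ C q → C q ⊂ C u → q ≠ r ∧ C (par q) ⊆ C u := by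
    intro q hq _ hpq hqu
    obtain ⟨a, ha⟩ := h.nonempty p hpN
    rcases h.nested hq hu.1 (hpq ha) (hqu.subset (hpq ha)) with h1 | h1
    · exact absurd h1 hqu.not_subset
    · exact h1
  obtain ⟨hpr, h1⟩ := up p hpN hpc.2.1 subset_rfl hpu
  have hpp := h.par_mem p hpN hpr
  have h2 : C (par p) ⊂ C u := h1.ssubset_of_ne fun he => (hf p hpc).1 (h.inj hu.1 hpp he.symm)
  have hmp := mixed_mono (h.ssub p hpN hpr).subset hpc.2.1
  have hpq := h.ssub p hpN hpr
  have h0 : lab (par p) = 0 := by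
    by_contra h0
    have hc := h.cand_of_mixed_child hx hδ hpN hpr hpc.2.1 h0
    exact absurd (hmax (par p) (mem_filter.2 ⟨hpp, hc, h2⟩))
      (not_le.2 (card_lt_card hpq))
  obtain ⟨hqr, h3⟩ := up (par p) hpp hmp hpq.subset h2
  have hqq := h.par_mem _ hpp hqr
  have h4 : C (par (par p)) ⊂ C u :=
    h3.ssubset_of_ne fun he => (hf p hpc).2 (h.inj hu.1 hqq he.symm)
  have hc := h.cand_of_mixed_child hx hδ hpp hqr hmp (h0 ▸ (h.canon _ hpp hqr hqr).symm)
  exact absurd (hmax _ (mem_filter.2 ⟨hqq, hc, h4⟩))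
    (not_le.2 (card_lt_card (hpq.trans (h.ssub _ hpp hqr))))

/-- There is a candidate that is neither the parent nor the grandparent of a candidate. -/
theorem exists_unflagged (hm : Mixed δ C x r) (hr₁ : par r ∉ N)
    (hr₂ : ¬ Mixed δ C x (par (par r))) :
    ∃ u, Cand δ N C par r x u ∧ ∀ p, Cand δ N C par r x p → u ≠ par p ∧ u ≠ par (par p) := by
  obtain ⟨u, hu, -, hum, huk⟩ := h.exists_lowest h.root_mem hm
  refine ⟨u, h.cand_of_lowest hx hδ hu hum huk, fun p hp => ?_⟩
  have key : ∀ q ∈ N, Mixed δ C x q → q ≠ r → u ≠ par q := by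
    intro q hq hqm hqr he
    obtain ⟨t, ht⟩ := huk q hq hqr he.symm
    exact hqm t ht
  by_cases hpr : p = r
  · subst hpr
    exact ⟨fun he => hr₁ (he ▸ hu), fun he => hr₂ (he ▸ hum)⟩
  · refine ⟨key p hp.1 hp.2.1 hpr, ?_⟩
    have hpm := mixed_mono (h.ssub p hp.1 hpr).subset hp.2.1
    by_cases hqr : par p = r
    · rw [hqr]; exact fun he => hr₁ (he ▸ hu)
    · exact key _ (h.par_mem p hp.1 hpr) hpm hqr

end IsTree


/-! ### Inserting a vertex into a tree -/

namespace IsTree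

variable {δ : ℕ → ℕ → ℕ} {V N : Finset ℕ} {C : ℕ → Finset ℕ} {par lab par' lab' : ℕ → ℕ}
  {r e x : ℕ}

/-- Collecting a set `Bs` of children of `u` below a new node. Of the two nodes `u` and `z`, the
upper one is `hi`, and `lo` is the parent of the nodes in `Bs`. -/
theorem split (h : IsTree δ V N C par lab r r) {u z hi lo : ℕ} (hu : u ∈ N) {Bs : Finset ℕ}
    (hB : Bs ⊆ kids N par r u) (hB2 : 2 ≤ Bs.card) (hA : ∃ w ∈ kids N par r u, w ∉ Bs)
    (hδ : ∀ a b, δ a b = δ b a)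
    (hz : z ∉ N) (hio : hi = u ∧ lo = z ∨ hi = z ∧ lo = u ∧ u ≠ r)
    (pB : ∀ w ∈ Bs, par' w = lo) (pA : ∀ w ∈ kids N par r u, w ∉ Bs → par' w = hi)
    (plo : par' lo = hi) (phi : hi ≠ r → par' hi = par u)
    (pw : ∀ w ∈ N, w ≠ r → w ≠ u → par w ≠ u → par' w = par w)
    (lhi : lab' hi = lab u) (llo : lab' lo = lab u) (lw : ∀ w ∈ N, w ≠ u → lab' w = lab w) :
    IsTree δ V (insert z N)
      (fun w => if w = hi then C u else if w = lo then Bs.biUnion C else C w) par' lab' r lo := by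
  have hB' : ∀ w ∈ Bs, w ∈ N ∧ w ≠ r ∧ par w = u := fun w hw => mem_kids.1 (hB hw)
  obtain ⟨v₀, hv₀, hv₀B⟩ := hA
  obtain ⟨hv₀N, hv₀r, rfl⟩ := mem_kids.1 hv₀
  generalize hue : par v₀ = u at *
  have huV : u ∉ V := hue ▸ h.par_notMem hv₀N hv₀r
  have hzV : z ∉ V := fun hh => hz (h.leaf_mem hh)
  have huz : u ≠ z := fun hh => hz (hh ▸ hu)
  have hzr : z ≠ r := fun hh => hz (hh ▸ h.root_mem)
  have hhl : hi ≠ lo := by rcases hio with ⟨rfl, rfl⟩ | ⟨rfl, rfl, -⟩ <;> [exact huz; exact huz.symm]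
  have hlr : lo ≠ r := by rcases hio with ⟨rfl, rfl⟩ | ⟨rfl, rfl, hh⟩ <;> [exact hzr; exact hh]
  have hhir : hi = r → u = r := by
    rcases hio with ⟨rfl, rfl⟩ | ⟨rfl, rfl, hh⟩ <;> [exact id; exact fun h => absurd h hzr]
  have hhiN : hi ∈ insert z N := by
    rcases hio with ⟨rfl, rfl⟩ | ⟨rfl, rfl, hh⟩ <;> simp [hu]
  have hloN : lo ∈ insert z N := by
    rcases hio with ⟨rfl, rfl⟩ | ⟨rfl, rfl, hh⟩ <;> simp [hu]
  have hhV : hi ∉ V := by rcases hio with ⟨rfl, rfl⟩ | ⟨rfl, rfl, hh⟩ <;> assumption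
  have hlV : lo ∉ V := by rcases hio with ⟨rfl, rfl⟩ | ⟨rfl, rfl, hh⟩ <;> assumption
  have hN : ∀ w ∈ N, w ≠ u → w ≠ hi ∧ w ≠ lo := by
    intro w hw hwu
    have : w ≠ z := fun hh => hz (hh ▸ hw)
    rcases hio with ⟨rfl, rfl⟩ | ⟨rfl, rfl, hh⟩ <;> exact ⟨by assumption, by assumption⟩
  have hcas : ∀ w ∈ insert z N, w = hi ∨ w = lo ∨ (w ∈ N ∧ w ≠ u) := by
    intro w hw
    rcases mem_insert.1 hw with rfl | hw
    · rcases hio with ⟨rfl, rfl⟩ | ⟨rfl, rfl, hh⟩ <;> simp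
    · by_cases hwu : w = u
      · subst hwu
        rcases hio with ⟨rfl, rfl⟩ | ⟨rfl, rfl, hh⟩ <;> simp
      · exact Or.inr (Or.inr ⟨hw, hwu⟩)
  have hkid : ∀ w ∈ N, w ≠ r → par w = u → w ≠ u := fun w hw hr hp he =>
    h.par_ne hw hr (hp.trans he.symm)
  set C' : ℕ → Finset ℕ := fun w => if w = hi then C u else if w = lo then Bs.biUnion C else C w
    with hC'
  have Chi : C' hi = C u := by simp [hC']
  have Clo : C' lo = Bs.biUnion C := by simp [hC', hhl.symm]
  have Cw : ∀ w ∈ N, w ≠ u → C' w = C w := by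
    intro w hw hwu; obtain ⟨h1, h2⟩ := hN w hw hwu; simp [hC', h1, h2]
  have hBne : Bs.Nonempty := card_pos.1 (by omega)
  have hBsub : ∀ w ∈ Bs, C w ⊆ C u := fun w hw => (hB' w hw).2.2 ▸ (h.ssub w (hB' w hw).1
    (hB' w hw).2.1).subset
  have hUsub : Bs.biUnion C ⊆ C u := biUnion_subset.2 hBsub
  have hdis : ∀ w ∈ kids N par r u, w ∉ Bs → ∀ a ∈ C w, ∀ b ∈ Bs.biUnion C,
      a ≠ b ∧ δ a b = lab u := by
    intro w hw hwB a ha b hb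
    obtain ⟨w', hw', hb⟩ := mem_biUnion.1 hb
    obtain ⟨h1, h2, h3⟩ := mem_kids.1 hw
    obtain ⟨h1', h2', h3'⟩ := hB' w' hw'
    have := h.sib w h1 h2 w' h1' h2' (h3.trans h3'.symm) (fun he => hwB (he ▸ hw')) a ha b hb
    rwa [h3] at this
  have hUss : Bs.biUnion C ⊂ C u := by
    obtain ⟨a, ha⟩ := h.nonempty v₀ hv₀N
    refine Finset.ssubset_iff_subset_ne.2 ⟨hUsub, fun he => ?_⟩
    exact (hdis v₀ (mem_kids.2 ⟨hv₀N, hv₀r, hue⟩) hv₀B a ha a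
      (he ▸ hue ▸ (h.ssub v₀ hv₀N hv₀r).subset ha)).1 rfl
  have hBss : ∀ w ∈ Bs, C w ⊂ Bs.biUnion C := by
    intro w hw
    refine Finset.ssubset_iff_subset_ne.2 ⟨subset_biUnion_of_mem C hw, fun he => ?_⟩
    obtain ⟨w', hw', hne⟩ := exists_mem_ne (s := Bs) (by omega) w
    obtain ⟨a, ha⟩ := h.nonempty w' (hB' w' hw').1
    exact hne (h.eq_of_sib (hB' w' hw').1 (hB' w' hw').2.1 (hB' w hw).1 (hB' w hw).2.1
      ((hB' w' hw').2.2.trans (hB' w hw).2.2.symm) ha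
      (he ▸ subset_biUnion_of_mem C hw' ha))
  -- the parent of an old node
  have hpar : ∀ w ∈ N, w ≠ r → w ≠ u →
      (w ∈ Bs ∧ par w = u ∧ par' w = lo) ∨ (w ∉ Bs ∧ par w = u ∧ par' w = hi) ∨
      (w ∉ Bs ∧ par w ≠ u ∧ par' w = par w) := by
    intro w hw hr hwu
    by_cases hp : par w = u
    · by_cases hwB : w ∈ Bs
      · exact Or.inl ⟨hwB, hp, pB w hwB⟩
      · exact Or.inr (Or.inl ⟨hwB, hp, pA w (mem_kids.2 ⟨hw, hr, hp⟩) hwB⟩)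
    · exact Or.inr (Or.inr ⟨fun hwB => hp (hB' w hwB).2.2, hp, pw w hw hr hwu hp⟩)
  have hpu : u ≠ r → par u ∈ N ∧ par u ≠ u := fun hr => ⟨h.par_mem u hu hr, h.par_ne hu hr⟩
  have hNi : ∀ {w}, w ∈ N → w ∈ insert z N := fun hw => mem_insert_of_mem hw
  have hloRoot : ∀ w ∈ N, w ≠ r → w ≠ u → C w ⊂ C' (par' w) := by
    intro w hw hr hwu
    rcases hpar w hw hr hwu with ⟨h1, h2, h3⟩ | ⟨h1, h2, h3⟩ | ⟨h1, h2, h3⟩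
    · rw [h3, Clo]; exact hBss w h1
    · rw [h3, Chi, ← h2]; exact h.ssub w hw hr
    · rw [h3, Cw _ (h.par_mem w hw hr) h2]; exact h.ssub w hw hr
  have hlabp : ∀ w ∈ N, w ≠ r → w ≠ u → lab' (par' w) = lab (par w) := by
    intro w hw hr hwu
    rcases hpar w hw hr hwu with ⟨h1, h2, h3⟩ | ⟨h1, h2, h3⟩ | ⟨h1, h2, h3⟩
    · rw [h3, llo, h2]
    · rw [h3, lhi, h2]
    · rw [h3, lw _ (h.par_mem w hw hr) h2]
  refine ⟨hNi h.root_mem, ?_, h.leaf_mem.trans (subset_insert _ _), ?_, ?_, ?_, ?_, ?_, ?_, ?_, ?_⟩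
  · by_cases hr : u = r
    · rcases hio with ⟨h1, -⟩ | ⟨-, -, h1⟩
      · rw [show C' r = C u by rw [← hr, ← Chi, h1], hr, h.root_eq]
      · exact absurd hr h1
    · rw [Cw r h.root_mem (Ne.symm hr), h.root_eq]
  · intro v hv
    rw [Cw v (h.leaf_mem hv) (fun he => huV (he ▸ hv)), h.leaf_eq v hv]
  · intro w hw
    rcases hcas w hw with rfl | rfl | ⟨hw, hwu⟩
    · rw [Chi]; exact h.nonempty u hu
    · rw [Clo]; obtain ⟨b, hb⟩ := hBne
      exact (h.nonempty b (hB' b hb).1).mono (subset_biUnion_of_mem C hb)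
    · rw [Cw w hw hwu]; exact h.nonempty w hw
  · intro w hw
    rcases hcas w hw with rfl | rfl | ⟨hw, hwu⟩
    · rw [Chi]; exact h.sub u hu
    · rw [Clo]; exact hUsub.trans (h.sub u hu)
    · rw [Cw w hw hwu]; exact h.sub w hw
  · intro w hw hr
    rcases hcas w hw with rfl | rfl | ⟨hw, hwu⟩
    · rw [phi hr]
      rcases hio with ⟨rfl, rfl⟩ | ⟨-, -, h1⟩
      · exact hNi (h.par_mem _ hu hr)
      · exact hNi (h.par_mem _ hu h1)
    · rw [plo]; exact hhiN
    · rcases hpar w hw hr hwu with ⟨h1, h2, h3⟩ | ⟨h1, h2, h3⟩ | ⟨h1, h2, h3⟩ <;> rw [h3]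
      · exact hloN
      · exact hhiN
      · exact hNi (h.par_mem w hw hr)
  · intro w hw hr
    rcases hcas w hw with rfl | rfl | ⟨hw, hwu⟩
    · have hur : u ≠ r := by
        rcases hio with ⟨rfl, -⟩ | ⟨-, -, h1⟩ <;> assumption
      rw [phi hr, Chi, Cw _ (hpu hur).1 (hpu hur).2]; exact h.ssub u hu hur
    · rw [plo, Chi, Clo]; exact hUss
    · rw [Cw w hw hwu]; exact hloRoot w hw hr hwu
  · have huri : hi ≠ r → u ≠ r := by
      rcases hio with ⟨rfl, -⟩ | ⟨-, -, h1⟩ <;> [exact id; exact fun _ => h1]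
    -- the pairs of nodes of different kinds
    have s1 : ∀ w ∈ N, w ≠ r → w ≠ u → hi ≠ r → par' w = par' hi →
        ∀ a ∈ C w, ∀ b ∈ C u, a ≠ b ∧ δ a b = lab (par u) := by
      intro w hw hr hwu hir hp a ha b hb
      have hur := huri hir
      rw [phi hir] at hp
      obtain ⟨h4, h5⟩ := hpu hur
      obtain ⟨h6, h7⟩ := hN _ h4 h5
      rcases hpar w hw hr hwu with ⟨h1, h2, h3⟩ | ⟨h1, h2, h3⟩ | ⟨h1, h2, h3⟩
      · exact absurd (hp.symm.trans h3) h7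
      · exact absurd (hp.symm.trans h3) h6
      · have h8 : par w = par u := h3.symm.trans hp
        have := h.sib w hw hr u hu hur h8 hwu a ha b hb
        rwa [h8] at this
    have s2 : ∀ w ∈ N, w ≠ r → w ≠ u → par' w = par' lo →
        ∀ a ∈ C w, ∀ b ∈ Bs.biUnion C, a ≠ b ∧ δ a b = lab u := by
      intro w hw hr hwu hp a ha b hb
      rw [plo] at hp
      rcases hpar w hw hr hwu with ⟨h1, h2, h3⟩ | ⟨h1, h2, h3⟩ | ⟨h1, h2, h3⟩
      · exact absurd (hp.symm.trans h3) hhl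
      · exact hdis w (mem_kids.2 ⟨hw, hr, h2⟩) h1 a ha b hb
      · exact absurd (h3.symm.trans hp) (hN _ (h.par_mem w hw hr) h2).1
    have s3 : hi ≠ r → par' hi ≠ par' lo := by
      intro hir he
      rw [phi hir, plo] at he
      exact (hN _ (hpu (huri hir)).1 (hpu (huri hir)).2).1 he
    intro w hw hr w' hw' hr' hp hne a ha b hb
    rcases hcas w hw with rfl | rfl | ⟨hw, hwu⟩ <;> rcases hcas w' hw' with rfl | rfl | ⟨hw', hwu'⟩
    · exact absurd rfl hne
    · exact absurd hp (s3 hr)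
    · rw [Chi] at ha; rw [Cw w' hw' hwu'] at hb
      have := s1 w' hw' hr' hwu' hr hp.symm b hb a ha
      rw [phi hr, lw _ (hpu (huri hr)).1 (hpu (huri hr)).2, hδ]
      exact ⟨this.1.symm, this.2⟩
    · exact absurd hp.symm (s3 hr')
    · exact absurd rfl hne
    · rw [Clo] at ha; rw [Cw w' hw' hwu'] at hb
      have := s2 w' hw' hr' hwu' hp.symm b hb a ha
      rw [plo, lhi, hδ]; exact ⟨this.1.symm, this.2⟩
    · rw [Chi] at hb; rw [Cw w hw hwu] at ha
      have := s1 w hw hr hwu hr' hp a ha b hb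
      rw [hp, phi hr', lw _ (hpu (huri hr')).1 (hpu (huri hr')).2]
      exact this
    · rw [Clo] at hb; rw [Cw w hw hwu] at ha
      rw [hp, plo, lhi]; exact s2 w hw hr hwu hp a ha b hb
    · rw [Cw w hw hwu] at ha; rw [Cw w' hw' hwu'] at hb
      rw [hlabp w hw hr hwu]
      refine h.sib w hw hr w' hw' hr' ?_ hne a ha b hb
      rcases hpar w hw hr hwu with ⟨h1, h2, h3⟩ | ⟨h1, h2, h3⟩ | ⟨h1, h2, h3⟩ <;>
        rcases hpar w' hw' hr' hwu' with ⟨h1', h2', h3'⟩ | ⟨h1', h2', h3'⟩ | ⟨h1', h2', h3'⟩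
      all_goals first
        | exact h2.trans h2'.symm
        | exact h3.symm.trans (hp.trans h3')
        | exact absurd (h3.symm.trans (hp.trans h3')) (hN _ (h.par_mem w hw hr) h2).1
        | exact absurd (h3.symm.trans (hp.trans h3')) (hN _ (h.par_mem w hw hr) h2).2
        | exact absurd (h3'.symm.trans (hp.symm.trans h3)) (hN _ (h.par_mem w' hw' hr') h2').1
        | exact absurd (h3'.symm.trans (hp.symm.trans h3)) (hN _ (h.par_mem w' hw' hr') h2').2
  · intro v hv hvV a ha
    rcases hcas v hv with rfl | rfl | ⟨hv, hvu⟩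
    · rw [Chi] at ha
      obtain ⟨w, hw, hr, hp, haw⟩ := h.cover u hu huV a ha
      have hwu := hkid w hw hr hp
      by_cases hwB : w ∈ Bs
      · exact ⟨lo, hloN, hlr, plo, Clo ▸ mem_biUnion.2 ⟨w, hwB, haw⟩⟩
      · exact ⟨w, hNi hw, hr, pA w (mem_kids.2 ⟨hw, hr, hp⟩) hwB, (Cw w hw hwu).symm ▸ haw⟩
    · rw [Clo] at ha
      obtain ⟨w, hw, haw⟩ := mem_biUnion.1 ha
      obtain ⟨h1, h2, h3⟩ := hB' w hw
      exact ⟨w, hNi h1, h2, pB w hw, (Cw w h1 (hkid w h1 h2 h3)).symm ▸ haw⟩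
    · rw [Cw v hv hvu] at ha
      obtain ⟨w, hw, hr, hp, haw⟩ := h.cover v hv hvV a ha
      by_cases hwu : w = u
      · subst hwu
        have hir : hi ≠ r := fun hh => hr (hhir hh)
        exact ⟨hi, hhiN, hir, (phi hir).trans hp, Chi ▸ haw⟩
      · have hpu' : par w ≠ u := fun hh => hvu (hp.symm.trans hh)
        exact ⟨w, hNi hw, hr, (pw w hw hr hwu hpu').trans hp, (Cw w hw hwu).symm ▸ haw⟩
  · intro w hw hr hwl
    rcases hcas w hw with rfl | rfl | ⟨hw, hwu⟩
    · have hur : u ≠ r := by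
        rcases hio with ⟨rfl, -⟩ | ⟨-, -, h1⟩ <;> assumption
      rw [lhi, phi hr, lw _ (hpu hur).1 (hpu hur).2]
      exact h.canon u hu hur hur
    · exact absurd rfl hwl
    · rw [lw w hw hwu, hlabp w hw hr hwu]; exact h.canon w hw hr hr

/-- The new vertex `x` becomes a child of the inner node `T`. -/
theorem attach_join (h : IsTree δ V N C par lab r e) {T : ℕ} (hT : T ∈ N) (hTV : T ∉ V)
    (hx : x ∉ N) (hδ : ∀ a b, δ a b = δ b a) (hxT : Uni δ C x T (lab T))
    (hanc : ∀ w ∈ N, w ≠ r → C T ⊆ C w → ∀ b ∈ C (par w), b ∉ C w → δ x b = lab (par w))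
    (px : par' x = T) (pw : ∀ w ∈ N, w ≠ r → par' w = par w)
    (lx : lab' x ≠ lab T) (lw : ∀ w ∈ N, lab' w = lab w) :
    IsTree δ (insert x V) (insert x N)
      (fun w => if w = x then {x} else if C T ⊆ C w then insert x (C w) else C w)
      par' lab' r e := by
  set C' : ℕ → Finset ℕ := fun w => if w = x then {x} else if C T ⊆ C w then insert x (C w) else C w
    with hC'
  have hne : ∀ w ∈ N, w ≠ x := fun w hw he => hx (he ▸ hw)
  have hxV : x ∉ V := fun hh => hx (h.leaf_mem hh)
  have Cx : C' x = {x} := by simp [hC']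
  have C1 : ∀ w ∈ N, C T ⊆ C w → C' w = insert x (C w) := fun w hw hs => by
    simp [hC', hne w hw, hs]
  have C2 : ∀ w ∈ N, ¬ C T ⊆ C w → C' w = C w := fun w hw hs => by simp [hC', hne w hw, hs]
  have Csub : ∀ w ∈ N, C w ⊆ C' w := by
    intro w hw
    by_cases hs : C T ⊆ C w
    · rw [C1 w hw hs]; exact subset_insert _ _
    · rw [C2 w hw hs]
  have hxC : ∀ w ∈ N, x ∉ C w := fun w hw hh => hxV (h.sub w hw hh)
  have hmem : ∀ w ∈ N, ∀ a ∈ C' w, (a = x ∧ C T ⊆ C w) ∨ a ∈ C w := by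
    intro w hw a ha
    by_cases hs : C T ⊆ C w
    · rw [C1 w hw hs] at ha
      rcases mem_insert.1 ha with rfl | ha
      · exact Or.inl ⟨rfl, hs⟩
      · exact Or.inr ha
    · rw [C2 w hw hs] at ha; exact Or.inr ha
  have hxr : x ≠ r := (hne r h.root_mem).symm
  have hNi : ∀ {w}, w ∈ N → w ∈ insert x N := fun hw => mem_insert_of_mem hw
  have hTroot : C T ⊆ C r := h.root_eq ▸ h.sub T hT
  obtain ⟨t₀, ht₀⟩ := h.nonempty T hT
  refine ⟨hNi h.root_mem, ?_, ?_, ?_, ?_, ?_, ?_, ?_, ?_, ?_, ?_⟩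
  · rw [C1 r h.root_mem hTroot, h.root_eq]
  · exact insert_subset_insert _ h.leaf_mem
  · intro v hv
    rcases mem_insert.1 hv with rfl | hv
    · exact Cx
    · rw [C2 v (h.leaf_mem hv), h.leaf_eq v hv]
      intro hs
      have := h.nested hT (h.leaf_mem hv) ht₀ (hs ht₀)
      rcases this with h1 | ⟨h1, h2⟩
      · exact hTV (h.inj hT (h.leaf_mem hv) (hs.antisymm h1) ▸ hv)
      · exact absurd (h2.trans_eq (h.leaf_eq v hv)) fun h3 => by
          have h4 := (h.ssub T hT h1).trans_subset h3
          rw [ssubset_singleton_iff] at h4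
          exact (h.nonempty T hT).ne_empty h4
  · intro w hw
    rcases mem_insert.1 hw with rfl | hw
    · rw [Cx]; simp
    · exact (h.nonempty w hw).mono (Csub w hw)
  · intro w hw a ha
    rcases mem_insert.1 hw with rfl | hw
    · rw [Cx] at ha; rw [mem_singleton.1 ha]; simp
    · rcases hmem w hw a ha with ⟨rfl, -⟩ | ha
      · simp
      · exact mem_insert_of_mem (h.sub w hw ha)
  · intro w hw hr
    rcases mem_insert.1 hw with rfl | hw
    · rw [px]; exact hNi hT
    · rw [pw w hw hr]; exact hNi (h.par_mem w hw hr)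
  · intro w hwi hr
    rcases mem_insert.1 hwi with rfl | hw
    · rw [px, Cx, C1 T hT subset_rfl, Finset.ssubset_iff_subset_ne]
      refine ⟨by simp, fun he => ?_⟩
      have : t₀ ∈ insert w (C T) := mem_insert_of_mem ht₀
      rw [← he, mem_singleton] at this
      exact hxC T hT (this ▸ ht₀)
    · have hp := h.par_mem w hw hr
      obtain ⟨a, ha, hna⟩ := exists_of_ssubset (h.ssub w hw hr)
      rw [pw w hw hr, ssubset_iff_of_subset]
      · refine ⟨a, Csub _ hp ha, fun hh => ?_⟩
        rcases hmem w hw a hh with ⟨rfl, -⟩ | hh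
        · exact hxC _ hp ha
        · exact hna hh
      · intro b hb
        rcases hmem w hw b hb with ⟨rfl, hs⟩ | hb
        · rw [C1 _ hp (hs.trans (h.ssub w hw hr).subset)]; simp
        · exact Csub _ hp ((h.ssub w hw hr).subset hb)
  · have s1 : ∀ w ∈ N, w ≠ r → par w = T → ∀ a ∈ C' w, a ∈ C w := by
      intro w hw hr hp a ha
      rcases hmem w hw a ha with ⟨-, hs⟩ | ha
      · exact absurd (hp ▸ hs) (h.ssub w hw hr).not_subset
      · exact ha
    intro w hwi hr w' hwi' hr' hp hne' a hai b hbi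
    rcases mem_insert.1 hwi with rfl | hw <;> rcases mem_insert.1 hwi' with rfl | hw'
    · exact absurd rfl hne'
    · rw [px, pw w' hw' hr'] at hp
      rw [Cx, mem_singleton] at hai
      rw [hai]
      have hb := s1 w' hw' hr' hp.symm b hbi
      rw [px, lw T hT]
      exact ⟨fun he => hxC w' hw' (he ▸ hb), hxT b (hp ▸ (h.ssub w' hw' hr').subset hb)⟩
    · rw [px, pw w hw hr] at hp
      rw [Cx, mem_singleton] at hbi
      rw [hbi]
      have ha := s1 w hw hr hp a hai
      rw [pw w hw hr, hp, lw T hT, hδ]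
      exact ⟨fun he => hxC w hw (he ▸ ha), hxT a (hp ▸ (h.ssub w hw hr).subset ha)⟩
    · rw [pw w hw hr, pw w' hw' hr'] at hp
      rw [pw w hw hr, lw _ (h.par_mem w hw hr)]
      have aux : ∀ w ∈ N, w ≠ r → ∀ w' ∈ N, w' ≠ r → par w = par w' → w ≠ w' → C T ⊆ C w →
          ∀ b ∈ C w', δ x b = lab (par w) := by
        intro w hw hr w' hw' hr' hp hne' hs b hb
        exact hanc w hw hr hs b (hp ▸ (h.ssub w' hw' hr').subset hb) fun hbw =>
          (h.sib w hw hr w' hw' hr' hp hne' b hbw b hb).1 rfl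
      rcases hmem w hw a hai with ⟨rfl, hs⟩ | ha <;> rcases hmem w' hw' b hbi with ⟨rfl, hs'⟩ | hb
      · exact absurd rfl (h.sib w hw hr w' hw' hr' hp hne' t₀ (hs ht₀) t₀ (hs' ht₀)).1
      · exact ⟨fun he => hxC w' hw' (he ▸ hb), aux w hw hr w' hw' hr' hp hne' hs b hb⟩
      · rw [hp, hδ]
        exact ⟨fun he => hxC w hw (he ▸ ha), aux w' hw' hr' w hw hr hp.symm hne'.symm hs' a ha⟩
      · exact h.sib w hw hr w' hw' hr' hp hne' a ha b hb
  · intro u hui huV a hai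
    rcases mem_insert.1 hui with rfl | hu
    · exact absurd (mem_insert_self _ _) huV
    have huV' : u ∉ V := fun hh => huV (mem_insert_of_mem hh)
    rcases hmem u hu a hai with ⟨rfl, hs⟩ | ha
    · by_cases huT : u = T
      · subst huT
        exact ⟨a, mem_insert_self _ _, hxr, px, by rw [Cx]; simp⟩
      · obtain ⟨w, hw, hr, rfl, htw⟩ := h.cover u hu huV' t₀ (hs ht₀)
        refine ⟨w, hNi hw, hr, pw w hw hr, ?_⟩
        have hs' : C T ⊆ C w := by
          rcases h.nested hw hT htw ht₀ with h1 | ⟨-, h1⟩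
          · exact h1
          · exact absurd (h.inj hu hT (h1.antisymm hs)) huT
        rw [C1 w hw hs']; simp
    · obtain ⟨w, hw, hr, hp, haw⟩ := h.cover u hu huV' a ha
      exact ⟨w, hNi hw, hr, (pw w hw hr).trans hp, Csub w hw haw⟩
  · intro w hw hr hwe
    rcases mem_insert.1 hw with rfl | hw
    · rw [px, lw T hT]; exact lx
    · rw [pw w hw hr, lw w hw, lw _ (h.par_mem w hw hr)]; exact h.canon w hw hr hwe

/-- The node `T` is replaced by a new node `p` with the children `T` and `x`. -/
theorem attach_new (h : IsTree δ V N C par lab r e) {T p : ℕ} (he : e = T ∨ e = r)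
    (hT : T ∈ N) (hTr : T ≠ r) (hx : x ∉ N) (hp : p ∉ N) (hpx : p ≠ x)
    (hδ : ∀ a b, δ a b = δ b a) (hxT : Uni δ C x T (lab' p))
    (hanc : ∀ w ∈ N, w ≠ r → C T ⊆ C w → ∀ b ∈ C (par w), b ∉ C w → δ x b = lab (par w))
    (px : par' x = p) (pT : par' T = p) (pp : par' p = par T)
    (pw : ∀ w ∈ N, w ≠ r → w ≠ T → par' w = par w)
    (lx : lab' x ≠ lab' p) (lT : lab T ≠ lab' p) (lpT : lab' p ≠ lab (par T))
    (lw : ∀ w ∈ N, lab' w = lab w) :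
    IsTree δ (insert x V) (insert p (insert x N))
      (fun w => if w = x then {x} else if w = p then insert x (C T) else
        if C T ⊂ C w then insert x (C w) else C w) par' lab' r r := by
  set C' : ℕ → Finset ℕ := fun w => if w = x then {x} else if w = p then insert x (C T) else
        if C T ⊂ C w then insert x (C w) else C w with hC'
  have hne : ∀ w ∈ N, w ≠ x := fun w hw he => hx (he ▸ hw)
  have hnp : ∀ w ∈ N, w ≠ p := fun w hw he => hp (he ▸ hw)
  have hxV : x ∉ V := fun hh => hx (h.leaf_mem hh)
  have hpV : p ∉ V := fun hh => hp (h.leaf_mem hh)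
  have Cx : C' x = {x} := by simp [hC']
  have Cp : C' p = insert x (C T) := by simp [hC', hpx]
  have C1 : ∀ w ∈ N, C T ⊂ C w → C' w = insert x (C w) := fun w hw hs => by
    simp [hC', hne w hw, hnp w hw, hs]
  have C2 : ∀ w ∈ N, ¬ C T ⊂ C w → C' w = C w := fun w hw hs => by
    simp [hC', hne w hw, hnp w hw, hs]
  have CT : C' T = C T := C2 T hT (fun hh => hh.ne rfl)
  have Csub : ∀ w ∈ N, C w ⊆ C' w := by
    intro w hw
    by_cases hs : C T ⊂ C w
    · rw [C1 w hw hs]; exact subset_insert _ _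
    · rw [C2 w hw hs]
  have hxC : ∀ w ∈ N, x ∉ C w := fun w hw hh => hxV (h.sub w hw hh)
  have hmem : ∀ w ∈ N, ∀ a ∈ C' w, (a = x ∧ C T ⊂ C w) ∨ a ∈ C w := by
    intro w hw a ha
    by_cases hs : C T ⊂ C w
    · rw [C1 w hw hs] at ha
      rcases mem_insert.1 ha with rfl | ha
      · exact Or.inl ⟨rfl, hs⟩
      · exact Or.inr ha
    · rw [C2 w hw hs] at ha; exact Or.inr ha
  have hxr : x ≠ r := (hne r h.root_mem).symm
  have hpr : p ≠ r := (hnp r h.root_mem).symm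
  have hNi : ∀ {w}, w ∈ N → w ∈ insert p (insert x N) := fun hw =>
    mem_insert_of_mem (mem_insert_of_mem hw)
  have hpi : p ∈ insert p (insert x N) := mem_insert_self _ _
  have hxi : x ∈ insert p (insert x N) := mem_insert_of_mem (mem_insert_self _ _)
  have hcas : ∀ {w}, w ∈ insert p (insert x N) → w = p ∨ w = x ∨ w = T ∨ (w ∈ N ∧ w ≠ T) := by
    intro w hw
    rcases mem_insert.1 hw with hw | hw
    · exact Or.inl hw
    rcases mem_insert.1 hw with hw | hw
    · exact Or.inr (Or.inl hw)
    by_cases hwT : w = T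
    · exact Or.inr (Or.inr (Or.inl hwT))
    · exact Or.inr (Or.inr (Or.inr ⟨hw, hwT⟩))
  have hTp := h.par_mem T hT hTr
  have hTs := h.ssub T hT hTr
  have hTroot : C T ⊂ C r := lt_of_lt_of_le hTs (h.root_eq ▸ h.sub _ hTp)
  obtain ⟨t₀, ht₀⟩ := h.nonempty T hT
  have mono : ∀ w ∈ N, w ≠ r → C' w ⊂ C' (par w) := by
    intro w hw hr
    have hpw := h.par_mem w hw hr
    obtain ⟨a, ha, hna⟩ := exists_of_ssubset (h.ssub w hw hr)
    rw [ssubset_iff_of_subset]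
    · refine ⟨a, Csub _ hpw ha, fun hh => ?_⟩
      rcases hmem w hw a hh with ⟨rfl, -⟩ | hh
      · exact hxC _ hpw ha
      · exact hna hh
    · intro b hb
      rcases hmem w hw b hb with ⟨rfl, hs⟩ | hb
      · rw [C1 _ hpw (hs.trans (h.ssub w hw hr))]; simp
      · exact Csub _ hpw ((h.ssub w hw hr).subset hb)
  have hpp : par T ≠ p := hnp _ hTp
  -- the colours between `x` or `T` and the siblings of `T`
  have sT : ∀ w ∈ N, w ≠ r → w ≠ T → par w = par T → ∀ a ∈ C' w, ∀ b ∈ insert x (C T),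
      a ≠ b ∧ δ a b = lab (par T) := by
    intro w hw hr hwT hpe a hai b hbi
    have ha : a ∈ C w := by
      rcases hmem w hw a hai with ⟨-, hs⟩ | ha
      · exact absurd rfl (h.sib w hw hr T hT hTr hpe hwT t₀ (hs.subset ht₀) t₀ ht₀).1
      · exact ha
    rcases mem_insert.1 hbi with hb | hb
    · rw [hb, hδ]
      refine ⟨fun he => hxC w hw (he ▸ ha), hanc T hT hTr subset_rfl a
        (hpe ▸ (h.ssub w hw hr).subset ha) fun hh => ?_⟩
      exact (h.sib w hw hr T hT hTr hpe hwT a ha a hh).1 rfl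
    · rw [← hpe]; exact h.sib w hw hr T hT hTr hpe hwT a ha b hb
  have sTx : ∀ a ∈ C T, ∀ b ∈ ({x} : Finset ℕ), a ≠ b ∧ δ a b = lab' p := by
    intro a ha b hb
    rw [mem_singleton] at hb
    rw [hb, hδ]
    exact ⟨fun he => hxC T hT (he ▸ ha), hxT a ha⟩
  have aux : ∀ w ∈ N, w ≠ r → ∀ w' ∈ N, w' ≠ r → par w = par w' → w ≠ w' → C T ⊂ C w →
      ∀ b ∈ C w', δ x b = lab (par w) := by
    intro w hw hr w' hw' hr' hp hne' hs b hb
    exact hanc w hw hr hs.subset b (hp ▸ (h.ssub w' hw' hr').subset hb) fun hbw =>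
      (h.sib w hw hr w' hw' hr' hp hne' b hbw b hb).1 rfl
  refine ⟨hNi h.root_mem, ?_, ?_, ?_, ?_, ?_, ?_, ?_, ?_, ?_, ?_⟩
  · rw [C1 r h.root_mem hTroot, h.root_eq]
  · exact (insert_subset_insert _ h.leaf_mem).trans (subset_insert _ _)
  · intro v hv
    rcases mem_insert.1 hv with rfl | hv
    · exact Cx
    · rw [C2 v (h.leaf_mem hv), h.leaf_eq v hv]
      rw [h.leaf_eq v hv, ssubset_singleton_iff]
      exact (h.nonempty T hT).ne_empty
  · intro w hwi
    rcases mem_insert.1 hwi with rfl | hwi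
    · rw [Cp]; simp
    rcases mem_insert.1 hwi with rfl | hw
    · rw [Cx]; simp
    · exact (h.nonempty w hw).mono (Csub w hw)
  · intro w hwi a hai
    rcases mem_insert.1 hwi with hw | hwi
    · rw [hw, Cp] at hai
      exact insert_subset_insert _ (h.sub T hT) hai
    rcases mem_insert.1 hwi with hw | hw
    · rw [hw, Cx] at hai; rw [mem_singleton.1 hai]; simp
    · rcases hmem w hw a hai with ⟨rfl, -⟩ | ha
      · simp
      · exact mem_insert_of_mem (h.sub w hw ha)
  · intro w hwi hr
    rcases hcas hwi with rfl | rfl | rfl | ⟨hw, hwT⟩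
    · rw [pp]; exact hNi hTp
    · rw [px]; exact hpi
    · rw [pT]; exact hpi
    · rw [pw w hw hr hwT]; exact hNi (h.par_mem w hw hr)
  · intro w hwi hr
    rcases hcas hwi with rfl | rfl | rfl | ⟨hw, hwT⟩
    · rw [pp, Cp, C1 _ hTp hTs]
      obtain ⟨a, ha, hna⟩ := exists_of_ssubset hTs
      refine (ssubset_iff_of_subset (insert_subset_insert _ hTs.subset)).2
        ⟨a, mem_insert_of_mem ha, fun hh => ?_⟩
      rcases mem_insert.1 hh with rfl | hh
      · exact hxC _ hTp ha
      · exact hna hh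
    · rw [px, Cx, Cp, Finset.ssubset_iff_subset_ne]
      refine ⟨by simp, fun he => ?_⟩
      have : t₀ ∈ insert w (C T) := mem_insert_of_mem ht₀
      rw [← he, mem_singleton] at this
      exact hxC T hT (this ▸ ht₀)
    · rw [pT, Cp, CT]; exact ssubset_insert (hxC _ hT)
    · rw [pw w hw hr hwT]; exact mono w hw hr
  · intro w hwi hr w' hwi' hr' hpe hne' a hai b hbi
    rcases hcas hwi with h1 | h1 | h1 | ⟨hw, hwT⟩ <;>
      rcases hcas hwi' with h2 | h2 | h2 | ⟨hw', hwT'⟩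
    · exact absurd (h1.trans h2.symm) hne'
    · rw [h1, h2, pp, px] at hpe; exact absurd hpe hpp
    · rw [h1, h2, pp, pT] at hpe; exact absurd hpe hpp
    · rw [h1, pp, pw w' hw' hr' hwT'] at hpe
      rw [h1, Cp] at hai
      have := sT w' hw' hr' hwT' hpe.symm b hbi a hai
      rw [h1, pp, lw _ hTp, hδ]
      exact ⟨this.1.symm, this.2⟩
    · rw [h1, h2, pp, px] at hpe; exact absurd hpe.symm hpp
    · exact absurd (h1.trans h2.symm) hne'
    · rw [h1, Cx] at hai; rw [h2, CT] at hbi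
      have := sTx b hbi a hai
      rw [h1, px, hδ]
      exact ⟨this.1.symm, this.2⟩
    · rw [h1, px, pw w' hw' hr' hwT'] at hpe
      exact absurd hpe.symm (hnp _ (h.par_mem w' hw' hr'))
    · rw [h1, h2, pp, pT] at hpe; exact absurd hpe.symm hpp
    · rw [h1, CT] at hai; rw [h2, Cx] at hbi
      rw [h1, pT]; exact sTx a hai b hbi
    · exact absurd (h1.trans h2.symm) hne'
    · rw [h1, pT, pw w' hw' hr' hwT'] at hpe
      exact absurd hpe.symm (hnp _ (h.par_mem w' hw' hr'))
    · rw [h2, pp, pw w hw hr hwT] at hpe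
      rw [h2, Cp] at hbi
      rw [pw w hw hr hwT, hpe, lw _ hTp]
      exact sT w hw hr hwT hpe a hai b hbi
    · rw [h2, px, pw w hw hr hwT] at hpe
      exact absurd hpe (hnp _ (h.par_mem w hw hr))
    · rw [h2, pT, pw w hw hr hwT] at hpe
      exact absurd hpe (hnp _ (h.par_mem w hw hr))
    · rw [pw w hw hr hwT, pw w' hw' hr' hwT'] at hpe
      rw [pw w hw hr hwT, lw _ (h.par_mem w hw hr)]
      rcases hmem w hw a hai with ⟨rfl, hs⟩ | ha <;> rcases hmem w' hw' b hbi with ⟨rfl, hs'⟩ | hb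
      · exact absurd rfl (h.sib w hw hr w' hw' hr' hpe hne' t₀ (hs.subset ht₀) t₀
          (hs'.subset ht₀)).1
      · exact ⟨fun he => hxC w' hw' (he ▸ hb), aux w hw hr w' hw' hr' hpe hne' hs b hb⟩
      · rw [hpe, hδ]
        exact ⟨fun he => hxC w hw (he ▸ ha), aux w' hw' hr' w hw hr hpe.symm hne'.symm hs' a ha⟩
      · exact h.sib w hw hr w' hw' hr' hpe hne' a ha b hb
  · intro u hui huV a hai
    have huV' : u ∉ V := fun hh => huV (mem_insert_of_mem hh)
    rcases mem_insert.1 hui with hu | hui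
    · rw [hu, Cp] at hai
      rw [hu]
      rcases mem_insert.1 hai with ha | ha
      · exact ⟨x, hxi, hxr, px, by rw [ha, Cx]; simp⟩
      · exact ⟨T, hNi hT, hTr, pT, CT.symm ▸ ha⟩
    rcases mem_insert.1 hui with hu | hu
    · exact absurd (hu ▸ mem_insert_self _ _) huV
    have old : ∀ w ∈ N, w ≠ r → par w = u → a ∈ C' w ∨ w = T ∧ a ∈ insert x (C T) →
        ∃ w ∈ insert p (insert x N), w ≠ r ∧ par' w = u ∧ a ∈ C' w := by
      intro w hw hr hpu haw
      by_cases hwT : w = T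
      · rw [hwT] at hpu
        refine ⟨p, hpi, hpr, pp.trans hpu, ?_⟩
        rw [Cp]
        rcases haw with haw | haw
        · rw [hwT, CT] at haw; exact mem_insert_of_mem haw
        · exact haw.2
      · exact ⟨w, hNi hw, hr, (pw w hw hr hwT).trans hpu, haw.resolve_right fun hh => hwT hh.1⟩
    rcases hmem u hu a hai with ⟨ha, hs⟩ | ha
    · obtain ⟨w, hw, hr, hpu, htw⟩ := h.cover u hu huV' t₀ (hs.subset ht₀)
      refine old w hw hr hpu ?_
      by_cases hwT : w = T
      · exact Or.inr ⟨hwT, by rw [ha]; simp⟩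
      · have hs' : C T ⊆ C w := by
          rcases h.nested hw hT htw ht₀ with h1 | ⟨-, h1⟩
          · exact h1
          · exact absurd (hpu ▸ h1) hs.not_subset
        rw [C1 w hw (hs'.ssubset_of_ne fun hh => hwT (h.inj hT hw hh).symm)]
        left; rw [ha]; simp
    · obtain ⟨w, hw, hr, hpu, haw⟩ := h.cover u hu huV' a ha
      exact old w hw hr hpu (Or.inl (Csub w hw haw))
  · intro w hwi hr _
    rcases hcas hwi with rfl | rfl | rfl | ⟨hw, hwT⟩
    · rw [pp, lw _ hTp]; exact lpT
    · rw [px]; exact lx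
    · rw [pT, lw _ hT]; exact lT
    · rw [pw w hw hr hwT, lw w hw, lw _ (h.par_mem w hw hr)]
      refine h.canon w hw hr ?_
      rcases he with rfl | rfl <;> assumption

end IsTree


/-! ### The children of the nodes after a change of the tree -/

namespace IsTree

variable {δ : ℕ → ℕ → ℕ} {V N : Finset ℕ} {C : ℕ → Finset ℕ} {par lab par' lab' : ℕ → ℕ}
  {r e x : ℕ}

theorem kids_split (h : IsTree δ V N C par lab r r) {u z hi lo : ℕ} (hu : u ∈ N) {Bs : Finset ℕ}
    (hB : Bs ⊆ kids N par r u)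
    (hz : z ∉ N) (hio : hi = u ∧ lo = z ∨ hi = z ∧ lo = u ∧ u ≠ r)
    (pB : ∀ w ∈ Bs, par' w = lo) (pA : ∀ w ∈ kids N par r u, w ∉ Bs → par' w = hi)
    (plo : par' lo = hi) (phi : hi ≠ r → par' hi = par u)
    (pw : ∀ w ∈ N, w ≠ r → w ≠ u → par w ≠ u → par' w = par w) :
    kids (insert z N) par' r hi = insert lo (kids N par r u \ Bs) ∧
    kids (insert z N) par' r lo = Bs ∧
    ∀ v ∈ N, v ≠ u → kids (insert z N) par' r v =
      if u ≠ r ∧ par u = v then insert hi ((kids N par r v).erase u) else kids N par r v := by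
  have hB' : ∀ w ∈ Bs, w ∈ N ∧ w ≠ r ∧ par w = u := fun w hw => mem_kids.1 (hB hw)
  have hpn : ∀ w ∈ N, w ≠ r → par w ≠ z := fun w hw hr he => hz (he ▸ h.par_mem w hw hr)
  have hps : ∀ w ∈ N, w ≠ r → par w ≠ w := fun w hw hr => h.par_ne hw hr
  have hrz : r ≠ z := fun hh => hz (hh ▸ h.root_mem)
  have huz : u ≠ z := fun hh => hz (hh ▸ hu)
  simp only [mem_kids] at pA
  rcases hio with ⟨rfl, rfl⟩ | ⟨rfl, rfl, hur⟩
  · refine ⟨?_, ?_, fun v hv hvu => ?_⟩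
    · ext w
      simp only [mem_kids, mem_insert, mem_sdiff]
      constructor
      · rintro ⟨rfl | hw, hwr, hp⟩
        · exact Or.inl rfl
        · refine Or.inr ?_
          by_cases hwB : w ∈ Bs
          · exact absurd ((pB w hwB).symm.trans hp).symm huz
          · by_cases hwu : w = hi
            · rw [hwu] at hp hwr hw
              exact absurd ((phi hwr).symm.trans hp) (hps _ hw hwr)
            · by_cases hpw : par w = hi
              · exact ⟨⟨hw, hwr, hpw⟩, hwB⟩
              · exact absurd ((pw w hw hwr hwu hpw).symm.trans hp) hpw
      · rintro (rfl | ⟨⟨hw, hwr, hp⟩, hwB⟩)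
        · exact ⟨Or.inl rfl, hrz.symm, plo⟩
        · exact ⟨Or.inr hw, hwr, pA w ⟨hw, hwr, hp⟩ hwB⟩
    · ext w
      simp only [mem_kids, mem_insert]
      constructor
      · rintro ⟨rfl | hw, hwr, hp⟩
        · exact absurd (plo.symm.trans hp) huz
        · by_contra hwB
          by_cases hwu : w = hi
          · rw [hwu] at hp hwr hw
            exact hpn _ hw hwr ((phi hwr).symm.trans hp)
          · by_cases hpw : par w = hi
            · exact huz ((pA w ⟨hw, hwr, hpw⟩ hwB).symm.trans hp)
            · exact hpn _ hw hwr ((pw w hw hwr hwu hpw).symm.trans hp)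
      · intro hw
        obtain ⟨h1, h2, h3⟩ := hB' w hw
        exact ⟨Or.inr h1, h2, pB w hw⟩
    · ext w
      have hvz : v ≠ lo := fun hh => hz (hh ▸ hv)
      have : (w ∈ if hi ≠ r ∧ par hi = v then insert hi ((kids N par r v).erase hi)
          else kids N par r v) ↔ w ∈ kids N par r v := by
        split_ifs with hc
        · by_cases hwu : w = hi <;> simp [hwu, mem_kids, hc, hu]
        · rfl
      rw [this]
      simp only [mem_kids, mem_insert]
      constructor
      · rintro ⟨rfl | hw, hwr, hp⟩
        · exact absurd (plo.symm.trans hp).symm hvu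
        · refine ⟨hw, hwr, ?_⟩
          by_cases hwB : w ∈ Bs
          · exact absurd ((pB w hwB).symm.trans hp).symm hvz
          · by_cases hwu : w = hi
            · rw [hwu] at hp hwr hw ⊢
              exact (phi hwr).symm.trans hp
            · by_cases hpw : par w = hi
              · exact absurd ((pA w ⟨hw, hwr, hpw⟩ hwB).symm.trans hp).symm hvu
              · exact (pw w hw hwr hwu hpw).symm.trans hp
      · rintro ⟨hw, hwr, hp⟩
        refine ⟨Or.inr hw, hwr, ?_⟩
        by_cases hwu : w = hi
        · rw [hwu] at hp hwr ⊢
          exact (phi hwr).trans hp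
        · exact (pw w hw hwr hwu (fun hh => hvu (hp.symm.trans hh))).trans hp
  · have phi' := phi hrz.symm
    refine ⟨?_, ?_, fun v hv hvu => ?_⟩
    · ext w
      simp only [mem_kids, mem_insert, mem_sdiff]
      constructor
      · rintro ⟨rfl | hw, hwr, hp⟩
        · exact absurd (phi'.symm.trans hp) (hpn _ hu hur)
        · by_cases hwu : w = lo
          · exact Or.inl hwu
          · refine Or.inr ?_
            by_cases hwB : w ∈ Bs
            · exact absurd ((pB w hwB).symm.trans hp) huz
            · by_cases hpw : par w = lo
              · exact ⟨⟨hw, hwr, hpw⟩, hwB⟩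
              · exact absurd ((pw w hw hwr hwu hpw).symm.trans hp) (hpn w hw hwr)
      · rintro (rfl | ⟨⟨hw, hwr, hp⟩, hwB⟩)
        · exact ⟨Or.inr hu, hur, plo⟩
        · exact ⟨Or.inr hw, hwr, pA w ⟨hw, hwr, hp⟩ hwB⟩
    · ext w
      simp only [mem_kids, mem_insert]
      constructor
      · rintro ⟨rfl | hw, hwr, hp⟩
        · exact absurd (phi'.symm.trans hp) (hps _ hu hur)
        · by_contra hwB
          by_cases hwu : w = lo
          · rw [hwu] at hp
            exact huz (plo.symm.trans hp).symm
          · by_cases hpw : par w = lo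
            · exact huz ((pA w ⟨hw, hwr, hpw⟩ hwB).symm.trans hp).symm
            · exact hpw ((pw w hw hwr hwu hpw).symm.trans hp)
      · intro hw
        obtain ⟨h1, h2, h3⟩ := hB' w hw
        exact ⟨Or.inr h1, h2, pB w hw⟩
    · ext w
      have hvz : v ≠ hi := fun hh => hz (hh ▸ hv)
      have key : ∀ w ∈ N, w ≠ r → w ≠ lo → (par' w = v ↔ par w = v) := by
        intro w hw hwr hwu
        by_cases hwB : w ∈ Bs
        · rw [pB w hwB, (hB' w hwB).2.2]
        · by_cases hpw : par w = lo
          · rw [pA w ⟨hw, hwr, hpw⟩ hwB, hpw]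
            exact ⟨fun hh => absurd hh.symm hvz, fun hh => absurd hh.symm hvu⟩
          · rw [pw w hw hwr hwu hpw]
      have hzk : hi ∉ kids N par r v := fun hh => hz (mem_kids.1 hh).1
      split_ifs with hc
      · simp only [mem_kids, mem_insert, mem_erase]
        constructor
        · rintro ⟨rfl | hw, hwr, hp⟩
          · exact Or.inl rfl
          · by_cases hwu : w = lo
            · rw [hwu, plo] at hp; exact absurd hp.symm hvz
            · exact Or.inr ⟨hwu, hw, hwr, (key w hw hwr hwu).1 hp⟩
        · rintro (rfl | ⟨hwu, hw, hwr, hp⟩)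
          · exact ⟨Or.inl rfl, hrz.symm, phi'.trans hc.2⟩
          · exact ⟨Or.inr hw, hwr, (key w hw hwr hwu).2 hp⟩
      · simp only [mem_kids, mem_insert]
        constructor
        · rintro ⟨rfl | hw, hwr, hp⟩
          · exact absurd ⟨hur, phi'.symm.trans hp⟩ hc
          · by_cases hwu : w = lo
            · rw [hwu, plo] at hp; exact absurd hp.symm hvz
            · exact ⟨hw, hwr, (key w hw hwr hwu).1 hp⟩
        · rintro ⟨hw, hwr, hp⟩
          have hwu : w ≠ lo := fun hh => hc ⟨hur, hh ▸ hp⟩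
          exact ⟨Or.inr hw, hwr, (key w hw hwr hwu).2 hp⟩

theorem kids_join (h : IsTree δ V N C par lab r e) {T : ℕ} (hT : T ∈ N)
    (hx : x ∉ N) (px : par' x = T) (pw : ∀ w ∈ N, w ≠ r → par' w = par w) :
    kids (insert x N) par' r T = insert x (kids N par r T) ∧
    kids (insert x N) par' r x = ∅ ∧
    ∀ v ∈ N, v ≠ T → kids (insert x N) par' r v = kids N par r v := by
  have hrx : x ≠ r := fun hh => hx (hh ▸ h.root_mem)
  have hxT : x ≠ T := fun hh => hx (hh ▸ hT)
  have hne : ∀ w ∈ N, w ≠ x := fun w hw he => hx (he ▸ hw)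
  refine ⟨?_, ?_, fun v hv hvT => ?_⟩
  · ext w
    simp only [mem_kids, mem_insert]
    constructor
    · rintro ⟨rfl | hw, hwr, hp⟩
      · exact Or.inl rfl
      · exact Or.inr ⟨hw, hwr, (pw w hw hwr).symm.trans hp⟩
    · rintro (rfl | ⟨hw, hwr, hp⟩)
      · exact ⟨Or.inl rfl, hrx, px⟩
      · exact ⟨Or.inr hw, hwr, (pw w hw hwr).trans hp⟩
  · rw [eq_empty_iff_forall_notMem]
    intro w hw
    obtain ⟨hw, hwr, hp⟩ := mem_kids.1 hw
    rcases mem_insert.1 hw with rfl | hw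
    · exact hxT (hp.symm.trans px)
    · exact hne _ (h.par_mem w hw hwr) ((pw w hw hwr).symm.trans hp)
  · ext w
    simp only [mem_kids, mem_insert]
    constructor
    · rintro ⟨rfl | hw, hwr, hp⟩
      · exact absurd (hp.symm.trans px) hvT
      · exact ⟨hw, hwr, (pw w hw hwr).symm.trans hp⟩
    · rintro ⟨hw, hwr, hp⟩
      exact ⟨Or.inr hw, hwr, (pw w hw hwr).trans hp⟩

theorem kids_new (h : IsTree δ V N C par lab r e) {T p : ℕ}
    (hT : T ∈ N) (hTr : T ≠ r) (hx : x ∉ N) (hp : p ∉ N) (hpx : p ≠ x)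
    (px : par' x = p) (pT : par' T = p) (pp : par' p = par T)
    (pw : ∀ w ∈ N, w ≠ r → w ≠ T → par' w = par w) :
    kids (insert p (insert x N)) par' r p = {T, x} ∧
    kids (insert p (insert x N)) par' r x = ∅ ∧
    kids (insert p (insert x N)) par' r (par T) = insert p ((kids N par r (par T)).erase T) ∧
    ∀ v ∈ N, v ≠ par T → kids (insert p (insert x N)) par' r v = kids N par r v := by
  have hrx : x ≠ r := fun hh => hx (hh ▸ h.root_mem)
  have hrp : p ≠ r := fun hh => hp (hh ▸ h.root_mem)
  have hne : ∀ w ∈ N, w ≠ x := fun w hw he => hx (he ▸ hw)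
  have hnp : ∀ w ∈ N, w ≠ p := fun w hw he => hp (he ▸ hw)
  have hTp := h.par_mem T hT hTr
  have key : ∀ w ∈ N, w ≠ r → par' w = p → w = T := by
    intro w hw hwr he
    by_contra hwT
    exact hnp _ (h.par_mem w hw hwr) ((pw w hw hwr hwT).symm.trans he)
  have key2 : ∀ v ∈ N, ∀ w ∈ N, w ≠ r → (par' w = v ↔ w ≠ T ∧ par w = v) := by
    intro v hv w hw hwr
    by_cases hwT : w = T
    · rw [hwT, pT]
      exact ⟨fun hh => absurd hh.symm (hnp v hv), fun hh => absurd rfl hh.1⟩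
    · rw [pw w hw hwr hwT]; simp [hwT]
  refine ⟨?_, ?_, ?_, fun v hv hvT => ?_⟩
  · ext w
    simp only [mem_kids, mem_insert, mem_singleton]
    constructor
    · rintro ⟨rfl | rfl | hw, hwr, he⟩
      · exact absurd (pp.symm.trans he) (hnp _ hTp)
      · exact Or.inr rfl
      · exact Or.inl (key w hw hwr he)
    · rintro (rfl | rfl)
      · exact ⟨Or.inr (Or.inr hT), hTr, pT⟩
      · exact ⟨Or.inr (Or.inl rfl), hrx, px⟩
  · rw [eq_empty_iff_forall_notMem]
    intro w hw
    obtain ⟨hw, hwr, he⟩ := mem_kids.1 hw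
    rcases mem_insert.1 hw with rfl | hw
    · exact hne _ hTp (pp.symm.trans he)
    rcases mem_insert.1 hw with rfl | hw
    · exact hpx (px.symm.trans he)
    · by_cases hwT : w = T
      · rw [hwT, pT] at he; exact hpx he
      · exact hne _ (h.par_mem w hw hwr) ((pw w hw hwr hwT).symm.trans he)
  · ext w
    simp only [mem_kids, mem_insert, mem_erase]
    constructor
    · rintro ⟨rfl | rfl | hw, hwr, he⟩
      · exact Or.inl rfl
      · exact absurd (px.symm.trans he).symm (hnp _ hTp)
      · obtain ⟨h1, h2⟩ := (key2 _ hTp w hw hwr).1 he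
        exact Or.inr ⟨h1, hw, hwr, h2⟩
    · rintro (rfl | ⟨h1, hw, hwr, h2⟩)
      · exact ⟨Or.inl rfl, hrp, pp⟩
      · exact ⟨Or.inr (Or.inr hw), hwr, (key2 _ hTp w hw hwr).2 ⟨h1, h2⟩⟩
  · ext w
    simp only [mem_kids, mem_insert]
    constructor
    · rintro ⟨rfl | rfl | hw, hwr, he⟩
      · exact absurd (pp.symm.trans he).symm hvT
      · exact absurd (px.symm.trans he).symm (hnp _ hv)
      · exact ⟨hw, hwr, ((key2 v hv w hw hwr).1 he).2⟩
    · rintro ⟨hw, hwr, he⟩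
      refine ⟨Or.inr (Or.inr hw), hwr, (key2 v hv w hw hwr).2 ⟨fun hh => hvT ?_, he⟩⟩
      rw [← he, hh]

end IsTree


/-! ### Weakest preconditions with running time -/

/-! Arithmetical notation for the expressions of the machine. -/

instance : Add Expr := ⟨Expr.bin .add⟩
instance : Sub Expr := ⟨Expr.bin .sub⟩
instance : Mul Expr := ⟨Expr.bin .mul⟩
instance (k : ℕ) : OfNat Expr k := ⟨.lit k⟩

/-- The test `a < b`. -/
def Expr.lt (a b : Expr) : Expr := .bin .lt a b

/-- The test `a = b`. -/
def Expr.eq (a b : Expr) : Expr := .bin .eq a b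

infixr:30 " ;; " => Program.seq

/-- A row of the input. -/
def Machine.row (M : Machine) (i : ℕ) : List ℕ := M.input.getD i []

/-- An entry of the input. -/
def Machine.entry (M : Machine) (i j : ℕ) : ℕ := (M.row i).getD j 0

/-- The value of an expression if no number is too large and no address out of range. -/
def Expr.val (M : Machine) (σ : Store) : Expr → ℕ
  | lit k => k
  | reg i => σ.reg i
  | mem a => σ.mem (a.val M σ)
  | inp i j => (M.input.getD (i.val M σ) []).getD (j.val M σ) 0
  | len i => (M.input.getD (i.val M σ) []).length
  | bin o a b => o.apply (a.val M σ) (b.val M σ)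

/-- All memory addresses in an expression are in range. -/
def Expr.Safe (M : Machine) (σ : Store) : Expr → Prop
  | lit _ => True
  | reg _ => True
  | mem a => a.Safe M σ ∧ a.val M σ < M.cells
  | inp i j => i.Safe M σ ∧ j.Safe M σ
  | len i => i.Safe M σ
  | bin _ a b => a.Safe M σ ∧ b.Safe M σ

/-- All constants are at most `100`. -/
def Expr.litLe : Expr → Bool
  | lit k => k ≤ 100
  | reg _ => true
  | mem a => a.litLe
  | inp i j => i.litLe && j.litLe
  | len i => i.litLe
  | bin _ a b => a.litLe && b.litLe

/-- An expression of bounded size with small constants, for which no overflow occurs if all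
stored numbers are bounded suitably. -/
def Expr.Small (e : Expr) : Prop := (e.litLe && Nat.ble e.cost 80) = true

theorem Expr.Small.litLe {e : Expr} (h : e.Small) : e.litLe = true :=
  (Bool.and_eq_true_iff.1 h).1

theorem Expr.Small.cost_le {e : Expr} (h : e.Small) : e.cost ≤ 80 :=
  Nat.le_of_ble_eq_true (Bool.and_eq_true_iff.1 h).2

/-- The bound `B` on stored numbers fits the machine and its input. -/
structure Env (M : Machine) (B : ℕ) : Prop where
  lit_le : 100 ≤ B
  pow_lt : B ^ 80 < M.range
  inp_le : ∀ i j, M.entry i j ≤ B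
  len_le : ∀ i, (M.row i).length ≤ B

/-- All registers and cells are at most `B`. -/
def Bdd (B : ℕ) (σ : Store) : Prop := (∀ i, σ.reg i ≤ B) ∧ ∀ a, σ.mem a ≤ B

namespace Expr

section simps
variable (M : Machine) (σ : Store)

@[simp] theorem val_ofNat (k : ℕ) : (no_index (OfNat.ofNat k) : Expr).val M σ = OfNat.ofNat k := rfl
@[simp] theorem val_reg (i : ℕ) : (Expr.reg i).val M σ = σ.reg i := rfl
@[simp] theorem val_mem (a : Expr) : (Expr.mem a).val M σ = σ.mem (a.val M σ) := rfl
@[simp] theorem val_inp (a b : Expr) :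
    (Expr.inp a b).val M σ = M.entry (a.val M σ) (b.val M σ) := rfl
@[simp] theorem val_len (a : Expr) :
    (Expr.len a).val M σ = (M.row (a.val M σ)).length := rfl
@[simp] theorem val_add (a b : Expr) : (a + b).val M σ = a.val M σ + b.val M σ := rfl
@[simp] theorem val_sub (a b : Expr) : (a - b).val M σ = a.val M σ - b.val M σ := rfl
@[simp] theorem val_mul (a b : Expr) : (a * b).val M σ = a.val M σ * b.val M σ := rfl
@[simp] theorem val_lt (a b : Expr) :
    (a.lt b).val M σ = if a.val M σ < b.val M σ then 1 else 0 := rfl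
@[simp] theorem val_eq (a b : Expr) :
    (a.eq b).val M σ = if a.val M σ = b.val M σ then 1 else 0 := rfl
@[simp] theorem safe_ofNat (k : ℕ) : (no_index (OfNat.ofNat k) : Expr).Safe M σ ↔ True := Iff.rfl
@[simp] theorem safe_reg (i : ℕ) : (Expr.reg i).Safe M σ ↔ True := Iff.rfl
@[simp] theorem safe_mem (a : Expr) :
    (Expr.mem a).Safe M σ ↔ a.Safe M σ ∧ a.val M σ < M.cells := Iff.rfl
@[simp] theorem safe_inp (a b : Expr) :
    (Expr.inp a b).Safe M σ ↔ a.Safe M σ ∧ b.Safe M σ := Iff.rfl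
@[simp] theorem safe_len (a : Expr) : (Expr.len a).Safe M σ ↔ a.Safe M σ := Iff.rfl
@[simp] theorem safe_add (a b : Expr) : (a + b).Safe M σ ↔ a.Safe M σ ∧ b.Safe M σ := Iff.rfl
@[simp] theorem safe_sub (a b : Expr) : (a - b).Safe M σ ↔ a.Safe M σ ∧ b.Safe M σ := Iff.rfl
@[simp] theorem safe_mul (a b : Expr) : (a * b).Safe M σ ↔ a.Safe M σ ∧ b.Safe M σ := Iff.rfl
@[simp] theorem safe_lt (a b : Expr) : (a.lt b).Safe M σ ↔ a.Safe M σ ∧ b.Safe M σ := Iff.rfl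
@[simp] theorem safe_eq (a b : Expr) : (a.eq b).Safe M σ ↔ a.Safe M σ ∧ b.Safe M σ := Iff.rfl

end simps

theorem one_le_cost (e : Expr) : 1 ≤ e.cost := by cases e <;> simp [cost]

theorem apply_le (o : BinOp) {a b B i j : ℕ} (hB : 2 ≤ B) (hi : 1 ≤ i) (hj : 1 ≤ j)
    (ha : a ≤ B ^ i) (hb : b ≤ B ^ j) : o.apply a b ≤ B ^ (i + j) := by
  have h1 : B ^ i ≤ B ^ (i + j) := Nat.pow_le_pow_right (by omega) (by omega)
  have h3 : 2 ≤ B ^ i := hB.trans (Nat.le_self_pow (by omega) B)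
  have h4 : 2 ≤ B ^ j := hB.trans (Nat.le_self_pow (by omega) B)
  have h5 : B ^ (i + j) = B ^ i * B ^ j := pow_add _ _ _
  cases o <;> simp only [BinOp.apply]
  · rw [h5]; nlinarith
  · omega
  · rw [h5]; exact Nat.mul_le_mul ha hb
  · exact (Nat.div_le_self _ _).trans (ha.trans h1)
  · exact (Nat.mod_le _ _).trans (ha.trans h1)
  · split_ifs <;> omega
  · split_ifs <;> omega

/-- Without overflow, the machine computes the value of an expression. -/
theorem eval_eq {M : Machine} {B : ℕ} (hE : Env M B) {σ : Store} (hσ : Bdd B σ) {e : Expr}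
    (hl : e.litLe = true) (hc : e.cost ≤ 80) (hs : e.Safe M σ) :
    e.eval M σ = some (e.val M σ) ∧ e.val M σ ≤ B ^ e.cost := by
  have h2 : 2 ≤ B := by have := hE.lit_le; omega
  have hw : ∀ v c, v ≤ B ^ c → c ≤ 80 → M.word v = some v := by
    intro v c hv hc
    have : v < M.range := lt_of_le_of_lt (hv.trans (Nat.pow_le_pow_right (by omega) hc)) hE.pow_lt
    simp [Machine.word, this]
  have h1 : ∀ (v : ℕ) (c : ℕ), v ≤ B → v ≤ B ^ (c + 1) := fun v c hv =>
    hv.trans (Nat.le_self_pow (by omega) B)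
  induction e with
  | lit k =>
    simp only [litLe, decide_eq_true_eq] at hl
    have hk : k ≤ B ^ 1 := by have := hE.lit_le; rw [pow_one]; omega
    exact ⟨hw k 1 hk (by norm_num), hk⟩
  | reg i => exact ⟨rfl, by simpa [val, cost] using hσ.1 i⟩
  | mem a ih =>
    simp only [litLe, cost] at hl hc
    obtain ⟨ha, -⟩ := ih hl (by omega) hs.1
    refine ⟨?_, h1 _ _ (hσ.2 _)⟩
    simp [eval, ha, hs.2, val]
  | inp i j ihi ihj =>
    simp only [litLe, cost, Bool.and_eq_true] at hl hc
    obtain ⟨hi, -⟩ := ihi hl.1 (by omega) hs.1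
    obtain ⟨hj, -⟩ := ihj hl.2 (by omega) hs.2
    have := h1 _ (i.cost + j.cost) (hE.inp_le (i.val M σ) (j.val M σ))
    refine ⟨?_, this⟩
    simp only [eval, hi, hj, Option.bind_some, val]
    exact hw _ _ this hc
  | len i ihi =>
    simp only [litLe, cost] at hl hc
    obtain ⟨hi, -⟩ := ihi hl (by omega) hs
    have := h1 _ (i.cost) (hE.len_le (i.val M σ))
    refine ⟨?_, this⟩
    simp only [eval, hi, Option.bind_some, val]
    exact hw _ _ this hc
  | bin o a b iha ihb =>
    simp only [litLe, cost, Bool.and_eq_true] at hl hc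
    obtain ⟨ha, ha'⟩ := iha hl.1 (by omega) hs.1
    obtain ⟨hb, hb'⟩ := ihb hl.2 (by omega) hs.2
    have := (apply_le o h2 (one_le_cost a) (one_le_cost b) ha' hb').trans
      (Nat.pow_le_pow_right (show B > 0 by omega) (Nat.le_succ (a.cost + b.cost)))
    refine ⟨?_, this⟩
    simp only [eval, ha, hb, Option.bind_some, val]
    exact hw _ _ this hc

end Expr

/-- Started in `σ` at time `t`, with all stored numbers at most `B`, the program halts with all
stored numbers at most `B`, and `Q` holds for the final store and the final time. -/
def wp (M : Machine) (B : ℕ) (P : Program) (Q : Store → ℕ → Prop) (σ : Store) (t : ℕ) : Prop :=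
  Bdd B σ → ∃ τ s, Runs M P σ τ s ∧ Bdd B τ ∧ Q τ (t + s)

section rules

variable {M : Machine} {B : ℕ} {Q : Store → ℕ → Prop} {σ : Store} {t : ℕ}

theorem wp_mono {P : Program} {Q' : Store → ℕ → Prop} (h : wp M B P Q' σ t)
    (hQ : ∀ τ s, Q' τ s → Q τ s) : wp M B P Q σ t := fun hb =>
  let ⟨τ, s, h1, h2, h3⟩ := h hb
  ⟨τ, s, h1, h2, hQ _ _ h3⟩

theorem wp_seq {p q : Program} (h : wp M B p (fun τ s => wp M B q Q τ s) σ t) :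
    wp M B (p ;; q) Q σ t := by
  intro hb
  obtain ⟨τ, s, h1, h2, h3⟩ := h hb
  obtain ⟨ρ, u, h4, h5, h6⟩ := h3 h2
  exact ⟨ρ, s + u, .seq h1 h4, h5, by rwa [← add_assoc]⟩

theorem wp_skip (h : Q σ (t + 1)) : wp M B .skip Q σ t := fun hb => ⟨σ, 1, .skip σ, hb, h⟩

theorem wp_assign (hE : Env M B) {i : ℕ} {e : Expr} (he : e.Small) (hs : e.Safe M σ)
    (hv : e.val M σ ≤ B)
    (h : Q ⟨Function.update σ.reg i (e.val M σ), σ.mem⟩ (t + (e.cost + 1))) :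
    wp M B (.assign i e) Q σ t := fun hb =>
  ⟨_, _, .assign (Expr.eval_eq hE hb he.litLe he.cost_le hs).1, ⟨fun j => by
    by_cases hj : j = i
    · subst hj; simpa using hv
    · simpa [hj] using hb.1 j, hb.2⟩, h⟩

theorem wp_store (hE : Env M B) {a e : Expr} (ha : a.Small) (he : e.Small) (hsa : a.Safe M σ)
    (hc : a.val M σ < M.cells) (hs : e.Safe M σ) (hv : e.val M σ ≤ B)
    (h : Q ⟨σ.reg, Function.update σ.mem (a.val M σ) (e.val M σ)⟩ (t + (a.cost + e.cost + 1))) :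
    wp M B (.store a e) Q σ t := fun hb =>
  ⟨_, _, .store (Expr.eval_eq hE hb ha.litLe ha.cost_le hsa).1 hc (Expr.eval_eq hE hb he.litLe he.cost_le hs).1,
    ⟨hb.1, fun j => by
      by_cases hj : j = a.val M σ
      · subst hj; simpa using hv
      · simpa [hj] using hb.2 j⟩, h⟩

theorem wp_branch (hE : Env M B) {e : Expr} {p q : Program} (he : e.Small) (hs : e.Safe M σ)
    (h1 : e.val M σ ≠ 0 → wp M B p Q σ (t + (e.cost + 1)))
    (h2 : e.val M σ = 0 → wp M B q Q σ (t + (e.cost + 1))) : wp M B (.branch e p q) Q σ t := by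
  intro hb
  have hev := (Expr.eval_eq hE hb he.litLe he.cost_le hs).1
  by_cases hv : e.val M σ = 0
  · obtain ⟨τ, s, h3, h4, h5⟩ := h2 hv hb
    exact ⟨τ, _, .branch_false (hv ▸ hev) h3, h4, by rwa [← add_assoc]⟩
  · obtain ⟨τ, s, h3, h4, h5⟩ := h1 hv hb
    exact ⟨τ, _, .branch_true hev hv h3, h4, by rwa [← add_assoc]⟩

/-- The rule for loops, with an invariant that depends on a decreasing counter. -/
theorem wp_loop (hE : Env M B) {e : Expr} {p : Program} (he : e.Small)
    (I : ℕ → Store → ℕ → Prop) {k : ℕ} (h0 : I k σ t)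
    (hs : ∀ k σ t, I k σ t → e.Safe M σ)
    (h1 : ∀ k σ t, I k σ t → e.val M σ ≠ 0 →
      wp M B p (fun τ s => ∃ k' < k, I k' τ s) σ (t + (e.cost + 1)))
    (h2 : ∀ k σ t, I k σ t → e.val M σ = 0 → Q σ (t + (e.cost + 1))) :
    wp M B (.loop e p) Q σ t := by
  induction k using Nat.strong_induction_on generalizing σ t with
  | _ k ih =>
    intro hb
    have hev := (Expr.eval_eq hE hb he.litLe he.cost_le (hs k σ t h0)).1
    by_cases hv : e.val M σ = 0
    · exact ⟨σ, _, .loop_false (hv ▸ hev), hb, h2 k σ t h0 hv⟩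
    · obtain ⟨τ, s, h3, h4, k', hk', h5⟩ := h1 k σ t h0 hv hb
      obtain ⟨ρ, u, h6, h7, h8⟩ := ih k' hk' h5 h4
      refine ⟨ρ, _, .loop_true hev hv h3 h6, h7, ?_⟩
      rw [show t + (e.cost + 1 + s + u) = t + (e.cost + 1) + s + u by ring]
      exact h8

end rules

/-- The loop `for i = 0, …, b - 1`, where the bound `b` is evaluated in every round. -/
def forLoop (i : ℕ) (b : Expr) (p : Program) : Program :=
  .assign i 0 ;; .loop ((Expr.reg i).lt b) (p ;; .assign i (.reg i + 1))

/-- The rule for counted loops. The body takes at most `T` steps per round and does not change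
the counter. -/
theorem wp_forLoop {M : Machine} {B : ℕ} {Q : Store → ℕ → Prop} {σ : Store} {t : ℕ}
    (hE : Env M B) {i : ℕ} {b : Expr} {p : Program} (hb : ((Expr.reg i).lt b).Small)
    (I : ℕ → Store → Prop) (n T : ℕ) (hn : n < B)
    (h0 : I 0 ⟨Function.update σ.reg i 0, σ.mem⟩)
    (hs : ∀ k τ, k ≤ n → I k τ → τ.reg i = k → b.Safe M τ ∧ b.val M τ = n)
    (h1 : ∀ k τ s, k < n → I k τ → τ.reg i = k → wp M B p (fun ρ u => ρ.reg i = k ∧ u ≤ s + T ∧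
        I (k + 1) ⟨Function.update ρ.reg i (k + 1), ρ.mem⟩) τ s)
    (h2 : ∀ τ s, I n τ → τ.reg i = n → s ≤ t + n * (T + b.cost + 7) + (b.cost + 5) → Q τ s) :
    wp M B (forLoop i b p) Q σ t := by
  refine wp_seq (wp_assign hE rfl (by simp) (by simp) ?_)
  simp only [Expr.val_ofNat]
  have hcost : ((Expr.reg i).lt b).cost = b.cost + 2 := by simp only [Expr.lt, Expr.cost]; omega
  refine wp_loop hE hb (fun k τ s => k ≤ n ∧ τ.reg i = n - k ∧ I (n - k) τ ∧
    s ≤ t + 2 + (n - k) * (T + b.cost + 7)) (k := n)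
    ⟨le_rfl, by simp, by simpa using h0, by simp; exact le_rfl⟩ ?_ ?_ ?_
  · rintro k τ s ⟨h3, h4, h5, -⟩
    simpa using (hs (n - k) τ (by omega) h5 h4).1
  · rintro k τ s ⟨h3, h4, h5, h6⟩ hv
    have hbn := (hs (n - k) τ (by omega) h5 h4).2
    simp only [Expr.val_lt, Expr.val_reg, h4, hbn, ne_eq, ite_eq_right_iff, one_ne_zero,
      imp_false, not_not] at hv
    refine wp_seq (wp_mono (h1 (n - k) τ _ hv h5 h4) ?_)
    rintro ρ u ⟨hρ, hu, hI⟩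
    refine wp_assign hE rfl (by simp) (by simp [hρ]; omega) ⟨k - 1, by omega, by omega, ?_, ?_, ?_⟩
    · simp [hρ]; omega
    · rw [show n - (k - 1) = n - k + 1 by omega]; simpa [hρ] using hI
    · rw [show n - (k - 1) = n - k + 1 by omega, add_mul, one_mul]
      rw [hcost] at hu
      have : (Expr.reg i + 1).cost = 3 := rfl
      omega
  · rintro k τ s ⟨h3, h4, h5, h6⟩ hv
    have hbn := (hs (n - k) τ (by omega) h5 h4).2
    simp only [Expr.val_lt, Expr.val_reg, h4, hbn, ite_eq_right_iff, one_ne_zero,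
      imp_false, not_lt] at hv
    have hk : k = 0 := by omega
    subst hk
    refine h2 τ _ h5 h4 ?_
    rw [hcost]; simp only [Nat.sub_zero] at h6; omega


/-! ### Records in the working memory

The first `n` cells are for the output. They are followed by `6 n` records with `32` fields, for the
nodes of the tree, the parts of the decomposition and the positions in lists, and by the tables of
the dynamic program. The fields of a record are

* `0` to `3`: parent, label, number of children and sum of the children of a node,
* `4` to `7`: the mark of a node, and for each nonzero colour the number of its marked children;
  `8`: the flag of a node; all of them relative to a time stamp,
* `9`: an entry of the queue of marked nodes,
* `10`, `11`: the number of folded children of a node, and the part that they form,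
* `12` to `14`: the two subparts of a part and the kind of their composition,
* `15`: the sorted list of the vertices; `16`, `20`: numbers and positions for the counting sort,
* `17` to `19`: the total size of a part, its mode and its share of the solution.

Register `0` holds `n`, register `1` the capacity, register `2` the vertex to be inserted, register
`3` the next free node or part, register `4` the time stamp and register `5` the length of the
queue. -/

/-- The address of field `j` of record `i`; the records follow the `n` output cells. -/
def fld (j i : Expr) : Expr := .reg 0 + 32 * i + j

/-- Field `j` of record `i`. -/
def get (j i : Expr) : Expr := .mem (fld j i)

/-- Writing field `j` of record `i`. -/
def put (j i e : Expr) : Program := .store (fld j i) e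

/-- The contents of field `j` of record `i`. -/
def fd (n : ℕ) (m : ℕ → ℕ) (j i : ℕ) : ℕ := m (n + 32 * i + j)

/-- Changing field `j` of record `i`. -/
def upd (n : ℕ) (m : ℕ → ℕ) (j i v : ℕ) : ℕ → ℕ := Function.update m (n + 32 * i + j) v

theorem fd_upd {n j j' i i' v : ℕ} {m : ℕ → ℕ} (hj : j < 32) (hj' : j' < 32) :
    fd n (upd n m j i v) j' i' = if j' = j ∧ i' = i then v else fd n m j' i' := by
  simp only [fd, upd, Function.update_apply]
  refine if_congr ⟨fun h => ⟨by omega, by omega⟩, ?_⟩ rfl rfl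
  rintro ⟨rfl, rfl⟩; rfl

/-- The numerical assumptions under which the program runs: the instance has `n` items, there is
room for `6 n` records and numbers of quadratic size. -/
structure Ctx (M : Machine) (B n : ℕ) : Prop extends Env M B where
  n_pos : 0 < n
  cells : 200 * n ≤ M.cells
  bound : 100 * (n * n) + 100 * n + 100 ≤ B

section

variable {M : Machine} {B n : ℕ} {Q : Store → ℕ → Prop} {σ : Store} {t : ℕ}

@[simp] theorem val_get (j i : Expr) :
    (get j i).val M σ = fd (σ.reg 0) σ.mem (j.val M σ) (i.val M σ) := rfl

@[simp] theorem safe_get (j i : Expr) : (get j i).Safe M σ ↔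
    (i.Safe M σ ∧ j.Safe M σ) ∧ σ.reg 0 + 32 * i.val M σ + j.val M σ < M.cells := by
  simp [get, fld]

theorem wp_set (hC : Ctx M B n) {i : ℕ} {e : Expr} (hs : e.Safe M σ) (hv : e.val M σ ≤ B)
    (h : ∀ s ≤ t + 100, Q ⟨Function.update σ.reg i (e.val M σ), σ.mem⟩ s)
    (he : e.Small := by rfl) :
    wp M B (.assign i e) Q σ t :=
  wp_assign hC.toEnv he hs hv (h _ (by have := he.cost_le; omega))

theorem wp_if (hC : Ctx M B n) {e : Expr} {p q : Program} (hs : e.Safe M σ)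
    (h1 : e.val M σ ≠ 0 → ∀ s ≤ t + 100, wp M B p Q σ s)
    (h2 : e.val M σ = 0 → ∀ s ≤ t + 100, wp M B q Q σ s) (he : e.Small := by rfl) :
    wp M B (.branch e p q) Q σ t :=
  wp_branch hC.toEnv he hs (fun h => h1 h _ (by have := he.cost_le; omega))
    (fun h => h2 h _ (by have := he.cost_le; omega))

theorem wp_put (hC : Ctx M B n) {j i e : Expr} (hs : j.Safe M σ ∧ i.Safe M σ ∧ e.Safe M σ)
    (hb : j.val M σ < 32 ∧ i.val M σ < 6 * n ∧ e.val M σ ≤ B)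
    (h : ∀ s ≤ t + 200, Q ⟨σ.reg, upd n σ.mem (j.val M σ) (i.val M σ) (e.val M σ)⟩ s)
    (h0 : σ.reg 0 = n := by first | (simp; done) | simpa) (ha : (fld j i).Small := by rfl)
    (he : e.Small := by rfl) : wp M B (put j i e) Q σ t := by
  have hv : (fld j i).val M σ = n + 32 * i.val M σ + j.val M σ := by simp [fld, h0]
  refine wp_store hC.toEnv ha he (by simp [fld, hs]) ?_ hs.2.2 hb.2.2 ?_
  · have := hC.cells; omega
  · rw [hv]
    exact h _ (by have := he.cost_le; have := ha.cost_le; omega)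

theorem wp_for (hC : Ctx M B n) {i : ℕ} {b : Expr} {p : Program} (I : ℕ → Store → Prop) (k T : ℕ) (hk : k < B)
    (h0 : I 0 ⟨Function.update σ.reg i 0, σ.mem⟩)
    (hs : ∀ a τ, a ≤ k → I a τ → τ.reg i = a → b.Safe M τ ∧ b.val M τ = k)
    (h1 : ∀ a τ s, a < k → I a τ → τ.reg i = a → wp M B p (fun ρ u => ρ.reg i = a ∧ u ≤ s + T ∧
        I (a + 1) ⟨Function.update ρ.reg i (a + 1), ρ.mem⟩) τ s)
    (h2 : ∀ τ s, I k τ → τ.reg i = k → s ≤ t + k * (T + 100) + 100 → Q τ s)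
    (hb : ((Expr.reg i).lt b).Small := by rfl) : wp M B (forLoop i b p) Q σ t := by
  refine wp_forLoop hC.toEnv hb I k T hk h0 hs h1 fun τ s h3 h4 h5 => h2 τ s h3 h4 (h5.trans ?_)
  have : ((Expr.reg i).lt b).cost ≤ 80 := hb.cost_le
  have h6 : ((Expr.reg i).lt b).cost = b.cost + 2 := by simp only [Expr.lt, Expr.cost]; omega
  have : k * (T + b.cost + 7) ≤ k * (T + 100) := Nat.mul_le_mul_left _ (by omega)
  omega

end

/-- Registers outside of `R` and fields outside of `J` are the same. Registers from `10` on hold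
temporary values and are not considered. -/
def Frame (n : ℕ) (J R : List ℕ) (σ τ : Store) : Prop :=
  (∀ i < 10, i ∉ R → τ.reg i = σ.reg i) ∧ ∀ j < 32, j ∉ J → ∀ i, fd n τ.mem j i = fd n σ.mem j i

namespace Frame

variable {n : ℕ} {J R : List ℕ} {σ τ ρ : Store}

theorem refl : Frame n J R σ σ := ⟨fun _ _ _ => rfl, fun _ _ _ _ => rfl⟩

theorem reg (h : Frame n J R σ τ) (i : ℕ) (hi : i < 10 := by omega) (hR : i ∉ R := by simp) :
    τ.reg i = σ.reg i :=
  h.1 i hi hR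

theorem fd (h : Frame n J R σ τ) (j : ℕ) (hj : j < 32 := by omega) (hJ : j ∉ J := by simp) :
    ∀ i, SSGW.fd n τ.mem j i = SSGW.fd n σ.mem j i :=
  h.2 j hj hJ

theorem trans (h : Frame n J R σ τ) (h' : Frame n J R τ ρ) : Frame n J R σ ρ :=
  ⟨fun i h1 h2 => (h'.1 i h1 h2).trans (h.1 i h1 h2),
    fun j h1 h2 i => (h'.2 j h1 h2 i).trans (h.2 j h1 h2 i)⟩

theorem mono {J' R' : List ℕ} (h : Frame n J R σ τ) (hJ : J ⊆ J' := by simp)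
    (hR : R ⊆ R' := by simp) : Frame n J' R' σ τ :=
  ⟨fun i h1 h2 => h.1 i h1 fun hh => h2 (hR hh), fun j h1 h2 => h.2 j h1 fun hh => h2 (hJ hh)⟩

theorem set_reg {i v : ℕ} (h : Frame n J R σ τ) (hi : 10 ≤ i ∨ i ∈ R := by simp) :
    Frame n J R σ ⟨Function.update τ.reg i v, τ.mem⟩ := by
  refine ⟨fun k h1 h2 => ?_, h.2⟩
  have : k ≠ i := by rintro rfl; rcases hi with hi | hi <;> [omega; exact h2 hi]
  simpa [this] using h.1 k h1 h2

theorem put {j i v : ℕ} (h : Frame n J R σ τ) (hj : j ∈ J := by simp)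
    (hj' : j < 32 := by omega) : Frame n J R σ ⟨τ.reg, upd n τ.mem j i v⟩ := by
  refine ⟨h.1, fun k h1 h2 a => ?_⟩
  have : k ≠ j := by rintro rfl; exact h2 hj
  simp only [fd_upd hj' h1, this, false_and, if_false]
  exact h.2 k h1 h2 a

end Frame

/-! ### Marking the vertices joined to the new vertex -/

/-- Field `j` of record `i`, relative to the time stamp in register `4`: fields written before the
current time stamp read as `0`. -/
def view (j i : Expr) : Expr := get j i - .reg 4

/-- Scans the input row given in register `14` and counts, in field `4`, how often each vertex
below `x` (register `2`) occurs; new vertices are appended to the queue, which consists of field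
`9` of the records below register `5`. -/
def scan : Program :=
  forLoop 10 (.len (.reg 14))
    (.assign 11 (.inp (.reg 14) (.reg 10) + 1) ;; .branch ((Expr.reg 11).lt (.reg 2))
      (.branch (view 4 (.reg 11)) .skip (put 9 (.reg 5) (.reg 11) ;; .assign 5 (.reg 5 + 1)) ;;
        put 4 (.reg 11) (.reg 4 + view 4 (.reg 11) + 1))
      .skip)

/-- The queue of length `q` contains the records whose mark in field `4` is nonzero relative to the
time stamp `X`, each exactly once. -/
structure Queue (n X q : ℕ) (m : ℕ → ℕ) : Prop where
  inj : ∀ k < q, ∀ k' < q, fd n m 9 k = fd n m 9 k' → k = k'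
  mem : ∀ a, fd n m 4 a - X ≠ 0 ↔ ∃ k < q, fd n m 9 k = a

/-- Appending a record with mark `v` to the queue. -/
theorem Queue.push {n X q a v : ℕ} {m : ℕ → ℕ} (h : Queue n X q m) (ha : fd n m 4 a - X = 0)
    (hv : v ≠ 0) : Queue n X (q + 1) (upd n (upd n m 9 q a) 4 a (X + v)) := by
  have h4 : ∀ b, fd n (upd n (upd n m 9 q a) 4 a (X + v)) 4 b =
      if b = a then X + v else fd n m 4 b := by
    intro b; simp [fd_upd]
  have h9 : ∀ k, fd n (upd n (upd n m 9 q a) 4 a (X + v)) 9 k =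
      if k = q then a else fd n m 9 k := by
    intro b; simp [fd_upd]
  have hn : ∀ k < q, fd n m 9 k ≠ a := fun k hk he => (h.mem a).2 ⟨k, hk, he⟩ ha
  constructor
  · intro k hk k' hk'
    rw [h9, h9]
    split_ifs with h1 h2 h2
    · omega
    · intro he; exact absurd he.symm (hn k' (by omega))
    · intro he; exact absurd he (hn k (by omega))
    · exact h.inj k (by omega) k' (by omega)
  · intro b
    rw [h4]
    by_cases hb : b = a
    · simp only [hb, if_true]
      exact ⟨fun _ => ⟨q, by omega, by rw [h9]; simp⟩, fun _ => by omega⟩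
    · simp only [hb, if_false, h.mem b]
      constructor
      · rintro ⟨k, hk, he⟩; exact ⟨k, by omega, by rw [h9, if_neg (by omega)]; exact he⟩
      · rintro ⟨k, hk, he⟩
        rw [h9] at he
        split_ifs at he with h1
        · exact absurd he.symm hb
        · exact ⟨k, by omega, he⟩

/-- Changing the mark of a record that is in the queue. -/
theorem Queue.remark {n X q a v : ℕ} {m : ℕ → ℕ} (h : Queue n X q m) (ha : fd n m 4 a - X ≠ 0)
    (hv : v ≠ 0) : Queue n X q (upd n m 4 a (X + v)) := by
  have h9 : ∀ k, fd n (upd n m 4 a (X + v)) 9 k = fd n m 9 k := by intro b; simp [fd_upd]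
  refine ⟨by simpa only [h9] using h.inj, fun b => ?_⟩
  simp only [h9]
  rw [← h.mem b]
  by_cases hb : b = a
  · subst hb; simp [fd_upd, ha, hv]
  · simp [fd_upd, hb]

theorem Queue.le {n X q N : ℕ} {m : ℕ → ℕ} (h : Queue n X q m) (hN : ∀ k < q, fd n m 9 k < N) :
    q ≤ N := by
  have := card_le_card_of_injOn (s := range q) (t := range N) (fd n m 9)
    (fun k hk => by simpa using hN k (by simpa using hk))
    (fun k hk k' hk' he => h.inj k (by simpa using hk) k' (by simpa using hk') he)
  simpa using this

theorem scan_spec {M : Machine} {B n : ℕ} {Q : Store → ℕ → Prop} {σ : Store} {t : ℕ}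
    (hC : Ctx M B n) {x X row : ℕ} (h0 : σ.reg 0 = n) (h2 : σ.reg 2 = x) (h4 : σ.reg 4 = X)
    (h14 : σ.reg 14 = row) (hx : x ≤ n) (hX : X + 100 ≤ B)
    (hl : ∀ a ∈ M.row row, a < n) (hnd : (M.row row).Nodup)
    (hb : ∀ a, fd n σ.mem 4 a - X ≤ 10) (hq : Queue n X (σ.reg 5) σ.mem)
    (hqx : ∀ k < σ.reg 5, fd n σ.mem 9 k < x)
    (hQ : ∀ τ s, Frame n [4, 9] [5] σ τ → Queue n X (τ.reg 5) τ.mem →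
      (∀ k < τ.reg 5, fd n τ.mem 9 k < x) →
      (∀ a, fd n τ.mem 4 a - X = fd n σ.mem 4 a - X +
        if 1 ≤ a ∧ a < x then (M.row row).count (a - 1) else 0) →
      s ≤ t + (M.row row).length * 1000 + 100 → Q τ s) :
    wp M B scan Q σ t := by
  set l := M.row row with hldef
  have ⟨_, hn0, hcells, hbound⟩ := hC
  have hlen : l.length ≤ n := by
    have := List.Nodup.length_le_card (α := Fin n)
      (l := l.attach.map fun a => ⟨a.1, hl a.1 a.2⟩) (by
        refine List.Nodup.map ?_ (List.nodup_attach.2 hnd)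
        intro a b hab; exact Subtype.ext (Fin.mk.inj_iff.1 hab))
    simpa using this
  refine wp_for hC (fun k τ => Frame n [4, 9] [5] σ τ ∧ τ.reg 14 = row ∧
    Queue n X (τ.reg 5) τ.mem ∧ (∀ k < τ.reg 5, fd n τ.mem 9 k < x) ∧
    ∀ a, fd n τ.mem 4 a - X = fd n σ.mem 4 a - X +
        if 1 ≤ a ∧ a < x then (l.take k).count (a - 1) else 0) l.length 900 (by omega) ?_ ?_ ?_ ?_
  · refine ⟨Frame.refl.set_reg, by simpa using h14, by simpa using hq,
      by simpa using hqx, by simp⟩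
  · rintro k τ hk ⟨-, h, -⟩ -
    simp [h, ← hldef]
  · rintro k τ s hk ⟨hF, ht14, hqτ, hqb, hv⟩ hi
    have e0 : τ.reg 0 = n := (hF.reg 0).trans h0
    have e2 : τ.reg 2 = x := (hF.reg 2).trans h2
    have e4 : τ.reg 4 = X := (hF.reg 4).trans h4
    have hlk : M.entry row k = l[k] := by
      rw [Machine.entry, ← hldef]; exact List.getD_eq_getElem _ _ hk
    have hln : l[k] < n := hl _ (List.getElem_mem hk)
    have htake : ∀ b, (l.take (k + 1)).count b = (l.take k).count b + if l[k] = b then 1 else 0 := by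
      intro b
      rw [List.take_add_one, List.count_append, List.getElem?_eq_getElem hk]
      simp [List.count_singleton]
    have hcnt : ∀ b, (l.take k).count b ≤ 1 := fun b =>
      List.nodup_iff_count_le_one.1 (hnd.sublist (List.take_sublist _ _)) b
    have hqlen := hqτ.le hqb
    have hg : fd n τ.mem 4 (l[k] + 1) - X ≤ 11 := by
      have h5 := hv (l[k] + 1)
      have h6 := hb (l[k] + 1)
      have h7 := hcnt (l[k] + 1 - 1)
      split_ifs at h5 <;> omega
    refine wp_seq (wp_set hC (by simp) (by simp [ht14, hi, hlk]; omega) fun s1 hs1 => ?_)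
    simp only [Expr.val_add, Expr.val_inp, Expr.val_reg, Expr.val_ofNat, ht14, hi, hlk]
    refine wp_if hC (by simp) (fun hlt s2 hs2 => ?_) (fun hge s2 hs2 => ?_)
    · simp [e2] at hlt
      refine wp_seq (wp_if hC ?_ (fun hm s3 hs3 => ?_) (fun hm s3 hs3 => ?_))
      · simp [view, e0]; omega
      · simp [view, e0, e4] at hm
        refine wp_skip (wp_put hC ?_ ?_ fun s4 hs4 => ?_)
        · simp [view, e0]; omega
        · simp [view, e0, e4]
          omega
        · simp [view, e0, e4]
          refine ⟨hi, by omega, ?_, ht14, ?_, ?_, ?_⟩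
          · exact (hF.set_reg.put (by simp) (by simp)).set_reg
          · exact hqτ.remark (v := fd n τ.mem 4 (l[k] + 1) - X + 1) (by omega) (by omega)
          · simpa [fd_upd] using hqb
          · intro a
            have := hv a
            simp only [fd_upd, show (4 : ℕ) < 32 by norm_num, htake, true_and]
            by_cases ha : a = l[k] + 1
            · subst ha
              simp_all
              omega
            · have : ¬ (1 ≤ a ∧ l[k] = a - 1) := by omega
              simp only [ha, if_false]
              split_ifs at * <;> omega
      · simp [view, e0, e4] at hm
        refine wp_seq (wp_put hC ?_ ?_ fun s4 hs4 => ?_)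
        · simp
        · simp; omega
        · refine wp_set hC (by simp) (by simp; omega) fun s5 hs5 => ?_
          refine wp_put hC ?_ ?_ fun s6 hs6 => ?_
          · simp [view, e0]; omega
          · simp [view, e0, e4, fd_upd]; omega
          · have h40 : fd n τ.mem 4 (l[k] + 1) - X = 0 := by omega
            simp [view, e0, e4, fd_upd, h40]
            refine ⟨hi, by omega, ?_, ht14, ?_, ?_, ?_⟩
            · exact (((hF.set_reg.put (by simp) (by simp)).set_reg).put (by simp) (by simp)).set_reg
            · exact hqτ.push h40 one_ne_zero
            · intro k' hk'
              split_ifs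
              · omega
              · exact hqb k' (by omega)
            · intro a
              have := hv a
              simp only [htake]
              by_cases ha : a = l[k] + 1
              · subst ha
                simp_all
              · have : ¬ (1 ≤ a ∧ l[k] = a - 1) := by omega
                simp only [ha, if_false]
                split_ifs at * <;> omega
    · simp [e2] at hge
      refine wp_skip ⟨by simpa using hi, by omega, hF.set_reg.set_reg,
        by simpa using ht14, by simpa using hqτ, by simpa using hqb, fun a => ?_⟩
      have := hv a
      simp only [htake]
      have : ¬ (1 ≤ a ∧ a < x ∧ l[k] = a - 1) := by omega
      split_ifs at * <;> omega
  · rintro τ s ⟨hF, -, h1, h2, h3⟩ - hs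
    refine hQ τ s hF h1 h2 (by simpa using h3) (by omega)


/-! ### Propagating the marks to the inner nodes -/

/-- Processes the queue: for every marked node, the counter of its colour at the parent is
increased; a node all of whose children have the same colour is marked and appended to the queue. -/
def propagate : Program :=
  .assign 10 0 ;;
  .loop ((Expr.reg 10).lt (.reg 5))
    (.assign 11 (get 9 (.reg 10)) ;; .assign 12 (get 0 (.reg 11)) ;;
    .assign 13 (view 4 (.reg 11)) ;;
    put (4 + .reg 13) (.reg 12) (.reg 4 + view (4 + .reg 13) (.reg 12) + 1) ;;
    .branch ((view (4 + .reg 13) (.reg 12)).eq (get 2 (.reg 12)))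
      (put 4 (.reg 12) (.reg 4 + .reg 13) ;; put 9 (.reg 5) (.reg 12) ;; .assign 5 (.reg 5 + 1))
      .skip ;;
    .assign 10 (.reg 10 + 1))

/-- The mark of a node, relative to the time stamp `X`. -/
def mark (n X : ℕ) (m : ℕ → ℕ) (w : ℕ) : ℕ := fd n m 4 w - X

/-- The state after the propagation: exactly the nodes whose leaves all have the same nonzero
colour with `x` are marked, with this colour; the fields `5`, `6`, `7` count the marked children
for the colours `1`, `2`, `3`. -/
structure Marks (δ : ℕ → ℕ → ℕ) (n x X q : ℕ) (N : Finset ℕ) (C : ℕ → Finset ℕ) (par : ℕ → ℕ)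
    (r : ℕ) (m : ℕ → ℕ) : Prop where
  queue : Queue n X q m
  sound : ∀ w, mark n X m w ≠ 0 → w ∈ N ∧ w ≠ r ∧ Uni δ C x w (mark n X m w)
  complete : ∀ w ∈ N, ∀ t, t ≠ 0 → Uni δ C x w t → mark n X m w = t
  cnt : ∀ p, ∀ t, 1 ≤ t → t ≤ 3 →
    fd n m (4 + t) p - X = ((kids N par r p).filter fun w => mark n X m w = t).card

/-- The queue after `i` rounds of the propagation. -/
structure PropInv (δ : ℕ → ℕ → ℕ) (n x X q i : ℕ) (N : Finset ℕ) (C : ℕ → Finset ℕ)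
    (par : ℕ → ℕ) (r : ℕ) (m : ℕ → ℕ) : Prop where
  le : i ≤ q
  queue : Queue n X q m
  sound : ∀ w, mark n X m w ≠ 0 → w ∈ N ∧ w ≠ r ∧ Uni δ C x w (mark n X m w)
  leaf : ∀ a < x, mark n X m a = δ x a
  cnt : ∀ p, ∀ t, 1 ≤ t → t ≤ 3 → fd n m (4 + t) p - X =
    (((range i).image (fd n m 9)).filter fun w => par w = p ∧ mark n X m w = t).card
  full : ∀ p ∈ N, x ≤ p →
    (mark n X m p ≠ 0 ↔ ∃ t, 1 ≤ t ∧ t ≤ 3 ∧ fd n m (4 + t) p - X = (kids N par r p).card)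

namespace PropInv

variable {δ : ℕ → ℕ → ℕ} {n x X q i : ℕ} {N : Finset ℕ} {C : ℕ → Finset ℕ} {par lab : ℕ → ℕ}
  {r : ℕ} {m : ℕ → ℕ}

theorem image_sub (h : PropInv δ n x X q i N C par r m) {w : ℕ}
    (hw : w ∈ (range i).image (fd n m 9)) : w ∈ N ∧ w ≠ r ∧ mark n X m w ≠ 0 := by
  obtain ⟨k, hk, rfl⟩ := mem_image.1 hw
  have h1 := (h.queue.mem (fd n m 9 k)).2
    ⟨k, lt_of_lt_of_le (mem_range.1 hk) h.le, rfl⟩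
  obtain ⟨h2, h3, -⟩ := h.sound _ h1
  exact ⟨h2, h3, h1⟩

/-- A node is marked only after all its children have been processed. -/
theorem kids_sub (h : PropInv δ n x X q i N C par r m) {p t : ℕ}
    (ht : 1 ≤ t) (ht' : t ≤ 3) (hc : fd n m (4 + t) p - X = (kids N par r p).card) :
    ∀ w ∈ kids N par r p, w ∈ (range i).image (fd n m 9) ∧ mark n X m w = t := by
  have hsub : (((range i).image (fd n m 9)).filter
      fun w => par w = p ∧ mark n X m w = t) ⊆ kids N par r p := by
    intro w hw
    obtain ⟨h1, h2, h3⟩ := mem_filter.1 hw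
    obtain ⟨h4, h5, -⟩ := h.image_sub h1
    exact mem_kids.2 ⟨h4, h5, h2⟩
  have := eq_of_subset_of_card_le hsub (by rw [← hc, h.cnt p t ht ht'])
  intro w hw
  rw [← this] at hw
  obtain ⟨h1, -, h3⟩ := mem_filter.1 hw
  exact ⟨h1, h3⟩

/-- Every inner node has at least two children, so that the queue is at most twice as long as the
number of marked leaves. -/
theorem queue_le (h : PropInv δ n x X q i N C par r m)
    (hT : IsTree δ (range x) N C par lab r r) :
    q ≤ 2 * ((range x).filter fun a => δ x a ≠ 0).card := by
  set Qs := (range q).image (fd n m 9) with hQs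
  have hcard : Qs.card = q := by
    rw [hQs, card_image_of_injOn, card_range]
    intro k hk k' hk' he
    exact h.queue.inj k (by simpa using hk) k' (by simpa using hk') he
  have hmem : ∀ w, w ∈ Qs ↔ mark n X m w ≠ 0 := by
    intro w
    rw [mark, h.queue.mem, hQs]; simp
  have hsplit := card_filter_add_card_filter_not (s := Qs) (fun w => w < x)
  have hleaf : (Qs.filter fun w => w < x) = (range x).filter fun a => δ x a ≠ 0 := by
    ext a
    simp only [mem_filter, mem_range, hmem]
    constructor
    · rintro ⟨h1, h2⟩; exact ⟨h2, h.leaf a h2 ▸ h1⟩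
    · rintro ⟨h1, h2⟩; exact ⟨(h.leaf a h1).symm ▸ h2, h1⟩
  set F := Qs.filter fun w => ¬ w < x with hF
  have hkid : ∀ p ∈ F, kids N par r p ⊆ (range i).image (fd n m 9) := by
    intro p hp
    obtain ⟨h1, h2⟩ := mem_filter.1 hp
    rw [hmem] at h1
    obtain ⟨t, ht, ht', hc⟩ := (h.full p (h.sound p h1).1 (not_lt.1 h2)).1 h1
    exact fun w hw => (h.kids_sub ht ht' hc w hw).1
  have hdisj : (F : Set ℕ).PairwiseDisjoint (kids N par r) := by
    intro p _ p' _ hne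
    refine disjoint_left.2 fun w hw hw' => hne ?_
    rw [← (mem_kids.1 hw).2.2, (mem_kids.1 hw').2.2]
  have h2 : F.card * 2 ≤ (F.biUnion (kids N par r)).card := by
    rw [card_biUnion hdisj, ← smul_eq_mul]
    refine card_nsmul_le_sum _ _ _ fun p hp => ?_
    obtain ⟨h1, h2⟩ := mem_filter.1 hp
    rw [hmem] at h1
    exact hT.two_le_card_kids (h.sound p h1).1 (by simpa using h2)
  have h3 := card_le_card (biUnion_subset.2 hkid)
  have h4 : ((range i).image (fd n m 9)).card ≤ i :=
    card_image_le.trans_eq (card_range i)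
  have := h.le
  rw [hleaf, hcard] at hsplit
  omega

theorem marks (h : PropInv δ n x X q q N C par r m)
    (hT : IsTree δ (range x) N C par lab r r) (hm : Mixed δ C x r)
    (hδ : ∀ a, δ x a ≤ 3) : Marks δ n x X q N C par r m := by
  have him : ∀ w, w ∈ (range q).image (fd n m 9) ↔ mark n X m w ≠ 0 := by
    intro w
    rw [mark, h.queue.mem]; simp
  have hcnt : ∀ p, ∀ t, 1 ≤ t → t ≤ 3 →
      fd n m (4 + t) p - X = ((kids N par r p).filter fun w => mark n X m w = t).card := by
    intro p t ht ht'
    rw [h.cnt p t ht ht']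
    congr 1
    ext w
    simp only [mem_filter, him, mem_kids]
    constructor
    · rintro ⟨h1, h2, h3⟩
      exact ⟨⟨(h.sound w h1).1, (h.sound w h1).2.1, h2⟩, h3⟩
    · rintro ⟨⟨h1, h2, h3⟩, h4⟩
      exact ⟨by omega, h3, h4⟩
  refine ⟨h.queue, h.sound, ?_, hcnt⟩
  intro w hw t ht hU
  induction hk : (C w).card using Nat.strong_induction_on generalizing w with
  | _ k ih =>
    by_cases hwx : w < x
    · rw [h.leaf w hwx]
      exact hU w (by rw [hT.leaf_eq w (mem_range.2 hwx)]; simp)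
    · have hwr : w ≠ r := fun he => hm t (he ▸ hU)
      obtain ⟨a, ha⟩ := hT.nonempty w hw
      have ht3 : t ≤ 3 := hU a ha ▸ hδ a
      have hall : ∀ v ∈ kids N par r w, mark n X m v = t := by
        intro v hv
        obtain ⟨h1, h2, h3⟩ := mem_kids.1 hv
        subst h3
        have := hT.ssub v h1 h2
        exact ih _ (hk ▸ card_lt_card this) v h1 (fun b hb => hU b (this.subset hb)) rfl
      have hne : mark n X m w ≠ 0 := by
        refine (h.full w hw (not_lt.1 hwx)).2 ⟨t, by omega, ht3, ?_⟩
        rw [hcnt w t (by omega) ht3, filter_true_of_mem hall]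
      exact hT.uni_unique hw (h.sound w hne).2.2 hU

end PropInv

theorem propagate_spec {M : Machine} {B n : ℕ} {Q : Store → ℕ → Prop} {σ : Store} {t : ℕ}
    (hC : Ctx M B n) {δ : ℕ → ℕ → ℕ} {x X r : ℕ} {N : Finset ℕ} {C : ℕ → Finset ℕ} {lab : ℕ → ℕ}
    (h0 : σ.reg 0 = n) (h4 : σ.reg 4 = X) (hx : x ≤ n) (hX : X + 100 * n + 100 ≤ B)
    (hT : IsTree δ (range x) N C (fd n σ.mem 0) lab r r) (hN : ∀ u ∈ N, u < 4 * n)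
    (hcnt : ∀ u ∈ N, fd n σ.mem 2 u = (kids N (fd n σ.mem 0) r u).card)
    (hδ : ∀ a, δ x a ≤ 3) (hm : Mixed δ C x r) (hq : Queue n X (σ.reg 5) σ.mem)
    (hleaf : ∀ a < x, mark n X σ.mem a = δ x a) (hinner : ∀ a, x ≤ a → mark n X σ.mem a = 0)
    (hzero : ∀ p t, 1 ≤ t → t ≤ 3 → fd n σ.mem (4 + t) p - X = 0)
    (hQ : ∀ τ s, Frame n [4, 5, 6, 7, 9] [5] σ τ →
      Marks δ n x X (τ.reg 5) N C (fd n σ.mem 0) r τ.mem →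
      τ.reg 5 ≤ 2 * ((range x).filter fun a => δ x a ≠ 0).card →
      s ≤ t + 2 * ((range x).filter fun a => δ x a ≠ 0).card * 2000 + 300 → Q τ s) :
    wp M B propagate Q σ t := by
  set d := ((range x).filter fun a => δ x a ≠ 0).card with hd
  set par := fd n σ.mem 0 with hpar
  have ⟨_, hn0, hcells, hbound⟩ := hC
  have hdx : d ≤ x := by
    rw [hd]; exact (card_filter_le _ _).trans_eq (card_range x)
  refine wp_seq (wp_set hC (by simp) (by simp) fun s0 hs0 => ?_)
  simp only [Expr.val_ofNat]
  refine wp_loop hC.toEnv rfl (fun k τ s => ∃ i, k + i = 2 * d ∧ τ.reg 10 = i ∧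
    Frame n [4, 5, 6, 7, 9] [5] σ τ ∧ PropInv δ n x X (τ.reg 5) i N C par r τ.mem ∧
    s ≤ t + 100 + i * 2000) (k := 2 * d)
    ⟨0, rfl, by simp, Frame.refl.set_reg, ?_, by omega⟩ ?_ ?_ ?_
  · refine ⟨by simp, by simpa using hq, fun w hw => ?_, hleaf, fun p t' ht ht' => by
      simpa using hzero p t' ht ht', fun p hp hpx => ?_⟩
    · have hwx : w < x := by
        by_contra hh; exact hw (hinner w (by omega))
      have hwV := mem_range.2 hwx
      have hU : Uni δ C x w (mark n X σ.mem w) := by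
        intro a ha
        rw [hT.leaf_eq w hwV, mem_singleton] at ha
        rw [ha, hleaf w hwx]
      exact ⟨hT.leaf_mem hwV, fun he => hm _ (he ▸ hU), hU⟩
    · have hk := hT.two_le_card_kids hp (by simpa using hpx)
      refine ⟨fun hh => absurd (hinner p hpx) hh, ?_⟩
      rintro ⟨t', ht, ht', hc⟩
      rw [hzero p t' ht ht'] at hc
      omega
  · rintro k τ s -; simp
  · rintro k τ s ⟨i, hki, hi, hF, hP, hs⟩ hlt
    simp [hi] at hlt
    have e0 : τ.reg 0 = n := (hF.reg 0).trans h0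
    have e4 : τ.reg 4 = X := (hF.reg 4).trans h4
    have f0 : ∀ a, fd n τ.mem 0 a = par a := hF.fd 0
    have f2 : ∀ a, fd n τ.mem 2 a = fd n σ.mem 2 a := hF.fd 2
    have hql := hP.queue_le hT
    set q := τ.reg 5 with hqdef
    set w := fd n τ.mem 9 i with hw
    have hwm : mark n X τ.mem w ≠ 0 := (hP.queue.mem w).2 ⟨i, hlt, rfl⟩
    obtain ⟨hwN, hwr, hwU⟩ := hP.sound w hwm
    set c := mark n X τ.mem w with hc
    have hc3 : c ≤ 3 := by
      obtain ⟨a, ha⟩ := hT.nonempty w hwN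
      exact hwU a ha ▸ hδ a
    have hpN : par w ∈ N := hT.par_mem w hwN hwr
    have hpx : x ≤ par w := by simpa using hT.par_notMem hwN hwr
    set p := par w with hp
    have hwim : w ∉ (range i).image (fd n τ.mem 9) := by
      intro hh
      obtain ⟨k', hk', he⟩ := mem_image.1 hh
      have hk' := mem_range.1 hk'
      have := hP.queue.inj k' (by omega) i hlt he
      omega
    have hwk : w ∈ kids N par r p := mem_kids.2 ⟨hwN, hwr, rfl⟩
    have hpm : mark n X τ.mem p = 0 := by
      by_contra hh
      obtain ⟨t', ht, ht', hc'⟩ := (hP.full p hpN hpx).1 hh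
      exact hwim (hP.kids_sub ht ht' hc' w hwk).1
    have hnot : ∀ t', 1 ≤ t' → t' ≤ 3 → fd n τ.mem (4 + t') p - X ≠ (kids N par r p).card :=
      fun t' ht ht' hh => hwim (hP.kids_sub ht ht' hh w hwk).1
    have hcl : fd n τ.mem (4 + c) p - X ≤ i := by
      rw [hP.cnt p c (by omega) hc3]
      exact (card_filter_le _ _).trans
        (card_image_le.trans_eq (card_range i))
    have hwn := hN w hwN
    have hpn := hN p hpN
    have hcost : ((Expr.reg 10).lt (.reg 5)).cost ≤ 80 := Expr.Small.cost_le rfl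
    have hcX : fd n τ.mem 4 w - X = c := rfl
    -- the counter fields after the step
    have hfilter : ∀ (g : ℕ → ℕ), (∀ v ∈ insert w ((range i).image (fd n τ.mem 9)),
        g v = mark n X τ.mem v) → ∀ p' t', 1 ≤ t' → t' ≤ 3 →
        ((insert w ((range i).image (fd n τ.mem 9))).filter fun v => par v = p' ∧ g v = t').card =
        fd n τ.mem (4 + t') p' - X + if t' = c ∧ p' = p then 1 else 0 := by
      intro g hg p' t' ht ht'
      rw [filter_congr fun v hv => by rw [hg v hv], filter_insert,
        hP.cnt p' t' ht ht', ← hc]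
      by_cases h5 : t' = c ∧ p' = p
      · rw [if_pos ⟨h5.2.symm, h5.1.symm⟩, if_pos h5, card_insert_of_notMem]
        exact fun hh => hwim (mem_filter.1 hh).1
      · rw [if_neg (fun hh => h5 ⟨hh.2.symm, hh.1.symm⟩), if_neg h5, add_zero]
    have himage : ∀ f : ℕ → ℕ, (∀ k ≤ i, f k = fd n τ.mem 9 k) →
        (range (i + 1)).image f = insert w ((range i).image (fd n τ.mem 9)) := by
      intro f hf
      rw [range_add_one, image_insert, hf i le_rfl]
      congr 1
      exact image_congr fun k hk => hf k (by simp at hk; omega)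
    refine wp_seq (wp_set hC (by simp [e0, hi]; omega) (by simp [e0, hi]; omega) fun s1 hs1 => ?_)
    refine wp_seq (wp_set hC (by simp [e0, hi]; omega)
      (by simp [e0, hi, ← hw, f0]; omega) fun s2 hs2 => ?_)
    refine wp_seq (wp_set hC (by simp [view, e0, hi]; omega)
      (by simp [view, e0, e4, hi, ← hw]; omega) fun s3 hs3 => ?_)
    simp [view, e0, e4, hi, ← hw, f0]
    change wp M B _ _ ⟨Function.update _ 13 c, _⟩ _
    refine wp_seq (wp_put hC (by simp [e0, ← hp]; omega)
      (by simp [e0, e4, ← hp]; omega) fun s4 hs4 => ?_)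
    simp [e0, e4, ← hp]
    -- the record fields after the update of the counter
    set m₁ := upd n τ.mem (4 + c) p (X + (fd n τ.mem (4 + c) p - X) + 1) with hm₁
    have g4 : ∀ a, fd n m₁ 4 a = fd n τ.mem 4 a := by
      intro a; rw [hm₁, fd_upd (by omega) (by omega), if_neg (by omega)]
    have g9 : ∀ a, fd n m₁ 9 a = fd n τ.mem 9 a := by
      intro a; rw [hm₁, fd_upd (by omega) (by omega), if_neg (by omega)]
    have g2 : ∀ a, fd n m₁ 2 a = fd n σ.mem 2 a := by
      intro a; rw [hm₁, fd_upd (by omega) (by omega), if_neg (by omega), f2]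
    have gc : ∀ p' t', 1 ≤ t' → t' ≤ 3 → fd n m₁ (4 + t') p' - X =
        fd n τ.mem (4 + t') p' - X + if t' = c ∧ p' = p then 1 else 0 := by
      intro p' t' ht ht'
      rw [hm₁, fd_upd (by omega) (by omega)]
      by_cases h5 : t' = c ∧ p' = p
      · rw [if_pos ⟨by omega, h5.2⟩, if_pos h5, h5.1, h5.2]; omega
      · rw [if_neg (fun hh => h5 ⟨by omega, hh.2⟩), if_neg h5, add_zero]
    have hF₁ : Frame n [4, 5, 6, 7, 9] [5] σ ⟨τ.reg, m₁⟩ := by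
      refine hF.put ?_ (by omega)
      have : c = 1 ∨ c = 2 ∨ c = 3 := by omega
      rcases this with h | h | h <;> simp [h]
    have hq₁ : Queue n X q m₁ :=
      ⟨by simpa only [g9] using hP.queue.inj, by simpa only [g9, g4] using hP.queue.mem⟩
    have hmk₁ : ∀ a, mark n X m₁ a = mark n X τ.mem a := fun a => by rw [mark, g4, mark]
    refine wp_seq (wp_if hC (by simp [e0]; omega) (fun hf s5 hs5 => ?_) (fun hf s5 hs5 => ?_))
    · simp [e0, e4, g2, hcnt p hpN] at hf
      rw [gc p c (by omega) hc3, if_pos ⟨rfl, rfl⟩] at hf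
      have hpim : p ∉ insert w ((range i).image (fd n τ.mem 9)) := by
        intro hh
        rcases mem_insert.1 hh with hh | hh
        · exact hT.par_ne hwN hwr hh
        · exact (hP.image_sub hh).2.2 hpm
      have hmem1 : ∀ k, k ≤ i → k ≠ q := by omega
      refine wp_seq (wp_put hC (by simp) (by simp [e4]; omega) fun s6 hs6 => ?_)
      simp [e4]
      refine wp_seq (wp_put hC (by simp) (by simp; omega) fun s7 hs7 => ?_)
      simp
      refine wp_set hC (by simp) (by simp; omega) fun s8 hs8 => ?_
      simp
      refine wp_set hC (by simp) (by simp [hi]; omega) fun s9 hs9 => ?_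
      simp [hi]
      set m₂ := upd n (upd n m₁ 4 p (X + c)) 9 q p with hm₂
      have k4 : ∀ a, fd n m₂ 4 a = if a = p then X + c else fd n τ.mem 4 a := by
        intro a; simp [hm₂, fd_upd, g4]
      have k9 : ∀ a, fd n m₂ 9 a = if a = q then p else fd n τ.mem 9 a := by
        intro a; simp [hm₂, fd_upd, g9]
      have kc : ∀ p' t', 1 ≤ t' → t' ≤ 3 → fd n m₂ (4 + t') p' = fd n m₁ (4 + t') p' := by
        intro p' t' ht ht'
        rw [hm₂, fd_upd (by omega) (by omega), if_neg (by omega), fd_upd (by omega) (by omega),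
          if_neg (by omega)]
      have hmk₂ : ∀ a, mark n X m₂ a = if a = p then c else mark n X τ.mem a := by
        intro a; rw [mark, k4]; split_ifs <;> simp [mark]
      have hq₂ : Queue n X (q + 1) m₂ := by
        have := hq₁.push (a := p) (v := c) (by rw [g4]; exact hpm) hwm
        constructor
        · intro k hk k' hk'
          have := this.inj k hk k' hk'
          simpa [fd_upd, k9, g9] using this
        · intro a
          have := this.mem a
          simpa [fd_upd, k9, g9, k4, g4] using this
      have hUp : Uni δ C x p c := by
        have hall : ∀ v ∈ kids N par r p, mark n X τ.mem v = c := by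
          have hcc := hfilter (mark n X τ.mem) (fun _ _ => rfl) p c (by omega) hc3
          rw [if_pos ⟨rfl, rfl⟩, hf] at hcc
          have hsub : ((insert w ((range i).image (fd n τ.mem 9))).filter
              fun v => par v = p ∧ mark n X τ.mem v = c) ⊆ kids N par r p := by
            intro v hv
            obtain ⟨h1, h2, h3⟩ := mem_filter.1 hv
            rcases mem_insert.1 h1 with rfl | h1
            · exact hwk
            · obtain ⟨h5, h6, -⟩ := hP.image_sub h1
              exact mem_kids.2 ⟨h5, h6, h2⟩
          have := eq_of_subset_of_card_le hsub hcc.ge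
          intro v hv
          rw [← this] at hv
          exact (mem_filter.1 hv).2.2
        intro a ha
        obtain ⟨v, hv, hvr, hvp, hav⟩ := hT.cover p hpN (by simpa using hpx) a ha
        have h5 := hall v (mem_kids.2 ⟨hv, hvr, hvp⟩)
        exact h5 ▸ (hP.sound v (by rw [h5]; exact hwm)).2.2 a hav
      refine ⟨k - 1, by omega, by omega, ?_, ⟨by omega, hq₂, ?_, ?_, ?_, ?_⟩,
        by omega⟩
      · have h5 : Frame n [4, 5, 6, 7, 9] [5] σ ⟨τ.reg, m₂⟩ :=
          hF₁.put.put
        exact ((((h5.set_reg (i := 11) (v := w) (by simp)).set_reg (i := 12) (v := p)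
          (by simp)).set_reg (i := 13) (v := c) (by simp)).set_reg (i := 5) (v := q + 1)
          (by simp)).set_reg (i := 10) (v := i + 1) (by simp)
      · intro a ha
        rw [hmk₂] at ha ⊢
        split_ifs at ha ⊢ with h5
        · rw [h5]; exact ⟨hpN, fun he => hm c (he ▸ hUp), hUp⟩
        · exact hP.sound a ha
      · intro a ha
        rw [hmk₂, if_neg (by omega)]; exact hP.leaf a ha
      · intro p' t' ht ht'
        rw [kc p' t' ht ht', gc p' t' ht ht', himage _ fun k hk => by rw [k9, if_neg (hmem1 k hk)]]
        refine (hfilter _ (fun v hv => ?_) p' t' ht ht').symm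
        rw [hmk₂, if_neg (show v ≠ p from fun he => hpim (he ▸ hv))]
      · intro p' hp' hpx'
        by_cases h5 : p' = p
        · rw [h5, hmk₂, if_pos rfl]
          exact ⟨fun _ => ⟨c, by omega, hc3, by
            rw [kc p c (by omega) hc3, gc p c (by omega) hc3, if_pos ⟨rfl, rfl⟩, hf]⟩, fun _ => hwm⟩
        · rw [hmk₂, if_neg h5, hP.full p' hp' hpx']
          refine exists_congr fun t' => and_congr_right fun ht => and_congr_right fun ht' => ?_
          rw [kc p' t' ht ht', gc p' t' ht ht', if_neg fun hh => h5 hh.2, add_zero]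
    · simp [e0, e4, g2, hcnt p hpN] at hf
      rw [gc p c (by omega) hc3, if_pos ⟨rfl, rfl⟩] at hf
      refine wp_skip (wp_set hC (by simp) (by simp [hi]; omega) fun s6 hs6 => ?_)
      simp [hi]
      refine ⟨k - 1, by omega, by omega, ?_, ⟨by simp; omega, by simpa using hq₁, ?_, ?_,
        ?_, ?_⟩, by omega⟩
      · exact (((hF₁.set_reg (i := 11) (v := w) (by simp)).set_reg (i := 12) (v := p)
          (by simp)).set_reg (i := 13) (v := c) (by simp)).set_reg (i := 10) (v := i + 1) (by simp)
      · intro a ha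
        rw [hmk₁] at ha ⊢; exact hP.sound a ha
      · intro a ha
        rw [hmk₁]; exact hP.leaf a ha
      · intro p' t' ht ht'
        rw [gc p' t' ht ht', himage _ fun k _ => g9 k]
        exact (hfilter _ (fun v _ => hmk₁ v) p' t' ht ht').symm
      · intro p' hp' hpx'
        rw [hmk₁, hP.full p' hp' hpx']
        refine exists_congr fun t' => and_congr_right fun ht => and_congr_right fun ht' => ?_
        rw [gc p' t' ht ht']
        by_cases h5 : t' = c ∧ p' = p
        · rw [h5.1, h5.2, if_pos ⟨rfl, rfl⟩]
          exact ⟨fun hh => absurd hh (hnot c (by omega) hc3), fun hh => absurd hh hf⟩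
        · rw [if_neg h5, add_zero]
  · rintro k τ s ⟨i, hki, hi, hF, hP, hs⟩ hlt
    simp [hi] at hlt
    have hql := hP.queue_le hT
    have h5 : τ.reg 5 = i := le_antisymm hlt hP.le
    refine hQ τ _ hF ?_ hql ?_
    · rw [h5] at hP ⊢; exact hP.marks hT hm hδ
    · have h6 := Expr.Small.cost_le (e := (Expr.reg 10).lt (.reg 5)) rfl
      have : i * 2000 ≤ 2 * d * 2000 := Nat.mul_le_mul_right _ (by omega)
      omega


/-! ### The position of the new vertex in the tree -/

/-- The functions `cnt` and `sum` give the number and the sum of the children of every node. The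
sum identifies a child when all the others are known. -/
structure Kept (N : Finset ℕ) (par : ℕ → ℕ) (r : ℕ) (cnt sum : ℕ → ℕ) : Prop where
  cnt : ∀ u, cnt u = (kids N par r u).card
  sum : ∀ u, sum u = ∑ w ∈ kids N par r u, w

/-- The node `u` is a lowest mixed node; the children of `u` have the colours `lab u` and `τ` with
the new vertex `x`, and `g` gives the colour of every child. -/
structure Lowest (δ : ℕ → ℕ → ℕ) (N : Finset ℕ) (C : ℕ → Finset ℕ) (par lab : ℕ → ℕ)
    (r x u τ : ℕ) (g : ℕ → ℕ) : Prop where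
  mem : u ∈ N
  mixed : Mixed δ C x u
  ne : τ ≠ lab u
  kid : ∀ w ∈ kids N par r u, Uni δ C x w (g w) ∧ (g w = lab u ∨ g w = τ)
  exists_lab : ∃ w ∈ kids N par r u, g w = lab u
  exists_tau : ∃ w ∈ kids N par r u, g w = τ

/-- The new vertex `x`, whose colour with all leaves below `T` is `τ`, can be inserted next to the
leaves below `T`: above `T`, its colours are those prescribed by the labels. -/
structure Target (δ : ℕ → ℕ → ℕ) (N : Finset ℕ) (C : ℕ → Finset ℕ) (par lab : ℕ → ℕ)
    (r e x τ T : ℕ) : Prop where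
  mem : T ∈ N
  ne : T ≠ r
  exc : e = T ∨ e = r
  join : lab T = τ → e = r
  uni : Uni δ C x T τ
  anc : ∀ w ∈ N, w ≠ r → C T ⊆ C w → ∀ b ∈ C (par w), b ∉ C w → δ x b = lab (par w)
  lab_par : τ ≠ lab (par T)

namespace IsTree

variable {δ : ℕ → ℕ → ℕ} {V N : Finset ℕ} {C : ℕ → Finset ℕ} {par lab par' lab' : ℕ → ℕ}
  {cnt sum cnt' sum' g : ℕ → ℕ} {r e x u τ : ℕ}

theorem kids_eq_empty (h : IsTree δ V N C par lab r e) {v : ℕ} (hv : v ∉ N) :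
    kids N par r v = ∅ := by
  refine eq_empty_of_forall_notMem fun w hw => ?_
  obtain ⟨h1, h2, rfl⟩ := mem_kids.1 hw
  exact hv (h.par_mem w h1 h2)

/-- Above a mixed node, the colours of the new vertex are those prescribed by the labels. -/
theorem anc_of_mixed (h : IsTree δ V N C par lab r r) (hx : x ∉ V)
    (hδ : IsUltra δ (insert x V)) (hm : Mixed δ C x u) {w : ℕ} (hw : w ∈ N)
    (hr : w ≠ r) (hsub : C u ⊆ C w) {b : ℕ} (hb : b ∈ C (par w)) (hbw : b ∉ C w) :
    δ x b = lab (par w) := by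
  obtain ⟨w', hw', hr', hp, hbw'⟩ := h.cover (par w) (h.par_mem w hw hr) (h.par_notMem hw hr) b hb
  exact h.sibling_of_mixed hx hδ hw hr hw' hr' hp (fun he => hbw (he ▸ hbw'))
    (mixed_mono hsub hm) hbw'

/-- If a single child of the lowest mixed node has the colour `τ`, it is the target. -/
theorem target_single (h : IsTree δ V N C par lab r r) (hx : x ∉ V)
    (hδ : IsUltra δ (insert x V)) (hL : Lowest δ N C par lab r x u τ g) {T : ℕ}
    (hT : (kids N par r u).filter (fun w => g w = τ) = {T}) :
    Target δ N C par lab r r x τ T := by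
  have hT' : T ∈ (kids N par r u).filter (fun w => g w = τ) := by simp [hT]
  obtain ⟨hTk, hTτ⟩ := mem_filter.1 hT'
  obtain ⟨h1, h2, h3⟩ := mem_kids.1 hTk
  refine ⟨h1, h2, Or.inr rfl, fun _ => rfl, hTτ ▸ (hL.kid T hTk).1, ?_, h3.symm ▸ hL.ne⟩
  intro w hw hr hsub b hb hbw
  obtain ⟨a, ha⟩ := h.nonempty T h1
  rcases h.nested h1 hw ha (hsub ha) with h4 | ⟨-, h4⟩
  · have : T = w := h.inj h1 hw (hsub.antisymm h4)
    subst this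
    obtain ⟨w', hw', hr', hp, hbw'⟩ := h.cover (par T) (h.par_mem T hw hr) (h.par_notMem hw hr) b hb
    have hwk : w' ∈ kids N par r u := mem_kids.2 ⟨hw', hr', hp.trans h3⟩
    rcases (hL.kid w' hwk).2 with h5 | h5
    · rw [h3, ← h5]; exact (hL.kid w' hwk).1 b hbw'
    · have : w' ∈ (kids N par r u).filter (fun w => g w = τ) := mem_filter.2 ⟨hwk, h5⟩
      rw [hT, mem_singleton] at this
      exact absurd (this ▸ hbw') hbw
  · exact h.anc_of_mixed hx hδ hL.mixed hw hr (h3 ▸ h4) hb hbw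

/-- If several children of the lowest mixed node have the colour `τ`, they are collected below a
new node, and the lower one of the two nodes is the target. -/
theorem target_split (h : IsTree δ V N C par lab r r) (hx : x ∉ V)
    (hδ : IsUltra δ (insert x V)) (hL : Lowest δ N C par lab r x u τ g) {z hi lo : ℕ}
    {Bs : Finset ℕ} (hBs : Bs = (kids N par r u).filter (fun w => g w = τ)) (hB2 : 2 ≤ Bs.card)
    (hz : z ∉ N) (hio : hi = u ∧ lo = z ∨ hi = z ∧ lo = u ∧ u ≠ r)
    (pB : ∀ w ∈ Bs, par' w = lo) (pA : ∀ w ∈ kids N par r u, w ∉ Bs → par' w = hi)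
    (plo : par' lo = hi) (phi : hi ≠ r → par' hi = par u)
    (pw : ∀ w ∈ N, w ≠ r → w ≠ u → par w ≠ u → par' w = par w)
    (lhi : lab' hi = lab u) (llo : lab' lo = lab u) (lw : ∀ w ∈ N, w ≠ u → lab' w = lab w) :
    ∃ C', IsTree δ V (insert z N) C' par' lab' r lo ∧
      Target δ (insert z N) C' par' lab' r lo x τ lo := by
  have hB : Bs ⊆ kids N par r u := hBs ▸ filter_subset _ _
  have hA : ∃ w ∈ kids N par r u, w ∉ Bs := by
    obtain ⟨w, hw, he⟩ := hL.exists_lab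
    refine ⟨w, hw, fun hh => ?_⟩
    rw [hBs, mem_filter, he] at hh
    exact hL.ne hh.2.symm
  have hu := hL.mem
  have h' := h.split hu hB hB2 hA hδ.comm hz hio pB pA plo phi pw lhi llo lw
  refine ⟨_, h', ?_⟩
  have huz : u ≠ z := fun hh => hz (hh ▸ hu)
  have hzr : z ≠ r := fun hh => hz (hh ▸ h.root_mem)
  have hhl : lo ≠ hi := by
    rcases hio with ⟨rfl, rfl⟩ | ⟨rfl, rfl, -⟩ <;> [exact huz.symm; exact huz]
  have hlr : lo ≠ r := by rcases hio with ⟨rfl, rfl⟩ | ⟨rfl, rfl, hh⟩ <;> [exact hzr; exact hh]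
  have hloN : lo ∈ insert z N := by
    rcases hio with ⟨rfl, rfl⟩ | ⟨rfl, rfl, hh⟩ <;> simp [hu]
  have hhir : u = r → hi = r := by
    rcases hio with ⟨rfl, rfl⟩ | ⟨rfl, rfl, hh⟩ <;> [exact id; exact fun h => absurd h hh]
  have hN : ∀ w ∈ N, w ≠ u → w ≠ hi ∧ w ≠ lo := by
    intro w hw hwu
    have : w ≠ z := fun hh => hz (hh ▸ hw)
    rcases hio with ⟨rfl, rfl⟩ | ⟨rfl, rfl, hh⟩ <;> exact ⟨by assumption, by assumption⟩
  have hcas : ∀ w ∈ insert z N, w = hi ∨ w = lo ∨ (w ∈ N ∧ w ≠ u) := by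
    intro w hw
    rcases mem_insert.1 hw with rfl | hw
    · rcases hio with ⟨rfl, rfl⟩ | ⟨rfl, rfl, hh⟩ <;> simp
    · by_cases hwu : w = u
      · subst hwu
        rcases hio with ⟨rfl, rfl⟩ | ⟨rfl, rfl, hh⟩ <;> simp
      · exact Or.inr (Or.inr ⟨hw, hwu⟩)
  have hBk : ∀ w ∈ Bs, w ∈ N ∧ w ≠ r ∧ par w = u := fun w hw => mem_kids.1 (hB hw)
  refine ⟨hloN, hlr, Or.inl rfl, fun hh => absurd (llo ▸ hh).symm hL.ne, ?_, ?_, by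
    rw [plo, lhi]; exact hL.ne⟩
  · intro a ha
    simp only [hhl, if_false, if_true, mem_biUnion] at ha
    obtain ⟨w, hw, ha⟩ := ha
    rw [hBs, mem_filter] at hw
    exact hw.2 ▸ (hL.kid w hw.1).1 a ha
  · intro w hw hr hsub b hb hbw
    rcases hcas w hw with rfl | rfl | ⟨hwN, hwu⟩
    · -- the upper node
      have hur : u ≠ r := fun he => hr (hhir he)
      have hpu : par u ≠ u := h.par_ne hu hur
      obtain ⟨h3, h4⟩ := hN (par u) (h.par_mem u hu hur) hpu
      simp only [phi hr, h3, h4, if_false, if_true] at hb hbw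
      rw [phi hr, lw _ (h.par_mem u hu hur) hpu]
      exact h.anc_of_mixed hx hδ hL.mixed hu hur subset_rfl hb hbw
    · -- the lower node
      simp only [plo, hhl, if_false, if_true, mem_biUnion, not_exists, not_and] at hb hbw
      rw [plo, lhi]
      obtain ⟨w', hw', hr', hp, hbw'⟩ := h.cover u hu (h.mixed_notMem hL.mixed) b hb
      have hwk : w' ∈ kids N par r u := mem_kids.2 ⟨hw', hr', hp⟩
      rcases (hL.kid w' hwk).2 with h5 | h5
      · rw [← h5]; exact (hL.kid w' hwk).1 b hbw'
      · exact absurd hbw' (hbw w' (by rw [hBs]; exact mem_filter.2 ⟨hwk, h5⟩))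
    · -- the node contains two children of `u`, hence `u`
      obtain ⟨h3, h4⟩ := hN w hwN hwu
      simp only [h3, h4, hhl, if_false, if_true] at hsub hbw
      obtain ⟨b₁, hb₁, b₂, hb₂, hne⟩ := one_lt_card.1 (show 1 < Bs.card by omega)
      obtain ⟨k1, k2, k3⟩ := hBk b₁ hb₁
      obtain ⟨l1, l2, l3⟩ := hBk b₂ hb₂
      obtain ⟨a, ha⟩ := h.nonempty b₁ k1
      obtain ⟨a', ha'⟩ := h.nonempty b₂ l1
      have hCu : C u ⊆ C w := by
        rcases h.nested k1 hwN ha (hsub (mem_biUnion.2 ⟨b₁, hb₁, ha⟩)) with h5 | ⟨-, h5⟩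
        · exact absurd (h.eq_of_sib k1 k2 l1 l2 (k3.trans l3.symm)
            (h5 (hsub (mem_biUnion.2 ⟨b₂, hb₂, ha'⟩))) ha') hne
        · rwa [k3] at h5
      have hpw : par w ≠ u := fun he => (h.ssub w hwN hr).2 (he ▸ hCu)
      obtain ⟨h5, h6⟩ := hN (par w) (h.par_mem w hwN hr) hpw
      rw [pw w hwN hr hwu hpw] at hb ⊢
      simp only [h5, h6, if_false] at hb
      rw [lw _ (h.par_mem w hwN hr) hpw]
      exact h.anc_of_mixed hx hδ hL.mixed hwN hr hCu hb hbw

/-- Moving the children in `Bs` below a new node `z`, which becomes a child of `u`. -/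
theorem split_below (h : IsTree δ V N C par lab r r) (hx : x ∉ V)
    (hδ : IsUltra δ (insert x V)) (hL : Lowest δ N C par lab r x u τ g) {z : ℕ}
    {Bs : Finset ℕ} (hBs : Bs = (kids N par r u).filter (fun w => g w = τ)) (hB2 : 2 ≤ Bs.card)
    (hz : z ∉ N) (hk : Kept N par r cnt sum)
    (hp : ∀ w, par' w = if w = z then u else if w ∈ Bs then z else par w)
    (hl : ∀ w, lab' w = if w = z then lab u else lab w)
    (hc : ∀ w, cnt' w = if w = z then Bs.card else if w = u then cnt u - Bs.card + 1 else cnt w)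
    (hs : ∀ w, sum' w = if w = z then ∑ v ∈ Bs, v else
      if w = u then sum u - ∑ v ∈ Bs, v + z else sum w) :
    ∃ C', IsTree δ V (insert z N) C' par' lab' r z ∧
      Target δ (insert z N) C' par' lab' r z x τ z ∧ Kept (insert z N) par' r cnt' sum' := by
  have hB : Bs ⊆ kids N par r u := hBs ▸ filter_subset _ _
  have hzw : ∀ w ∈ N, w ≠ z := fun w hw he => hz (he ▸ hw)
  have hkN : ∀ w ∈ kids N par r u, w ∈ N := fun w hw => (mem_kids.1 hw).1
  have hu := hL.mem
  have pB : ∀ w ∈ Bs, par' w = z := fun w hw => by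
    rw [hp, if_neg (hzw w (hkN w (hB hw))), if_pos hw]
  have pA : ∀ w ∈ kids N par r u, w ∉ Bs → par' w = u := fun w hw hwB => by
    rw [hp, if_neg (hzw w (hkN w hw)), if_neg hwB]; exact (mem_kids.1 hw).2.2
  have pz : par' z = u := by rw [hp, if_pos rfl]
  have huB : u ∉ Bs := fun hh => h.par_ne (hkN u (hB hh)) (mem_kids.1 (hB hh)).2.1
    (mem_kids.1 (hB hh)).2.2
  have pu : u ≠ r → par' u = par u := fun _ => by rw [hp, if_neg (hzw u hu), if_neg huB]
  have pw : ∀ w ∈ N, w ≠ r → w ≠ u → par w ≠ u → par' w = par w := fun w hw _ _ hpw => by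
    rw [hp, if_neg (hzw w hw), if_neg fun hh => hpw (mem_kids.1 (hB hh)).2.2]
  obtain ⟨C', h', hT⟩ := h.target_split (lab' := lab') hx hδ hL hBs hB2 hz (Or.inl ⟨rfl, rfl⟩) pB pA pz pu pw
    (by rw [hl, if_neg (hzw u hu)]) (by rw [hl, if_pos rfl])
    (fun w hw _ => by rw [hl, if_neg (hzw w hw)])
  obtain ⟨e1, e2, e3⟩ := h.kids_split hu hB hz (Or.inl ⟨rfl, rfl⟩) pB pA pz pu pw
  have e4 : ∀ v, v ≠ z → v ≠ u → kids (insert z N) par' r v = kids N par r v := by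
    intro v hvz hvu
    by_cases hv : v ∈ N
    · rw [e3 v hv hvu]
      split_ifs with h5
      · refine insert_erase (mem_kids.2 ⟨hu, h5.1, h5.2⟩)
      · rfl
    · rw [h.kids_eq_empty hv, h'.kids_eq_empty (by simp [hvz, hv])]
  have hzn : z ∉ kids N par r u \ Bs := fun hh =>
    hzw z (hkN z (mem_sdiff.1 hh).1) rfl
  refine ⟨C', h', hT, fun v => ?_, fun v => ?_⟩
  · rw [hc]
    split_ifs with h1 h2
    · rw [h1, e2]
    · rw [h2, e1, card_insert_of_notMem hzn, card_sdiff_of_subset hB, hk.cnt]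
    · rw [e4 v h1 h2, hk.cnt]
  · rw [hs]
    split_ifs with h1 h2
    · rw [h1, e2]
    · rw [h2, e1, sum_insert hzn, hk.sum, ← sum_sdiff hB]; omega
    · rw [e4 v h1 h2, hk.sum]

/-- Moving the children outside of `Bs` to a new node `z`, which becomes the parent of `u`. -/
theorem split_above (h : IsTree δ V N C par lab r r) (hx : x ∉ V)
    (hδ : IsUltra δ (insert x V)) (hL : Lowest δ N C par lab r x u τ g) {z : ℕ}
    {Bs As : Finset ℕ} (hBs : Bs = (kids N par r u).filter (fun w => g w = τ))
    (hAs : As = (kids N par r u).filter (fun w => g w = lab u)) (hB2 : 2 ≤ Bs.card)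
    (hz : z ∉ N) (hur : u ≠ r) (hk : Kept N par r cnt sum)
    (hp : ∀ w, par' w = if w = u then z else if w = z then par u else if w ∈ As then z else par w)
    (hl : ∀ w, lab' w = if w = z then lab u else lab w)
    (hc : ∀ w, cnt' w = if w = u then cnt u - As.card else if w = z then As.card + 1 else cnt w)
    (hs : ∀ w, sum' w = if w = u then sum u - ∑ v ∈ As, v else if w = z then ∑ v ∈ As, v + u else
      if w = par u then sum (par u) - u + z else sum w) :
    ∃ C', IsTree δ V (insert z N) C' par' lab' r u ∧
      Target δ (insert z N) C' par' lab' r u x τ u ∧ Kept (insert z N) par' r cnt' sum' := by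
  have hB : Bs ⊆ kids N par r u := hBs ▸ filter_subset _ _
  have hA : As ⊆ kids N par r u := hAs ▸ filter_subset _ _
  have hAB : kids N par r u \ Bs = As := by
    ext w
    rw [hBs, hAs]
    simp only [mem_sdiff, mem_filter, not_and]
    constructor
    · rintro ⟨h1, h2⟩; exact ⟨h1, (hL.kid w h1).2.resolve_right (h2 h1)⟩
    · rintro ⟨h1, h2⟩; exact ⟨h1, fun _ he => hL.ne (he.symm.trans h2)⟩
  have hBA : kids N par r u \ As = Bs := by
    rw [← hAB, Finset.sdiff_sdiff_eq_self hB]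
  have hzw : ∀ w ∈ N, w ≠ z := fun w hw he => hz (he ▸ hw)
  have hkN : ∀ w ∈ kids N par r u, w ∈ N := fun w hw => (mem_kids.1 hw).1
  have hu := hL.mem
  have hku : ∀ w ∈ kids N par r u, w ≠ u := fun w hw he =>
    h.par_ne (hkN w hw) (mem_kids.1 hw).2.1 ((mem_kids.1 hw).2.2.trans he.symm)
  have pB : ∀ w ∈ Bs, par' w = u := fun w hw => by
    have hw' := hB hw
    rw [← hBA, mem_sdiff] at hw
    rw [hp, if_neg (hku w hw'), if_neg (hzw w (hkN w hw')), if_neg hw.2, (mem_kids.1 hw').2.2]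
  have pA : ∀ w ∈ kids N par r u, w ∉ Bs → par' w = z := fun w hw hwB => by
    rw [hp, if_neg (hku w hw), if_neg (hzw w (hkN w hw)), if_pos]
    rw [← hAB]; exact mem_sdiff.2 ⟨hw, hwB⟩
  have pu : par' u = z := by rw [hp, if_pos rfl]
  have huz := hzw u hu
  have pz : z ≠ r → par' z = par u := fun _ => by rw [hp, if_neg huz.symm, if_pos rfl]
  have pw : ∀ w ∈ N, w ≠ r → w ≠ u → par w ≠ u → par' w = par w := fun w hw _ hwu hpw => by
    rw [hp, if_neg hwu, if_neg (hzw w hw), if_neg fun hh => hpw (mem_kids.1 (hA hh)).2.2]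
  obtain ⟨C', h', hT⟩ := h.target_split (lab' := lab') hx hδ hL hBs hB2 hz (Or.inr ⟨rfl, rfl, hur⟩) pB pA pu pz pw
    (by rw [hl, if_pos rfl]) (by rw [hl, if_neg huz])
    (fun w hw _ => by rw [hl, if_neg (hzw w hw)])
  obtain ⟨e1, e2, e3⟩ := h.kids_split hu hB hz (Or.inr ⟨rfl, rfl, hur⟩) pB pA pu pz pw
  rw [hAB] at e1
  have hpu := h.par_mem u hu hur
  have hpuu := h.par_ne hu hur
  have hpuz := hzw _ hpu
  have e4 : ∀ v, v ≠ z → v ≠ u → v ≠ par u → kids (insert z N) par' r v = kids N par r v := by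
    intro v hvz hvu hvp
    by_cases hv : v ∈ N
    · rw [e3 v hv hvu, if_neg fun hh => hvp hh.2.symm]
    · rw [h.kids_eq_empty hv, h'.kids_eq_empty (by simp [hvz, hv])]
  have e5 : kids (insert z N) par' r (par u) = insert z ((kids N par r (par u)).erase u) := by
    rw [e3 _ hpu hpuu, if_pos ⟨hur, rfl⟩]
  have hum : u ∈ kids N par r (par u) := mem_kids.2 ⟨hu, hur, rfl⟩
  have hzn : z ∉ (kids N par r (par u)).erase u := fun hh =>
    hzw z (mem_kids.1 (mem_of_mem_erase hh)).1 rfl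
  have huA : u ∉ As := fun hh => hku u (hA hh) rfl
  refine ⟨C', h', hT, fun v => ?_, fun v => ?_⟩
  · rw [hc]
    split_ifs with h1 h2
    · rw [h1, e2, hk.cnt, ← hBA, card_sdiff_of_subset hA]
    · rw [h2, e1, card_insert_of_notMem huA]
    · by_cases h3 : v = par u
      · rw [h3, e5, card_insert_of_notMem hzn, card_erase_of_mem hum, hk.cnt]
        have := card_pos.2 ⟨u, hum⟩
        omega
      · rw [e4 v h2 h1 h3, hk.cnt]
  · rw [hs]
    split_ifs with h1 h2 h3
    · rw [h1, e2, hk.sum, ← sum_sdiff hA, hBA]; omega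
    · rw [h2, e1, sum_insert huA]; omega
    · rw [h3, e5, sum_insert hzn, hk.sum, ← add_sum_erase _ _ hum]
      simp; omega
    · rw [e4 v h2 h1 h3, hk.sum]

/-- Inserting the new vertex below a target with label `τ`. -/
theorem join (h : IsTree δ V N C par lab r e) {T : ℕ} (hT : Target δ N C par lab r e x τ T)
    (hTV : T ∉ V) (hlT : lab T = τ) (hx : x ∉ N) (hδ : ∀ a b, δ a b = δ b a)
    (hk : Kept N par r cnt sum)
    (hp : ∀ w, par' w = if w = x then T else par w)
    (hlx : lab' x ≠ τ) (hl : ∀ w ∈ N, lab' w = lab w)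
    (hc : ∀ w, cnt' w = if w = T then cnt w + 1 else cnt w)
    (hs : ∀ w, sum' w = if w = T then sum w + x else sum w) :
    ∃ C', IsTree δ (insert x V) (insert x N) C' par' lab' r r ∧
      Kept (insert x N) par' r cnt' sum' := by
  have hxw : ∀ w ∈ N, w ≠ x := fun w hw he => hx (he ▸ hw)
  have pw : ∀ w ∈ N, w ≠ r → par' w = par w := fun w hw _ => by rw [hp, if_neg (hxw w hw)]
  have px : par' x = T := by rw [hp, if_pos rfl]
  have h' := h.attach_join hT.mem hTV hx hδ (hlT.symm ▸ hT.uni) hT.anc px pw (hlT.symm ▸ hlx) hl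
  obtain ⟨e1, e2, e3⟩ := h.kids_join hT.mem hx px pw
  rw [hT.join hlT] at h'
  have e4 : ∀ v, v ≠ T → kids (insert x N) par' r v = kids N par r v := by
    intro v hvT
    by_cases hv : v ∈ N
    · exact e3 v hv hvT
    · rw [h.kids_eq_empty hv]
      by_cases hvx : v = x
      · rw [hvx, e2]
      · rw [h'.kids_eq_empty (by simp [hvx, hv])]
  have hxk : x ∉ kids N par r T := fun hh => hx (mem_kids.1 hh).1
  refine ⟨_, h', fun v => ?_, fun v => ?_⟩
  · rw [hc]
    split_ifs with h1
    · rw [h1, e1, card_insert_of_notMem hxk, hk.cnt]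
    · rw [e4 v h1, hk.cnt]
  · rw [hs]
    split_ifs with h1
    · rw [h1, e1, sum_insert hxk, hk.sum]; omega
    · rw [e4 v h1, hk.sum]

/-- Inserting the new vertex next to a target whose label is not `τ`. -/
theorem pair (h : IsTree δ V N C par lab r e) {T p : ℕ} (hT : Target δ N C par lab r e x τ T)
    (hlT : lab T ≠ τ) (hx : x ∉ N) (hpN : p ∉ N) (hpx : p ≠ x) (hδ : ∀ a b, δ a b = δ b a)
    (hk : Kept N par r cnt sum)
    (hp : ∀ w, par' w = if w = x then p else if w = T then p else if w = p then par T else par w)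
    (hlx : lab' x ≠ τ) (hlp : lab' p = τ) (hl : ∀ w ∈ N, lab' w = lab w)
    (hc : ∀ w, cnt' w = if w = p then 2 else cnt w)
    (hs : ∀ w, sum' w = if w = par T then sum w - T + p else if w = p then T + x else sum w) :
    ∃ C', IsTree δ (insert x V) (insert p (insert x N)) C' par' lab' r r ∧
      Kept (insert p (insert x N)) par' r cnt' sum' := by
  have hxw : ∀ w ∈ N, w ≠ x := fun w hw he => hx (he ▸ hw)
  have hpw : ∀ w ∈ N, w ≠ p := fun w hw he => hpN (he ▸ hw)
  have px : par' x = p := by rw [hp, if_pos rfl]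
  have pT : par' T = p := by rw [hp, if_neg (hxw T hT.mem), if_pos rfl]
  have pp : par' p = par T := by
    rw [hp, if_neg hpx, if_neg (hpw T hT.mem).symm, if_pos rfl]
  have pw : ∀ w ∈ N, w ≠ r → w ≠ T → par' w = par w := fun w hw _ hwT => by
    rw [hp, if_neg (hxw w hw), if_neg hwT, if_neg (hpw w hw)]
  have h' := h.attach_new hT.exc hT.mem hT.ne hx hpN hpx hδ (hlp.symm ▸ hT.uni) hT.anc px pT pp pw
    (hlp.symm ▸ hlx) (hlp.symm ▸ hlT) (hlp.symm ▸ hT.lab_par) hl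
  obtain ⟨e1, e2, e3, e4⟩ := h.kids_new hT.mem hT.ne hx hpN hpx px pT pp pw
  have hTN := h.par_mem T hT.mem hT.ne
  have e5 : ∀ v, v ≠ p → v ≠ par T →
      kids (insert p (insert x N)) par' r v = kids N par r v := by
    intro v hvp hvT
    by_cases hv : v ∈ N
    · exact e4 v hv hvT
    · rw [h.kids_eq_empty hv]
      by_cases hvx : v = x
      · rw [hvx, e2]
      · rw [h'.kids_eq_empty (by simp [hvx, hvp, hv])]
  have hTm : T ∈ kids N par r (par T) := mem_kids.2 ⟨hT.mem, hT.ne, rfl⟩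
  have hpn : p ∉ (kids N par r (par T)).erase T := fun hh =>
    hpw p (mem_kids.1 (mem_of_mem_erase hh)).1 rfl
  refine ⟨_, h', fun v => ?_, fun v => ?_⟩
  · rw [hc]
    split_ifs with h1
    · rw [h1, e1, card_pair (hxw T hT.mem)]
    · by_cases h2 : v = par T
      · rw [h2, e3, card_insert_of_notMem hpn, card_erase_of_mem hTm, hk.cnt]
        have := card_pos.2 ⟨T, hTm⟩
        omega
      · rw [e5 v h1 h2, hk.cnt]
  · rw [hs]
    split_ifs with h1 h2
    · rw [h1, e3, sum_insert hpn, hk.sum, ← add_sum_erase _ _ hTm]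
      simp; omega
    · rw [h2, e1, sum_pair (hxw T hT.mem)]
    · rw [e5 v h2 h1, hk.sum]

end IsTree


/-! ### Passes over the queue -/

/-- Runs a program for every record in the queue, with the record in register `11`. -/
def pass (p : Program) : Program :=
  forLoop 10 (.reg 5) (.assign 11 (get 9 (.reg 10)) ;; p)

/-- Flags the parents and the grandparents of the unmarked parents of marked nodes. -/
def flagPass : Program :=
  pass (.assign 12 (get 0 (.reg 11)) ;; .branch (view 4 (.reg 12)) .skip
      (put 8 (get 0 (.reg 12)) (.reg 4 + 1) ;; put 8 (get 0 (get 0 (.reg 12))) (.reg 4 + 1)))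

/-- Finds an unmarked and unflagged parent of a marked node. -/
def findPass : Program :=
  pass (.assign 12 (get 0 (.reg 11)) ;;
    .branch (view 4 (.reg 12)) .skip (.branch (view 8 (.reg 12)) .skip (.assign 6 (.reg 12))))

/-- Finds the mark of a child of the node in register `6` that is not the label of that node. -/
def colourPass : Program :=
  .assign 7 0 ;;
  pass (.branch ((get 0 (.reg 11)).eq (.reg 6))
    (.branch ((view 4 (.reg 11)).eq (get 1 (.reg 6))) .skip (.assign 7 (view 4 (.reg 11)))) .skip)

/-- Adds up the children of the node in register `6` whose mark is in register `8`, and gives them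
a new parent if register `16` exceeds `1`. -/
def movePass : Program :=
  .assign 15 0 ;;
  pass (.branch ((get 0 (.reg 11)).eq (.reg 6)) (.branch ((view 4 (.reg 11)).eq (.reg 8))
      (.assign 15 (.reg 15 + .reg 11) ;;
        .branch (Expr.lt 1 (.reg 16)) (put 0 (.reg 11) (.reg 3)) .skip) .skip) .skip)

section

variable {M : Machine} {B n : ℕ} {Q : Store → ℕ → Prop} {σ : Store} {t : ℕ}

theorem wp_pass (hC : Ctx M B n) {p : Program} (h0 : σ.reg 0 = n) (hq : σ.reg 5 ≤ 4 * n)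
    (hQn : ∀ k < σ.reg 5, fd n σ.mem 9 k < 4 * n) {J R : List ℕ} (hJ : 9 ∉ J) (hR0 : 0 ∉ R)
    (hR5 : 5 ∉ R) (I : ℕ → Store → Prop) (T : ℕ)
    (hstab : ∀ a ρ i v, i = 10 ∨ i = 11 → I a ρ → I a ⟨Function.update ρ.reg i v, ρ.mem⟩)
    (hI : I 0 σ)
    (hp : ∀ a ρ s, a < σ.reg 5 → Frame n J R σ ρ → I a ρ → ρ.reg 0 = n → ρ.reg 11 = fd n σ.mem 9 a →
      wp M B p (fun ρ' u => ρ'.reg 10 = ρ.reg 10 ∧ u ≤ s + T ∧ Frame n J R σ ρ' ∧ I (a + 1) ρ') ρ s)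
    (hQ : ∀ ρ s, Frame n J R σ ρ → I (σ.reg 5) ρ → s ≤ t + σ.reg 5 * (T + 300) + 100 → Q ρ s) :
    wp M B (pass p) Q σ t := by
  have ⟨_, _, hcells, hbound⟩ := hC
  refine wp_for hC (fun a ρ => Frame n J R σ ρ ∧ I a ρ) (σ.reg 5) (T + 100) (by omega)
    ⟨Frame.refl.set_reg, hstab _ _ _ _ (by simp) hI⟩ ?_ ?_ ?_
  · rintro a τ - ⟨hF, -⟩ -
    simpa using hF.1 5 (by omega) hR5
  · rintro a τ s ha ⟨hF, hIa⟩ hi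
    have e0 : τ.reg 0 = n := (hF.1 0 (by omega) hR0).trans h0
    have e9 : fd n τ.mem 9 a = fd n σ.mem 9 a := hF.2 9 (by omega) hJ a
    have := hQn a ha
    refine wp_seq (wp_set hC (by simp [e0, hi]; omega) (by simp [e0, hi, e9]; omega)
      fun s1 hs1 => ?_)
    simp [e0, hi, e9]
    refine wp_mono (hp a _ s1 ha (hF.set_reg) (hstab _ _ _ _ (by simp) hIa)
      (by simpa using e0) (by simp)) ?_
    rintro ρ u ⟨h1, h2, h3, h4⟩
    exact ⟨by simpa [hi] using h1, by omega, h3.set_reg, hstab _ _ _ _ (by simp) h4⟩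
  · rintro τ s ⟨hF, hI⟩ - hs
    refine hQ τ s hF hI (hs.trans ?_)
    rw [show T + 100 + 100 = T + 200 by ring]
    have := Nat.mul_le_mul_left (σ.reg 5) (show T + 200 ≤ T + 300 by omega)
    omega

theorem flagPass_spec (hC : Ctx M B n) (h0 : σ.reg 0 = n) (hq : σ.reg 5 ≤ 4 * n) {Z : Finset ℕ}
    (hZ : ∀ a ∈ Z, a ≤ 4 * n ∧ fd n σ.mem 0 a ∈ Z)
    (hQn : ∀ k < σ.reg 5, fd n σ.mem 9 k < 4 * n ∧ fd n σ.mem 9 k ∈ Z)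
    (hX : σ.reg 4 + 1 ≤ B) (hst : ∀ a, fd n σ.mem 8 a ≤ σ.reg 4)
    (hQ : ∀ τ s, Frame n [8] [] σ τ → (∀ a, fd n τ.mem 8 a ≤ σ.reg 4 + 1) →
      (∀ a, fd n τ.mem 8 a - σ.reg 4 ≠ 0 ↔ ∃ k < σ.reg 5,
        mark n (σ.reg 4) σ.mem (fd n σ.mem 0 (fd n σ.mem 9 k)) = 0 ∧
        (a = fd n σ.mem 0 (fd n σ.mem 0 (fd n σ.mem 9 k)) ∨
          a = fd n σ.mem 0 (fd n σ.mem 0 (fd n σ.mem 0 (fd n σ.mem 9 k))))) →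
      s ≤ t + σ.reg 5 * 1300 + 100 → Q τ s) :
    wp M B flagPass Q σ t := by
  have ⟨_, hn, hcells, hbound⟩ := hC
  refine wp_pass hC h0 hq (fun k hk => (hQn k hk).1) (J := [8]) (R := []) (by simp) (by simp)
    (by simp) (fun b ρ => (∀ a, fd n ρ.mem 8 a ≤ σ.reg 4 + 1) ∧
      ∀ a, fd n ρ.mem 8 a - σ.reg 4 ≠ 0 ↔ ∃ k < b,
        mark n (σ.reg 4) σ.mem (fd n σ.mem 0 (fd n σ.mem 9 k)) = 0 ∧
        (a = fd n σ.mem 0 (fd n σ.mem 0 (fd n σ.mem 9 k)) ∨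
          a = fd n σ.mem 0 (fd n σ.mem 0 (fd n σ.mem 0 (fd n σ.mem 9 k))))) 1000 ?_ ?_ ?_ ?_
  · rintro a ρ i v - h; exact h
  · exact ⟨fun a => (hst a).trans (by omega), fun a => by have := hst a; simp; omega⟩
  · rintro a ρ s ha hF ⟨hb, hI⟩ e0 e11
    have f0 : ∀ a, fd n ρ.mem 0 a = fd n σ.mem 0 a := hF.fd 0
    have f4 : ∀ a, fd n ρ.mem 4 a = fd n σ.mem 4 a := hF.fd 4
    have e4 : ρ.reg 4 = σ.reg 4 := hF.reg 4
    obtain ⟨-, hw⟩ := hQn a ha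
    set w := fd n σ.mem 9 a with hwdef
    have hw0 := (hZ _ hw).1
    have hw1 := (hZ _ (hZ _ hw).2).1
    have hw2 := (hZ _ (hZ _ (hZ _ hw).2).2).1
    have hw3 := (hZ _ (hZ _ (hZ _ (hZ _ hw).2).2).2).1
    have hstep : ∀ c, (∃ k ≤ a, mark n (σ.reg 4) σ.mem (fd n σ.mem 0 (fd n σ.mem 9 k)) = 0 ∧
        (c = fd n σ.mem 0 (fd n σ.mem 0 (fd n σ.mem 9 k)) ∨
          c = fd n σ.mem 0 (fd n σ.mem 0 (fd n σ.mem 0 (fd n σ.mem 9 k))))) ↔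
        fd n ρ.mem 8 c - σ.reg 4 ≠ 0 ∨ mark n (σ.reg 4) σ.mem (fd n σ.mem 0 w) = 0 ∧
        (c = fd n σ.mem 0 (fd n σ.mem 0 w) ∨ c = fd n σ.mem 0 (fd n σ.mem 0 (fd n σ.mem 0 w))) := by
      intro c
      rw [hI c]
      constructor
      · rintro ⟨k, hk, h⟩
        rcases Nat.lt_or_eq_of_le hk with hk | rfl
        · exact Or.inl ⟨k, hk, h⟩
        · exact Or.inr h
      · rintro (⟨k, hk, h⟩ | h)
        · exact ⟨k, by omega, h⟩
        · exact ⟨a, by omega, h⟩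
    refine wp_seq (wp_set hC (by simp [e0, e11]; omega) (by simp [e0, e11, f0]; omega)
      fun s1 hs1 => ?_)
    simp [e0, e11, f0]
    refine wp_if hC (by simp [view, e0]; omega) (fun hm s2 hs2 => ?_) (fun hm s2 hs2 => ?_)
    · simp [view, e0, e4, f4] at hm
      refine wp_skip ⟨by simp, by omega, hF.set_reg, hb, fun c => ?_⟩
      refine Iff.trans ?_ (hstep c).symm
      have : mark n (σ.reg 4) σ.mem (fd n σ.mem 0 w) ≠ 0 := by rw [mark]; omega
      simp [this]
    · simp [view, e0, e4, f4] at hm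
      refine wp_seq (wp_put hC (by simp [e0]; omega) (by simp [e0, f0, e4]; omega) fun s3 hs3 => ?_)
      simp [e0, f0, e4]
      refine wp_put hC (by simp [e0, fd_upd, f0]; omega)
        (by simp [e0, fd_upd, f0, e4]; omega) fun s4 hs4 => ?_
      simp [e0, fd_upd, f0, e4]
      refine ⟨by omega, ?_, ?_, fun c => ?_⟩
      · exact hF.put.put.set_reg
      · intro c; split_ifs <;> first | exact le_rfl | exact hb c
      · have := hstep c
        have hm' : mark n (σ.reg 4) σ.mem (fd n σ.mem 0 w) = 0 := by rw [mark]; omega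
        simp only [hm', true_and] at this
        simp only [ne_eq] at this
        rw [this]
        split_ifs with h1 h2
        · simp [h1]
        · simp [h2]
        · simp [h1, h2]
  · rintro ρ s hF ⟨hb, hI⟩ hs
    exact hQ ρ s hF hb hI hs

theorem findPass_spec (hC : Ctx M B n) (h0 : σ.reg 0 = n) (hq : σ.reg 5 ≤ 4 * n)
    (hQn : ∀ k < σ.reg 5, fd n σ.mem 9 k < 4 * n)
    (hQp : ∀ k < σ.reg 5, fd n σ.mem 0 (fd n σ.mem 9 k) < 4 * n)
    (hex : ∃ k < σ.reg 5, mark n (σ.reg 4) σ.mem (fd n σ.mem 0 (fd n σ.mem 9 k)) = 0 ∧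
      fd n σ.mem 8 (fd n σ.mem 0 (fd n σ.mem 9 k)) - σ.reg 4 = 0)
    (hQ : ∀ τ s, Frame n [] [6] σ τ → (∃ k < σ.reg 5, τ.reg 6 = fd n σ.mem 0 (fd n σ.mem 9 k) ∧
        mark n (σ.reg 4) σ.mem (τ.reg 6) = 0 ∧ fd n σ.mem 8 (τ.reg 6) - σ.reg 4 = 0) →
      s ≤ t + σ.reg 5 * 1300 + 100 → Q τ s) :
    wp M B findPass Q σ t := by
  have ⟨_, hn, hcells, hbound⟩ := hC
  set good : ℕ → Prop := fun p => mark n (σ.reg 4) σ.mem p = 0 ∧ fd n σ.mem 8 p - σ.reg 4 = 0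
    with hgood
  refine wp_pass hC h0 hq hQn (J := []) (R := [6]) (by simp) (by simp)
    (by simp) (fun b ρ => (∃ k < b, good (fd n σ.mem 0 (fd n σ.mem 9 k))) →
      ∃ k < σ.reg 5, ρ.reg 6 = fd n σ.mem 0 (fd n σ.mem 9 k) ∧ good (ρ.reg 6)) 1000 ?_ ?_ ?_ ?_
  · rintro a ρ i v hi h
    have : (6 : ℕ) ≠ i := by omega
    simpa [this] using h
  · simp
  · rintro a ρ s ha hF hI e0 e11
    have f0 : ∀ a, fd n ρ.mem 0 a = fd n σ.mem 0 a := hF.fd 0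
    have f4 : ∀ a, fd n ρ.mem 4 a = fd n σ.mem 4 a := hF.fd 4
    have f8 : ∀ a, fd n ρ.mem 8 a = fd n σ.mem 8 a := hF.fd 8
    have e4 : ρ.reg 4 = σ.reg 4 := hF.reg 4
    have hw0 := hQn a ha
    have hw1 := hQp a ha
    set w := fd n σ.mem 9 a with hwdef
    have hstep : ¬ good (fd n σ.mem 0 w) → (∃ k < a + 1, good (fd n σ.mem 0 (fd n σ.mem 9 k))) →
        ∃ k < a, good (fd n σ.mem 0 (fd n σ.mem 9 k)) := by
      rintro hng ⟨k, hk, h⟩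
      rcases Nat.lt_succ_iff_lt_or_eq.1 hk with hk | rfl
      · exact ⟨k, hk, h⟩
      · exact absurd h hng
    refine wp_seq (wp_set hC (by simp [e0, e11]; omega) (by simp [e0, e11, f0]; omega)
      fun s1 hs1 => ?_)
    simp [e0, e11, f0]
    refine wp_if hC (by simp [view, e0]; omega) (fun hm s2 hs2 => ?_) (fun hm s2 hs2 => ?_)
    · simp [view, e0, e4, f4] at hm
      refine wp_skip ⟨by simp, by omega, hF.set_reg, fun k hk hg => ?_⟩
      simpa using hI (hstep (fun hg => by have := hg.1; rw [mark] at this; omega) ⟨k, by omega, hg⟩)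
    simp [view, e0, e4, f4] at hm
    refine wp_if hC (by simp [view, e0]; omega) (fun hm' s3 hs3 => ?_)
      (fun hm' s3 hs3 => ?_)
    · simp [view, e0, e4, f8] at hm'
      refine wp_skip ⟨by simp, by omega, hF.set_reg, fun k hk hg => ?_⟩
      simpa using hI (hstep (fun hg => by have := hg.2; omega) ⟨k, by omega, hg⟩)
    · simp [view, e0, e4, f8] at hm'
      refine wp_set hC (by simp) (by simp; omega) fun s4 hs4 => ?_
      refine ⟨by simp, by omega, hF.set_reg.set_reg, fun _ _ _ =>
        ⟨a, ha, by simp [hwdef], ?_, ?_⟩⟩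
      · simp [mark]; omega
      · simp; omega
  · rintro ρ s hF hI hs
    exact hQ ρ s hF (hI hex) hs

theorem colourPass_spec (hC : Ctx M B n) (h0 : σ.reg 0 = n) (hq : σ.reg 5 ≤ 4 * n)
    (hQn : ∀ k < σ.reg 5, fd n σ.mem 9 k < 4 * n) {u : ℕ} (hu : σ.reg 6 = u) (hun : u < 4 * n)
    (hst : ∀ a, fd n σ.mem 4 a ≤ B)
    (hQ : ∀ τ s, Frame n [] [7] σ τ →
      ((τ.reg 7 = 0 ∧ ∀ k < σ.reg 5, fd n σ.mem 0 (fd n σ.mem 9 k) = u →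
        mark n (σ.reg 4) σ.mem (fd n σ.mem 9 k) = fd n σ.mem 1 u) ∨
      ∃ k < σ.reg 5, fd n σ.mem 0 (fd n σ.mem 9 k) = u ∧
        mark n (σ.reg 4) σ.mem (fd n σ.mem 9 k) ≠ fd n σ.mem 1 u ∧
        τ.reg 7 = mark n (σ.reg 4) σ.mem (fd n σ.mem 9 k)) →
      s ≤ t + σ.reg 5 * 1300 + 300 → Q τ s) :
    wp M B colourPass Q σ t := by
  have ⟨_, hn, hcells, hbound⟩ := hC
  refine wp_seq (wp_set hC (by simp) (by simp) fun s0 hs0 => ?_)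
  simp only [Expr.val_ofNat]
  refine wp_pass hC h0 (by simpa using hq) (by simpa using hQn) (J := []) (R := [7]) (by simp) (by simp)
    (by simp) (fun b ρ =>
      ((ρ.reg 7 = 0 ∧ ∀ k < b, fd n σ.mem 0 (fd n σ.mem 9 k) = u →
        mark n (σ.reg 4) σ.mem (fd n σ.mem 9 k) = fd n σ.mem 1 u) ∨
      ∃ k < b, fd n σ.mem 0 (fd n σ.mem 9 k) = u ∧
        mark n (σ.reg 4) σ.mem (fd n σ.mem 9 k) ≠ fd n σ.mem 1 u ∧
        ρ.reg 7 = mark n (σ.reg 4) σ.mem (fd n σ.mem 9 k))) 1000 ?_ ?_ ?_ ?_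
  · rintro a ρ i v hi h
    have : (7 : ℕ) ≠ i := by omega
    simpa [this] using h
  · simp
  · rintro a ρ s ha hF hI e0 e11
    simp at ha e11
    have hF' : Frame n [] [7] σ ρ := (Frame.refl.set_reg (i := 7) (v := 0) (by simp)).trans hF
    have f0 : ∀ a, fd n ρ.mem 0 a = fd n σ.mem 0 a := hF.fd 0
    have f1 : ∀ a, fd n ρ.mem 1 a = fd n σ.mem 1 a := hF.fd 1
    have f4 : ∀ a, fd n ρ.mem 4 a = fd n σ.mem 4 a := hF.fd 4
    have e4 : ρ.reg 4 = σ.reg 4 := hF'.reg 4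
    have e6 : ρ.reg 6 = u := (hF'.reg 6).trans hu
    have hw0 := hQn a ha
    set w := fd n σ.mem 9 a with hwdef
    have hw4 := hst w
    have hstep : (fd n σ.mem 0 w = u → mark n (σ.reg 4) σ.mem w = fd n σ.mem 1 u) →
      ((ρ.reg 7 = 0 ∧ ∀ k < a + 1, fd n σ.mem 0 (fd n σ.mem 9 k) = u →
        mark n (σ.reg 4) σ.mem (fd n σ.mem 9 k) = fd n σ.mem 1 u) ∨
      ∃ k < a + 1, fd n σ.mem 0 (fd n σ.mem 9 k) = u ∧
        mark n (σ.reg 4) σ.mem (fd n σ.mem 9 k) ≠ fd n σ.mem 1 u ∧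
        ρ.reg 7 = mark n (σ.reg 4) σ.mem (fd n σ.mem 9 k)) := by
      intro hng
      rcases hI with ⟨h1, h2⟩ | ⟨k, hk, h⟩
      · refine Or.inl ⟨h1, fun k hk => ?_⟩
        rcases Nat.lt_succ_iff_lt_or_eq.1 hk with hk | rfl
        · exact h2 k hk
        · exact hng
      · exact Or.inr ⟨k, by omega, h⟩
    refine wp_if hC (by simp [e0, e11]; omega) (fun hm s2 hs2 => ?_)
      (fun hm s2 hs2 => ?_)
    · simp [e0, e11, f0, e6] at hm
      refine wp_if hC (by simp [view, e0, e11, e6]; omega) (fun hm' s3 hs3 => ?_)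
        (fun hm' s3 hs3 => ?_)
      · simp [view, e0, e11, f4, f1, e6, e4] at hm'
        refine wp_skip ⟨rfl, by omega, hF, hstep fun _ => hm'⟩
      · simp [view, e0, e11, f4, f1, e6, e4] at hm'
        refine wp_set hC (by simp [view, e0, e11]; omega)
          (by simp [view, e0, e11, f4, e4]; omega) fun s4 hs4 => ?_
        refine ⟨by simp, by omega, hF.set_reg, Or.inr ⟨a, by omega, hm, hm', ?_⟩⟩
        simp [view, e0, e11, f4, e4, mark, hwdef]
    · simp [e0, e11, f0, e6] at hm
      refine wp_skip ⟨rfl, by omega, hF, hstep fun h => absurd h hm⟩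
  · rintro ρ s hF hI hs
    simp at hI hs
    exact hQ ρ s ((Frame.refl.set_reg (i := 7) (v := 0) (by simp)).trans hF) hI (by omega)

theorem movePass_spec (hC : Ctx M B n) (h0 : σ.reg 0 = n) (hq : σ.reg 5 ≤ 4 * n)
    (hQn : ∀ k < σ.reg 5, fd n σ.mem 9 k < 4 * n) {u t0 nw kb : ℕ} (hu : σ.reg 6 = u)
    (h8 : σ.reg 8 = t0) (h3 : σ.reg 3 = nw) (h16 : σ.reg 16 = kb)
    (hnB : nw ≤ B) (hQi : ∀ k < σ.reg 5, ∀ k' < σ.reg 5, fd n σ.mem 9 k = fd n σ.mem 9 k' → k = k')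
    {S : Finset ℕ} (hS : ∀ w, w ∈ S ↔ (∃ k < σ.reg 5, fd n σ.mem 9 k = w) ∧
      fd n σ.mem 0 w = u ∧ mark n (σ.reg 4) σ.mem w = t0)
    (hQ : ∀ τ s, Frame n [0] [] σ τ → τ.reg 15 = ∑ w ∈ S, w → τ.reg 16 = kb → τ.reg 17 = σ.reg 17 →
      (∀ w, fd n τ.mem 0 w = if 1 < kb ∧ w ∈ S then nw else fd n σ.mem 0 w) →
      s ≤ t + σ.reg 5 * 1300 + 300 → Q τ s) :
    wp M B movePass Q σ t := by
  have ⟨_, hn, hcells, hbound⟩ := hC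
  have hnn : 4 * n * (4 * n) = 16 * (n * n) := by ring
  refine wp_seq (wp_set hC (by simp) (by simp) fun s0 hs0 => ?_)
  simp only [Expr.val_ofNat]
  -- the processed part of the set
  set P : ℕ → Finset ℕ := fun a => S.filter fun w => ∃ k < a, fd n σ.mem 9 k = w with hP
  have hPsum : ∀ a, a ≤ σ.reg 5 → ∑ w ∈ P a, w ≤ a * (4 * n) := by
    intro a ha
    have h1 : (P a).card ≤ a := by
      have h2 : P a ⊆ (range a).image (fd n σ.mem 9) := by
        intro w hw
        obtain ⟨k, hk, he⟩ := (mem_filter.1 hw).2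
        exact mem_image.2 ⟨k, by simpa using hk, he⟩
      exact (card_le_card h2).trans (card_image_le.trans_eq (card_range a))
    have h3 := sum_le_card_nsmul (P a) (fun w => w) (4 * n) (by
      intro w hw
      obtain ⟨k, hk, he⟩ := (mem_filter.1 hw).2
      exact he ▸ (hQn k (by omega)).le)
    rw [smul_eq_mul] at h3
    exact h3.trans (Nat.mul_le_mul_right _ h1)
  have hPin : ∀ a, a < σ.reg 5 → fd n σ.mem 9 a ∈ S →
      fd n σ.mem 9 a ∉ P a ∧ P (a + 1) = insert (fd n σ.mem 9 a) (P a) := by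
    intro a ha hS
    refine ⟨fun hh => ?_, ?_⟩
    · obtain ⟨k, hk, he⟩ := (mem_filter.1 hh).2
      have := hQi k (by omega) a ha he
      omega
    · ext w
      simp only [hP, mem_filter, mem_insert]
      constructor
      · rintro ⟨h1, k, hk, he⟩
        rcases Nat.lt_succ_iff_lt_or_eq.1 hk with hk | rfl
        · exact Or.inr ⟨h1, k, hk, he⟩
        · exact Or.inl he.symm
      · rintro (rfl | ⟨h1, k, hk, he⟩)
        · exact ⟨hS, a, by omega, rfl⟩
        · exact ⟨h1, k, by omega, he⟩
  have hPout : ∀ a, fd n σ.mem 9 a ∉ S → P (a + 1) = P a := by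
    intro a hS
    ext w
    simp only [hP, mem_filter]
    refine and_congr_right fun h1 => ⟨?_, ?_⟩
    · rintro ⟨k, hk, he⟩
      rcases Nat.lt_succ_iff_lt_or_eq.1 hk with hk | rfl
      · exact ⟨k, hk, he⟩
      · exact absurd (he ▸ h1) hS
    · rintro ⟨k, hk, he⟩; exact ⟨k, by omega, he⟩
  refine wp_pass hC h0 (by simpa using hq) (by simpa using hQn) (J := [0]) (R := []) (by simp) (by simp)
    (by simp) (fun b ρ => ρ.reg 15 = ∑ w ∈ P b, w ∧ ρ.reg 16 = kb ∧ ρ.reg 17 = σ.reg 17 ∧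
      ∀ w, fd n ρ.mem 0 w = if 1 < kb ∧ w ∈ P b then nw else fd n σ.mem 0 w) 1000 ?_ ?_ ?_ ?_
  · rintro a ρ i v hi h
    have h1 : (15 : ℕ) ≠ i := by omega
    have h2 : (16 : ℕ) ≠ i := by omega
    have h3 : (17 : ℕ) ≠ i := by omega
    simpa [h1, h2, h3] using h
  · refine ⟨by simp [hP], by simpa using h16, by simp, by simp [hP]⟩
  · rintro a ρ s ha hF ⟨i15, i16, i17, ip⟩ e0 e11
    simp at ha e11
    have hF' : Frame n [0] [] σ ρ := (Frame.refl.set_reg (i := 15) (v := 0) (by simp)).trans hF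
    have f4 : ∀ a, fd n ρ.mem 4 a = fd n σ.mem 4 a := hF.fd 4
    have e4 : ρ.reg 4 = σ.reg 4 := hF'.reg 4
    have e6 : ρ.reg 6 = u := (hF'.reg 6).trans hu
    have e8 : ρ.reg 8 = t0 := (hF'.reg 8).trans h8
    have e3 : ρ.reg 3 = nw := (hF'.reg 3).trans h3
    have hw0 := hQn a ha
    have hin := hPin a ha
    have hout := hPout a
    have hsum := hPsum a ha.le
    have hmul : a * (4 * n) ≤ 4 * n * (4 * n) := Nat.mul_le_mul_right _ (by omega)
    have hwS : fd n σ.mem 9 a ∈ S ↔ fd n σ.mem 0 (fd n σ.mem 9 a) = u ∧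
        mark n (σ.reg 4) σ.mem (fd n σ.mem 9 a) = t0 := by
      rw [hS]; exact and_iff_right ⟨a, ha, rfl⟩
    set w := fd n σ.mem 9 a with hwdef
    have hwP : w ∉ P a := by
      intro hh
      obtain ⟨h5, k, hk, he⟩ := mem_filter.1 hh
      exact (hin h5).1 hh
    have hpw : fd n ρ.mem 0 w = fd n σ.mem 0 w := by rw [ip, if_neg fun h => hwP h.2]
    refine wp_if hC (by simp [e0, e11]; omega) (fun hm s2 hs2 => ?_)
      (fun hm s2 hs2 => ?_)
    · simp [e0, e11, hpw, e6] at hm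
      refine wp_if hC (by simp [view, e0, e11]; omega) (fun hm' s3 hs3 => ?_)
        (fun hm' s3 hs3 => ?_)
      · simp [view, e0, e11, f4, e8, e4] at hm'
        have hmem := hwS.2 ⟨hm, hm'⟩
        obtain ⟨-, hPs⟩ := hin hmem
        refine wp_seq (wp_set hC (by simp) (by simp [i15, e11]; omega) fun s4 hs4 => ?_)
        simp [i15, e11]
        refine wp_if hC (by simp) (fun hk s5 hs5 => ?_) (fun hk s5 hs5 => ?_)
        · simp [i16] at hk
          refine wp_put hC (by simp) (by simp [e11, e3]; omega)
            fun s6 hs6 => ?_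
          simp [e11, e3, i16]
          refine ⟨by omega, hF.set_reg.put, ?_, i17, ?_⟩
          · rw [hPs, sum_insert hwP]; omega
          · intro v
            rw [fd_upd (by omega) (by omega), hPs, ip]
            by_cases hv : v = w <;> simp [hv, hk]
        · simp [i16] at hk
          refine wp_skip ⟨by simp, by omega, hF.set_reg, ?_, by simpa using i16,
            by simpa using i17, ?_⟩
          · simp; rw [hPs, sum_insert hwP]; omega
          · intro v
            have hk' : ¬ 1 < kb := by omega
            simp [ip, hk']
      · simp [view, e0, e11, f4, e8, e4] at hm'
        have hPs := hout fun hh => hm' (hwS.1 hh).2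
        exact wp_skip ⟨rfl, by omega, hF, by rw [hPs]; exact ⟨i15, i16, i17, ip⟩⟩
    · simp [e0, e11, hpw, e6] at hm
      have hPs := hout fun hh => hm (hwS.1 hh).1
      exact wp_skip ⟨rfl, by omega, hF, by rw [hPs]; exact ⟨i15, i16, i17, ip⟩⟩
  · rintro ρ s hF ⟨i15, i16, i17, ip⟩ hs
    simp at hs
    have hPS : P (σ.reg 5) = S := by
      refine filter_true_of_mem fun w hw => ((hS w).1 hw).1
    simp [hPS] at i15 ip
    exact hQ ρ s ((Frame.refl.set_reg (i := 15) (v := 0) (by simp)).trans hF) i15 i16 i17 ip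
      (by omega)

end


/-! ### Inserting a vertex -/

/-- The nodes of the tree for the leaves below `x`, if `nw` is the next free identifier. -/
def nodes (n x nw : ℕ) : Finset ℕ := range x ∪ Finset.Ico (n + 1) nw

theorem mem_nodes {n x nw a : ℕ} : a ∈ nodes n x nw ↔ a < x ∨ n + 1 ≤ a ∧ a < nw := by
  simp [nodes]

theorem nodes_succ_left {n x nw : ℕ} : nodes n (x + 1) nw = insert x (nodes n x nw) := by
  ext a; simp only [mem_nodes, mem_insert]; omega

theorem nodes_succ_right {n x nw : ℕ} (h : n + 1 ≤ nw) :
    nodes n x (nw + 1) = insert nw (nodes n x nw) := by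
  ext a; simp only [mem_nodes, mem_insert]; omega

/-- The memory represents a tree with leaves `0, …, x - 1` and root `n + 1`: the fields `0`, `1`,
`2`, `3` hold the parent, the label, the number of children and the sum of the children. The leaf
`0` has colour `3` with all other leaves, so that the root stays in place. The parent of the root
is a dummy node. -/
structure TreeState (δ : ℕ → ℕ → ℕ) (n x nw e : ℕ) (C : ℕ → Finset ℕ) (m : ℕ → ℕ) : Prop where
  tree : IsTree δ (range x) (nodes n x nw) C (fd n m 0) (fd n m 1) (n + 1) e
  kept : Kept (nodes n x nw) (fd n m 0) (n + 1) (fd n m 2) (fd n m 3)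
  par_root : fd n m 0 (n + 1) = 4 * n
  par_top : fd n m 0 (4 * n) = 0
  lab_root : fd n m 1 (n + 1) = 3
  lab_leaf : ∀ a < x, fd n m 1 a = 4

theorem TreeState.congr {δ : ℕ → ℕ → ℕ} {n x nw e : ℕ} {C : ℕ → Finset ℕ} {m m' : ℕ → ℕ}
    (h : TreeState δ n x nw e C m) (hm : ∀ j < 4, ∀ a, fd n m' j a = fd n m j a) :
    TreeState δ n x nw e C m' := by
  have h0 : fd n m' 0 = fd n m 0 := funext (hm 0 (by omega))
  have h1 : fd n m' 1 = fd n m 1 := funext (hm 1 (by omega))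
  have h2 : fd n m' 2 = fd n m 2 := funext (hm 2 (by omega))
  have h3 : fd n m' 3 = fd n m 3 := funext (hm 3 (by omega))
  constructor
  · rw [h0, h1]; exact h.tree
  · rw [h0, h2, h3]; exact h.kept
  · rw [h0]; exact h.par_root
  · rw [h0]; exact h.par_top
  · rw [h1]; exact h.lab_root
  · rw [h1]; exact h.lab_leaf

/-- The assumptions on the colours of the new vertex `x`; `l` and `l'` list its successors and its
predecessors, where vertex `a` is represented by the leaf `a + 1`. -/
structure NewVertex (δ : ℕ → ℕ → ℕ) (n x : ℕ) (l l' : List ℕ) : Prop where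
  two_le : 2 ≤ x
  le : x ≤ n
  ultra : IsUltra δ (insert x (range x))
  zero : δ x 0 = 3
  pos : ∀ a, a ≠ 0 → δ x a ≤ 2
  count : ∀ a, 1 ≤ a → a < x → δ x a = l.count (a - 1) + l'.count (a - 1)
  pair : ∀ a b, a ≠ 0 → b ≠ 0 → δ a b ≤ 2
  nodup : l.Nodup
  nodup' : l'.Nodup
  lt : ∀ a ∈ l, a < n
  lt' : ∀ a ∈ l', a < n

theorem NewVertex.le_three {δ : ℕ → ℕ → ℕ} {n x : ℕ} {l l' : List ℕ} (h : NewVertex δ n x l l')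
    (a : ℕ) : δ x a ≤ 3 := by
  by_cases ha : a = 0
  · rw [ha, h.zero]
  · exact (h.pos a ha).trans (by omega)

/-- The number of leaves with nonzero colour is bounded by the degree. -/
theorem NewVertex.card_le {δ : ℕ → ℕ → ℕ} {n x : ℕ} {l l' : List ℕ} (h : NewVertex δ n x l l') :
    ((range x).filter fun a => δ x a ≠ 0).card ≤ l.length + l'.length + 1 := by
  have hsub : ((range x).filter fun a => δ x a ≠ 0) ⊆
      insert 0 ((l ++ l').map (· + 1)).toFinset := by
    intro a ha
    obtain ⟨h1, h2⟩ := mem_filter.1 ha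
    rw [mem_insert]
    by_cases ha0 : a = 0
    · exact Or.inl ha0
    · right
      rw [h.count a (by omega) (by simpa using h1)] at h2
      rw [List.mem_toFinset, List.mem_map]
      refine ⟨a - 1, ?_, by omega⟩
      rw [List.mem_append]
      by_contra hh
      rw [not_or] at hh
      exact h2 (by rw [List.count_eq_zero_of_not_mem hh.1, List.count_eq_zero_of_not_mem hh.2])
  refine (card_le_card hsub).trans ((card_insert_le _ _).trans ?_)
  have := List.toFinset_card_le ((l ++ l').map (· + 1))
  simp only [List.length_map, List.length_append] at this
  omega

/-- Finds the place of the new vertex: register `6` receives a lowest mixed node, register `7` the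
second colour of its children. -/
def locate : Program :=
  .assign 4 (8 * .reg 0 * .reg 2) ;;
  put 9 0 0 ;; put 4 0 (.reg 4 + 3) ;; .assign 5 1 ;;
  .assign 14 (.reg 2 + 1) ;; scan ;;
  .assign 14 (.reg 2 + 1 + .reg 0) ;; scan ;;
  propagate ;; flagPass ;; findPass ;; colourPass

section

variable {M : Machine} {B n : ℕ} {Q : Store → ℕ → Prop} {σ : Store} {t : ℕ}

theorem cand_iff {δ : ℕ → ℕ → ℕ} {V N : Finset ℕ} {C : ℕ → Finset ℕ} {par lab : ℕ → ℕ}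
    {r x X q : ℕ} {m : ℕ → ℕ} (hT : IsTree δ V N C par lab r r)
    (hM : Marks δ n x X q N C par r m) {p : ℕ} :
    IsTree.Cand δ N C par r x p ↔ ∃ k < q, par (fd n m 9 k) = p ∧ mark n X m p = 0 := by
  constructor
  · rintro ⟨hp, hm, w, hw, hr, rfl, t, ht, hU⟩
    obtain ⟨k, hk, he⟩ := (hM.queue.mem w).1 (by
      have := hM.complete w hw t ht hU; rw [mark] at this; omega)
    refine ⟨k, hk, by rw [he], ?_⟩
    by_contra hh
    exact hm _ (hM.sound _ hh).2.2
  · rintro ⟨k, hk, rfl, hm⟩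
    obtain ⟨h1, h2, h3⟩ := hM.sound _ ((hM.queue.mem _).2 ⟨k, hk, rfl⟩)
    have h0 : mark n X m (fd n m 9 k) ≠ 0 := (hM.queue.mem _).2 ⟨k, hk, rfl⟩
    refine ⟨hT.par_mem _ h1 h2, fun t hU => ?_, _, h1, h2, rfl, _, h0, h3⟩
    by_cases ht : t = 0
    · obtain ⟨a, ha⟩ := hT.nonempty _ h1
      have h5 := h3 a ha
      have h6 := hU a ((hT.ssub _ h1 h2).subset ha)
      omega
    · have := hM.complete _ (hT.par_mem _ h1 h2) t ht hU
      omega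

theorem locate_spec (hC : Ctx M B n) {δ : ℕ → ℕ → ℕ} {x nw : ℕ} {C : ℕ → Finset ℕ}
    (hx : NewVertex δ n x (M.row (x + 1)) (M.row (x + 1 + n)))
    (h0 : σ.reg 0 = n) (h2 : σ.reg 2 = x) (hnw : nw ≤ 4 * n)
    (hT : TreeState δ n x nw (n + 1) C σ.mem)
    (hst : ∀ j, 4 ≤ j → j ≤ 8 → ∀ a, fd n σ.mem j a ≤ 8 * n * x)
    (hQ : ∀ ρ s, Frame n [4, 5, 6, 7, 8, 9] [4, 5, 6, 7] σ ρ → ρ.reg 4 = 8 * n * x →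
      Marks δ n x (8 * n * x) (ρ.reg 5) (nodes n x nw) C (fd n σ.mem 0) (n + 1) ρ.mem →
      Lowest δ (nodes n x nw) C (fd n σ.mem 0) (fd n σ.mem 1) (n + 1) x (ρ.reg 6) (ρ.reg 7)
        (mark n (8 * n * x) ρ.mem) →
      (∀ j, 4 ≤ j → j ≤ 8 → ∀ a, fd n ρ.mem j a ≤ 8 * n * (x + 1)) →
      ρ.reg 5 ≤ 2 * ((M.row (x + 1)).length + (M.row (x + 1 + n)).length + 1) →
      s ≤ t + ((M.row (x + 1)).length + (M.row (x + 1 + n)).length + 1) * 20000 → Q ρ s) :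
    wp M B locate Q σ t := by
  have ⟨_, hn, hcells, hbound⟩ := hC
  have hx2 := hx.two_le
  have hxn := hx.le
  set X := 8 * n * x with hX
  have hXn : X ≤ 8 * (n * n) := by rw [hX, mul_assoc]; gcongr
  have hX1 : 8 * n * (x + 1) = X + 8 * n := by rw [hX]; ring
  set N := nodes n x nw with hN
  have hNlt : ∀ a ∈ N, a < 4 * n := by
    intro a ha; rw [hN, mem_nodes] at ha; omega
  refine wp_seq (wp_set hC (by simp) (by simp [h0, h2]; omega) fun s1 hs1 => ?_)
  simp [h0, h2]
  rw [← hX]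
  refine wp_seq (wp_put hC (by simp) (by simp; omega) fun s2 hs2 => ?_)
  refine wp_seq (wp_put hC (by simp) (by simp; omega) fun s3 hs3 => ?_)
  refine wp_seq (wp_set hC (by simp) (by simp; omega) fun s4 hs4 => ?_)
  refine wp_seq (wp_set hC (by simp) (by simp [h2]; omega) fun s5 hs5 => ?_)
  simp [h2]
  have hq0 : Queue n X 0 σ.mem := ⟨by omega, fun a => by
    have := hst 4 (by omega) (by omega) a
    simp; omega⟩
  have hq1 := hq0.push (a := 0) (v := 3) (by
    have := hst 4 (by omega) (by omega) 0; omega) (by omega)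
  set m₁ := upd n (upd n σ.mem 9 0 0) 4 0 (X + 3) with hm₁
  have m₁4 : ∀ a, fd n m₁ 4 a - X = if a = 0 then 3 else 0 := by
    intro a
    have := hst 4 (by omega) (by omega) a
    simp [hm₁, fd_upd]
    split_ifs <;> omega
  have m₁9 : fd n m₁ 9 0 = 0 := by simp [hm₁, fd_upd]
  have hF1 : Frame n [4, 9] [] σ ⟨σ.reg, m₁⟩ :=
    Frame.refl.put.put
  refine wp_seq (scan_spec hC (x := x) (X := X) (row := x + 1) (by simpa using h0)
    (by simpa using h2) (by simp) (by simp) hxn (by omega) hx.lt hx.nodup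
    (fun a => by simp [m₁4]; split_ifs <;> omega) (by simpa using hq1)
    (by simp; omega) ?_)
  intro τ1 u1 hF2 hq2 hqb2 hc2 hu1
  simp only [m₁4] at hc2
  have e0 : τ1.reg 0 = n := (hF2.reg 0).trans (by simpa using h0)
  have e2 : τ1.reg 2 = x := (hF2.reg 2).trans (by simpa using h2)
  have e4 : τ1.reg 4 = X := (hF2.reg 4).trans (by simp)
  have hnd1 : ∀ b, (M.row (x + 1)).count b ≤ 1 := List.nodup_iff_count_le_one.1 hx.nodup
  have hnd2 : ∀ b, (M.row (x + 1 + n)).count b ≤ 1 := List.nodup_iff_count_le_one.1 hx.nodup'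
  refine wp_seq (wp_set hC (by simp) (by simp [e2, e0]; omega) fun s6 hs6 => ?_)
  simp [e2, e0]
  refine wp_seq (scan_spec hC (x := x) (X := X) (row := x + 1 + n) (by simpa using e0)
    (by simpa using e2) (by simpa using e4) (by simp) hxn (by omega) hx.lt' hx.nodup'
    (fun a => by
      simp only [hc2]
      have := hnd1 (a - 1)
      split_ifs <;> omega) (by simpa using hq2)
    (by simpa using hqb2) ?_)
  intro τ2 u2 hF3 hq3 hqb3 hc3 hu2
  simp only [hc2] at hc3
  have k0 : τ2.reg 0 = n := (hF3.reg 0).trans (by simpa using e0)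
  have k4 : τ2.reg 4 = X := (hF3.reg 4).trans (by simpa using e4)
  have hleaf : ∀ a < x, mark n X τ2.mem a = δ x a := by
    intro a ha
    rw [mark, hc3]
    by_cases ha0 : a = 0
    · simp [ha0, hx.zero]
    · rw [hx.count a (by omega) ha, if_neg ha0, if_pos ⟨by omega, ha⟩, if_pos ⟨by omega, ha⟩]
      omega
  have hinner : ∀ a, x ≤ a → mark n X τ2.mem a = 0 := by
    intro a ha
    rw [mark, hc3, if_neg (by omega), if_neg (by omega), if_neg (by omega)]
  have hF4 : Frame n [4, 5, 6, 7, 8, 9] [4, 5, 6, 7] σ τ2 := by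
    have h5 : Frame n [4, 5, 6, 7, 8, 9] [4, 5, 6, 7] σ ⟨σ.reg, m₁⟩ :=
      hF1.mono
    have h6 := ((h5.set_reg (i := 4) (v := X) (by simp)).set_reg (i := 5) (v := 1)
      (by simp)).set_reg (i := 14) (v := x + 1) (by simp)
    have h7 := h6.trans (hF2.mono)
    have h8 := h7.set_reg (i := 14) (v := x + 1 + n) (by simp)
    exact h8.trans (hF3.mono)
  have hf : ∀ j < 4, ∀ a, fd n τ2.mem j a = fd n σ.mem j a := fun j hj a =>
    hF4.2 j (by omega) (by simp; omega) a
  have f0 : fd n τ2.mem 0 = fd n σ.mem 0 := funext (hf 0 (by omega))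
  have f1 : fd n τ2.mem 1 = fd n σ.mem 1 := funext (hf 1 (by omega))
  have hf8 : ∀ j, 5 ≤ j → j ≤ 8 → ∀ a, fd n τ2.mem j a = fd n σ.mem j a := by
    intro j hj hj' a
    rw [hF3.2 j (by omega) (by simp; omega) a]
    exact (hF2.2 j (by omega) (by simp; omega) a).trans (hF1.2 j (by omega) (by simp; omega) a)
  have hmix : Mixed δ C x (n + 1) := by
    intro t' hU
    have h5 := hU 0 (by rw [hT.tree.root_eq]; simp; omega)
    have h6 := hU 1 (by rw [hT.tree.root_eq]; simp; omega)
    have := hx.pos 1 (by omega)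
    rw [hx.zero] at h5
    omega
  have hd := hx.card_le
  set d := ((range x).filter fun a => δ x a ≠ 0).card with hdd
  have hT2 : TreeState δ n x nw (n + 1) C τ2.mem := hT.congr hf
  refine wp_seq (propagate_spec hC k0 k4 hxn (by omega) hT2.tree hNlt
    (fun u _ => hT2.kept.cnt u) hx.le_three hmix hq3 hleaf hinner (fun p t' ht ht' => by
      rw [hf8 (4 + t') (by omega) (by omega)]
      have := hst (4 + t') (by omega) (by omega) p
      omega) ?_)
  rw [f0]
  intro τ3 u3 hF5 hM hq hu3
  have l0 : τ3.reg 0 = n := (hF5.reg 0).trans k0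
  have l4 : τ3.reg 4 = X := (hF5.reg 4).trans k4
  have g0 : fd n τ3.mem 0 = fd n σ.mem 0 := by
    rw [← f0]; exact funext (hF5.fd 0)
  have g1 : fd n τ3.mem 1 = fd n σ.mem 1 := by
    rw [← f1]; exact funext (hF5.fd 1)
  have hQN : ∀ k < τ3.reg 5, fd n τ3.mem 9 k ∈ N := fun k hk =>
    (hM.sound _ ((hM.queue.mem _).2 ⟨k, hk, rfl⟩)).1
  have hQr : ∀ k < τ3.reg 5, fd n τ3.mem 9 k ≠ n + 1 := fun k hk =>
    (hM.sound _ ((hM.queue.mem _).2 ⟨k, hk, rfl⟩)).2.1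
  have hqn : τ3.reg 5 ≤ 4 * n := hM.queue.le fun k hk => hNlt _ (hQN k hk)
  have h8 : ∀ a, fd n τ3.mem 8 a ≤ X := fun a => by
    rw [(hF5.fd 8), hf8 8 (by omega) (by omega)]
    exact hst 8 (by omega) (by omega) a
  refine wp_seq (flagPass_spec hC l0 hqn (Z := insert (4 * n) N) (fun a ha => ?_)
    (fun k hk => ⟨hNlt _ (hQN k hk), mem_insert_of_mem (hQN k hk)⟩) (by omega)
    (by rw [l4]; exact h8) ?_)
  · rw [g0]
    have hr := hT.tree.root_mem
    rw [mem_insert] at ha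
    rcases ha with rfl | ha
    · rw [hT.par_top]
      refine ⟨le_rfl, mem_insert_of_mem ?_⟩
      rw [hN, mem_nodes]; omega
    · refine ⟨(hNlt a ha).le, ?_⟩
      by_cases har : a = n + 1
      · rw [har, hT.par_root]; exact mem_insert_self _ _
      · exact mem_insert_of_mem (hT.tree.par_mem a ha har)
  rw [g0, l4]
  intro τ4 u4 hF6 hb8 hflag hu4
  have e9 : ∀ k, fd n τ4.mem 9 k = fd n τ3.mem 9 k := hF6.fd 9
  have e5 : τ4.reg 5 = τ3.reg 5 := hF6.reg 5
  have p0 : τ4.reg 0 = n := (hF6.reg 0).trans l0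
  have p4 : τ4.reg 4 = X := (hF6.reg 4).trans l4
  have i0 : fd n τ4.mem 0 = fd n σ.mem 0 := by
    rw [← g0]; exact funext (hF6.fd 0)
  have i1 : fd n τ4.mem 1 = fd n σ.mem 1 := by
    rw [← g1]; exact funext (hF6.fd 1)
  have i4 : fd n τ4.mem 4 = fd n τ3.mem 4 := funext (hF6.fd 4)
  have imk : mark n X τ4.mem = mark n X τ3.mem := by funext a; simp [mark, i4]
  set par := fd n σ.mem 0 with hpar
  set lab := fd n σ.mem 1 with hlab
  have hcand := fun p => cand_iff hT.tree hM (p := p)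
  have hflag' : ∀ a, fd n τ4.mem 8 a - X = 0 ↔
      ∀ p, IsTree.Cand δ N C par (n + 1) x p → a ≠ par p ∧ a ≠ par (par p) := by
    intro a
    rw [← not_iff_not, ← ne_eq, hflag a]
    constructor
    · rintro ⟨k, hk, hm, ha⟩ hh
      obtain ⟨h5, h6⟩ := hh _ ((hcand _).2 ⟨k, hk, rfl, hm⟩)
      exact ha.elim h5 h6
    · intro hh
      simp only [not_forall] at hh
      obtain ⟨p, hp, hne⟩ := hh
      obtain ⟨k, hk, rfl, hm⟩ := (hcand p).1 hp
      exact ⟨k, hk, hm, by tauto⟩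
  have hxV : x ∉ range x := by simp
  obtain ⟨u₀, hu₀, hfl₀⟩ := hT.tree.exists_unflagged hxV hx.ultra hmix
    (by rw [hT.par_root]; intro hh; exact absurd (hNlt _ hh) (by omega))
    (by
      rw [hT.par_root, hT.par_top]
      intro hh
      refine hh (δ x 0) fun a ha => ?_
      rw [hT.tree.leaf_eq 0 (by simp; omega), mem_singleton] at ha
      rw [ha])
  have hQp : ∀ k < τ3.reg 5, par (fd n τ3.mem 9 k) ∈ N := fun k hk =>
    hT.tree.par_mem _ (hQN k hk) (hQr k hk)
  refine wp_seq (findPass_spec hC p0 (by omega) (fun k hk => ?_) (fun k hk => ?_) ?_ ?_)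
  · rw [e9]; exact hNlt _ (hQN k (by omega))
  · rw [e9, i0]; exact hNlt _ (hQp k (by omega))
  · obtain ⟨k, hk, hp, hm⟩ := (hcand u₀).1 hu₀
    refine ⟨k, by omega, ?_⟩
    have hp' : par (fd n τ3.mem 9 k) = u₀ := hp
    rw [e9, i0, hp', p4, imk]
    exact ⟨hm, (hflag' u₀).2 hfl₀⟩
  rw [p4, i0, imk]
  rintro τ5 u5 hF7 ⟨k, hk, hku, hkm, hkf⟩ hu5
  set u := τ5.reg 6 with hu
  rw [e9] at hku
  have huC : IsTree.Cand δ N C par (n + 1) x u := (hcand u).2 ⟨k, by omega, hku.symm, hkm⟩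
  have hkids := hT.tree.lowest_of_unflagged hxV hx.ultra huC ((hflag' u).1 hkf)
  obtain ⟨huN, humix, -⟩ := huC
  obtain ⟨c, hcl, hcu, ⟨wA, hwA, hwAr, hwAp, hwAu⟩, wB, hwB, hwBr, hwBp, hwBu⟩ :=
    hT.tree.lowest_mixed hxV hx.ultra huN humix hkids
  have r0 : τ5.reg 0 = n := (hF7.reg 0).trans p0
  have r4 : τ5.reg 4 = X := (hF7.reg 4).trans p4
  have r5 : τ5.reg 5 = τ3.reg 5 := (hF7.reg 5).trans e5
  have j0 : fd n τ5.mem 0 = par := by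
    rw [← i0]; exact funext (hF7.fd 0)
  have j1 : fd n τ5.mem 1 = lab := by
    rw [← i1]; exact funext (hF7.fd 1)
  have j4 : fd n τ5.mem 4 = fd n τ3.mem 4 := by
    rw [← i4]; exact funext (hF7.fd 4)
  have j9 : ∀ k, fd n τ5.mem 9 k = fd n τ3.mem 9 k := fun k =>
    ((hF7.fd 9) k).trans (e9 k)
  have jmk : mark n X τ5.mem = mark n X τ3.mem := by funext a; simp [mark, j4]
  have hmk3 : ∀ a, mark n X τ3.mem a ≤ 3 := by
    intro a
    by_cases hz : mark n X τ3.mem a = 0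
    · omega
    · obtain ⟨h5, -, h6⟩ := hM.sound a hz
      obtain ⟨b, hb⟩ := hT.tree.nonempty a h5
      rw [← h6 b hb]; exact hx.le_three b
  have hb4 : ∀ a, fd n τ3.mem 4 a ≤ X + 3 := by
    intro a
    have := hmk3 a
    rw [mark] at this; omega
  refine colourPass_spec hC r0 (by omega) (fun k hk => ?_) rfl (hNlt u huN) (fun a => ?_) ?_
  · rw [j9]; exact hNlt _ (hQN k (by omega))
  · rw [j4]; have := hb4 a; omega
  rw [j0, j1, r4, r5, jmk]
  intro τ6 u6 hF8 hcol hu6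
  have hF9 : Frame n [4, 5, 6, 7, 8, 9] [4, 5, 6, 7] τ3 τ6 :=
    (hF6.mono.trans (hF7.mono)).trans
      (hF8.mono)
  have q5 : τ6.reg 5 = τ3.reg 5 := (hF8.reg 5).trans r5
  have q6 : τ6.reg 6 = u := hF8.reg 6
  have q4 : τ6.reg 4 = X := (hF8.reg 4).trans r4
  have fj : ∀ j, 4 ≤ j → j ≤ 9 → j ≠ 8 → ∀ a, fd n τ6.mem j a = fd n τ3.mem j a := by
    intro j hj hj' hj8 a
    rw [hF8.2 j (by omega) (by simp), hF7.2 j (by omega) (by simp)]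
    exact hF6.2 j (by omega) (by simp; omega) a
  have fmk : mark n X τ6.mem = mark n X τ3.mem := by
    funext a; simp only [mark, fj 4 (by omega) (by omega) (by omega)]
  have hM6 : Marks δ n x X (τ3.reg 5) N C par (n + 1) τ6.mem := by
    refine ⟨⟨?_, ?_⟩, by rw [fmk]; exact hM.sound, by rw [fmk]; exact hM.complete, ?_⟩
    · simp only [fj 9 (by omega) (by omega) (by omega)]; exact hM.queue.inj
    · simp only [fj 9 (by omega) (by omega) (by omega), fj 4 (by omega) (by omega) (by omega)]
      exact hM.queue.mem
    · intro p t' ht ht'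
      rw [fj (4 + t') (by omega) (by omega) (by omega), fmk]; exact hM.cnt p t' ht ht'
  have hmkU : ∀ w ∈ N, ∀ t', Uni δ C x w t' → mark n X τ3.mem w = t' := by
    intro w hw t' hU
    by_cases ht : t' = 0
    · by_contra hh
      have := hT.tree.uni_unique hw (hM.sound w (by omega)).2.2 hU
      omega
    · exact hM.complete w hw t' ht hU
  have hc : τ6.reg 7 = c := by
    rcases hcol with ⟨h5, h6⟩ | ⟨k', hk', h5, h6, h7⟩
    · by_contra hne
      have hm := hM.complete wB hwB c (by omega) hwBu
      obtain ⟨k', hk', he⟩ := (hM.queue.mem wB).1 (by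
        change mark n X τ3.mem wB ≠ 0; rw [hm]; omega)
      have h7 := h6 k' hk' (by rw [j9, he]; exact hwBp)
      rw [j9, he, hm] at h7
      exact hcl h7
    · rw [j9] at h5 h6 h7
      rw [h7]
      rcases hcu _ (hQN k' hk') (hQr k' hk') h5 with h8 | h8
      · exact absurd (hmkU _ (hQN k' hk') _ h8) h6
      · exact hmkU _ (hQN k' hk') _ h8
  have hqq : τ6.reg 5 ≤ 2 * ((M.row (x + 1)).length + (M.row (x + 1 + n)).length + 1) := by omega
  refine hQ τ6 _ (hF4.trans (hF5.mono.trans hF9)) q4 (q5 ▸ hM6) ?_ ?_ hqq ?_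
  · rw [q6, hc, fmk]
    refine ⟨huN, humix, hcl, fun w hw => ?_, ⟨wA, mem_kids.2 ⟨hwA, hwAr, hwAp⟩, hmkU wA hwA _ hwAu⟩,
      ⟨wB, mem_kids.2 ⟨hwB, hwBr, hwBp⟩, hmkU wB hwB _ hwBu⟩⟩
    obtain ⟨h5, h6, h7⟩ := mem_kids.1 hw
    rcases hcu w h5 h6 h7 with h8 | h8
    · rw [hmkU w h5 _ h8]; exact ⟨h8, Or.inl rfl⟩
    · rw [hmkU w h5 _ h8]; exact ⟨h8, Or.inr rfl⟩
  · intro j hj hj' a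
    rw [hX1]
    by_cases h48 : j = 8
    · rw [h48, (hF8.fd 8), (hF7.fd 8)]
      have := hb8 a
      omega
    · rw [fj j hj (by omega) h48]
      by_cases h44 : j = 4
      · rw [h44]; have := hb4 a; omega
      · have h9 := hM.cnt a (j - 4) (by omega) (by omega)
        rw [show 4 + (j - 4) = j by omega] at h9
        have h10 : ((kids N par (n + 1) a).filter fun w => mark n X τ3.mem w = j - 4).card ≤ 4 * n := by
          refine (card_le_card (t := range (4 * n)) fun w hw => ?_).trans_eq
            (card_range _)
          exact mem_range.2 (hNlt w (mem_kids.1 (mem_filter.1 hw).1).1)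
        have h11 : fd n τ3.mem j a - X ≤ 4 * n := h9.trans_le h10
        omega
  · have h5 : τ3.reg 5 * 1300 ≤ 2 * d * 1300 := Nat.mul_le_mul_right _ hq
    simp only [e5] at hu5 hu6
    omega

end


/-! ### Changing the stored tree -/

/-- Collects the children whose colour is the mark in register `8` below the new node. -/
def splitBelow : Program :=
  put 1 (.reg 3) (get 1 (.reg 6)) ;; put 0 (.reg 3) (.reg 6) ;;
  put 2 (.reg 3) (.reg 17) ;; put 3 (.reg 3) (.reg 15) ;;
  put 2 (.reg 6) (get 2 (.reg 6) - .reg 17 + 1) ;;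
  put 3 (.reg 6) (get 3 (.reg 6) - .reg 15 + .reg 3) ;;
  .assign 9 (.reg 3) ;; .assign 3 (.reg 3 + 1)

/-- Puts the new node, which has received the marked children, above the node in register `6`. -/
def splitAbove : Program :=
  .assign 12 (get 0 (.reg 6)) ;;
  put 1 (.reg 3) (get 1 (.reg 6)) ;;
  put 3 (.reg 12) (get 3 (.reg 12) - .reg 6 + .reg 3) ;;
  put 0 (.reg 3) (.reg 12) ;; put 0 (.reg 6) (.reg 3) ;;
  put 2 (.reg 3) (.reg 17 + 1) ;; put 3 (.reg 3) (.reg 15 + .reg 6) ;;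
  put 2 (.reg 6) (.reg 16) ;; put 3 (.reg 6) (get 3 (.reg 6) - .reg 15) ;;
  .assign 9 (.reg 6) ;; .assign 3 (.reg 3 + 1)

/-- Separates the children of the node in register `6` whose colour is in register `7` from the
others, and stores their parent, or the only such child, in register `9`. -/
def restructure : Program :=
  (.branch (.reg 7)
    (.assign 8 (.reg 7) ;; .assign 17 (view (4 + .reg 8) (.reg 6)) ;; .assign 16 (.reg 17))
    (.assign 8 (get 1 (.reg 6)) ;; .assign 17 (view (4 + .reg 8) (.reg 6)) ;;
      .assign 16 (get 2 (.reg 6) - .reg 17))) ;;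
  movePass ;;
  .branch (Expr.lt 1 (.reg 16)) (.branch (.reg 7) splitBelow splitAbove)
    (.branch (.reg 7) (.assign 9 (.reg 15)) (.assign 9 (get 3 (.reg 6) - .reg 15)))

/-- Inserts the vertex in register `2` next to the node in register `9`. -/
def attach : Program :=
  put 1 (.reg 2) 4 ;;
  .branch ((get 1 (.reg 9)).eq (.reg 7))
    (put 0 (.reg 2) (.reg 9) ;; put 2 (.reg 9) (get 2 (.reg 9) + 1) ;;
      put 3 (.reg 9) (get 3 (.reg 9) + .reg 2))
    (.assign 12 (get 0 (.reg 9)) ;;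
      put 0 (.reg 3) (.reg 12) ;; put 1 (.reg 3) (.reg 7) ;; put 2 (.reg 3) 2 ;;
      put 3 (.reg 3) (.reg 9 + .reg 2) ;;
      put 3 (.reg 12) (get 3 (.reg 12) - .reg 9 + .reg 3) ;;
      put 0 (.reg 9) (.reg 3) ;; put 0 (.reg 2) (.reg 3) ;; .assign 3 (.reg 3 + 1))

/-- Inserts the vertex in register `2` into the tree. -/
def insertVertex : Program := locate ;; restructure ;; attach

section

variable {M : Machine} {B n : ℕ} {Q : Store → ℕ → Prop} {σ : Store} {t : ℕ}

theorem Frame.regs {J R : List ℕ} {g m : ℕ → ℕ} (h : Frame n J R σ ⟨σ.reg, m⟩)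
    (hg : ∀ i < 10, i ∉ R → g i = σ.reg i) : Frame n J R σ ⟨g, m⟩ :=
  ⟨hg, h.2⟩

theorem TreeState.bounds {δ : ℕ → ℕ → ℕ} {x nw e : ℕ} {C : ℕ → Finset ℕ} {m : ℕ → ℕ}
    (h : TreeState δ n x nw e C m) (hx : x ≤ 4 * n) (hnw : nw ≤ 4 * n) (u : ℕ) :
    fd n m 2 u ≤ 4 * n ∧ fd n m 3 u ≤ 16 * (n * n) := by
  have hsub : kids (nodes n x nw) (fd n m 0) (n + 1) u ⊆ range (4 * n) := by
    intro w hw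
    have := (mem_kids.1 hw).1
    rw [mem_nodes] at this
    rw [mem_range]; omega
  have hc := card_le_card hsub
  rw [card_range] at hc
  refine ⟨(h.kept.cnt u).trans_le hc, (h.kept.sum u).trans_le ?_⟩
  have := sum_le_card_nsmul (kids (nodes n x nw) (fd n m 0) (n + 1) u) (fun w => w) (4 * n)
    (fun w hw => (mem_range.1 (hsub hw)).le)
  rw [smul_eq_mul] at this
  refine this.trans ((Nat.mul_le_mul_right _ hc).trans (le_of_eq (by ring)))

theorem attach_spec (hC : Ctx M B n) {δ : ℕ → ℕ → ℕ} {x nw e T τ : ℕ} {C : ℕ → Finset ℕ}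
    (hx2 : 2 ≤ x) (hxn : x ≤ n) (hδ : ∀ a b, δ a b = δ b a)
    (h0 : σ.reg 0 = n) (h2 : σ.reg 2 = x) (h3 : σ.reg 3 = nw) (h7 : σ.reg 7 = τ) (h9 : σ.reg 9 = T)
    (hτ : τ ≤ 3) (hnw : nw < 4 * n) (hnw' : n + 2 ≤ nw)
    (hS : TreeState δ n x nw e C σ.mem)
    (hT : Target δ (nodes n x nw) C (fd n σ.mem 0) (fd n σ.mem 1) (n + 1) e x τ T)
    (hQ : ∀ ρ s C', Frame n [0, 1, 2, 3] [3] σ ρ → nw ≤ ρ.reg 3 → ρ.reg 3 ≤ nw + 1 →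
      TreeState δ n (x + 1) (ρ.reg 3) (n + 1) C' ρ.mem → s ≤ t + 3000 → Q ρ s) :
    wp M B attach Q σ t := by
  have ⟨_, _, hcells, hbound⟩ := hC
  have hTN := mem_nodes.1 hT.mem
  have hb := hS.bounds (by omega) hnw.le
  have hxN : x ∉ nodes n x nw := by rw [mem_nodes]; omega
  have hnN : nw ∉ nodes n x nw := by rw [mem_nodes]; omega
  have hTx : T ≠ x := fun h => hxN (h ▸ hT.mem)
  have hTn : T ≠ nw := fun h => hnN (h ▸ hT.mem)
  have hxnw : x ≠ nw := by omega
  refine wp_seq (wp_put hC (by simp) (by simp [h2]; omega) fun s1 hs1 => ?_)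
  simp [h2]
  have k1 : ∀ a, fd n (upd n σ.mem 1 x 4) 1 a = if a = x then 4 else fd n σ.mem 1 a := by
    intro a; simp [fd_upd]
  refine wp_if hC (by simp [h9, h0]; omega) (fun hl s2 hs2 => ?_) (fun hl s2 hs2 => ?_)
  · simp [h0, h9, h7, k1, hTx] at hl
    have hb2 := (hb T).1
    have hb3 := (hb T).2
    refine wp_seq (wp_put hC (by simp) (by simp [h2, h9]; omega) fun s3 hs3 => ?_)
    simp [h2, h9]
    refine wp_seq (wp_put hC (by simp [h9, h0]; omega)
      (by simp [h0, h9, fd_upd]; omega) fun s4 hs4 => ?_)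
    simp [h0, h9, fd_upd]
    refine wp_put hC (by simp [h9, h0]; omega)
      (by simp [h0, h9, h2, fd_upd]; omega) fun s5 hs5 => ?_
    simp [h0, h2, h9, fd_upd]
    set m' := upd n (upd n (upd n (upd n σ.mem 1 x 4) 0 x T) 2 T (fd n σ.mem 2 T + 1)) 3 T
      (fd n σ.mem 3 T + x) with hm'
    have p0 : ∀ a, fd n m' 0 a = if a = x then T else fd n σ.mem 0 a := by
      intro a; simp [hm', fd_upd]
    have p1 : ∀ a, fd n m' 1 a = if a = x then 4 else fd n σ.mem 1 a := by
      intro a; simp [hm', fd_upd]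
    have p2 : ∀ a, fd n m' 2 a = if a = T then fd n σ.mem 2 a + 1 else fd n σ.mem 2 a := by
      intro a; simp [hm', fd_upd]; split_ifs with h <;> simp [h]
    have p3 : ∀ a, fd n m' 3 a = if a = T then fd n σ.mem 3 a + x else fd n σ.mem 3 a := by
      intro a; simp [hm', fd_upd]; split_ifs with h <;> simp [h]
    obtain ⟨C', hT', hK'⟩ := hS.tree.join (lab' := fd n m' 1) hT (fun hh => by
      have := hS.lab_leaf T (by simpa using hh); omega) hl hxN hδ hS.kept p0
      (by rw [p1, if_pos rfl]; omega)
      (fun w hw => by rw [p1, if_neg (show w ≠ x from fun h => hxN (h ▸ hw))]) p2 p3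
    refine hQ _ _ C' ?_ (by simpa using h3.ge) (by simp; omega) ⟨?_, ?_, ?_, ?_, ?_, ?_⟩ (by omega)
    · exact Frame.refl.put.put.put.put
    · rw [range_add_one]; simpa only [h3, nodes_succ_left] using hT'
    · simpa only [h3, nodes_succ_left] using hK'
    · rw [p0, if_neg (by omega)]; exact hS.par_root
    · rw [p0, if_neg (by omega)]; exact hS.par_top
    · rw [p1, if_neg (by omega)]; exact hS.lab_root
    · intro a ha
      simp only [p1]
      split_ifs with h
      · rfl
      · exact hS.lab_leaf a (by omega)
  · simp [h0, h9, h7, k1, hTx] at hl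
    have hqN := hS.tree.par_mem T hT.mem hT.ne
    have hqN' := mem_nodes.1 hqN
    have hqx : fd n σ.mem 0 T ≠ x := fun h => hxN (h ▸ hqN)
    have hqn : fd n σ.mem 0 T ≠ nw := fun h => hnN (h ▸ hqN)
    have hqT := hS.tree.par_ne hT.mem hT.ne
    set q := fd n σ.mem 0 T with hq
    have hb3 := (hb q).2
    refine wp_seq (wp_set hC (by simp [h0, h9]; omega)
      (by simp [h0, h9, fd_upd, ← hq]; omega) fun s3 hs3 => ?_)
    simp [h0, h9, fd_upd, ← hq]
    refine wp_seq (wp_put hC (by simp) (by simp [h3]; omega) fun s4 hs4 => ?_)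
    refine wp_seq (wp_put hC (by simp) (by simp [h3, h7]; omega) fun s5 hs5 => ?_)
    refine wp_seq (wp_put hC (by simp) (by simp [h3]; omega) fun s6 hs6 => ?_)
    refine wp_seq (wp_put hC (by simp) (by simp [h3, h9, h2]; omega) fun s7 hs7 => ?_)
    simp [h3, h7, h9, h2]
    refine wp_seq (wp_put hC (by simp [h0]; omega)
      (by simp [h3, h9, h0, fd_upd, hqn]; omega) fun s8 hs8 => ?_)
    simp [h3, h9, h0, fd_upd, hqn]
    refine wp_seq (wp_put hC (by simp) (by simp [h3, h9]; omega) fun s9 hs9 => ?_)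
    refine wp_seq (wp_put hC (by simp) (by simp [h3, h2]; omega) fun s10 hs10 => ?_)
    refine wp_set hC (by simp) (by simp [h3]; omega) fun s11 hs11 => ?_
    simp [h3, h2, h9]
    generalize hm' : upd n (upd n (upd n _ 3 q _) 0 T nw) 0 x nw = m'
    have p0 : ∀ a, fd n m' 0 a = if a = x then nw else if a = T then nw else
        if a = nw then q else fd n σ.mem 0 a := by
      intro a; simp [← hm', fd_upd]
    have p1 : ∀ a, fd n m' 1 a = if a = nw then τ else if a = x then 4 else fd n σ.mem 1 a := by
      intro a; simp [← hm', fd_upd]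
    have p2 : ∀ a, fd n m' 2 a = if a = nw then 2 else fd n σ.mem 2 a := by
      intro a; simp [← hm', fd_upd]
    have p3 : ∀ a, fd n m' 3 a = if a = q then fd n σ.mem 3 a - T + nw else if a = nw then T + x else
        fd n σ.mem 3 a := by
      intro a; simp [← hm', fd_upd]; split_ifs with h <;> simp [h]
    obtain ⟨C', hT', hK'⟩ := hS.tree.pair (p := nw) (lab' := fd n m' 1) hT hl hxN hnN hxnw.symm hδ
      hS.kept p0 (by rw [p1, if_neg hxnw, if_pos rfl]; omega) (by rw [p1, if_pos rfl])
      (fun w hw => by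
        rw [p1, if_neg (show w ≠ nw from fun h => hnN (h ▸ hw)),
          if_neg (show w ≠ x from fun h => hxN (h ▸ hw))]) p2 p3
    have hN' : nodes n (x + 1) (nw + 1) = insert nw (insert x (nodes n x nw)) := by
      rw [nodes_succ_right (by omega), nodes_succ_left]
    refine hQ _ _ C' ?_ (by simp) (by simp) ⟨?_, ?_, ?_, ?_, ?_, ?_⟩ (by omega)
    · rw [← hm']
      refine Frame.regs ?_ fun i h1 h2 => by
        have h12 : i ≠ 12 := by omega
        simp at h2
        simp [h2, h12]
      exact Frame.refl.put.put.put.put.put.put.put.put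
    · rw [range_add_one]; simpa [hN'] using hT'
    · simpa [hN'] using hK'
    · rw [p0, if_neg (by omega), if_neg (fun h => hT.ne h.symm), if_neg (by omega)]
      exact hS.par_root
    · rw [p0, if_neg (by omega), if_neg (by omega), if_neg (by omega)]; exact hS.par_top
    · rw [p1, if_neg (by omega), if_neg (by omega)]; exact hS.lab_root
    · intro a ha
      simp only [p1]
      rw [if_neg (by omega)]
      split_ifs with h
      · rfl
      · exact hS.lab_leaf a (by omega)

theorem splitBelow_spec (hC : Ctx M B n) {u nw cm sm : ℕ} (h0 : σ.reg 0 = n) (h3 : σ.reg 3 = nw)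
    (h6 : σ.reg 6 = u) (h15 : σ.reg 15 = sm) (h17 : σ.reg 17 = cm) (hu : u < 4 * n)
    (hun : u ≠ nw) (hnw : nw < 4 * n) (hsm : sm ≤ 16 * (n * n)) (hcm : cm ≤ 4 * n)
    (hb2 : fd n σ.mem 2 u ≤ 4 * n) (hb3 : fd n σ.mem 3 u ≤ 16 * (n * n))
    (hb1 : fd n σ.mem 1 u ≤ B)
    (hQ : ∀ ρ s, Frame n [0, 1, 2, 3] [3, 9] σ ρ → ρ.reg 9 = nw → ρ.reg 3 = nw + 1 →
      (∀ w, fd n ρ.mem 0 w = if w = nw then u else fd n σ.mem 0 w) →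
      (∀ w, fd n ρ.mem 1 w = if w = nw then fd n σ.mem 1 u else fd n σ.mem 1 w) →
      (∀ w, fd n ρ.mem 2 w = if w = nw then cm else if w = u then fd n σ.mem 2 u - cm + 1 else
        fd n σ.mem 2 w) →
      (∀ w, fd n ρ.mem 3 w = if w = nw then sm else if w = u then fd n σ.mem 3 u - sm + nw else
        fd n σ.mem 3 w) → s ≤ t + 3000 → Q ρ s) :
    wp M B splitBelow Q σ t := by
  have ⟨_, _, hcells, hbound⟩ := hC
  refine wp_seq (wp_put hC (by simp [h0, h6]; omega) (by simp [h0, h6, h3]; omega) fun s1 hs1 => ?_)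
  refine wp_seq (wp_put hC (by simp) (by simp [h3, h6]; omega) fun s2 hs2 => ?_)
  refine wp_seq (wp_put hC (by simp) (by simp [h3, h17]; omega) fun s3 hs3 => ?_)
  refine wp_seq (wp_put hC (by simp) (by simp [h3, h15]; omega) fun s4 hs4 => ?_)
  simp [h0, h3, h6, h15, h17]
  refine wp_seq (wp_put hC (by simp [h0, h6]; omega)
    (by simp [h0, h6, h17, fd_upd, hun]; omega) fun s5 hs5 => ?_)
  simp [h0, h6, h17, fd_upd, hun]
  refine wp_seq (wp_put hC (by simp [h0, h6]; omega)
    (by simp [h0, h6, h15, h3, fd_upd, hun]; omega) fun s6 hs6 => ?_)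
  simp [h0, h6, h15, h3, fd_upd, hun]
  refine wp_seq (wp_set hC (by simp) (by simp [h3]; omega) fun s7 hs7 => ?_)
  refine wp_set hC (by simp) (by simp [h3]; omega) fun s8 hs8 => ?_
  simp [h3]
  refine hQ _ _ ?_ (by simp) (by simp) (fun w => ?_) (fun w => ?_) (fun w => ?_) (fun w => ?_)
    (by omega)
  · refine Frame.regs ?_ fun i h1 h2 => by
      have h12 : i ≠ 12 := by omega
      simp at h2
      simp [h2]
    exact Frame.refl.put.put.put.put.put.put
  · simp [fd_upd]
  · simp [fd_upd]
  · simp [fd_upd]; split_ifs <;> simp_all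
  · simp [fd_upd]; split_ifs <;> simp_all

theorem splitAbove_spec (hC : Ctx M B n) {u q nw cm sm kb : ℕ} (h0 : σ.reg 0 = n)
    (h3 : σ.reg 3 = nw)
    (h6 : σ.reg 6 = u) (h15 : σ.reg 15 = sm) (h16 : σ.reg 16 = kb) (h17 : σ.reg 17 = cm)
    (hq : fd n σ.mem 0 u = q) (hu : u < 4 * n) (hqn : q < 4 * n) (huq : u ≠ q)
    (hun : u ≠ nw) (hnw : nw < 4 * n) (hsm : sm ≤ 16 * (n * n)) (hcm : cm ≤ 4 * n)
    (hkb : kb ≤ 4 * n) (hb2 : fd n σ.mem 3 q ≤ 16 * (n * n)) (hb3 : fd n σ.mem 3 u ≤ 16 * (n * n))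
    (hb1 : fd n σ.mem 1 u ≤ B)
    (hQ : ∀ ρ s, Frame n [0, 1, 2, 3] [3, 9] σ ρ → ρ.reg 9 = u → ρ.reg 3 = nw + 1 →
      (∀ w, fd n ρ.mem 0 w = if w = u then nw else if w = nw then q else fd n σ.mem 0 w) →
      (∀ w, fd n ρ.mem 1 w = if w = nw then fd n σ.mem 1 u else fd n σ.mem 1 w) →
      (∀ w, fd n ρ.mem 2 w = if w = u then kb else if w = nw then cm + 1 else fd n σ.mem 2 w) →
      (∀ w, fd n ρ.mem 3 w = if w = u then fd n σ.mem 3 u - sm else if w = nw then sm + u else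
        if w = q then fd n σ.mem 3 q - u + nw else fd n σ.mem 3 w) → s ≤ t + 3000 → Q ρ s) :
    wp M B splitAbove Q σ t := by
  have ⟨_, _, hcells, hbound⟩ := hC
  refine wp_seq (wp_set hC (by simp [h0, h6]; omega) (by simp [h0, h6, hq]; omega) fun s0 hs0 => ?_)
  refine wp_seq (wp_put hC (by simp [h0, h6]; omega) (by simp [h0, h6, h3]; omega) fun s1 hs1 => ?_)
  simp [h0, h3, h6, hq]
  refine wp_seq (wp_put hC (by simp [h0]; omega)
    (by simp [h3, h6, h0, fd_upd]; omega) fun s2 hs2 => ?_)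
  simp [h0, h3, h6, fd_upd]
  refine wp_seq (wp_put hC (by simp) (by simp [h3]; omega) fun s3 hs3 => ?_)
  refine wp_seq (wp_put hC (by simp) (by simp [h3, h6]; omega) fun s4 hs4 => ?_)
  refine wp_seq (wp_put hC (by simp) (by simp [h3, h17]; omega) fun s5 hs5 => ?_)
  refine wp_seq (wp_put hC (by simp) (by simp [h3, h15, h6]; omega) fun s6 hs6 => ?_)
  refine wp_seq (wp_put hC (by simp) (by simp [h6, h16]; omega) fun s7 hs7 => ?_)
  simp [h3, h6, h15, h16, h17]
  refine wp_seq (wp_put hC (by simp [h0, h6]; omega)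
    (by simp [h0, h6, h15, fd_upd, hun, huq]; omega) fun s8 hs8 => ?_)
  simp [h0, h6, h15, fd_upd, hun, huq]
  refine wp_seq (wp_set hC (by simp) (by simp [h6]; omega) fun s9 hs9 => ?_)
  refine wp_set hC (by simp) (by simp [h3]; omega) fun s10 hs10 => ?_
  simp [h3, h6]
  refine hQ _ _ ?_ (by simp) (by simp) (fun w => ?_) (fun w => ?_) (fun w => ?_) (fun w => ?_)
    (by omega)
  · refine Frame.regs ?_ fun i h1 h2 => by
      have h12 : i ≠ 12 := by omega
      simp at h2
      simp [h2, h12]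
    exact Frame.refl.put.put.put.put.put.put.put.put
  · simp [fd_upd]
  · simp [fd_upd]
  · simp [fd_upd]
  · simp [fd_upd]

theorem restructure_spec (hC : Ctx M B n) {δ : ℕ → ℕ → ℕ} {x X nw u τ : ℕ} {C : ℕ → Finset ℕ}
    {l l' : List ℕ} (hx : NewVertex δ n x l l')
    (h0 : σ.reg 0 = n) (h3 : σ.reg 3 = nw) (h4 : σ.reg 4 = X)
    (h6 : σ.reg 6 = u) (h7 : σ.reg 7 = τ) (hnw : nw < 4 * n) (hnw' : n + 2 ≤ nw)
    (hS : TreeState δ n x nw (n + 1) C σ.mem)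
    (hM : Marks δ n x X (σ.reg 5) (nodes n x nw) C (fd n σ.mem 0) (n + 1) σ.mem)
    (hL : Lowest δ (nodes n x nw) C (fd n σ.mem 0) (fd n σ.mem 1) (n + 1) x u τ (mark n X σ.mem))
    (hQ : ∀ ρ s e C' T, Frame n [0, 1, 2, 3] [3, 8, 9] σ ρ → ρ.reg 9 = T → nw ≤ ρ.reg 3 →
      ρ.reg 3 ≤ nw + 1 → TreeState δ n x (ρ.reg 3) e C' ρ.mem →
      Target δ (nodes n x (ρ.reg 3)) C' (fd n ρ.mem 0) (fd n ρ.mem 1) (n + 1) e x τ T →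
      s ≤ t + σ.reg 5 * 1300 + 5000 → Q ρ s) :
    wp M B restructure Q σ t := by
  have ⟨_, _, hcells, hbound⟩ := hC
  have hxn := hx.le
  have hx2 := hx.two_le
  have hxV : x ∉ range x := by simp
  have hNlt : ∀ a ∈ nodes n x nw, a < 4 * n := by
    intro a ha; rw [mem_nodes] at ha; omega
  have hnN : nw ∉ nodes n x nw := by rw [mem_nodes]; omega
  have hb := hS.bounds (by omega) hnw.le
  set N := nodes n x nw with hN
  set par := fd n σ.mem 0 with hpar
  set lab := fd n σ.mem 1 with hlab
  set g := mark n X σ.mem with hg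
  have hu := hL.mem
  have hun := hNlt u hu
  have hunw : u ≠ nw := fun h => hnN (h ▸ hu)
  have hcol : ∀ w ∈ kids N par (n + 1) u, g w ≤ 3 := by
    intro w hw
    obtain ⟨a, ha⟩ := hS.tree.nonempty w (mem_kids.1 hw).1
    rw [← (hL.kid w hw).1 a ha]; exact hx.le_three a
  have hτ3 : τ ≤ 3 := by
    obtain ⟨w, hw, he⟩ := hL.exists_tau; exact he ▸ hcol w hw
  have hl3 : lab u ≤ 3 := by
    obtain ⟨w, hw, he⟩ := hL.exists_lab; exact he ▸ hcol w hw
  obtain ⟨t0, ht0⟩ : ∃ t0, t0 = if τ = 0 then lab u else τ := ⟨_, rfl⟩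
  have ht1 : 1 ≤ t0 := by
    have := hL.ne
    rw [ht0]; split_ifs <;> omega
  have ht3 : t0 ≤ 3 := by rw [ht0]; split_ifs <;> omega
  set S := (kids N par (n + 1) u).filter fun w => g w = t0 with hSdef
  set Bs := (kids N par (n + 1) u).filter fun w => g w = τ with hBs
  have hSk : S ⊆ kids N par (n + 1) u := filter_subset _ _
  have hBk : Bs ⊆ kids N par (n + 1) u := filter_subset _ _
  have hcS : S.card ≤ fd n σ.mem 2 u := (card_le_card hSk).trans_eq (hS.kept.cnt u).symm
  have hcB : Bs.card ≤ fd n σ.mem 2 u := (card_le_card hBk).trans_eq (hS.kept.cnt u).symm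
  have hsS : ∑ w ∈ S, w ≤ fd n σ.mem 3 u :=
    (sum_le_sum_of_subset hSk).trans_eq (hS.kept.sum u).symm
  have hbu := hb u
  have hview := hM.cnt u t0 ht1 ht3
  rw [← hg, ← hSdef] at hview
  have hB0 : τ = 0 → S = (kids N par (n + 1) u).filter (fun w => g w = lab u) ∧
      kids N par (n + 1) u \ S = Bs := by
    intro h
    rw [if_pos h] at ht0
    refine ⟨by rw [hSdef, ht0], ?_⟩
    ext w
    simp only [hSdef, hBs, mem_sdiff, mem_filter, not_and, ht0]
    constructor
    · rintro ⟨h5, h6⟩; exact ⟨h5, (hL.kid w h5).2.resolve_left (h6 h5)⟩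
    · rintro ⟨h5, h6⟩; exact ⟨h5, fun _ he => hL.ne (h6.symm.trans he)⟩
  have hB1 : τ ≠ 0 → S = Bs := by
    intro h
    rw [if_neg h] at ht0
    rw [hSdef, hBs, ht0]
  have hBne : Bs.Nonempty := by
    obtain ⟨w, hw, he⟩ := hL.exists_tau
    exact ⟨w, mem_filter.2 ⟨hw, he⟩⟩
  have hroot : 1 < Bs.card → u ≠ n + 1 := by
    rintro h2 rfl
    obtain ⟨w, hw, w', hw', hne⟩ := one_lt_card.1 h2
    obtain ⟨h5, h6⟩ := mem_filter.1 hw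
    obtain ⟨h5', h6'⟩ := mem_filter.1 hw'
    obtain ⟨k1, k2, k3⟩ := mem_kids.1 h5
    obtain ⟨k1', k2', k3'⟩ := mem_kids.1 h5'
    obtain ⟨a, ha⟩ := hS.tree.nonempty w k1
    obtain ⟨a', ha'⟩ := hS.tree.nonempty w' k1'
    have h7 := (hS.tree.sib w k1 k2 w' k1' k2' (k3.trans k3'.symm) hne a ha a' ha').2
    have hl : lab (n + 1) = 3 := hS.lab_root
    have hne := hL.ne
    have hz : ∀ v ∈ kids N par (n + 1) (n + 1), g v = τ → ∀ b ∈ C v, b ≠ 0 := by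
      rintro v hv hvτ b hb rfl
      have := (hL.kid v hv).1 0 hb
      rw [hx.zero, hvτ] at this
      omega
    have := hx.pair a a' (hz w h5 h6 a ha) (hz w' h5' h6' a' ha')
    change δ a a' = lab (par w) at h7
    change par w = n + 1 at k3
    rw [k3, hl] at h7
    omega
  have hkey : ∀ ρ s, Frame n [] [8] σ ρ → ρ.reg 8 = t0 → ρ.reg 17 = S.card →
      ρ.reg 16 = Bs.card → s ≤ t + 500 → wp M B (movePass ;;
        .branch (Expr.lt 1 (.reg 16)) (.branch (.reg 7) splitBelow splitAbove)
          (.branch (.reg 7) (.assign 9 (.reg 15)) (.assign 9 (get 3 (.reg 6) - .reg 15)))) Q ρ s := by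
    intro ρ s hF e8 e17 e16 hs
    have e0 : ρ.reg 0 = n := (hF.reg 0).trans h0
    have e3 : ρ.reg 3 = nw := (hF.reg 3).trans h3
    have e4 : ρ.reg 4 = X := (hF.reg 4).trans h4
    have e5 : ρ.reg 5 = σ.reg 5 := hF.reg 5
    have e6 : ρ.reg 6 = u := (hF.reg 6).trans h6
    have ff : ∀ j < 32, fd n ρ.mem j = fd n σ.mem j := fun j hj => funext (hF.2 j hj (by simp))
    have hQN : ∀ k < σ.reg 5, fd n σ.mem 9 k < 4 * n := fun k hk =>
      hNlt _ (hM.sound _ ((hM.queue.mem _).2 ⟨k, hk, rfl⟩)).1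
    have hmk : mark n X ρ.mem = g := by funext a; simp [mark, ff, hg]
    refine wp_seq (movePass_spec hC e0 (by rw [e5]; exact hM.queue.le hQN)
      (by rw [e5, ff 9 (by omega)]; exact hQN) e6 e8 e3 e16 (by omega)
      (by rw [e5, ff 9 (by omega)]; exact hM.queue.inj) (S := S) ?_ ?_)
    · intro w
      rw [e5, ff 9 (by omega), ff 0 (by omega), e4, hmk, ← hM.queue.mem w]
      change _ ↔ g w ≠ 0 ∧ _
      rw [hSdef, mem_filter, mem_kids]
      constructor
      · rintro ⟨⟨-, -, h5⟩, h6⟩; exact ⟨by omega, h5, h6⟩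
      · rintro ⟨h5, h6, h7⟩
        obtain ⟨h8, h9, -⟩ := hM.sound w h5
        exact ⟨⟨h8, h9, h6⟩, h7⟩
    rw [e5, e17, ff 0 (by omega)]
    intro ρ' s' hF' e15 e16' e17' hp0 hs'
    have k0 : ρ'.reg 0 = n := (hF'.reg 0).trans e0
    have k3 : ρ'.reg 3 = nw := (hF'.reg 3).trans e3
    have k6 : ρ'.reg 6 = u := (hF'.reg 6).trans e6
    have k7 : ρ'.reg 7 = τ :=
      (hF'.reg 7).trans ((hF.reg 7).trans h7)
    have ff' : ∀ j, 1 ≤ j → j < 32 → fd n ρ'.mem j = fd n σ.mem j := fun j hj hj' => by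
      rw [← ff j hj']; exact funext (hF'.2 j hj' (by simp; omega))
    have hFF : Frame n [0, 1, 2, 3] [3, 8, 9] σ ρ' :=
      hF.mono.trans (hF'.mono)
    have huS : u ∉ S := fun h => by
      obtain ⟨h5, h6, h7⟩ := mem_kids.1 (hSk h)
      exact hS.tree.par_ne h5 h6 h7
    have hpu : fd n ρ'.mem 0 u = par u := by rw [hp0, if_neg fun h => huS h.2]
    refine wp_if hC (by simp) (fun hk s2 hs2 => ?_) (fun hk s2 hs2 => ?_)
    · simp [e16'] at hk
      have hur := hroot hk
      have hpN := hS.tree.par_mem u hu hur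
      have hpuu := hS.tree.par_ne hu hur
      have hp0' : ∀ w, fd n ρ'.mem 0 w = if w ∈ S then nw else par w := by
        intro w; rw [hp0]; simp [hk, hpar]
      have hq4 : 4 * n ∉ N := fun h => by have := hNlt _ h; omega
      have hrS : n + 1 ∉ S := fun h => (mem_kids.1 (hSk h)).2.1 rfl
      have h4S : 4 * n ∉ S := fun h => hq4 (mem_kids.1 (hSk h)).1
      have hN' : nodes n x (nw + 1) = insert nw N := nodes_succ_right (by omega)
      have hlabu : ∀ ρ'' : Store, (∀ w, fd n ρ''.mem 1 w = if w = nw then lab u else lab w) →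
          fd n ρ''.mem 1 (n + 1) = 3 ∧ ∀ a < x, fd n ρ''.mem 1 a = 4 := by
        intro ρ'' h
        refine ⟨by rw [h, if_neg (by omega)]; exact hS.lab_root, fun a ha => ?_⟩
        rw [h, if_neg (by omega)]; exact hS.lab_leaf a ha
      refine wp_if hC (by simp) (fun hτ s3 hs3 => ?_) (fun hτ s3 hs3 => ?_)
      · simp [k7] at hτ
        have hSB := hB1 hτ
        refine splitBelow_spec hC k0 k3 k6 e15 e17' hun hunw hnw (by omega) (by omega)
          (by rw [ff' 2 (by omega) (by omega)]; omega) (by rw [ff' 3 (by omega) (by omega)]; omega)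
          (by rw [ff' 1 (by omega) (by omega)]; exact hl3.trans (by omega)) ?_
        intro ρ'' s4 hF'' r9 r3 q0 q1 q2 q3 hs4
        rw [ff' 1 (by omega) (by omega)] at q1
        rw [ff' 2 (by omega) (by omega)] at q2
        rw [ff' 3 (by omega) (by omega)] at q3
        simp only [hp0'] at q0
        obtain ⟨C', hT', hG, hK'⟩ := hS.tree.split_below hxV hx.ultra hL (hSB ▸ hBs) (hSB ▸ hk) hnN
          hS.kept q0 q1 q2 q3
        obtain ⟨hl1, hl2⟩ := hlabu ρ'' q1
        refine hQ ρ'' s4 nw C' nw (hFF.trans (hF''.mono)) r9 (by omega)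
          (by omega) ⟨?_, ?_, ?_, ?_, hl1, hl2⟩ ?_ (by omega)
        · rw [r3, hN']; exact hT'
        · rw [r3, hN']; exact hK'
        · rw [q0, if_neg (by omega), if_neg hrS]; exact hS.par_root
        · rw [q0, if_neg (by omega), if_neg h4S]; exact hS.par_top
        · rw [r3, hN']; exact hG
      · simp [k7] at hτ
        obtain ⟨hSA, hSB⟩ := hB0 hτ
        have hb3 := (hb (par u)).2
        have hpn := hNlt _ hpN
        refine splitAbove_spec hC k0 k3 k6 e15 e16' e17' hpu hun hpn hpuu.symm hunw hnw (by omega)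
          (by omega) (by omega) (by rw [ff' 3 (by omega) (by omega)]; omega)
          (by rw [ff' 3 (by omega) (by omega)]; omega)
          (by rw [ff' 1 (by omega) (by omega)]; exact hl3.trans (by omega)) ?_
        intro ρ'' s4 hF'' r9 r3 q0 q1 q2 q3 hs4
        rw [ff' 1 (by omega) (by omega)] at q1
        rw [ff' 2 (by omega) (by omega)] at q2
        rw [ff' 3 (by omega) (by omega)] at q3
        simp only [hp0'] at q0
        have hcard : Bs.card = fd n σ.mem 2 u - S.card := by
          rw [← hSB, card_sdiff_of_subset hSk, hS.kept.cnt]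
        rw [hcard] at q2
        obtain ⟨C', hT', hG, hK'⟩ := hS.tree.split_above hxV hx.ultra hL hBs hSA hk hnN hur
          hS.kept q0 q1 q2 q3
        obtain ⟨hl1, hl2⟩ := hlabu ρ'' q1
        refine hQ ρ'' s4 u C' u (hFF.trans (hF''.mono)) r9 (by omega)
          (by omega) ⟨?_, ?_, ?_, ?_, hl1, hl2⟩ ?_ (by omega)
        · rw [r3, hN']; exact hT'
        · rw [r3, hN']; exact hK'
        · rw [q0, if_neg (Ne.symm hur), if_neg (by omega), if_neg hrS]; exact hS.par_root
        · rw [q0, if_neg (by omega), if_neg (by omega), if_neg h4S]; exact hS.par_top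
        · rw [r3, hN']; exact hG
    · simp [e16'] at hk
      obtain ⟨T, hT⟩ := card_eq_one.1 (le_antisymm hk (card_pos.2 hBne))
      have hG := hS.tree.target_single hxV hx.ultra hL hT
      have hp0' : fd n ρ'.mem 0 = fd n σ.mem 0 := by
        funext w
        have : ¬ 1 < Bs.card := by omega
        rw [hp0]; simp [this]
      have hS' : TreeState δ n x nw (n + 1) C ρ'.mem := hS.congr fun j hj a => by
        by_cases hj0 : j = 0
        · rw [hj0, hp0']
        · rw [ff' j (by omega) (by omega)]
      have hTn := hNlt T hG.mem
      have hfin : ∀ i ≤ s2 + 200, Q ⟨Function.update ρ'.reg 9 T, ρ'.mem⟩ i := by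
        intro i hi
        refine hQ _ i (n + 1) C T (hFF.set_reg) (by simp) (by simp [k3]) (by simp [k3])
          (by simpa [k3] using hS') ?_ (by omega)
        simpa [k3, hp0', ff'] using hG
      refine wp_if hC (by simp) (fun hτ s3 hs3 => ?_) (fun hτ s3 hs3 => ?_)
      · simp [k7] at hτ
        have hsum : ∑ w ∈ S, w = T := by rw [hB1 hτ, hT, sum_singleton]
        refine wp_set hC (by simp) (by simp [e15, hsum]; omega) fun s4 hs4 => ?_
        simp only [Expr.val_reg, e15, hsum]
        exact hfin _ (by omega)
      · simp [k7] at hτ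
        have hsum : fd n ρ'.mem 3 u - ∑ w ∈ S, w = T := by
          rw [ff' 3 (by omega) (by omega), hS.kept.sum u, ← sum_sdiff hSk, (hB0 hτ).2, hT,
            sum_singleton]
          omega
        refine wp_set hC (by simp [k0, k6]; omega)
          (by simp [e15, k0, k6, hsum]; omega) fun s4 hs4 => ?_
        simp only [Expr.val_reg, Expr.val_sub, val_get, Expr.val_ofNat, k0, k6, e15, hsum]
        exact hfin _ (by omega)
  refine wp_seq (wp_if hC (by simp) (fun hτ s1 hs1 => ?_) (fun hτ s1 hs1 => ?_))
  · simp [h7] at hτ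
    rw [if_neg hτ] at ht0
    refine wp_seq (wp_set hC (by simp) (by simp [h7]; omega) fun s2 hs2 => ?_)
    simp [h7, ← ht0]
    refine wp_seq (wp_set hC (by simp [view, h0, h6]; omega)
      (by simp [view, h0, h6, h4, hview]; omega) fun s3 hs3 => ?_)
    simp [view, h0, h6, h4, hview]
    refine wp_set hC (by simp) (by simp; omega) fun s4 hs4 => ?_
    simp
    refine hkey _ _ (Frame.refl.set_reg.set_reg.set_reg)
      (by simp) (by simp) (by simp [hB1 hτ]) (by omega)
  · simp [h7] at hτ
    rw [if_pos hτ] at ht0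
    have hcard : fd n σ.mem 2 u - S.card = Bs.card := by
      rw [← (hB0 hτ).2, card_sdiff_of_subset hSk, hS.kept.cnt]
    refine wp_seq (wp_set hC (by simp [h0, h6]; omega)
      (by simp [h0, h6, ← hlab]; omega) fun s2 hs2 => ?_)
    simp [h0, h6, ← hlab, ← ht0]
    refine wp_seq (wp_set hC (by simp [view, h0, h6]; omega)
      (by simp [view, h0, h6, h4, hview]; omega) fun s3 hs3 => ?_)
    simp [view, h0, h6, h4, hview]
    refine wp_set hC (by simp [h0, h6]; omega) (by simp [h0, h6]; omega) fun s4 hs4 => ?_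
    simp [h0, h6]
    refine hkey _ _ (Frame.refl.set_reg.set_reg.set_reg)
      (by simp) (by simp) (by simp [hcard]) (by omega)

/-- The state before the insertion of the vertex `x`: a tree for the vertices below `x`, and time
stamps before the next one. -/
structure InsertInv (δ : ℕ → ℕ → ℕ) (n x nw : ℕ) (C : ℕ → Finset ℕ) (m : ℕ → ℕ) : Prop where
  state : TreeState δ n x nw (n + 1) C m
  le : n + 2 ≤ nw
  le' : nw + 2 ≤ n + 2 * x
  stamp : ∀ j, 4 ≤ j → j ≤ 8 → ∀ a, fd n m j a ≤ 8 * n * x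

theorem insertVertex_spec (hC : Ctx M B n) {δ : ℕ → ℕ → ℕ} {x nw : ℕ} {C : ℕ → Finset ℕ}
    (hx : NewVertex δ n x (M.row (x + 1)) (M.row (x + 1 + n)))
    (h0 : σ.reg 0 = n) (h2 : σ.reg 2 = x) (h3 : σ.reg 3 = nw)
    (hI : InsertInv δ n x nw C σ.mem)
    (hQ : ∀ ρ s C', Frame n [0, 1, 2, 3, 4, 5, 6, 7, 8, 9] [3, 4, 5, 6, 7, 8, 9] σ ρ →
      InsertInv δ n (x + 1) (ρ.reg 3) C' ρ.mem →
      s ≤ t + ((M.row (x + 1)).length + (M.row (x + 1 + n)).length + 1) * 40000 → Q ρ s) :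
    wp M B insertVertex Q σ t := by
  have hxn := hx.le
  have hx2 := hx.two_le
  have hnw := hI.le
  have hnw' := hI.le'
  refine wp_seq (locate_spec hC hx h0 h2 (by omega) hI.state hI.stamp ?_)
  intro ρ s hF e4 hM hL hst hq hs
  have hf : ∀ j < 4, fd n ρ.mem j = fd n σ.mem j := fun j hj =>
    funext (hF.2 j (by omega) (by simp; omega))
  have e3 : ρ.reg 3 = nw := (hF.reg 3).trans h3
  have e0 : ρ.reg 0 = n := (hF.reg 0).trans h0
  have e2 : ρ.reg 2 = x := (hF.reg 2).trans h2
  have hτ3 : ρ.reg 7 ≤ 3 := by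
    obtain ⟨w, hw, he⟩ := hL.exists_tau
    obtain ⟨a, ha⟩ := hI.state.tree.nonempty w (mem_kids.1 hw).1
    rw [← he, ← (hL.kid w hw).1 a ha]; exact hx.le_three a
  refine wp_seq (restructure_spec hC hx e0 e3 e4 rfl rfl (by omega) hnw
    (hI.state.congr fun j hj a => by rw [hf j hj]) (by rw [hf 0 (by omega)]; exact hM)
    (by rw [hf 0 (by omega), hf 1 (by omega)]; exact hL) ?_)
  intro ρ' s' e C' T hF' e9 hle hle' hS' hT' hs'
  refine attach_spec hC hx2 hxn hx.ultra.comm ((hF'.reg 0).trans e0)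
    ((hF'.reg 2).trans e2) rfl (hF'.reg 7) e9 hτ3 (by omega)
    (by omega) hS' hT' ?_
  intro ρ'' s'' C'' hF'' hl hl' hS'' hs''
  refine hQ ρ'' s'' C'' (hF.mono.trans (hF'.mono.trans
    (hF''.mono))) ⟨hS'', by omega, by omega, fun j hj hj' a => ?_⟩ ?_
  · rw [hF''.2 j (by omega) (by simp; omega), hF'.2 j (by omega) (by simp; omega)]
    exact hst j hj hj' a
  · have := Nat.mul_le_mul_right 1300 hq
    omega

end


/-! ### Building the tree -/

open Classical in
/-- The colour of two leaves: the number of arcs between the vertices that they represent. The leaf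
`a + 1` stands for the vertex `a`; the leaf `0` has the extra colour `3` with all others. -/
noncomputable def colour (A : ℕ → ℕ → Prop) (a b : ℕ) : ℕ :=
  if a = 0 ∨ b = 0 then 3 else
    (if A (a - 1) (b - 1) then 1 else 0) + if A (b - 1) (a - 1) then 1 else 0

theorem colour_comm (A : ℕ → ℕ → Prop) (a b : ℕ) : colour A a b = colour A b a := by
  simp only [colour, or_comm, add_comm]

theorem colour_le_two (A : ℕ → ℕ → Prop) {a b : ℕ} (ha : a ≠ 0) (hb : b ≠ 0) :
    colour A a b ≤ 2 := by
  simp only [colour, ha, hb, or_self, if_false]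
  split_ifs <;> omega

/-- The input rows from `2` on are the adjacency lists of the relation `A` on the vertices below
`n`. -/
structure Adj (M : Machine) (n : ℕ) (A : ℕ → ℕ → Prop) : Prop where
  succ_nodup : ∀ v < n, (M.row (2 + v)).Nodup
  mem_succ : ∀ v < n, ∀ u, u ∈ M.row (2 + v) ↔ A v u
  pred_nodup : ∀ v < n, (M.row (2 + n + v)).Nodup
  mem_pred : ∀ v < n, ∀ u, u ∈ M.row (2 + n + v) ↔ A u v
  lt : ∀ u v, A u v → u < n ∧ v < n

/-- The work for the first `x` vertices. -/
def Machine.load (M : Machine) (n x : ℕ) : ℕ :=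
  ∑ v ∈ Finset.range x, ((M.row (2 + v)).length + (M.row (2 + n + v)).length + 1)

theorem IsUltra.mono {δ : ℕ → ℕ → ℕ} {W W' : Finset ℕ} (h : IsUltra δ W) (hW : W' ⊆ W) :
    IsUltra δ W' where
  comm := h.comm
  tri a ha b hb c hc := h.tri a (hW ha) b (hW hb) c (hW hc)
  path a ha b hb c hc d hd := h.path a (hW ha) b (hW hb) c (hW hc) d (hW hd)

theorem Adj.newVertex {M : Machine} {n x : ℕ} {A : ℕ → ℕ → Prop} (h : Adj M n A)
    (hU : IsUltra (colour A) (range (n + 1))) (hx : 2 ≤ x) (hxn : x ≤ n) :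
    NewVertex (colour A) n x (M.row (x + 1)) (M.row (x + 1 + n)) := by
  have e1 : x + 1 = 2 + (x - 1) := by omega
  have e2 : x + 1 + n = 2 + n + (x - 1) := by omega
  have hv : x - 1 < n := by omega
  refine ⟨hx, hxn, hU.mono ?_, by simp [colour], fun a ha => colour_le_two A (by omega) ha, ?_,
    fun a b => colour_le_two A, ?_, ?_, ?_, ?_⟩
  · intro a ha
    rw [mem_insert, mem_range] at ha
    rw [mem_range]; omega
  · intro a ha hax
    rw [e1, show 2 + (x - 1) + n = 2 + n + (x - 1) by omega, (h.succ_nodup _ hv).count,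
      (h.pred_nodup _ hv).count]
    simp only [colour, show ¬ (x = 0 ∨ a = 0) by omega, if_false]
    have h1 := h.mem_succ _ hv (a - 1)
    have h2 := h.mem_pred _ hv (a - 1)
    congr 1
    · split_ifs <;> tauto
    · split_ifs <;> tauto
  · rw [e1]; exact h.succ_nodup _ hv
  · rw [e2]; exact h.pred_nodup _ hv
  · intro a ha
    rw [e1, h.mem_succ _ hv] at ha; exact (h.lt _ _ ha).2
  · intro a ha
    rw [e2, h.mem_pred _ hv] at ha; exact (h.lt _ _ ha).1

/-- Builds the tree for all vertices. -/
def buildTree : Program :=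
  .assign 0 (.inp 0 0) ;; .assign 1 (.inp 0 1) ;;
  put 0 0 (.reg 0 + 1) ;; put 0 1 (.reg 0 + 1) ;; put 1 0 4 ;; put 1 1 4 ;;
  put 0 (.reg 0 + 1) (4 * .reg 0) ;; put 1 (.reg 0 + 1) 3 ;; put 2 (.reg 0 + 1) 2 ;;
  put 3 (.reg 0 + 1) 1 ;; .assign 3 (.reg 0 + 2) ;; .assign 2 2 ;;
  .loop ((Expr.reg 2).lt (.reg 0 + 1)) (insertVertex ;; .assign 2 (.reg 2 + 1))

/-- The tree with the two leaves `0` and `1`. -/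
theorem insertInv_two {A : ℕ → ℕ → Prop} {n : ℕ} (hn : 0 < n) {m : ℕ → ℕ}
    (p0 : ∀ a, fd n m 0 a = if a = n + 1 then 4 * n else if a = 0 ∨ a = 1 then n + 1 else 0)
    (p1 : ∀ a, fd n m 1 a = if a = n + 1 then 3 else if a = 0 ∨ a = 1 then 4 else 0)
    (p2 : ∀ a, fd n m 2 a = if a = n + 1 then 2 else 0)
    (p3 : ∀ a, fd n m 3 a = if a = n + 1 then 1 else 0)
    (ps : ∀ j, 4 ≤ j → j ≤ 8 → ∀ a, fd n m j a = 0) :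
    InsertInv (colour A) n 2 (n + 2) (fun u => if u = n + 1 then range 2 else {u}) m := by
  have hN : ∀ a, a ∈ nodes n 2 (n + 2) ↔ a = 0 ∨ a = 1 ∨ a = n + 1 := by
    intro a; rw [mem_nodes]; omega
  have hk : ∀ u w, w ∈ kids (nodes n 2 (n + 2)) (fd n m 0) (n + 1) u ↔
      u = n + 1 ∧ (w = 0 ∨ w = 1) := by
    intro u w
    rw [mem_kids, hN, p0]
    constructor
    · rintro ⟨h1, h2, h3⟩
      rw [if_neg h2, if_pos (by tauto)] at h3
      exact ⟨h3.symm, by tauto⟩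
    · rintro ⟨rfl, h1⟩
      exact ⟨by tauto, by omega, by rw [if_neg (by omega), if_pos h1]⟩
  have hk1 : kids (nodes n 2 (n + 2)) (fd n m 0) (n + 1) (n + 1) = {0, 1} := by
    ext w; rw [hk]; simp
  have hk2 : ∀ u, u ≠ n + 1 → kids (nodes n 2 (n + 2)) (fd n m 0) (n + 1) u = ∅ := by
    intro u hu; ext w; rw [hk]; simp [hu]
  have hpar : ∀ w, w ∈ nodes n 2 (n + 2) → w ≠ n + 1 → fd n m 0 w = n + 1 ∧ (w = 0 ∨ w = 1) := by
    intro w hw hr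
    rw [hN] at hw
    have : w = 0 ∨ w = 1 := by tauto
    exact ⟨by rw [p0, if_neg hr, if_pos this], this⟩
  refine ⟨⟨⟨?_, ?_, ?_, ?_, ?_, ?_, ?_, ?_, ?_, ?_, ?_⟩, ⟨?_, ?_⟩, ?_, ?_, ?_, ?_⟩, le_rfl, by omega, ?_⟩
  · simp [hN]
  · simp
  · intro a ha; rw [hN]; rw [mem_range] at ha; omega
  · intro v hv
    rw [mem_range] at hv
    simp [show v ≠ n + 1 by omega]
  · intro u _
    split_ifs
    · exact ⟨0, by simp⟩
    · exact ⟨u, by simp⟩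
  · intro u hu
    split_ifs with h
    · rfl
    · rw [hN] at hu
      intro a ha
      rw [mem_singleton] at ha
      rw [mem_range]; omega
  · intro w hw hr
    rw [(hpar w hw hr).1, hN]; simp
  · intro w hw hr
    obtain ⟨h1, h2⟩ := hpar w hw hr
    rw [h1, if_neg hr, if_pos rfl]
    refine Finset.ssubset_iff_subset_ne.2 ⟨by intro a; simp; omega, fun he => ?_⟩
    have := congrArg card he
    simp at this
  · intro w hw hr w' hw' hr' _ hne a ha b hb
    rw [(hpar w hw hr).1, p1, if_pos rfl]
    simp only [hr, hr', if_false, mem_singleton] at ha hb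
    subst ha hb
    refine ⟨hne, ?_⟩
    have h1 := (hpar a hw hr).2
    have h2 := (hpar b hw' hr').2
    simp [colour]
    omega
  · intro u hu hV a ha
    have hu' : u = n + 1 := by
      rw [hN] at hu; rw [mem_range] at hV; omega
    simp only [hu', if_true, mem_range] at ha
    refine ⟨a, by rw [hN]; omega, by omega, ?_, by simp [show a ≠ n + 1 by omega]⟩
    rw [hu', p0, if_neg (by omega), if_pos (by omega)]
  · intro w hw hr _
    obtain ⟨h1, h2⟩ := hpar w hw hr
    rw [h1, p1, p1, if_neg hr, if_pos h2, if_pos rfl]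
    omega
  · intro u
    rw [p2]
    split_ifs with h
    · rw [h, hk1]; rfl
    · rw [hk2 u h]; rfl
  · intro u
    rw [p3]
    split_ifs with h
    · rw [h, hk1]; rfl
    · rw [hk2 u h]; rfl
  · rw [p0, if_pos rfl]
  · rw [p0]
    split_ifs <;> omega
  · rw [p1, if_pos rfl]
  · intro a ha
    rw [p1, if_neg (by omega), if_pos (by omega)]
  · intro j hj hj' a
    rw [ps j hj hj']; omega

theorem buildTree_spec {M : Machine} {B n c : ℕ} {Q : Store → ℕ → Prop} {t : ℕ}
    (hC : Ctx M B n) {A : ℕ → ℕ → Prop} (hA : Adj M n A)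
    (hU : IsUltra (colour A) (range (n + 1))) (hn : M.entry 0 0 = n) (hc : M.entry 0 1 = c)
    (hQ : ∀ ρ s nw C, ρ.reg 0 = n → ρ.reg 1 = c →
      InsertInv (colour A) n (n + 1) nw C ρ.mem → (∀ j, 10 ≤ j → j < 32 → ∀ a, fd n ρ.mem j a = 0) →
      s ≤ t + M.load n n * 41000 + 3000 → Q ρ s) :
    wp M B buildTree Q Store.init t := by
  have ⟨_, hnp, hcells, hbound⟩ := hC
  have hcB : c ≤ B := hc ▸ hC.inp_le 0 1
  refine wp_seq (wp_set hC (by simp) (by simp [hn]; omega) fun s1 hs1 => ?_)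
  refine wp_seq (wp_set hC (by simp) (by simp [hc]; omega) fun s2 hs2 => ?_)
  simp [hn, hc]
  refine wp_seq (wp_put hC (by simp) (by simp; omega) fun s3 hs3 => ?_)
  refine wp_seq (wp_put hC (by simp) (by simp; omega) fun s4 hs4 => ?_)
  refine wp_seq (wp_put hC (by simp) (by simp; omega) fun s5 hs5 => ?_)
  refine wp_seq (wp_put hC (by simp) (by simp; omega) fun s6 hs6 => ?_)
  refine wp_seq (wp_put hC (by simp) (by simp; omega) fun s7 hs7 => ?_)
  refine wp_seq (wp_put hC (by simp) (by simp; omega) fun s8 hs8 => ?_)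
  refine wp_seq (wp_put hC (by simp) (by simp; omega) fun s9 hs9 => ?_)
  refine wp_seq (wp_put hC (by simp) (by simp; omega) fun s10 hs10 => ?_)
  refine wp_seq (wp_set hC (by simp) (by simp; omega) fun s11 hs11 => ?_)
  refine wp_seq (wp_set hC (by simp) (by simp; omega) fun s12 hs12 => ?_)
  simp
  generalize hm' : upd n (upd n _ 2 (n + 1) 2) 3 (n + 1) 1 = m'
  have z : ∀ j a, fd n Store.init.mem j a = 0 := fun _ _ => rfl
  have hne : ∀ a, a = n + 1 → a ≠ 0 ∧ a ≠ 1 := by omega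
  have hinv := by
    refine insertInv_two (A := A) (m := m') hnp (fun a => ?_) (fun a => ?_) (fun a => ?_) (fun a => ?_)
      (fun j hj hj' a => ?_)
    · simp [← hm', fd_upd, z]; split_ifs <;> omega
    · simp [← hm', fd_upd, z]; split_ifs <;> omega
    · simp [← hm', fd_upd, z]
    · simp [← hm', fd_upd, z]
    · simp [← hm', fd_upd, z, show j < 32 by omega, show j ≠ 0 by omega, show j ≠ 1 by omega,
        show j ≠ 2 by omega, show j ≠ 3 by omega]
  have hz' : ∀ j, 10 ≤ j → j < 32 → ∀ a, fd n m' j a = 0 := by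
    intro j hj hj' a
    simp [← hm', fd_upd, z, hj', show j ≠ 0 by omega, show j ≠ 1 by omega,
        show j ≠ 2 by omega, show j ≠ 3 by omega]
  refine wp_loop hC.toEnv rfl (fun k τ s => ∃ x nw C, k + x = n + 1 ∧ 2 ≤ x ∧ τ.reg 0 = n ∧
    τ.reg 1 = c ∧ τ.reg 2 = x ∧ τ.reg 3 = nw ∧ InsertInv (colour A) n x nw C τ.mem ∧
    (∀ j, 10 ≤ j → j < 32 → ∀ a, fd n τ.mem j a = 0) ∧
    s ≤ t + 2500 + M.load n (x - 1) * 41000) (k := n + 1 - 2)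
    ⟨2, n + 2, _, by omega, le_rfl, by simp, by simp, by simp, by simp, hinv, hz', by omega⟩ ?_ ?_ ?_
  · rintro k τ s -; simp
  · rintro k τ s ⟨x, nw, C, hk, hx, r0, r1, r2, r3, hI, hz, hs⟩ hlt
    simp [r0, r2] at hlt
    have hcost : ((Expr.reg 2).lt (.reg 0 + 1)).cost ≤ 80 := Expr.Small.cost_le rfl
    refine wp_seq (insertVertex_spec hC (hA.newVertex hU hx hlt) r0 r2 r3 hI ?_)
    intro ρ s' C' hF hI' hs'
    have q2 : ρ.reg 2 = x := (hF.reg 2).trans r2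
    refine wp_set hC (by simp) (by simp [q2]; omega) fun s3 hs3 => ?_
    refine ⟨k - 1, by omega, x + 1, ρ.reg 3, C', by omega, by omega, ?_, ?_, by simp [q2], by simp,
      hI', fun j hj hj' a => ?_, ?_⟩
    · simpa using (hF.reg 0).trans r0
    · simpa using (hF.reg 1).trans r1
    · refine (hF.2 j hj' ?_ a).trans (hz j hj hj' a)
      simp; omega
    · rw [show x + 1 - 1 = x - 1 + 1 by omega, Machine.load, sum_range_succ, ← Machine.load]
      rw [show x + 1 + n = 2 + n + (x - 1) by omega, show x + 1 = 2 + (x - 1) by omega] at hs'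
      omega
  · rintro k τ s ⟨x, nw, C, hk, hx, r0, r1, r2, r3, hI, hz, hs⟩ hlt
    simp [r0, r2] at hlt
    have hcost : ((Expr.reg 2).lt (.reg 0 + 1)).cost ≤ 80 := Expr.Small.cost_le rfl
    obtain rfl : x = n + 1 := by omega
    exact hQ τ _ nw C r0 r1 hI hz (by simp at hs; omega)


/-! ### Sorting the vertices -/

/-- The position of `v` when the numbers below `n` are sorted by `key`, stably. -/
def rank (n : ℕ) (key : ℕ → ℕ) (v : ℕ) : ℕ :=
  ((range n).filter fun u => key u < key v ∨ key u = key v ∧ u < v).card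

theorem rank_lt_rank {n u v : ℕ} {key : ℕ → ℕ} (hu : u < n)
    (h : key u < key v ∨ key u = key v ∧ u < v) : rank n key u < rank n key v := by
  refine card_lt_card (ssubset_iff_of_subset ?_ |>.2 ⟨u, ?_, ?_⟩)
  · intro w hw
    rw [mem_filter] at hw ⊢
    exact ⟨hw.1, by omega⟩
  · rw [mem_filter, mem_range]; exact ⟨hu, h⟩
  · simp

theorem rank_lt {n v : ℕ} {key : ℕ → ℕ} (hv : v < n) : rank n key v < n := by
  conv_rhs => rw [← card_range n]
  refine card_lt_card (ssubset_iff_of_subset (filter_subset _ _) |>.2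
    ⟨v, by simpa using hv, by simp⟩)

theorem rank_inj {n u v : ℕ} {key : ℕ → ℕ} (hu : u < n) (hv : v < n)
    (h : rank n key u = rank n key v) : u = v := by
  by_contra hne
  rcases Nat.lt_trichotomy (key u) (key v) with h1 | h1 | h1
  · have := rank_lt_rank hu (Or.inl h1); omega
  · rcases Nat.lt_or_gt_of_ne hne with h2 | h2
    · have := rank_lt_rank hu (Or.inr ⟨h1, h2⟩); omega
    · have := rank_lt_rank hv (Or.inr ⟨h1.symm, h2⟩); omega
  · have := rank_lt_rank hv (Or.inl h1); omega

theorem exists_rank_eq {n i : ℕ} {key : ℕ → ℕ} (hi : i < n) : ∃ v < n, rank n key v = i := by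
  have := surjOn_of_injOn_of_card_le (s := range n) (t := range n) (rank n key)
    (fun v hv => by simpa using rank_lt (by simpa using hv))
    (fun u hu v hv => rank_inj (by simpa using hu) (by simpa using hv)) le_rfl
  obtain ⟨v, hv, he⟩ := this (show i ∈ _ by simpa using hi)
  exact ⟨v, by simpa using hv, he⟩

theorem rank_eq {n v : ℕ} {key : ℕ → ℕ} (hv : v ≤ n) : rank n key v =
    ((range n).filter fun u => key u < key v).card +
      ((range v).filter fun u => key u = key v).card := by
  rw [rank, ← card_union_of_disjoint]
  · congr 1
    ext u
    simp only [mem_filter, mem_union, mem_range]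
    omega
  · refine disjoint_left.2 fun u hu hu' => ?_
    simp only [mem_filter] at hu hu'
    omega

/-- The number of predecessors minus the number of successors, shifted by `n`. -/
def Machine.key (M : Machine) (n v : ℕ) : ℕ :=
  (M.row (2 + n + v)).length + n - (M.row (2 + v)).length

/-- The key of the vertex in register `10`. -/
def keyExpr : Expr := .len (2 + .reg 0 + .reg 10) + .reg 0 - .len (2 + .reg 10)

/-- Counting sort of the vertices by their keys: field `15` of record `i` receives the `i`-th
vertex. -/
def sortVertices : Program :=
  forLoop 10 (.reg 0) (.assign 11 keyExpr ;; put 16 (.reg 11) (get 16 (.reg 11) + 1)) ;;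
  .assign 12 0 ;;
  forLoop 10 (.reg 0 + .reg 0 + 1)
    (put 20 (.reg 10) (.reg 12) ;; .assign 12 (.reg 12 + get 16 (.reg 10))) ;;
  forLoop 10 (.reg 0)
    (.assign 11 keyExpr ;; put 15 (get 20 (.reg 11)) (.reg 10) ;;
      put 20 (.reg 11) (get 20 (.reg 11) + 1))

theorem card_filter_range_succ (n : ℕ) (p : ℕ → Prop) [DecidablePred p] :
    ((range (n + 1)).filter p).card = ((range n).filter p).card +
      if p n then 1 else 0 := by
  rw [range_add_one, filter_insert]
  split_ifs with h
  · rw [card_insert_of_notMem (by simp)]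
  · rfl

theorem card_filter_range_le (n : ℕ) (p : ℕ → Prop) [DecidablePred p] :
    ((range n).filter p).card ≤ n :=
  (card_filter_le _ _).trans_eq (card_range n)

theorem sortVertices_spec {M : Machine} {B n : ℕ} {Q : Store → ℕ → Prop} {σ : Store} {t : ℕ}
    (hC : Ctx M B n) (h0 : σ.reg 0 = n)
    (hp : ∀ v < n, (M.row (2 + n + v)).length ≤ n)
    (hz : ∀ a, fd n σ.mem 16 a = 0)
    (hQ : ∀ ρ s, Frame n [15, 16, 20] [] σ ρ →
      (∀ v < n, fd n ρ.mem 15 (rank n (M.key n) v) = v) → s ≤ t + n * 2000 + 2000 → Q ρ s) :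
    wp M B sortVertices Q σ t := by
  have ⟨_, hnp, hcells, hbound⟩ := hC
  have hkey : ∀ v < n, M.key n v ≤ 2 * n := fun v hv => by
    have := hp v hv; rw [Machine.key]; omega
  refine wp_seq (wp_for hC (fun i τ => Frame n [15, 16, 20] [] σ τ ∧
    ∀ k, fd n τ.mem 16 k = ((range i).filter fun u => M.key n u = k).card) n 400 (by omega)
    ⟨Frame.refl.set_reg, by simpa using hz⟩ ?_ ?_ ?_)
  · rintro i τ - ⟨hF, -⟩ -
    simpa using (hF.reg 0).trans h0
  · rintro i τ s hi ⟨hF, hc⟩ hr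
    have e0 : τ.reg 0 = n := (hF.reg 0).trans h0
    have hk := hkey i hi
    have hv : keyExpr.val M τ = M.key n i := by simp [keyExpr, e0, hr, Machine.key]
    have hcl := card_filter_range_le i (fun u => M.key n u = M.key n i)
    refine wp_seq (wp_set hC (by simp [keyExpr]) (by rw [hv]; omega) fun s1 hs1 => ?_)
    rw [hv]
    refine wp_put hC (by simp [e0]; omega)
      (by simp [e0, hc]; omega) fun s2 hs2 => ?_
    simp [e0, hc]
    refine ⟨hr, by omega, hF.set_reg.put.set_reg,
      fun k => ?_⟩
    rw [fd_upd (by omega) (by omega), hc, card_filter_range_succ]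
    by_cases h : k = M.key n i
    · simp [h]
    · simp [h, Ne.symm h]
  intro τ1 s1 ⟨hF1, hc1⟩ _ hs1
  have e0 : τ1.reg 0 = n := (hF1.reg 0).trans h0
  refine wp_seq (wp_set hC (by simp) (by simp) fun s2 hs2 => ?_)
  simp only [Expr.val_ofNat]
  refine wp_seq (wp_for hC (fun i τ => Frame n [15, 16, 20] [] σ τ ∧
    (∀ k, fd n τ.mem 16 k = ((range n).filter fun u => M.key n u = k).card) ∧
    τ.reg 12 = ((range n).filter fun u => M.key n u < i).card ∧
    ∀ k < i, fd n τ.mem 20 k = ((range n).filter fun u => M.key n u < k).card)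
    (2 * n + 1) 300 (by omega)
    ⟨hF1.set_reg.set_reg, by simpa using hc1, by simp, by simp⟩ ?_ ?_ ?_)
  · rintro i τ - ⟨hF, -⟩ -
    have : τ.reg 0 = n := (hF.reg 0).trans h0
    simp [this]; omega
  · rintro i τ s hi ⟨hF, hc, h12, hst⟩ hr
    have e0 : τ.reg 0 = n := (hF.reg 0).trans h0
    have hl1 := card_filter_range_le n (fun u => M.key n u < i)
    have hl2 := card_filter_range_le n (fun u => M.key n u = i)
    refine wp_seq (wp_put hC (by simp) (by simp [hr, h12]; omega) fun s2 hs2 => ?_)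
    simp [hr, h12]
    refine wp_set hC (by simp [e0, hr]; omega) (by simp [e0, hr, fd_upd, hc, h12]; omega)
      fun s3 hs3 => ?_
    simp [e0, hr, fd_upd, hc, h12]
    refine ⟨by omega, hF.put.set_reg.set_reg, ?_, ?_⟩
    · rw [← card_union_of_disjoint]
      · congr 1
        ext u
        simp only [mem_filter, mem_union, mem_range]
        omega
      · refine disjoint_left.2 fun u hu hu' => ?_
        simp only [mem_filter] at hu hu'
        omega
    · intro k hk
      split_ifs with h
      · rw [h]
      · exact hst k (by omega)
  intro τ2 s3 ⟨hF2, _, _, hst2⟩ _ hs3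
  refine wp_for hC (fun i τ => Frame n [15, 16, 20] [] σ τ ∧
    (∀ k ≤ 2 * n, fd n τ.mem 20 k = ((range n).filter fun u => M.key n u < k).card +
      ((range i).filter fun u => M.key n u = k).card) ∧
    ∀ v < i, fd n τ.mem 15 (rank n (M.key n) v) = v) n 500 (by omega)
    ⟨hF2.set_reg, fun k hk => by simpa using hst2 k (by omega), by simp⟩ ?_ ?_ ?_
  · rintro i τ - ⟨hF, -⟩ -
    simpa using (hF.reg 0).trans h0
  · rintro i τ s hi ⟨hF, hst, hord⟩ hr
    have e0 : τ.reg 0 = n := (hF.reg 0).trans h0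
    have hk := hkey i hi
    have hv : keyExpr.val M τ = M.key n i := by simp [keyExpr, e0, hr, Machine.key]
    have hrk := hst _ hk
    rw [← rank_eq hi.le] at hrk
    have hrl := rank_lt (key := M.key n) hi
    refine wp_seq (wp_set hC (by simp [keyExpr]) (by rw [hv]; omega) fun s1 hs1 => ?_)
    rw [hv]
    refine wp_seq (wp_put hC (by simp [e0]; omega) (by simp [e0, hrk, hr]; omega) fun s2 hs2 => ?_)
    simp [e0, hrk, hr]
    refine wp_put hC (by simp [e0]; omega)
      (by simp [e0, fd_upd, hrk]; omega) fun s3 hs3 => ?_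
    simp [e0, fd_upd, hrk]
    refine ⟨hr, by omega, hF.set_reg.put.put.set_reg, fun k hk => ?_, fun v hv => ?_⟩
    · rw [card_filter_range_succ]
      by_cases h : k = M.key n i
      · rw [if_pos h, if_pos h.symm, h, ← add_assoc, ← hst _ (by omega), hrk]
      · rw [if_neg h, if_neg (Ne.symm h), hst k hk, add_zero]
    · split_ifs with h
      · exact (rank_inj (by omega) hi h).symm
      · refine hord v ?_
        rcases Nat.lt_or_eq_of_le hv with h' | rfl
        · exact h'
        · exact absurd rfl h
  intro τ3 s4 ⟨hF3, _, hord⟩ _ hs4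
  refine hQ τ3 s4 hF3 hord ?_
  have : (2 * n + 1) * (300 + 100) = n * 800 + 400 := by ring
  omega


/-! ### Binary decompositions -/

/-- The set `S k` is the set of the vertices of part `k`. The parts below `n` are the single
vertices; a part `k ≥ n` consists of two smaller parts `L k` and `R k`, and `op k` tells which arcs
there are between them: none for `0`, all arcs from left to right for `1`, all arcs in both
directions for `2`. No part is used twice. -/
structure Line (A : ℕ → ℕ → Prop) (n kk : ℕ) (L R op : ℕ → ℕ) (S : ℕ → Finset ℕ) : Prop where
  leaf : ∀ v < n, S v = {v}
  sub : ∀ k < kk, S k ⊆ range n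
  nonempty : ∀ k < kk, (S k).Nonempty
  lt : ∀ k, n ≤ k → k < kk → L k < k ∧ R k < k
  union : ∀ k, n ≤ k → k < kk → S k = S (L k) ∪ S (R k)
  arcs : ∀ k, n ≤ k → k < kk → ∀ a ∈ S (L k), ∀ b ∈ S (R k),
    a ≠ b ∧ (A a b ↔ op k ≠ 0) ∧ (A b a ↔ op k = 2)
  op_le : ∀ k, n ≤ k → k < kk → op k ≤ 2
  uniq : ∀ k k', n ≤ k → k < kk → n ≤ k' → k' < kk → k ≠ k' →
    L k ≠ L k' ∧ L k ≠ R k' ∧ R k ≠ R k'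

/-- Part `l` has not been used. -/
def Unused (n kk : ℕ) (L R : ℕ → ℕ) (l : ℕ) : Prop := ∀ k, n ≤ k → k < kk → L k ≠ l ∧ R k ≠ l

/-- Joining two unused parts. -/
theorem Line.snoc {A : ℕ → ℕ → Prop} {n kk l r o : ℕ} {L R op L' R' op' : ℕ → ℕ}
    {S : ℕ → Finset ℕ} (h : Line A n kk L R op S) (hn : n ≤ kk) (hl : l < kk) (hr : r < kk)
    (hul : Unused n kk L R l) (hur : Unused n kk L R r) (ho : o ≤ 2)
    (harcs : ∀ a ∈ S l, ∀ b ∈ S r, a ≠ b ∧ (A a b ↔ o ≠ 0) ∧ (A b a ↔ o = 2))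
    (hL : ∀ k, L' k = if k = kk then l else L k) (hR : ∀ k, R' k = if k = kk then r else R k)
    (hop : ∀ k, op' k = if k = kk then o else op k) :
    Line A n (kk + 1) L' R' op' (Function.update S kk (S l ∪ S r)) := by
  have hS : ∀ k < kk, Function.update S kk (S l ∪ S r) k = S k := fun k hk => by
    rw [Function.update_of_ne (by omega)]
  have hSk : Function.update S kk (S l ∪ S r) kk = S l ∪ S r := by simp
  have hcase : ∀ k, k < kk + 1 → k < kk ∨ k = kk := by omega
  refine ⟨fun v hv => by rw [hS v (by omega)]; exact h.leaf v hv, ?_, ?_, ?_, ?_, ?_, ?_, ?_⟩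
  · intro k hk
    rcases hcase k hk with h1 | rfl
    · rw [hS k h1]; exact h.sub k h1
    · rw [hSk]; exact union_subset (h.sub l hl) (h.sub r hr)
  · intro k hk
    rcases hcase k hk with h1 | rfl
    · rw [hS k h1]; exact h.nonempty k h1
    · rw [hSk]; exact (h.nonempty l hl).mono subset_union_left
  · intro k hk hk'
    rcases hcase k hk' with h1 | rfl
    · rw [hL, hR, if_neg (by omega), if_neg (by omega)]; exact h.lt k hk h1
    · rw [hL, hR, if_pos rfl, if_pos rfl]; exact ⟨hl, hr⟩
  · intro k hk hk'
    rcases hcase k hk' with h1 | rfl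
    · have := h.lt k hk h1
      rw [hL, hR, if_neg (by omega), if_neg (by omega), hS k h1, hS _ (by omega), hS _ (by omega)]
      exact h.union k hk h1
    · rw [hL, hR, if_pos rfl, if_pos rfl, hSk, hS l hl, hS r hr]
  · intro k hk hk'
    rcases hcase k hk' with h1 | rfl
    · have := h.lt k hk h1
      rw [hL, hR, hop, if_neg (by omega), if_neg (by omega), if_neg (by omega), hS _ (by omega),
        hS _ (by omega)]
      exact h.arcs k hk h1
    · rw [hL, hR, hop, if_pos rfl, if_pos rfl, if_pos rfl, hS l hl, hS r hr]; exact harcs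
  · intro k hk hk'
    rw [hop]
    split_ifs
    · exact ho
    · exact h.op_le k hk (by omega)
  · intro k k' hk hk2 hk' hk2' hne
    simp only [hL, hR]
    rcases hcase k hk2 with h1 | h1 <;> rcases hcase k' hk2' with h2 | h2
    · simp only [h1.ne, h2.ne, if_false]
      exact h.uniq k k' hk h1 hk' h2 hne
    · simp only [h1.ne, h2, if_true, if_false]
      exact ⟨(hul k hk h1).1, (hur k hk h1).1, (hur k hk h1).2⟩
    · simp only [h2.ne, h1, if_true, if_false]
      exact ⟨(hul k' hk' h2).1.symm, (hul k' hk' h2).2.symm, (hur k' hk' h2).2.symm⟩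
    · omega

/-- Below a node whose parent has label `1`, a vertex outside has all its arcs in the same
direction. Otherwise, by transitivity, there is an arc between any vertex with incoming arcs and
any vertex with outgoing arcs, so that these are below the same child, and its sibling yields a
contradiction because the labels of a node and its parent are different. -/
theorem IsTree.direction {A : ℕ → ℕ → Prop} {V N : Finset ℕ} {C : ℕ → Finset ℕ} {par lab : ℕ → ℕ}
    {r : ℕ} (h : IsTree (colour A) V N C par lab r r)
    (htr : ∀ a b c, A a b → ¬ A b a → A b c → ¬ A c b → A a c ∧ ¬ A c a)
    {w a x y : ℕ} (hw : w ∈ N) (hr : w ≠ r) (hl : lab (par w) = 1) (h0 : 0 ∉ C w)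
    (ha0 : a ≠ 0) (ha : ∀ b ∈ C w, colour A a b = 1) (hx : x ∈ C w) (hy : y ∈ C w)
    (hax : A (a - 1) (x - 1)) : A (a - 1) (y - 1) ∧ ¬ A (y - 1) (a - 1) := by
  have hne : ∀ b ∈ C w, b ≠ 0 := fun b hb he => h0 (he ▸ hb)
  have hcol : ∀ b ∈ C w, (A (a - 1) (b - 1) ∧ ¬ A (b - 1) (a - 1)) ∨
      (A (b - 1) (a - 1) ∧ ¬ A (a - 1) (b - 1)) := by
    intro b hb
    have := ha b hb
    simp only [colour, ha0, hne b hb, or_self, if_false] at this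
    split_ifs at this <;> first | omega | tauto
  have hx' : A (a - 1) (x - 1) ∧ ¬ A (x - 1) (a - 1) := by
    rcases hcol x hx with h1 | h1
    · exact h1
    · exact absurd hax h1.2
  by_contra hcon
  have hy' := (hcol y hy).resolve_left hcon
  have hone : ∀ b ∈ C w, ∀ b' ∈ C w, A (b - 1) (a - 1) ∧ ¬ A (a - 1) (b - 1) →
      A (a - 1) (b' - 1) ∧ ¬ A (b' - 1) (a - 1) → colour A b b' = 1 ∧ colour A b' b = 1 := by
    intro b hb b' hb' h1 h2
    have h3 := htr _ _ _ h1.1 h1.2 h2.1 h2.2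
    simp [colour, hne b hb, hne b' hb', h3.1, h3.2]
  have hxy : x ≠ y := fun he => by rw [he] at hx'; exact hx'.2 hy'.1
  have hwV : w ∉ V := fun hV => by
    rw [h.leaf_eq w hV, mem_singleton] at hx hy
    exact hxy (hx.trans hy.symm)
  have hlw : lab w ≠ 1 := hl ▸ h.canon w hw hr hr
  have hsame : ∀ b ∈ C w, ∀ b' ∈ C w, colour A b b' = 1 → ∀ v ∈ N, v ≠ r → par v = w → b ∈ C v →
      b' ∈ C v := by
    intro b hb b' hb' h1 v hv hvr hvp hbv
    obtain ⟨v', hv', hvr', hvp', hbv'⟩ := h.cover w hw hwV b' hb'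
    by_contra hcc
    have := (h.sib v hv hvr v' hv' hvr' (hvp.trans hvp'.symm) (fun he => hcc (he ▸ hbv')) b hbv b'
      hbv').2
    rw [hvp] at this
    exact hlw (this.symm.trans h1)
  obtain ⟨v, hv, hvr, hvp, hxv⟩ := h.cover w hw hwV x hx
  have hyv := hsame x hx y hy (hone y hy x hx hy' hx').2 v hv hvr hvp hxv
  obtain ⟨v', hv', hvr', hvp', hvv⟩ := h.exists_other hv hvr
  obtain ⟨z, hz⟩ := h.nonempty v' hv'
  have hzw : z ∈ C w := by
    rw [← hvp, ← hvp']; exact (h.ssub v' hv' hvr').subset hz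
  have hzv : z ∈ C v := by
    rcases hcol z hzw with h1 | h1
    · exact hsame y hy z hzw (hone y hy z hzw hy' h1).1 v hv hvr hvp hyv
    · exact hsame x hx z hzw (hone z hzw x hx h1 hx').2 v hv hvr hvp hxv
  exact hvv (h.eq_of_sib hv' hvr' hv hvr hvp' hz hzv)

/-- The set `F` of nodes has been folded into their parents: field `10` counts the folded children
of a node, field `11` is the part formed by them; the fields `12`, `13` and `14` hold the binary
decomposition. -/
structure Folding (A : ℕ → ℕ → Prop) (n : ℕ) (N : Finset ℕ) (C : ℕ → Finset ℕ) (par : ℕ → ℕ)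
    (r : ℕ) (F : Finset ℕ) (kk : ℕ) (S : ℕ → Finset ℕ) (m : ℕ → ℕ) : Prop where
  line : Line A n kk (fd n m 12) (fd n m 13) (fd n m 14) S
  le : n ≤ kk
  le' : kk ≤ n + F.card
  fold : ∀ p, fd n m 10 p = ((kids N par r p).filter (· ∈ F)).card
  acc : ∀ p, ∀ v ∈ kids N par r p, v ∈ F → fd n m 11 p < kk ∧
    ∀ a, a ∈ S (fd n m 11 p) ↔ ∃ w ∈ kids N par r p, w ∈ F ∧ a + 1 ∈ C w
  unused_leaf : ∀ v < n, v + 1 ∉ F → Unused n kk (fd n m 12) (fd n m 13) v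
  unused : ∀ p, p ∉ F → ∀ v ∈ kids N par r p, v ∈ F →
    Unused n kk (fd n m 12) (fd n m 13) (fd n m 11 p)

section

variable {A : ℕ → ℕ → Prop} {n : ℕ} {N : Finset ℕ} {C : ℕ → Finset ℕ} {par lab : ℕ → ℕ}
  {r : ℕ} {F : Finset ℕ} {kk : ℕ} {S : ℕ → Finset ℕ} {m m' : ℕ → ℕ} {w cur : ℕ}

theorem card_filter_insert (hw : w ∈ N) (hr : w ≠ r) (hF : w ∉ F) (p : ℕ) :
    ((kids N par r p).filter (· ∈ insert w F)).card =
      ((kids N par r p).filter (· ∈ F)).card + if p = par w then 1 else 0 := by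
  by_cases hp : p = par w
  · rw [if_pos hp, ← card_insert_of_notMem (a := w) (by simp [hF])]
    congr 1
    ext v
    simp only [mem_filter, mem_insert, mem_kids]
    constructor
    · rintro ⟨h1, h2 | h2⟩
      · exact Or.inl h2
      · exact Or.inr ⟨h1, h2⟩
    · rintro (rfl | ⟨h1, h2⟩)
      · exact ⟨⟨hw, hr, hp.symm⟩, Or.inl rfl⟩
      · exact ⟨h1, Or.inr h2⟩
  · rw [if_neg hp, add_zero]
    congr 1
    ext v
    simp only [mem_filter, mem_insert, mem_kids]
    refine and_congr_right fun h => or_iff_right ?_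
    rintro rfl
    exact hp h.2.2.symm

/-- Folding the first child of a node. -/
theorem Folding.first (h : Folding A n N C par r F kk S m) (hw : w ∈ N) (hr : w ≠ r) (hF : w ∉ F)
    (hcur : cur < kk) (hS : ∀ a, a ∈ S cur ↔ a + 1 ∈ C w)
    (hu : Unused n kk (fd n m 12) (fd n m 13) cur) (hfirst : ∀ v ∈ kids N par r (par w), v ∉ F)
    (h10 : ∀ p, fd n m' 10 p = if p = par w then fd n m 10 p + 1 else fd n m 10 p)
    (h11 : ∀ p, fd n m' 11 p = if p = par w then cur else fd n m 11 p)
    (hj : ∀ j, 12 ≤ j → j ≤ 14 → fd n m' j = fd n m j) :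
    Folding A n N C par r (insert w F) kk S m' := by
  have hk : ∀ p, p ≠ par w → ∀ v ∈ kids N par r p, v ∈ insert w F → v ∈ F := by
    intro p hp v hv hvF
    rcases mem_insert.1 hvF with rfl | hvF
    · exact absurd (mem_kids.1 hv).2.2.symm hp
    · exact hvF
  refine ⟨?_, h.le, ?_, fun p => ?_, fun p v hv hvF => ?_, fun v hv hvF => ?_,
    fun p hp v hv hvF => ?_⟩
  · rw [hj 12 (by omega) (by omega), hj 13 (by omega) (by omega), hj 14 (by omega) (by omega)]
    exact h.line
  · rw [card_insert_of_notMem hF]; exact h.le'.trans (by omega)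
  · rw [h10, card_filter_insert hw hr hF, h.fold]
    split_ifs <;> rfl
  · rw [h11]
    by_cases hp : p = par w
    · rw [if_pos hp]
      refine ⟨hcur, fun a => (hS a).trans ⟨fun ha => ⟨w, mem_kids.2 ⟨hw, hr, hp.symm⟩, by simp, ha⟩,
        ?_⟩⟩
      rintro ⟨v', hv', hvF', ha⟩
      rcases mem_insert.1 hvF' with rfl | hvF'
      · exact ha
      · exact absurd hvF' (hfirst v' (hp ▸ hv'))
    · rw [if_neg hp]
      obtain ⟨h1, h2⟩ := h.acc p v hv (hk p hp v hv hvF)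
      refine ⟨h1, fun a => (h2 a).trans (exists_congr fun v' => and_congr_right fun hv' =>
        and_congr_left fun _ => ⟨fun hh => mem_insert_of_mem hh, hk p hp v' hv'⟩)⟩
  · rw [hj 12 (by omega) (by omega), hj 13 (by omega) (by omega)]
    exact h.unused_leaf v hv fun hh => hvF (mem_insert_of_mem hh)
  · rw [hj 12 (by omega) (by omega), hj 13 (by omega) (by omega), h11]
    split_ifs with hp'
    · exact hu
    · exact h.unused p (fun hh => hp (mem_insert_of_mem hh)) v hv (hk p hp' v hv hvF)

/-- Folding a further child of a node. -/
theorem Folding.next (h : Folding A n N C par r F kk S m)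
    (hT : IsTree (colour A) (range (n + 1)) N C par lab r r)
    (hw : w ∈ N) (hr : w ≠ r) (hF : w ∉ F)
    (hcl : ∀ v ∈ F, v ∈ N ∧ v ≠ r ∧ ∀ u ∈ N, C u ⊆ C v → u ∈ F)
    (hpend : ∀ u ∈ N, C u ⊆ C w → u = w ∨ u ∈ F)
    (hcur : cur < kk) (hS : ∀ a, a ∈ S cur ↔ a + 1 ∈ C w)
    (hu : Unused n kk (fd n m 12) (fd n m 13) cur)
    (hnext : ∃ v ∈ kids N par r (par w), v ∈ F) (hlab : lab (par w) ≤ 2)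
    (harcs : ∀ v ∈ kids N par r (par w), v ∈ F → ∀ a b, a + 1 ∈ C v → b + 1 ∈ C w →
      a ≠ b ∧ (A a b ↔ lab (par w) ≠ 0) ∧ (A b a ↔ lab (par w) = 2))
    (h10 : ∀ p, fd n m' 10 p = if p = par w then fd n m 10 p + 1 else fd n m 10 p)
    (h11 : ∀ p, fd n m' 11 p = if p = par w then kk else fd n m 11 p)
    (h12 : ∀ k, fd n m' 12 k = if k = kk then fd n m 11 (par w) else fd n m 12 k)
    (h13 : ∀ k, fd n m' 13 k = if k = kk then cur else fd n m 13 k)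
    (h14 : ∀ k, fd n m' 14 k = if k = kk then lab (par w) else fd n m 14 k) :
    ∃ S', Folding A n N C par r (insert w F) (kk + 1) S' m' := by
  obtain ⟨v₀, hv₀, hv₀F⟩ := hnext
  obtain ⟨hacc, hSacc⟩ := h.acc _ v₀ hv₀ hv₀F
  have hpF : par w ∉ F := fun hh => hF ((hcl _ hh).2.2 w hw (hT.ssub w hw hr).subset)
  have huacc := h.unused _ hpF v₀ hv₀ hv₀F
  have hk : ∀ p, p ≠ par w → ∀ v ∈ kids N par r p, v ∈ insert w F → v ∈ F := by
    intro p hp v hv hvF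
    rcases mem_insert.1 hvF with rfl | hvF
    · exact absurd (mem_kids.1 hv).2.2.symm hp
    · exact hvF
  -- an unused part stays unused if it is different from the two parts
  have hext : ∀ l, Unused n kk (fd n m 12) (fd n m 13) l → fd n m 11 (par w) ≠ l → cur ≠ l →
      Unused n (kk + 1) (fd n m' 12) (fd n m' 13) l := by
    intro l hl h1 h2 k hk hk'
    rw [h12, h13]
    split_ifs with h3
    · exact ⟨h1, h2⟩
    · exact hl k hk (by omega)
  refine ⟨_, h.line.snoc h.le hacc hcur huacc hu hlab ?_ h12 h13 h14, by have := h.le; omega, ?_,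
    fun p => ?_, fun p v hv hvF => ?_, fun v hv hvF => ?_, fun p hp v hv hvF => ?_⟩
  · intro a ha b hb
    obtain ⟨v, hv, hvF, hav⟩ := (hSacc a).1 ha
    exact harcs v hv hvF a b hav ((hS b).1 hb)
  · rw [card_insert_of_notMem hF]; have := h.le'; omega
  · rw [h10, card_filter_insert hw hr hF, h.fold]
    split_ifs <;> rfl
  · rw [h11]
    by_cases hp : p = par w
    · rw [if_pos hp]
      refine ⟨by omega, fun a => ?_⟩
      rw [Function.update_self, mem_union, hSacc, hS, hp]
      constructor
      · rintro (⟨v', h1, h2, h3⟩ | h1)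
        · exact ⟨v', h1, mem_insert_of_mem h2, h3⟩
        · exact ⟨w, mem_kids.2 ⟨hw, hr, rfl⟩, by simp, h1⟩
      · rintro ⟨v', h1, h2, h3⟩
        rcases mem_insert.1 h2 with rfl | h2
        · exact Or.inr h3
        · exact Or.inl ⟨v', h1, h2, h3⟩
    · rw [if_neg hp]
      obtain ⟨h1, h2⟩ := h.acc p v hv (hk p hp v hv hvF)
      rw [Function.update_of_ne (by omega)]
      refine ⟨by omega, fun a => (h2 a).trans (exists_congr fun v' => and_congr_right fun hv' =>
        and_congr_left fun _ => ⟨fun hh => mem_insert_of_mem hh, hk p hp v' hv'⟩)⟩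
  · have hvF' : v + 1 ∉ F := fun hh => hvF (mem_insert_of_mem hh)
    have hvC : C (v + 1) = {v + 1} := hT.leaf_eq _ (by simpa using hv)
    have hvN : v + 1 ∈ N := hT.leaf_mem (by simpa using hv)
    have hvS : v ∈ S v := by rw [h.line.leaf v hv]; simp
    refine hext v (h.unused_leaf v hv hvF') (fun he => ?_) (fun he => ?_)
    · obtain ⟨v', -, h2, h3⟩ := (hSacc v).1 (he ▸ hvS)
      exact hvF' ((hcl v' h2).2.2 _ hvN (by rw [hvC]; simpa using h3))
    · have h3 := (hS v).1 (he ▸ hvS)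
      rcases hpend _ hvN (by rw [hvC]; simpa using h3) with h4 | h4
      · exact hvF (by rw [h4]; simp)
      · exact hvF' h4
  · rw [h11]
    split_ifs with hp'
    · intro k hk hk'
      rw [h12, h13]
      split_ifs with h3
      · exact ⟨by omega, by omega⟩
      · have := h.line.lt k hk (by omega); exact ⟨by omega, by omega⟩
    · have hvF' := hk p hp' v hv hvF
      have hpF' : p ∉ F := fun hh => hp (mem_insert_of_mem hh)
      have hpw : p ≠ w := fun he => hp (by rw [he]; simp)
      obtain ⟨h1, h2⟩ := h.acc p v hv hvF'
      obtain ⟨k1, k2, k3⟩ := mem_kids.1 hv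
      obtain ⟨a, ha⟩ := h.line.nonempty _ h1
      have hpN : p ∈ N := k3 ▸ hT.par_mem v k1 k2
      refine hext _ (h.unused p hpF' v hv hvF') (fun he => ?_) (fun he => ?_)
      · obtain ⟨u, hu1, hu2, hu3⟩ := (h2 a).1 ha
        obtain ⟨u', hu1', hu2', hu3'⟩ := (hSacc a).1 (he ▸ ha)
        obtain ⟨l1, l2, l3⟩ := mem_kids.1 hu1
        obtain ⟨l1', l2', l3'⟩ := mem_kids.1 hu1'
        rcases hT.nested l1 l1' hu3 hu3' with h5 | ⟨-, h5⟩
        · rcases hT.nested l1' l1 hu3' hu3 with h6 | ⟨-, h6⟩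
          · exact hp' (by rw [← l3, ← l3', hT.inj l1 l1' (h6.antisymm h5)])
          · rw [l3'] at h6
            exact hpF ((hcl u hu2).2.2 _ (hT.par_mem w hw hr) h6)
        · rw [l3] at h5
          exact hpF' ((hcl u' hu2').2.2 _ hpN h5)
      · obtain ⟨u, hu1, hu2, hu3⟩ := (h2 a).1 ha
        obtain ⟨l1, l2, l3⟩ := mem_kids.1 hu1
        rcases hT.nested l1 hw hu3 ((hS a).1 (he ▸ ha)) with h5 | ⟨-, h5⟩
        · exact hF ((hcl u hu2).2.2 w hw h5)
        · rw [l3] at h5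
          rcases hpend p hpN h5 with h6 | h6
          · exact hpw h6
          · exact hpF' h6

end


/-! ### Folding the tree into a binary decomposition -/

/-- All leaves below `u` stand for vertices of rank less than `i`. -/
def Covered (C : ℕ → Finset ℕ) (rk : ℕ → ℕ) (i u : ℕ) : Prop := ∀ a ∈ C u, 1 ≤ a ∧ rk (a - 1) < i

/-- The folded nodes are those all of whose leaves have been treated. -/
structure Done (N : Finset ℕ) (C : ℕ → Finset ℕ) (rk : ℕ → ℕ) (r i : ℕ) (F : Finset ℕ) : Prop where
  sub : F ⊆ N
  iff : ∀ u ∈ N, u ∈ F ↔ u ≠ r ∧ Covered C rk i u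

/-- While the vertex `l` of rank `i` is treated, all nodes are folded that have only treated leaves,
except for `w` and its ancestors. -/
structure Pending (N : Finset ℕ) (C : ℕ → Finset ℕ) (rk : ℕ → ℕ) (r i l w : ℕ) (F : Finset ℕ) :
    Prop where
  sub : F ⊆ N
  mem : w ∈ N
  ne : w ≠ r
  leaf : l + 1 ∈ C w
  cov : Covered C rk (i + 1) w
  iff : ∀ u ∈ N, u ∈ F ↔ u ≠ r ∧ Covered C rk (i + 1) u ∧ (l + 1 ∈ C u → C u ⊂ C w)

section

variable {A : ℕ → ℕ → Prop} {n : ℕ} {N : Finset ℕ} {C : ℕ → Finset ℕ} {par lab rk : ℕ → ℕ}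
  {r i l w : ℕ} {F : Finset ℕ}

/-- The extra leaf `0` is a child of the root. -/
theorem IsTree.eq_zero (h : IsTree (colour A) (range (n + 1)) N C par lab r r) {w : ℕ}
    (hw : w ∈ N) (hr : w ≠ r) (h0 : 0 ∈ C w) : w = 0 := by
  have hl : ∀ w ∈ N, w ≠ r → 0 ∈ C w → lab (par w) = 3 := by
    intro w hw hr h0
    obtain ⟨v, hv, hvr, hvp, hvw⟩ := h.exists_other hw hr
    obtain ⟨b, hb⟩ := h.nonempty v hv
    rw [← (h.sib w hw hr v hv hvr hvp.symm hvw.symm 0 h0 b hb).2]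
    simp [colour]
  by_cases hV : w ∈ range (n + 1)
  · rw [h.leaf_eq w hV, mem_singleton] at h0; exact h0.symm
  · obtain ⟨v, hv, hvr, rfl, hv0⟩ := h.cover w hw hV 0 h0
    exact absurd ((hl v hv hvr hv0).trans (hl _ hw hr h0).symm) (h.canon _ hw hr hr)

theorem IsTree.par_zero (h : IsTree (colour A) (range (n + 1)) N C par lab r r)
    (hr : 0 ≠ r) : par 0 = r := by
  have h0 : 0 ∈ N := h.leaf_mem (by simp)
  have hC : 0 ∈ C 0 := by rw [h.leaf_eq 0 (by simp)]; simp
  by_contra hp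
  exact h.par_ne h0 hr (h.eq_zero (h.par_mem 0 h0 hr) hp ((h.ssub 0 h0 hr).subset hC))

theorem Done.start (h : Done N C rk r i F)
    (hT : IsTree (colour A) (range (n + 1)) N C par lab r r) (hr : n < r) (hl : l < n)
    (hi : rk l = i) (hinj : ∀ u < n, ∀ v < n, rk u = rk v → u = v) :
    Pending N C rk r i l (l + 1) F := by
  have hV : l + 1 ∈ range (n + 1) := by simpa using hl
  have hC := hT.leaf_eq _ hV
  refine ⟨h.sub, hT.leaf_mem hV, by omega, by simp [hC], ?_, fun u hu => ?_⟩
  · intro a ha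
    rw [hC, mem_singleton] at ha
    subst ha; simp [hi]
  · rw [h.iff u hu]
    refine and_congr_right fun _ => ⟨fun hc => ⟨fun a ha => ⟨(hc a ha).1, by
      have := (hc a ha).2; omega⟩, fun hlu => ?_⟩, fun hc a ha => ⟨(hc.1 a ha).1, ?_⟩⟩
    · have := (hc _ hlu).2; simp at this; omega
    · have h1 := hc.1 a ha
      rcases Nat.lt_or_eq_of_le (Nat.le_of_lt_succ h1.2) with h2 | h2
      · exact h2
      · have han := mem_range.1 (hT.sub u hu ha)
        have h3 := hinj (a - 1) (by omega) l hl (h2.trans hi.symm)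
        have h4 := hc.2 (by rw [← h3, Nat.sub_add_cancel h1.1]; exact ha)
        rw [hC, ssubset_singleton_iff] at h4
        rw [h4] at ha; simp at ha

theorem Pending.notMem (h : Pending N C rk r i l w F) : w ∉ F := fun hh =>
  absurd (((h.iff w h.mem).1 hh).2.2 h.leaf) (fun h2 => h2.ne rfl)

theorem Pending.closed (h : Pending N C rk r i l w F)
    (hT : IsTree (colour A) (range (n + 1)) N C par lab r r) :
    ∀ v ∈ F, v ∈ N ∧ v ≠ r ∧ ∀ u ∈ N, C u ⊆ C v → u ∈ F := by
  intro v hv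
  have hvN := h.sub hv
  obtain ⟨h1, h2, h3⟩ := (h.iff v hvN).1 hv
  refine ⟨hvN, h1, fun u hu hs => (h.iff u hu).2 ⟨?_, fun a ha => h2 a (hs ha), fun hl =>
    lt_of_le_of_lt hs (h3 (hs hl))⟩⟩
  rintro rfl
  have h4 := hT.sub _ (hT.par_mem v hvN h1)
  rw [← hT.root_eq] at h4
  exact (hT.ssub v hvN h1).not_subset (h4.trans hs)

theorem Pending.below (h : Pending N C rk r i l w F)
    (hT : IsTree (colour A) (range (n + 1)) N C par lab r r) :
    ∀ u ∈ N, C u ⊆ C w → u = w ∨ u ∈ F := by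
  intro u hu hs
  rcases hs.eq_or_ssubset with he | hs'
  · exact Or.inl (hT.inj hu h.mem he)
  · refine Or.inr ((h.iff u hu).2 ⟨?_, fun a ha => h.cov a (hs ha), fun _ => hs'⟩)
    rintro rfl
    have h4 := hT.sub _ h.mem
    rw [← hT.root_eq] at h4
    exact hs'.not_subset h4

theorem Pending.par_notMem (h : Pending N C rk r i l w F)
    (hT : IsTree (colour A) (range (n + 1)) N C par lab r r) : par w ∉ insert w F := by
  rw [mem_insert]
  rintro (h1 | h1)
  · exact hT.par_ne h.mem h.ne h1
  · exact h.notMem ((h.closed hT _ h1).2.2 w h.mem (hT.ssub w h.mem h.ne).subset)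

/-- If all children of the parent have been folded, then the parent is folded next. -/
theorem Pending.up (h : Pending N C rk r i l w F)
    (hT : IsTree (colour A) (range (n + 1)) N C par lab r r) (hr : 0 ≠ r)
    (hall : ∀ v ∈ kids N par r (par w), v ∈ insert w F) :
    Pending N C rk r i l (par w) (insert w F) := by
  have hp := hT.par_mem w h.mem h.ne
  have hss := hT.ssub w h.mem h.ne
  have hcov : ∀ v ∈ insert w F, Covered C rk (i + 1) v := by
    intro v hv
    rcases mem_insert.1 hv with rfl | hv
    · exact h.cov
    · exact ((h.iff v (h.sub hv)).1 hv).2.1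
  refine ⟨insert_subset h.mem h.sub, hp, fun he => ?_, hss.subset h.leaf, fun a ha => ?_,
    fun u hu => ⟨fun hh => ?_, fun ⟨h1, h2, h3⟩ => ?_⟩⟩
  · have := hcov 0 (hall 0 (mem_kids.2 ⟨hT.leaf_mem (by simp), hr, (hT.par_zero hr).trans he.symm⟩))
      0 (by rw [hT.leaf_eq 0 (by simp)]; simp)
    omega
  · obtain ⟨v, hv, hvr, hvp, hav⟩ := hT.cover _ hp (hT.par_notMem h.mem h.ne) a ha
    exact hcov v (hall v (mem_kids.2 ⟨hv, hvr, hvp⟩)) a hav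
  · refine ⟨?_, hcov u hh, fun hl => ?_⟩
    · rintro rfl
      rcases mem_insert.1 hh with h1 | h1
      · exact h.ne h1.symm
      · exact (h.closed hT _ h1).2.1 rfl
    · rcases mem_insert.1 hh with rfl | h1
      · exact hss
      · exact (((h.iff u hu).1 h1).2.2 hl).trans hss
  · rw [mem_insert]
    by_cases hl : l + 1 ∈ C u
    · rcases hT.nested h.mem hu h.leaf hl with h4 | h4
      · exact h.below hT u hu h4
      · exact absurd h4.2 (h3 hl).not_subset
    · exact Or.inr ((h.iff u hu).2 ⟨h1, h2, fun hh => absurd hh hl⟩)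

/-- If some child of the parent has not been folded, then the treatment of `l` is complete. -/
theorem Pending.complete (h : Pending N C rk r i l w F)
    (hT : IsTree (colour A) (range (n + 1)) N C par lab r r)
    (hex : ∃ v ∈ kids N par r (par w), v ∉ insert w F) : Done N C rk r (i + 1) (insert w F) := by
  refine ⟨insert_subset h.mem h.sub, fun u hu => ⟨fun hh => ?_, fun ⟨h1, h2⟩ => ?_⟩⟩
  · rcases mem_insert.1 hh with rfl | h1
    · exact ⟨h.ne, h.cov⟩
    · have := (h.iff u hu).1 h1
      exact ⟨this.1, this.2.1⟩
  · rw [mem_insert]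
    by_cases hl : l + 1 ∈ C u
    · rcases hT.nested h.mem hu h.leaf hl with h4 | ⟨-, h4⟩
      · exact h.below hT u hu h4
      · exfalso
        obtain ⟨v, hv, hvF⟩ := hex
        obtain ⟨k1, k2, k3⟩ := mem_kids.1 hv
        rw [mem_insert, not_or] at hvF
        refine hvF.2 ((h.iff v k1).2 ⟨k2, fun a ha => h2 a (h4 ?_), fun hh => ?_⟩)
        · exact k3 ▸ (hT.ssub v k1 k2).subset ha
        · exact absurd (hT.eq_of_sib k1 k2 h.mem h.ne k3 hh h.leaf) hvF.1
    · exact Or.inr ((h.iff u hu).2 ⟨h1, h2, fun hh => absurd hh hl⟩)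

/-- The arcs between a folded child and the child that is folded next. Since the vertices are
treated in sorted order, one-directional arcs go from the former to the latter. -/
theorem Pending.arcs (h : Pending N C rk r i l w F)
    (hT : IsTree (colour A) (range (n + 1)) N C par lab r r)
    (htr : ∀ a b c, A a b → ¬ A b a → A b c → ¬ A c b → A a c ∧ ¬ A c a)
    (hord : ∀ a b, A a b → ¬ A b a → rk a < rk b)
    (hinj : ∀ u < n, ∀ v < n, rk u = rk v → u = v) (hln : l < n) (hi : rk l = i)
    {v : ℕ} (hv : v ∈ kids N par r (par w)) (hvF : v ∈ F) :
    lab (par w) ≤ 2 ∧ ∀ a b, a + 1 ∈ C v → b + 1 ∈ C w →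
      a ≠ b ∧ (A a b ↔ lab (par w) ≠ 0) ∧ (A b a ↔ lab (par w) = 2) := by
  obtain ⟨k1, k2, k3⟩ := mem_kids.1 hv
  have hvw : v ≠ w := fun he => h.notMem (he ▸ hvF)
  have hvc := ((h.iff v k1).1 hvF).2.1
  have hsib := hT.sib v k1 k2 w h.mem h.ne k3 hvw
  rw [k3] at hsib
  have h0 : 0 ∉ C w := fun hh => by have := h.cov 0 hh; omega
  refine ⟨?_, fun a b ha hb => ?_⟩
  · obtain ⟨a, ha⟩ := hT.nonempty v k1
    rw [← (hsib a ha _ h.leaf).2]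
    exact colour_le_two A (by have := hvc a ha; omega) (by omega)
  have hab := hsib _ ha _ hb
  have hne : a ≠ b := fun he => hab.1 (by rw [he])
  refine ⟨hne, ?_⟩
  have hcol := hab.2
  simp only [colour, Nat.add_sub_cancel, Nat.succ_ne_zero, or_self, if_false] at hcol
  by_cases h1 : lab (par w) = 1
  · have hal := hsib _ ha _ h.leaf
    have hcl := hal.2
    simp only [colour, Nat.add_sub_cancel, Nat.succ_ne_zero, or_self, if_false] at hcl
    have hA : A a l := by
      by_contra hn
      have hla : A l a := by
        by_contra hn'
        simp [hn, hn'] at hcl; omega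
      have h2 := hord _ _ hla hn
      have h3 := (hvc _ ha).2
      rw [Nat.add_sub_cancel] at h3
      have := mem_range.1 (hT.sub v k1 ha)
      have := hinj a (by omega) l hln (by omega)
      exact hal.1 (by rw [this])
    have := hT.direction htr h.mem h.ne h1 h0 (a := a + 1) (x := l + 1) (y := b + 1) (by omega)
      (fun c hc => (hsib _ ha _ hc).2.trans h1) h.leaf hb hA
    simp only [Nat.add_sub_cancel] at this
    simp [this.1, this.2, h1]
  · split_ifs at hcol with h2 h3 h3
    · rw [← hcol]; exact ⟨iff_of_true h2 (by omega), iff_of_true h3 (by omega)⟩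
    · omega
    · omega
    · rw [← hcol]; exact ⟨iff_of_false h2 (by omega), iff_of_false h3 (by omega)⟩

end

/-- Folds the tree into a binary decomposition: the vertices are treated in sorted order, and after
every vertex the nodes are folded into their parents from there upwards, as far as all children of a
node have been folded. The next part is `.reg 3`. -/
def climb : Program :=
  .assign 3 (.reg 0) ;;
  forLoop 10 (.reg 0)
    (.assign 11 (get 15 (.reg 10) + 1) ;; .assign 13 (.reg 11 - 1) ;; .assign 12 1 ;;
    .loop (.reg 12)
      (.assign 14 (get 0 (.reg 11)) ;; .branch (get 10 (.reg 14))
        (put 12 (.reg 3) (get 11 (.reg 14)) ;; put 13 (.reg 3) (.reg 13) ;;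
          put 14 (.reg 3) (get 1 (.reg 14)) ;; put 11 (.reg 14) (.reg 3) ;; .assign 3 (.reg 3 + 1))
        (put 11 (.reg 14) (.reg 13)) ;;
      put 10 (.reg 14) (get 10 (.reg 14) + 1) ;;
      .assign 12 ((get 10 (.reg 14)).eq (get 2 (.reg 14))) ;;
      .assign 11 (.reg 14) ;; .assign 13 (get 11 (.reg 14))))

theorem climb_spec {M : Machine} {B n : ℕ} {Q : Store → ℕ → Prop} {σ : Store} {t : ℕ}
    (hC : Ctx M B n) {A : ℕ → ℕ → Prop} {nw : ℕ} {C : ℕ → Finset ℕ} {rk : ℕ → ℕ}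
    (h0 : σ.reg 0 = n) (hI : InsertInv (colour A) n (n + 1) nw C σ.mem)
    (htr : ∀ a b c, A a b → ¬ A b a → A b c → ¬ A c b → A a c ∧ ¬ A c a)
    (hord : ∀ a b, A a b → ¬ A b a → rk a < rk b)
    (hinj : ∀ u < n, ∀ v < n, rk u = rk v → u = v) (hrk : ∀ v < n, rk v < n)
    (hsort : ∀ i < n, fd n σ.mem 15 i < n ∧ rk (fd n σ.mem 15 i) = i)
    (hz : ∀ a, fd n σ.mem 10 a = 0)
    (hQ : ∀ ρ s S, Frame n [10, 11, 12, 13, 14] [3] σ ρ → n ≤ ρ.reg 3 → ρ.reg 3 ≤ 4 * n →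
      Line A n (ρ.reg 3) (fd n ρ.mem 12) (fd n ρ.mem 13) (fd n ρ.mem 14) S →
      fd n ρ.mem 11 (n + 1) < ρ.reg 3 → S (fd n ρ.mem 11 (n + 1)) = range n →
      s ≤ t + n * 10000 + 1000 → Q ρ s) :
    wp M B climb Q σ t := by
  have ⟨_, hnp, hcells, hbound⟩ := hC
  have hT := hI.state.tree
  have hnw : nw ≤ 3 * n := by have := hI.le'; omega
  set N := nodes n (n + 1) nw with hN
  have hNlt : ∀ a ∈ N, a < 3 * n := fun a ha => by
    rw [hN, mem_nodes] at ha; omega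
  have hNc : ∀ F : Finset ℕ, F ⊆ N → F.card ≤ 3 * n := fun F hF => by
    rw [← card_range (3 * n)]
    exact card_le_card fun a ha => mem_range.2 (hNlt a (hF ha))
  have hlab : ∀ p, ∀ w ∈ N, w ≠ n + 1 → p = fd n σ.mem 0 w → fd n σ.mem 1 p ≤ 3 := by
    rintro p w hw hr rfl
    obtain ⟨v, hv, hvr, hvp, hvw⟩ := hT.exists_other hw hr
    obtain ⟨a, ha⟩ := hT.nonempty w hw
    obtain ⟨b, hb⟩ := hT.nonempty v hv
    rw [← (hT.sib w hw hr v hv hvr hvp.symm hvw.symm a ha b hb).2]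
    rw [colour]; split_ifs <;> omega
  refine wp_seq (wp_set hC (by simp) (by simp [h0]; omega) fun s1 hs1 => ?_)
  simp [h0]
  have hfold0 : Folding A n N C (fd n σ.mem 0) (n + 1) ∅ n (fun v => {v}) σ.mem := by
    refine ⟨⟨fun v _ => rfl, fun v hv => singleton_subset_iff.2 (mem_range.2 hv),
      fun v _ => singleton_nonempty v, ?_, ?_, ?_, ?_, ?_⟩,
      le_rfl, by simp, fun p => by simp [hz], fun p v _ hv => absurd hv (by simp), ?_,
      fun p _ v _ hv => absurd hv (by simp)⟩
    all_goals intros; first | omega | (intro k hk hk'; omega)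
  have hdone0 : Done N C rk (n + 1) 0 ∅ := by
    refine ⟨by simp, fun u hu => ⟨by simp, fun hh => ?_⟩⟩
    obtain ⟨a, ha⟩ := hT.nonempty u hu
    have := (hh.2 a ha).2; omega
  refine wp_seq (wp_set hC (by simp) (by simp) fun s2 hs2 => ?_)
  simp
  obtain ⟨J, hJ⟩ : ∃ J : ℕ → Store → ℕ → Prop, ∀ k τ s, J k τ s ↔ ∃ i F S, k + i = n ∧ τ.reg 10 = i ∧
    Frame n [10, 11, 12, 13, 14] [3] σ τ ∧ Done N C rk (n + 1) i F ∧
    Folding A n N C (fd n σ.mem 0) (n + 1) F (τ.reg 3) S τ.mem ∧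
    s ≤ t + 300 + i * 1000 + F.card * 3000 :=
    ⟨_, fun _ _ _ => Iff.rfl⟩
  refine wp_loop hC.toEnv rfl J (k := n)
    ((hJ _ _ _).2 ⟨0, ∅, fun v => {v}, by omega, by simp, ?_, hdone0, hfold0, by simp; omega⟩) ?_ ?_ ?_
  · exact Frame.refl.set_reg.set_reg
  · rintro k τ s -; simp
  · intro k τ s hJk hlt
    obtain ⟨i, F, S, hki, r10, hF, hD, hfo, hs⟩ := (hJ _ _ _).1 hJk
    have r0 : τ.reg 0 = n := (hF.reg 0).trans h0
    simp [r0, r10] at hlt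
    have hcost : ((Expr.reg 10).lt (.reg 0)).cost ≤ 80 := Expr.Small.cost_le rfl
    have e15 : fd n τ.mem 15 i = fd n σ.mem 15 i := (hF.fd 15) i
    obtain ⟨hl, hli⟩ := hsort i hlt
    generalize hle : fd n σ.mem 15 i = l at *
    have hlF : l + 1 ∉ F := fun hh =>
      (hD.start hT (by omega) hl hli hinj).notMem hh
    refine wp_seq (wp_seq (wp_set hC (by simp [r0, r10]; omega)
      (by simp [r0, r10, e15]; omega) fun s3 hs3 => ?_))
    simp [r0, r10, e15]
    refine wp_seq (wp_set hC (by simp) (by simp; omega) fun s4 hs4 => ?_)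
    simp
    refine wp_seq (wp_set hC (by simp) (by simp; omega) fun s5 hs5 => ?_)
    simp
    obtain ⟨H, hH⟩ : ∃ H : ℕ → Store → ℕ → Prop, ∀ k ρ s, H k ρ s ↔ ∃ F S, ρ.reg 10 = i ∧
      Frame n [10, 11, 12, 13, 14] [3] σ ρ ∧
      Folding A n N C (fd n σ.mem 0) (n + 1) F (ρ.reg 3) S ρ.mem ∧
      s ≤ t + 300 + i * 1000 + 700 + F.card * 3000 ∧
      (ρ.reg 12 = 0 ∧ Done N C rk (n + 1) (i + 1) F ∨ ρ.reg 12 = 1 ∧ k + F.card = 3 * n ∧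
        Pending N C rk (n + 1) i l (ρ.reg 11) F ∧ ρ.reg 13 < ρ.reg 3 ∧
        (∀ a, a ∈ S (ρ.reg 13) ↔ a + 1 ∈ C (ρ.reg 11)) ∧
        Unused n (ρ.reg 3) (fd n ρ.mem 12) (fd n ρ.mem 13) (ρ.reg 13)) :=
      ⟨_, fun _ _ _ => Iff.rfl⟩
    refine wp_loop hC.toEnv rfl H (k := 3 * n - F.card)
      ((hH _ _ _).2 ⟨F, S, by simpa using r10, ?_, by simpa using hfo, by omega,
        Or.inr ⟨by simp, ?_, ?_, ?_, ?_, ?_⟩⟩) ?_ ?_ ?_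
    · exact hF.set_reg.set_reg.set_reg
    · have := hNc F hD.sub; omega
    · simpa using hD.start hT (by omega) hl hli hinj
    · have := hfo.le; simp; omega
    · intro a
      simp only [Function.update_self, Function.update_of_ne (show (13 : ℕ) ≠ 12 by decide),
        Function.update_of_ne (show (11 : ℕ) ≠ 12 by decide),
        Function.update_of_ne (show (11 : ℕ) ≠ 13 by decide)]
      rw [hfo.line.leaf l hl, hT.leaf_eq _ (by simpa using hl)]; simp
    · simpa using hfo.unused_leaf l hl hlF
    · rintro k ρ s -; simp
    · intro k ρ s hHk hne
      obtain ⟨F, S, q10, hF, hfo, hs, ⟨q12, -⟩ | ⟨q12, hk, hP, hcur, hS, hu⟩⟩ := (hH _ _ _).1 hHk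
      · simp [q12] at hne
      have q0 : ρ.reg 0 = n := (hF.reg 0).trans h0
      generalize hw : ρ.reg 11 = w at *
      generalize hcu : ρ.reg 13 = cur at *
      generalize hkk : ρ.reg 3 = kk at *
      have hwN := hP.mem
      have hwlt := hNlt w hwN
      have e0 : fd n ρ.mem 0 w = fd n σ.mem 0 w := (hF.fd 0) w
      have hpN := hT.par_mem w hP.mem hP.ne
      have hplt := hNlt _ hpN
      have hlp := hlab _ w hP.mem hP.ne rfl
      have hfr := hNc _ (insert_subset hP.mem hP.sub)
      rw [card_insert_of_notMem hP.notMem] at hfr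
      have hkn := hfo.le'
      have hcost : (Expr.reg 12).cost ≤ 80 := Expr.Small.cost_le rfl
      have e1 : ∀ a, fd n ρ.mem 1 a = fd n σ.mem 1 a := hF.fd 1
      have e2 : ∀ a, fd n ρ.mem 2 a = fd n σ.mem 2 a := hF.fd 2
      have h10 := hfo.fold (fd n σ.mem 0 w)
      have h10le : fd n ρ.mem 10 (fd n σ.mem 0 w) ≤ 3 * n := by
        rw [h10]
        exact hNc _ ((filter_subset _ _).trans (filter_subset _ _))
      refine wp_seq (wp_set hC (by simp [q0, hw]; omega) (by simp [q0, hw, e0]; omega)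
        fun s6 hs6 => ?_)
      simp [q0, hw, e0]
      generalize hpe : fd n σ.mem 0 w = p at *
      refine wp_seq (wp_mono (Q' := fun υ u => υ.reg 14 = p ∧ υ.reg 10 = i ∧ u ≤ s6 + 1300 ∧
        Frame n [10, 11, 12, 13, 14] [3] σ υ ∧ (∀ q, fd n υ.mem 10 q = fd n ρ.mem 10 q) ∧
        ∀ m', (∀ q, fd n m' 10 q = if q = p then fd n ρ.mem 10 q + 1 else fd n ρ.mem 10 q) →
          (∀ j, 11 ≤ j → j ≤ 14 → fd n m' j = fd n υ.mem j) →
          ∃ S', Folding A n N C (fd n σ.mem 0) (n + 1) (insert w F) (υ.reg 3) S' m') ?_ ?_)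
      · refine wp_if hC (by simp [q0]; omega) (fun hne s7 hs7 => ?_) (fun heq s7 hs7 => ?_)
        · simp [q0] at hne
          obtain ⟨v, hv⟩ := card_ne_zero.1 (h10 ▸ hne)
          rw [mem_filter] at hv
          have harcs := hP.arcs hT htr hord hinj hl hli (v := v) (by rw [hpe]; exact hv.1) hv.2
          have hacc := hfo.acc p v hv.1 hv.2
          refine wp_seq (wp_put hC (by simp [q0]; omega)
            (by simp [q0, hkk]; omega) fun s8 hs8 => ?_)
          simp [q0, hkk]
          refine wp_seq (wp_put hC (by simp) (by simp [hkk, hcu]; omega) fun s9 hs9 => ?_)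
          simp [hkk, hcu]
          refine wp_seq (wp_put hC (by simp [q0]; omega)
            (by simp [q0, hkk, fd_upd, e1]; omega) fun s10 hs10 => ?_)
          simp [q0, hkk, fd_upd, e1]
          refine wp_seq (wp_put hC (by simp) (by simp [hkk]; omega) fun s11 hs11 => ?_)
          simp [hkk]
          refine wp_set hC (by simp) (by simp [hkk]; omega) fun s12 hs12 => ?_
          simp [hkk]
          refine ⟨q10, by omega, ?_, fun q => by simp [fd_upd], fun m' hm hm' => ?_⟩
          · exact hF.set_reg.put.put.put.put.set_reg
          · refine hfo.next hT hP.mem hP.ne hP.notMem (hP.closed hT) (hP.below hT) hcur hS hu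
              ⟨v, hpe ▸ hv.1, hv.2⟩ harcs.1 (fun v hv hvF => (hP.arcs hT htr hord hinj hl hli hv
                hvF).2) (hpe ▸ hm) ?_ ?_ ?_ ?_
            · intro q; simp [hm' 11, fd_upd, hpe]
            · intro q; simp [hm' 12, fd_upd, hpe]
            · intro q; simp [hm' 13, fd_upd]
            · intro q; simp [hm' 14, fd_upd, hpe]
        · simp [q0] at heq
          refine wp_put hC (by simp)
            (by simp [hcu]; omega) fun s8 hs8 => ?_
          simp [hcu]
          refine ⟨q10, by omega, hF.set_reg.put,
            fun q => by simp [fd_upd], fun m' hm hm' => ⟨S, ?_⟩⟩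
          rw [hkk]
          refine hfo.first hP.mem hP.ne hP.notMem hcur hS hu ?_ (hpe ▸ hm) ?_ ?_
          · rw [hpe]
            intro v hv hvF
            rw [heq, eq_comm, card_eq_zero] at h10
            have : v ∈ (∅ : Finset ℕ) := h10 ▸ mem_filter.2 ⟨hv, hvF⟩
            simp at this
          · intro q; simp [hm' 11, fd_upd, hpe]
          · intro j hj hj'
            rw [hm' j (by omega) hj']
            funext q; simp [fd_upd, show j < 32 by omega, show j ≠ 11 by omega]
      rintro υ s7 ⟨u14, u10, hs7, hFu, e10, hfu⟩
      have u0 : υ.reg 0 = n := (hFu.reg 0).trans h0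
      have f2 : fd n υ.mem 2 p = (kids N (fd n σ.mem 0) (n + 1) p).card :=
        ((hFu.fd 2) p).trans (hI.state.kept.cnt p)
      have hkids : (kids N (fd n σ.mem 0) (n + 1) p).card ≤ 3 * n :=
        hNc _ (filter_subset _ _)
      refine wp_seq (wp_put hC (by simp [u0, u14]; omega)
        (by simp [u0, u14, e10]; omega) fun s8 hs8 => ?_)
      simp [u0, u14, e10]
      obtain ⟨S', hfo'⟩ := hfu (upd n υ.mem 10 p (fd n ρ.mem 10 p + 1)) (fun q => by
        rw [fd_upd (by omega) (by omega), e10]; by_cases hq : q = p <;> simp [hq])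
        (fun j hj hj' => by
          funext q
          simp [fd_upd, show j < 32 by omega, show j ≠ 10 by omega])
      have hFm : Frame n [10, 11, 12, 13, 14] [3] σ
          ⟨υ.reg, upd n υ.mem 10 p (fd n ρ.mem 10 p + 1)⟩ := hFu.put
      have hv10 : fd n (upd n υ.mem 10 p (fd n ρ.mem 10 p + 1)) 10 p = fd n ρ.mem 10 p + 1 := by
        simp [fd_upd]
      have hv2 : fd n (upd n υ.mem 10 p (fd n ρ.mem 10 p + 1)) 2 p =
          (kids N (fd n σ.mem 0) (n + 1) p).card := by simp [fd_upd, f2]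
      have hcard := hfo'.fold p
      rw [hv10] at hcard
      have hwk : w ∈ kids N (fd n σ.mem 0) (n + 1) p := mem_kids.2 ⟨hP.mem, hP.ne, hpe⟩
      have hacc := hfo'.acc p w hwk (by simp)
      have hkn' := hfo'.le'
      rw [card_insert_of_notMem hP.notMem] at hkn'
      generalize upd n υ.mem 10 p (fd n ρ.mem 10 p + 1) = m' at *
      refine wp_seq (wp_set hC (by simp [u0, u14]; omega)
        (by simp [u0, u14]; split_ifs <;> omega) fun s9 hs9 => ?_)
      simp [u0, u14, hv10, hv2]
      refine wp_seq (wp_set hC (by simp) (by simp [u14]; omega) fun s10 hs10 => ?_)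
      simp [u14]
      refine wp_set hC (by simp [u0, u14]; omega) (by simp [u0, u14]; omega)
        fun s11 hs11 => ?_
      simp [u0, u14]
      refine ⟨k - 1, by omega, (hH _ _ _).2 ⟨insert w F, S', by simpa using u10, ?_,
        by simpa using hfo', ?_, ?_⟩⟩
      · exact hFm.set_reg.set_reg.set_reg
      · rw [card_insert_of_notMem hP.notMem]; omega
      · by_cases hall : fd n ρ.mem 10 p + 1 = (kids N (fd n σ.mem 0) (n + 1) p).card
        · refine Or.inr ⟨by simp [hall], ?_, ?_, hacc.1, fun a => (hacc.2 a).trans ?_, ?_⟩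
          · rw [card_insert_of_notMem hP.notMem]; omega
          · rw [← hpe]
            refine hP.up hT (by omega) (filter_card_eq ?_)
            rw [hpe, ← hcard, hall]
          · have hall' := filter_card_eq (hcard.symm.trans hall)
            constructor
            · rintro ⟨v, hv, -, hav⟩
              obtain ⟨k1, k2, k3⟩ := mem_kids.1 hv
              rw [← k3]; exact (hT.ssub v k1 k2).subset hav
            · intro ha
              obtain ⟨v, hv, hvr, hvp, hav⟩ := hT.cover p hpN
                (hpe ▸ hT.par_notMem hP.mem hP.ne) _ ha
              have hvk := mem_kids.2 ⟨hv, hvr, hvp⟩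
              exact ⟨v, hvk, hall' v hvk, hav⟩
          · refine hfo'.unused p ?_ w hwk (by simp)
            rw [← hpe]; exact hP.par_notMem hT
        · refine Or.inl ⟨by simp [hall], hP.complete hT ?_⟩
          by_contra hcon
          push Not at hcon
          rw [hpe] at hcon
          rw [filter_true_of_mem hcon] at hcard
          exact hall hcard
    · intro k' ρ s' hHk hne
      obtain ⟨F, S, q10, hF, hfo, hs', ⟨q12, hD⟩ | ⟨q12, -⟩⟩ := (hH _ _ _).1 hHk
      · refine wp_set hC (by simp) (by simp [q10]; omega) fun s6 hs6 => ?_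
        have : (Expr.reg 12).cost = 1 := rfl
        exact ⟨k - 1, by omega, (hJ _ _ _).2 ⟨i + 1, F, S, by omega, by simp [q10],
          hF.set_reg, hD, by simpa using hfo, by omega⟩⟩
      · simp [q12] at hne
  · intro k τ s hJk hlt
    obtain ⟨i, F, S, hki, r10, hF, hD, hfo, hs⟩ := (hJ _ _ _).1 hJk
    have r0 : τ.reg 0 = n := (hF.reg 0).trans h0
    simp [r0, r10] at hlt
    obtain rfl : i = n := by omega
    have hcost : ((Expr.reg 10).lt (.reg 0)).cost ≤ 80 := Expr.Small.cost_le rfl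
    have hFc := hNc F hD.sub
    have hmem : ∀ v ∈ N, v ≠ i + 1 → v ≠ 0 → v ∈ F := by
      intro v hv hvr hv0
      refine (hD.iff v hv).2 ⟨hvr, fun a ha => ?_⟩
      have h1 : 1 ≤ a := Nat.one_le_iff_ne_zero.2 fun hh => hv0 (hT.eq_zero hv hvr (hh ▸ ha))
      have h2 := mem_range.1 (hT.sub v hv ha)
      exact ⟨h1, hrk _ (by omega)⟩
    have hr1 : i + 1 ∉ range (i + 1) := by simp
    have hkid : ∀ a < i, ∃ v ∈ kids N (fd i σ.mem 0) (i + 1) (i + 1), v ∈ F ∧ a + 1 ∈ C v := by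
      intro a ha
      obtain ⟨v, hv, hvr, hvp, hav⟩ := hT.cover _ hT.root_mem hr1 (a + 1)
        (by rw [hT.root_eq]; simpa using ha)
      refine ⟨v, mem_kids.2 ⟨hv, hvr, hvp⟩, hmem v hv hvr ?_, hav⟩
      rintro rfl
      rw [hT.leaf_eq 0 (by simp)] at hav
      simp at hav
    obtain ⟨v, hv, hvF, -⟩ := hkid 0 hnp
    obtain ⟨h1, h2⟩ := hfo.acc _ v hv hvF
    have hle := hfo.le'
    refine hQ τ _ S hF hfo.le (by omega) hfo.line h1 ?_ (by omega)
    refine (hfo.line.sub _ h1).antisymm fun a ha => (h2 a).2 (hkid a (mem_range.1 ha))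


/-! ### The recurrence of the dynamic program -/

/-- The requirement on the part `X ∩ S` of a solution inside of a part `S` in mode `m`. In mode `0`
there is none. In mode `1` it is the weak digraph constraint for the digraph induced by `S`. In mode
`2`, in addition, all vertices without predecessors in `S` have to be chosen; this is what is left
of the constraint if all vertices outside of `S` that precede the vertices of `S` are chosen. -/
def Good (A : ℕ → ℕ → Prop) (m : ℕ) (S X : Finset ℕ) : Prop :=
  m = 0 ∨ ∀ y ∈ S, (m = 2 ∨ ∃ x ∈ S, A x y) → (∀ x ∈ S, A x y → x ∈ X) → y ∈ X

/-- The part `S` has a subset of total size `s` that is good in mode `m`. -/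
def Feas (A : ℕ → ℕ → Prop) (sz : ℕ → ℕ) (S : Finset ℕ) (m s : ℕ) : Prop :=
  ∃ X ⊆ S, ∑ v ∈ X, sz v = s ∧ Good A m S X

/-- The mode of a part inside of a union in mode `m`: here `z = 1` if there are arcs to this part
from the other part, and `e = 1` if the other part is chosen completely. -/
def childMode (z e m : ℕ) : ℕ := z * e * (2 - 2 * (if m = 0 then 1 else 0)) + (1 - z) * m

section

variable {A : ℕ → ℕ → Prop} {sz : ℕ → ℕ} {S T X : Finset ℕ} {m z e o s : ℕ}

theorem childMode_le (hz : z ≤ 1) (he : e ≤ 1) (hm : m ≤ 2) : childMode z e m ≤ 2 := by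
  unfold childMode
  interval_cases z <;> interval_cases e <;> split_ifs <;> omega

theorem good_iff (hm : m ≠ 0) : Good A m S X ↔
    ∀ y ∈ S, (m = 2 ∨ ∃ x ∈ S, A x y) → (∀ x ∈ S, A x y → x ∈ X) → y ∈ X := by
  simp [Good, hm]

theorem Good.congr {Y : Finset ℕ} (h : Good A m S X) (hXY : ∀ v ∈ S, v ∈ X ↔ v ∈ Y) :
    Good A m S Y := by
  rcases h with h | h
  · exact Or.inl h
  · exact Or.inr fun y hy h1 h2 => (hXY y hy).1 (h y hy h1 fun x hx hxy =>
      (hXY x hx).2 (h2 x hx hxy))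

/-- The requirement on the part `S` of a union of `S` and `T`, where `z = 1` if there are arcs from
`T` to `S`: in this case it is void unless `T` is chosen completely, and then also the vertices of
`S` without predecessors in `S` have to be chosen. -/
theorem good_half (hT : T.Nonempty) (hz : z ≤ 1) (harc : ∀ a ∈ S, ∀ b ∈ T, A b a ↔ z = 1)
    (hm : m ≠ 0) : (∀ y ∈ S, (m = 2 ∨ ∃ x, (x ∈ S ∨ x ∈ T) ∧ A x y) →
      (∀ x, x ∈ S ∨ x ∈ T → A x y → x ∈ X) → y ∈ X) ↔
    Good A (childMode z (if T ⊆ X then 1 else 0) m) S X := by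
  obtain ⟨b, hb⟩ := hT
  have hz' : z = 0 ∨ z = 1 := by omega
  rcases hz' with rfl | rfl
  · have h1 : childMode 0 (if T ⊆ X then 1 else 0) m = m := by simp [childMode]
    rw [h1, good_iff hm]
    have harc' : ∀ a ∈ S, ∀ b ∈ T, ¬ A b a := fun a ha b hb => by simp [harc a ha b hb]
    refine forall₂_congr fun y hy => ?_
    have e1 : (∃ x, (x ∈ S ∨ x ∈ T) ∧ A x y) ↔ ∃ x ∈ S, A x y := exists_congr fun x => by
      have := harc' y hy x; tauto
    have e2 : (∀ x, x ∈ S ∨ x ∈ T → A x y → x ∈ X) ↔ ∀ x ∈ S, A x y → x ∈ X :=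
      forall_congr' fun x => by have := harc' y hy x; tauto
    rw [e1, e2]
  · have harc' : ∀ a ∈ S, ∀ b ∈ T, A b a := fun a ha b hb => by simp [harc a ha b hb]
    by_cases hX : T ⊆ X
    · have h1 : childMode 1 (if T ⊆ X then 1 else 0) m = 2 := by simp [childMode, hX, hm]
      rw [h1, good_iff (by omega)]
      refine forall₂_congr fun y hy => ?_
      have e2 : (∀ x, x ∈ S ∨ x ∈ T → A x y → x ∈ X) ↔ ∀ x ∈ S, A x y → x ∈ X :=
        forall_congr' fun x => by have := @hX x; tauto
      rw [e2]
      have e1 : ∃ x, (x ∈ S ∨ x ∈ T) ∧ A x y := ⟨b, Or.inr hb, harc' y hy b hb⟩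
      simp [e1]
    · have h1 : childMode 1 (if T ⊆ X then 1 else 0) m = 0 := by simp [childMode, hX]
      rw [h1]
      refine iff_of_true (fun y hy _ h2 => absurd (fun x hx => ?_) hX) (Or.inl rfl)
      exact h2 x (Or.inr hx) (harc' y hy x hx)

theorem good_union (hS : S.Nonempty) (hT : T.Nonempty)
    (harcs : ∀ a ∈ S, ∀ b ∈ T, a ≠ b ∧ (A a b ↔ o ≠ 0) ∧ (A b a ↔ o = 2)) :
    Good A m (S ∪ T) X ↔
      Good A (childMode (if o = 2 then 1 else 0) (if T ⊆ X then 1 else 0) m) S X ∧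
      Good A (childMode (1 - if o = 0 then 1 else 0) (if S ⊆ X then 1 else 0) m) T X := by
  by_cases hm : m = 0
  · simp [hm, Good, childMode]
  rw [← good_half hT (by split_ifs <;> omega) (fun a ha b hb => by
      rw [(harcs a ha b hb).2.2]; split_ifs <;> simp [*]) hm,
    ← good_half hS (by omega) (fun a ha b hb => by
      rw [(harcs b hb a ha).2.1]; split_ifs <;> simp [*]) hm, good_iff hm]
  simp only [mem_union]
  constructor
  · intro h
    refine ⟨fun y hy => h y (Or.inl hy), fun y hy h1 h2 => h y (Or.inr hy) ?_ ?_⟩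
    · simpa only [or_comm] using h1
    · simpa only [or_comm] using h2
  · rintro ⟨h1, h2⟩ y (hy | hy)
    · exact h1 y hy
    · intro h3 h4
      refine h2 y hy ?_ ?_
      · simpa only [or_comm] using h3
      · simpa only [or_comm] using h4

/-- As the sizes are positive, a subset is recognized to be the whole set by its total size. -/
theorem sum_eq_iff (hpos : ∀ v ∈ S, 0 < sz v) :
    ∑ v ∈ X ∩ S, sz v = ∑ v ∈ S, sz v ↔ S ⊆ X := by
  constructor
  · intro h v hv
    by_contra hX
    have : ∑ v ∈ X ∩ S, sz v < ∑ v ∈ S, sz v :=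
      sum_lt_sum_of_subset inter_subset_right hv (by simp [hX]) (hpos v hv)
        fun _ _ _ => Nat.zero_le _
    omega
  · intro h
    rw [inter_eq_right.2 h]

theorem sum_inter_union (hd : Disjoint S T) :
    ∑ v ∈ X ∩ (S ∪ T), sz v = ∑ v ∈ X ∩ S, sz v + ∑ v ∈ X ∩ T, sz v := by
  rw [inter_union_distrib_left, sum_union]
  exact hd.mono inter_subset_right inter_subset_right

theorem feas_iff : Feas A sz S m s ↔ ∃ X, ∑ v ∈ X ∩ S, sz v = s ∧ Good A m S X := by
  constructor
  · rintro ⟨X, h1, h2, h3⟩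
    exact ⟨X, by rw [inter_eq_left.2 h1]; exact h2, h3⟩
  · rintro ⟨X, h2, h3⟩
    exact ⟨X ∩ S, inter_subset_right, h2, h3.congr fun v hv => by simp [hv]⟩

/-- A set of total size `s` that is good in mode `m` in the union of `S` and `T` can be composed of
subsets of `S` and `T`, where the first has total size `s₁`. -/
def Split (A : ℕ → ℕ → Prop) (sz : ℕ → ℕ) (S T : Finset ℕ) (o m s s₁ : ℕ) : Prop :=
  s₁ ≤ s ∧
    Feas A sz S (childMode (if o = 2 then 1 else 0)
      (if s - s₁ = ∑ v ∈ T, sz v then 1 else 0) m) s₁ ∧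
    Feas A sz T (childMode (1 - if o = 0 then 1 else 0)
      (if s₁ = ∑ v ∈ S, sz v then 1 else 0) m) (s - s₁)

theorem feas_union (hS : S.Nonempty) (hT : T.Nonempty)
    (harcs : ∀ a ∈ S, ∀ b ∈ T, a ≠ b ∧ (A a b ↔ o ≠ 0) ∧ (A b a ↔ o = 2))
    (hpS : ∀ v ∈ S, 0 < sz v) (hpT : ∀ v ∈ T, 0 < sz v) :
    Feas A sz (S ∪ T) m s ↔ ∃ s₁, Split A sz S T o m s s₁ := by
  have hd : Disjoint S T := disjoint_left.2 fun a ha hb => (harcs a ha a hb).1 rfl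
  constructor
  · rintro ⟨X, hX, rfl, hg⟩
    have h1 := sum_inter_union (sz := sz) (X := X) hd
    rw [inter_eq_left.2 hX] at h1
    rw [good_union hS hT harcs] at hg
    have h2 : ∑ v ∈ X, sz v - ∑ v ∈ X ∩ S, sz v = ∑ v ∈ X ∩ T, sz v := by omega
    refine ⟨∑ v ∈ X ∩ S, sz v, by omega, ?_, ?_⟩
    · rw [h2]
      simp only [sum_eq_iff hpT]
      exact feas_iff.2 ⟨X, rfl, hg.1⟩
    · rw [h2]
      simp only [sum_eq_iff hpS]
      exact feas_iff.2 ⟨X, rfl, hg.2⟩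
  · rintro ⟨s₁, hs, ⟨X, hX, h1, h2⟩, Y, hY, h3, h4⟩
    have eX : (X ∪ Y) ∩ S = X := by
      ext v; have := @hX v; have := @hY v; have hv := fun h => disjoint_left.1 hd (h : v ∈ S)
      simp only [mem_inter, mem_union]
      tauto
    have eY : (X ∪ Y) ∩ T = Y := by
      ext v; have := @hX v; have := @hY v; have hv := fun h => disjoint_left.1 hd (h : v ∈ S)
      simp only [mem_inter, mem_union]
      tauto
    have hsX : ∑ v ∈ (X ∪ Y) ∩ S, sz v = s₁ := by rw [eX, h1]
    have hsY : ∑ v ∈ (X ∪ Y) ∩ T, sz v = s - s₁ := by rw [eY, h3]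
    refine feas_iff.2 ⟨X ∪ Y, by rw [sum_inter_union hd]; omega, ?_⟩
    rw [good_union hS hT harcs]
    rw [← hsX] at h4
    rw [← hsY] at h2
    simp only [sum_eq_iff hpS] at h4
    simp only [sum_eq_iff hpT] at h2
    refine ⟨h2.congr fun v hv => ?_, h4.congr fun v hv => ?_⟩
    · rw [← eX]; simp [hv]
    · rw [← eY]; simp [hv]

theorem feas_single {v : ℕ} (hirr : ¬ A v v) : Feas A sz {v} m s ↔
    s = sz v ∨ s = 0 ∧ m ≠ 2 := by
  constructor
  · rintro ⟨X, hX, rfl, hg⟩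
    rcases subset_singleton_iff.1 hX with rfl | rfl
    · refine Or.inr ⟨rfl, ?_⟩
      rintro rfl
      rw [good_iff (by omega)] at hg
      simpa [hirr] using hg v
    · left; simp
  · rintro (rfl | ⟨rfl, hm⟩)
    · exact ⟨{v}, subset_rfl, by simp, Or.inr (by simp)⟩
    · exact ⟨∅, by simp, rfl, Or.inr (by simp [hm])⟩

theorem feas_empty (hm : m ≠ 2) : Feas A sz S m 0 :=
  ⟨∅, by simp, rfl, Or.inr fun y _ h1 h2 => by
    rcases h1 with h1 | ⟨x, hx, hxy⟩
    · exact absurd h1 hm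
    · exact absurd (h2 x hx hxy) (by simp)⟩

end


/-! ### The tables -/

/-- The address of the table entry for the part `k`, the total size `s` and the mode `m`. The tables
follow the `6 n` records. -/
def cell (k s m : Expr) : Expr := (96 + 97) * .reg 0 + 4 * (k * (.reg 1 + 1) + s) + m

/-- The table entry for the part `k`, the total size `s` and the mode `m`. -/
def tb (n c : ℕ) (μ : ℕ → ℕ) (k s m : ℕ) : ℕ := μ (193 * n + 4 * (k * (c + 1) + s) + m)

/-- Changing a table entry. -/
def tput (n c : ℕ) (μ : ℕ → ℕ) (k s m v : ℕ) : ℕ → ℕ :=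
  Function.update μ (193 * n + 4 * (k * (c + 1) + s) + m) v

section

variable {n c k k' s s' m m' v i j : ℕ} {μ : ℕ → ℕ}

theorem tb_tput (hs : s ≤ c) (hs' : s' ≤ c) (hm : m < 4) (hm' : m' < 4) :
    tb n c (tput n c μ k s m v) k' s' m' =
      if k' = k ∧ s' = s ∧ m' = m then v else tb n c μ k' s' m' := by
  simp only [tb, tput, Function.update_apply]
  refine if_congr ⟨fun h => ?_, ?_⟩ rfl rfl
  · have h1 : m' = m := by omega
    have h2 : k' * (c + 1) + s' = k * (c + 1) + s := by omega
    have h3 : k' = k := by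
      have h4 := congrArg (· / (c + 1)) h2
      simp only [Nat.add_comm (_ * _), Nat.add_mul_div_right _ _ (Nat.succ_pos c)] at h4
      rwa [Nat.div_eq_of_lt (by omega), Nat.div_eq_of_lt (by omega), zero_add, zero_add] at h4
    subst h3
    exact ⟨rfl, by omega, h1⟩
  · rintro ⟨rfl, rfl, rfl⟩; rfl

theorem fd_tput (hj : j < 32) (hi : i < 6 * n) : fd n (tput n c μ k s m v) j i = fd n μ j i := by
  rw [fd, tput, Function.update_of_ne (by omega), fd]

theorem tb_upd (hj : j < 32) (hi : i < 6 * n) : tb n c (upd n μ j i v) k s m = tb n c μ k s m := by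
  rw [tb, upd, Function.update_of_ne (by omega), tb]

end

/-- An instance of the dynamic program: the parts of a binary decomposition of the digraph and the
sizes `sz` of the vertices; `c` is the capacity. -/
structure Parts (M : Machine) (B n c kk : ℕ) (A : ℕ → ℕ → Prop) (sz L R op : ℕ → ℕ)
    (S : ℕ → Finset ℕ) : Prop extends Ctx M B n where
  line : Line A n kk L R op S
  le : n ≤ kk
  le' : kk ≤ 4 * n
  size : ∀ v < n, M.entry 1 v = sz v
  pos : ∀ v < n, 0 < sz v
  irrefl : ∀ v, ¬ A v v
  total : ∑ v ∈ range n, sz v ≤ B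
  room : 193 * n + 16 * (n * (c + 1)) ≤ M.cells
  cap : c + 100 ≤ B

/-- The memory holds the decomposition into parts. -/
def Stored (n c kk : ℕ) (L R op : ℕ → ℕ) (σ : Store) : Prop :=
  (σ.reg 0 = n ∧ σ.reg 1 = c ∧ σ.reg 3 = kk) ∧
    ∀ k < kk, fd n σ.mem 12 k = L k ∧ fd n σ.mem 13 k = R k ∧ fd n σ.mem 14 k = op k

/-- The tables of the parts below `b` have been filled; field `17` holds the total size. -/
def Filled (n c : ℕ) (A : ℕ → ℕ → Prop) (sz : ℕ → ℕ) (S : ℕ → Finset ℕ) (b : ℕ) (μ : ℕ → ℕ) : Prop :=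
  ∀ k < b, fd n μ 17 k = ∑ v ∈ S k, sz v ∧
    ∀ s ≤ c, ∀ m ≤ 2, tb n c μ k s m ≤ 1 ∧ (tb n c μ k s m ≠ 0 ↔ Feas A sz (S k) m s)

section

variable {M : Machine} {B n c kk : ℕ} {A : ℕ → ℕ → Prop} {sz L R op : ℕ → ℕ} {S : ℕ → Finset ℕ}
  {Q : Store → ℕ → Prop} {σ : Store} {t : ℕ}

theorem Stored.set_reg (h : Stored n c kk L R op σ) {i v : ℕ} (hi : 4 ≤ i) :
    Stored n c kk L R op ⟨Function.update σ.reg i v, σ.mem⟩ := by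
  obtain ⟨⟨h0, h1, h3⟩, h⟩ := h
  refine ⟨⟨?_, ?_, ?_⟩, h⟩
  · rw [← h0]; exact Function.update_of_ne (by omega) _ _
  · rw [← h1]; exact Function.update_of_ne (by omega) _ _
  · rw [← h3]; exact Function.update_of_ne (by omega) _ _

theorem Stored.put (h : Stored n c kk L R op σ) {j i v : ℕ} (hj : 15 ≤ j) (hj' : j < 32) :
    Stored n c kk L R op ⟨σ.reg, upd n σ.mem j i v⟩ := by
  refine ⟨h.1, fun k hk => ?_⟩
  obtain ⟨h1, h2, h3⟩ := h.2 k hk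
  simp only [fd_upd hj' (show 12 < 32 by norm_num), fd_upd hj' (show 13 < 32 by norm_num),
    fd_upd hj' (show 14 < 32 by norm_num), show 12 ≠ j by omega, show 13 ≠ j by omega,
    show 14 ≠ j by omega, false_and, if_false]
  exact ⟨h1, h2, h3⟩

theorem Stored.tput (h : Stored n c kk L R op σ) (hk : kk ≤ 4 * n) {k s m v : ℕ} :
    Stored n c kk L R op ⟨σ.reg, tput n c σ.mem k s m v⟩ := by
  refine ⟨h.1, fun k hk => ?_⟩
  simp only [fd_tput (show 12 < 32 by norm_num) (show k < 6 * n by omega),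
    fd_tput (show 13 < 32 by norm_num) (show k < 6 * n by omega),
    fd_tput (show 14 < 32 by norm_num) (show k < 6 * n by omega)]
  exact h.2 k hk

theorem Parts.sum_le (h : Parts M B n c kk A sz L R op S) {k : ℕ} (hk : k < kk) :
    ∑ v ∈ S k, sz v ≤ B :=
  (sum_le_sum_of_subset (h.line.sub k hk)).trans h.total

theorem Parts.cell_lt (h : Parts M B n c kk A sz L R op S) {k s m : ℕ} (hk : k < 4 * n)
    (hs : s ≤ c) (hm : m < 4) : 193 * n + 4 * (k * (c + 1) + s) + m < M.cells := by
  have h1 : (k + 1) * (c + 1) ≤ 4 * n * (c + 1) := Nat.mul_le_mul_right _ hk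
  have h2 : 4 * n * (c + 1) = 4 * (n * (c + 1)) := by ring
  have h3 : (k + 1) * (c + 1) = k * (c + 1) + (c + 1) := by ring
  have := h.room
  omega

theorem val_cell (h0 : σ.reg 0 = n) (h1 : σ.reg 1 = c) {k s m : Expr} :
    (cell k s m).val M σ =
      193 * n + 4 * (k.val M σ * (c + 1) + s.val M σ) + m.val M σ := by
  simp [cell, h0, h1]

/-- Writing a table entry. -/
theorem wp_tput (h : Parts M B n c kk A sz L R op S) (h0 : σ.reg 0 = n) (h1 : σ.reg 1 = c)
    {k s m e : Expr} (ha : (cell k s m).Small) (he : e.Small)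
    (hs : k.Safe M σ ∧ s.Safe M σ ∧ m.Safe M σ ∧ e.Safe M σ)
    (hb : k.val M σ < 4 * n ∧ s.val M σ ≤ c ∧ m.val M σ < 4 ∧ e.val M σ ≤ B)
    (hQ : ∀ u ≤ t + 200,
      Q ⟨σ.reg, tput n c σ.mem (k.val M σ) (s.val M σ) (m.val M σ) (e.val M σ)⟩ u) :
    wp M B (.store (cell k s m) e) Q σ t := by
  have hv := val_cell (M := M) h0 h1 (k := k) (s := s) (m := m)
  refine wp_store h.toEnv ha he (by simp [cell, hs]) ?_ hs.2.2.2 hb.2.2.2 ?_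
  · rw [hv]; exact h.cell_lt hb.1 hb.2.1 hb.2.2.1
  · rw [hv]
    exact hQ _ (by have := he.cost_le; have := ha.cost_le; omega)

/-- Fills the tables of the single vertices. -/
def fillLeaves : Program :=
  forLoop 10 (.reg 0)
    (put 17 (.reg 10) (.inp 1 (.reg 10)) ;; forLoop 11 (.reg 1 + 1)
      (.store (cell (.reg 10) (.reg 11) 2) ((Expr.reg 11).eq (.inp 1 (.reg 10))) ;;
      .assign 12 (1 - (1 - (Expr.reg 11).eq (.inp 1 (.reg 10))) * (1 - (Expr.reg 11).eq 0)) ;;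
      .store (cell (.reg 10) (.reg 11) 1) (.reg 12) ;;
      .store (cell (.reg 10) (.reg 11) 0) (.reg 12)))

theorem fillLeaves_spec (h : Parts M B n c kk A sz L R op S) (hσ : Stored n c kk L R op σ)
    (hQ : ∀ ρ s, Stored n c kk L R op ρ → Filled n c A sz S n ρ.mem →
      (∀ j < 32, j ≠ 17 → ∀ i < 6 * n, fd n ρ.mem j i = fd n σ.mem j i) →
      s ≤ t + n * ((c + 1) * 1000 + 1000) + 100 → Q ρ s) :
    wp M B fillLeaves Q σ t := by
  have hC := h.toCtx
  have ⟨_, hnp, hcells, hbound⟩ := hC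
  have hcap := h.cap
  have hkk := h.le
  have hkk' := h.le'
  obtain ⟨J, hJ⟩ : ∃ J : ℕ → Store → Prop, ∀ a τ, J a τ ↔ Stored n c kk L R op τ ∧
      Filled n c A sz S a τ.mem ∧
      ∀ j < 32, j ≠ 17 → ∀ i < 6 * n, fd n τ.mem j i = fd n σ.mem j i := ⟨_, fun _ _ => Iff.rfl⟩
  refine wp_for hC J n ((c + 1) * 1000 + 900) (by omega) ((hJ _ _).2
    ⟨hσ.set_reg (by omega), fun k hk => absurd hk (by omega), fun _ _ _ _ _ => rfl⟩) ?_ ?_ ?_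
  · intro a τ _ hτ _
    simpa using ((hJ _ _).1 hτ).1.1.1
  · intro a τ s ha hτ r10
    obtain ⟨hst, hfi, hfr⟩ := (hJ _ _).1 hτ
    obtain ⟨⟨r0, r1, r3⟩, -⟩ := id hst
    have hsz := h.size a ha
    have hszB : sz a ≤ B := hsz ▸ hC.inp_le 1 a
    refine wp_seq (wp_put hC (by simp) (by simp [r10, hsz]; omega) fun s1 hs1 => ?_)
    simp [r10, hsz]
    obtain ⟨H, hH⟩ : ∃ H : ℕ → Store → Prop, ∀ b ρ, H b ρ ↔ ρ.reg 10 = a ∧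
      Stored n c kk L R op ρ ∧ Filled n c A sz S a ρ.mem ∧ fd n ρ.mem 17 a = sz a ∧
      (∀ j < 32, j ≠ 17 → ∀ i < 6 * n, fd n ρ.mem j i = fd n σ.mem j i) ∧
      ∀ s < b, s ≤ c → ∀ m ≤ 2, tb n c ρ.mem a s m =
        if s = sz a ∨ s = 0 ∧ m ≠ 2 then 1 else 0 := ⟨_, fun _ _ => Iff.rfl⟩
    refine wp_for hC H (c + 1) 800 (by omega) ((hH _ _).2 ⟨by simpa using r10,
      (hst.put (by omega) (by omega)).set_reg (by omega), fun k hk => ?_, by simp [fd_upd],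
      fun j hj hj' i hi => ?_, by omega⟩) ?_ ?_ ?_
    · obtain ⟨h1, h2⟩ := hfi k hk
      simp only [fd_upd (show 17 < 32 by norm_num) (show 17 < 32 by norm_num),
        tb_upd (show 17 < 32 by norm_num) (show a < 6 * n by omega), hk.ne, and_false, if_false]
      exact ⟨h1, h2⟩
    · simp only [fd_upd (show 17 < 32 by norm_num) hj, hj', false_and, if_false]
      exact hfr j hj hj' i hi
    · intro b ρ _ hρ _
      simpa using ((hH _ _).1 hρ).2.1.1.2.1
    · intro b ρ s2 hb hρ r11
      obtain ⟨q10, hst, hfi, h17, hfr, htb⟩ := (hH _ _).1 hρ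
      obtain ⟨⟨q0, q1, q3⟩, -⟩ := id hst
      refine wp_seq (wp_tput h q0 q1 rfl rfl (by simp) (by simp [q10, r11]; split_ifs <;> omega)
        fun s3 hs3 => ?_)
      simp [q10, r11, hsz]
      refine wp_seq (wp_set hC (by simp) (by simp; omega) fun s4 hs4 => ?_)
      simp [q10, r11, hsz]
      generalize hw : (1 - (1 - if b = sz a then 1 else 0) * (1 - if b = 0 then 1 else 0)) = w
      have hw1 : w ≤ 1 := by omega
      refine wp_seq (wp_tput h (by simpa using q0) (by simpa using q1) rfl rfl (by simp)
        (by simp [q10, r11]; omega) fun s5 hs5 => ?_)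
      simp [q10, r11]
      refine wp_tput h (by simpa using q0) (by simpa using q1) rfl rfl (by simp)
        (by simp [q10, r11]; omega) fun s6 hs6 => ?_
      simp [q10, r11]
      refine ⟨by omega, (hH _ _).2 ⟨by simpa using q10, ?_, fun k hk => ?_, ?_,
        fun j hj hj' i hi => ?_, fun s hs hsc m hm => ?_⟩⟩
      · exact ((((hst.tput hkk').set_reg (by omega)).tput hkk').tput hkk').set_reg (by omega)
      · obtain ⟨h1, h2⟩ := hfi k hk
        rw [fd_tput (by omega) (by omega), fd_tput (by omega) (by omega),
          fd_tput (by omega) (by omega)]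
        refine ⟨h1, fun s hs m hm => ?_⟩
        rw [tb_tput (by omega) hs (by omega) (by omega), tb_tput (by omega) hs (by omega)
          (by omega), tb_tput (by omega) hs (by omega) (by omega)]
        simp only [hk.ne, false_and, if_false]
        exact h2 s hs m hm
      · rw [fd_tput (by omega) (by omega), fd_tput (by omega) (by omega),
          fd_tput (by omega) (by omega), h17]
      · rw [fd_tput (by omega) (by omega), fd_tput (by omega) (by omega),
          fd_tput (by omega) (by omega), hfr j hj hj' i hi]
      · rw [tb_tput (by omega) hsc (by omega) (by omega), tb_tput (by omega) hsc (by omega)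
          (by omega), tb_tput (by omega) hsc (by omega) (by omega)]
        by_cases hsb : s = b
        · subst hsb
          have hm' : m = 0 ∨ m = 1 ∨ m = 2 := by omega
          have hw' : w = if s = sz a ∨ s = 0 then 1 else 0 := by
            rw [← hw]
            by_cases h1 : s = sz a <;> by_cases h2 : s = 0 <;> simp [h1, h2]
          rcases hm' with rfl | rfl | rfl <;> simp [hw']
        · simp only [hsb, and_false, false_and, if_false]
          exact htb s (by omega) hsc m hm
    · intro ρ s2 hρ r11 hs2
      obtain ⟨q10, hst, hfi, h17, hfr, htb⟩ := (hH _ _).1 hρ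
      refine ⟨q10, by have : (c + 1) * (800 + 100) ≤ (c + 1) * 1000 := by omega
                      omega, (hJ _ _).2 ⟨hst.set_reg (by omega), fun k hk => ?_, hfr⟩⟩
      rcases Nat.lt_or_eq_of_le (Nat.le_of_lt_succ hk) with hk | rfl
      · exact hfi k hk
      · refine ⟨by rw [h.line.leaf k ha, sum_singleton]; exact h17, fun s hs m hm => ?_⟩
        rw [h.line.leaf k ha, feas_single (h.irrefl k), htb s (by omega) hs m hm]
        split_ifs with h1 <;> simp [h1]
  · intro τ s hτ _ hs
    obtain ⟨hst, hfi, hfr⟩ := (hJ _ _).1 hτ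
    refine hQ τ s hst hfi hfr (hs.trans ?_)
    have : n * ((c + 1) * 1000 + 900 + 100) = n * ((c + 1) * 1000 + 1000) := by ring
    omega

end


/-! ### Filling the tables -/

/-- The machine expression for `childMode`. -/
def childExpr (z e m : Expr) : Expr := z * e * (2 - 2 * m.eq 0) + (1 - z) * m

/-- The mode of the left part, in register `4`, if the two parts get the total sizes `.reg 13` and
`.reg 11 - .reg 13`. -/
def modeL : Expr :=
  childExpr ((Expr.reg 6).eq 2) ((Expr.reg 11 - .reg 13).eq (get 17 (.reg 5))) (.reg 12)

/-- The mode of the right part, in register `5`. -/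
def modeR : Expr :=
  childExpr (1 - (Expr.reg 6).eq 0) ((Expr.reg 13).eq (get 17 (.reg 4))) (.reg 12)

/-- Searches for the total size of the left part in a solution of total size `.reg 11` in mode
`.reg 12`. The result is increased by `1` and stored in register `14`. -/
def search : Program :=
  .assign 14 0 ;;
  forLoop 13 (.reg 11 + 1)
    (.assign 15 modeL ;; .assign 16 modeR ;; .branch (.mem (cell (.reg 4) (.reg 13) (.reg 15)) *
        .mem (cell (.reg 5) (.reg 11 - .reg 13) (.reg 16)))
      (.assign 14 (.reg 13 + 1)) .skip)

/-- Loads the description of the part in register `7`. -/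
def loadPart : Program :=
  .assign 4 (get 12 (.reg 7)) ;; .assign 5 (get 13 (.reg 7)) ;; .assign 6 (get 14 (.reg 7))

/-- Fills the table of the part in register `7`. -/
def fillTable : Program :=
  forLoop 11 (.reg 1 + 1)
    (forLoop 12 3 (search ;; .store (cell (.reg 7) (.reg 11) (.reg 12)) (1 - (Expr.reg 14).eq 0)))

/-- Fills the tables of the composed parts. -/
def fillParts : Program :=
  forLoop 10 (.reg 3 - .reg 0)
    (.assign 7 (.reg 10 + .reg 0) ;; loadPart ;;
    put 17 (.reg 7) (get 17 (.reg 4) + get 17 (.reg 5)) ;; fillTable)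

section

variable {M : Machine} {B n c kk : ℕ} {A : ℕ → ℕ → Prop} {sz L R op : ℕ → ℕ} {S : ℕ → Finset ℕ}
  {Q : Store → ℕ → Prop} {σ : Store} {t : ℕ}

@[simp] theorem val_childExpr (z e m : Expr) :
    (childExpr z e m).val M σ = childMode (z.val M σ) (e.val M σ) (m.val M σ) := rfl

@[simp] theorem safe_childExpr (z e m : Expr) :
    (childExpr z e m).Safe M σ ↔ z.Safe M σ ∧ e.Safe M σ ∧ m.Safe M σ := by
  simp [childExpr]; tauto

theorem search_spec (h : Parts M B n c kk A sz L R op S) {b l r o m s : ℕ} (hb : b ≤ kk)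
    (hfi : Filled n c A sz S b σ.mem) (h0 : σ.reg 0 = n) (h1 : σ.reg 1 = c) (h4 : σ.reg 4 = l)
    (h5 : σ.reg 5 = r) (h6 : σ.reg 6 = o) (h11 : σ.reg 11 = s) (h12 : σ.reg 12 = m)
    (hl : l < b) (hr : r < b) (hs : s ≤ c) (hm : m ≤ 2)
    (hQ : ∀ ρ u, ρ.mem = σ.mem → (∀ i, i < 13 → ρ.reg i = σ.reg i) →
      (ρ.reg 14 = 0 → ∀ s₁, ¬ Split A sz (S l) (S r) o m s s₁) →
      (ρ.reg 14 ≠ 0 → Split A sz (S l) (S r) o m s (ρ.reg 14 - 1)) →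
      u ≤ t + (c + 1) * 1000 + 300 → Q ρ u) :
    wp M B search Q σ t := by
  have hC := h.toCtx
  have ⟨_, _, hcells, hbound⟩ := hC
  have hcap := h.cap
  have hkk' := h.le'
  obtain ⟨htl, hTl⟩ := hfi l hl
  obtain ⟨htr, hTr⟩ := hfi r hr
  refine wp_seq (wp_set hC (by simp) (by simp) fun s1 hs1 => ?_)
  simp only [Expr.val_ofNat]
  obtain ⟨J, hJ⟩ : ∃ J : ℕ → Store → Prop, ∀ a τ, J a τ ↔ τ.mem = σ.mem ∧
    (∀ i, i < 13 → τ.reg i = σ.reg i) ∧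
    (τ.reg 14 = 0 → ∀ s₁ < a, ¬ Split A sz (S l) (S r) o m s s₁) ∧
    (τ.reg 14 ≠ 0 → Split A sz (S l) (S r) o m s (τ.reg 14 - 1)) := ⟨_, fun _ _ => Iff.rfl⟩
  refine wp_for hC J (s + 1) 500 (by omega) ((hJ _ _).2 ⟨rfl, fun i hi => ?_,
    by simp, by simp⟩) ?_ ?_ ?_
  · simp [show i ≠ 13 by omega, show i ≠ 14 by omega]
  · intro a τ _ hτ _
    simp [((hJ _ _).1 hτ).2.1, h11]
  · intro a τ u ha hτ r13
    obtain ⟨hmem, hreg, hno, hyes⟩ := (hJ _ _).1 hτ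
    have q0 := (hreg 0 (by omega)).trans h0
    have q1 := (hreg 1 (by omega)).trans h1
    have q4 := (hreg 4 (by omega)).trans h4
    have q5 := (hreg 5 (by omega)).trans h5
    have q6 := (hreg 6 (by omega)).trans h6
    have q11 := (hreg 11 (by omega)).trans h11
    have q12 := (hreg 12 (by omega)).trans h12
    have e1 : (if o = 2 then 1 else 0) ≤ 1 := by split_ifs <;> omega
    have e2 : (if s - a = ∑ v ∈ S r, sz v then 1 else 0) ≤ 1 := by split_ifs <;> omega
    have e3 : (if a = ∑ v ∈ S l, sz v then 1 else 0) ≤ 1 := by split_ifs <;> omega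
    have hml := childMode_le e1 e2 hm
    have hmr := childMode_le (show (1 - if o = 0 then 1 else 0) ≤ 1 by omega) e3 hm
    refine wp_seq (wp_set hC (by simp [modeL, q0, q5]; omega)
      (by simp [modeL, q0, q5, q6, q11, q12, r13, hmem, htr]; omega) fun s2 hs2 => ?_)
    simp [modeL, q0, q5, q6, q11, q12, r13, hmem, htr]
    refine wp_seq (wp_set hC (by simp [modeR, q0, q4]; omega)
      (by simp [modeR, q0, q4, q6, q12, r13, htl]; omega) fun s3 hs3 => ?_)
    simp [modeR, q0, q4, q6, q12, r13, htl]
    have hsplit : Split A sz (S l) (S r) o m s a ↔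
        tb n c σ.mem l a (childMode (if o = 2 then 1 else 0)
          (if s - a = ∑ v ∈ S r, sz v then 1 else 0) m) ≠ 0 ∧
        tb n c σ.mem r (s - a) (childMode (1 - if o = 0 then 1 else 0)
          (if a = ∑ v ∈ S l, sz v then 1 else 0) m) ≠ 0 := by
      rw [(hTl a (by omega) _ hml).2, (hTr (s - a) (by omega) _ hmr).2, Split]
      exact and_iff_right (by omega)
    generalize childMode (if o = 2 then 1 else 0)
      (if s - a = ∑ v ∈ S r, sz v then 1 else 0) m = ml at *
    generalize childMode (1 - if o = 0 then 1 else 0)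
      (if a = ∑ v ∈ S l, sz v then 1 else 0) m = mr at *
    have c1 := h.cell_lt (k := l) (s := a) (m := ml) (by omega) (by omega) (by omega)
    have c2 := h.cell_lt (k := r) (s := s - a) (m := mr) (by omega) (by omega) (by omega)
    refine wp_if hC ?_ (fun hne s4 hs4 => ?_) (fun heq s4 hs4 => ?_)
    · simp [cell, q0, q1, q4, q5, q11, r13]
      exact ⟨by omega, by omega⟩
    · simp [cell, q0, q1, q4, q5, q11, r13] at hne
      have hsp := hsplit.2 hne
      refine wp_set hC (by simp) (by simp [r13]; omega) fun s5 hs5 => ?_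
      simp [r13]
      refine ⟨by omega, (hJ _ _).2 ⟨rfl, fun i hi => ?_, by simp, fun _ => by simpa using hsp⟩⟩
      simp [show i ≠ 13 by omega, show i ≠ 14 by omega, show i ≠ 15 by omega,
        show i ≠ 16 by omega, hreg i hi]
    · simp [cell, q0, q1, q4, q5, q11, r13] at heq
      have hsp : ¬ Split A sz (S l) (S r) o m s a := fun hh => by
        have := hsplit.1 hh
        simp only [tb] at this; tauto
      refine wp_skip ⟨by simpa using r13, by omega, (hJ _ _).2 ⟨rfl, fun i hi => ?_, fun h14 s₁ hs₁ => ?_,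
        fun h14 => ?_⟩⟩
      · simp [show i ≠ 13 by omega, show i ≠ 15 by omega, show i ≠ 16 by omega, hreg i hi]
      · rcases Nat.lt_or_eq_of_le (Nat.le_of_lt_succ hs₁) with h' | rfl
        · exact hno (by simpa using h14) s₁ h'
        · exact hsp
      · simpa using hyes (by simpa using h14)
  · intro τ u hτ _ hu
    obtain ⟨hmem, hreg, hno, hyes⟩ := (hJ _ _).1 hτ
    refine hQ τ u hmem hreg (fun h14 s₁ hs₁ => hno h14 s₁ (by have := hs₁.1; omega) hs₁) hyes ?_
    have : (s + 1) * (500 + 100) ≤ (c + 1) * 1000 := Nat.mul_le_mul (by omega) (by omega)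
    omega

theorem loadPart_spec (h : Parts M B n c kk A sz L R op S) (hσ : Stored n c kk L R op σ) {k : ℕ}
    (hk : k < kk) (h7 : σ.reg 7 = k) (hk' : n ≤ k)
    (hQ : ∀ ρ u, ρ.mem = σ.mem → (∀ i, i ≠ 4 → i ≠ 5 → i ≠ 6 → ρ.reg i = σ.reg i) →
      ρ.reg 4 = L k → ρ.reg 5 = R k → ρ.reg 6 = op k → u ≤ t + 300 → Q ρ u) :
    wp M B loadPart Q σ t := by
  have hC := h.toCtx
  have ⟨_, _, hcells, hbound⟩ := hC
  have hkk' := h.le'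
  obtain ⟨⟨r0, r1, r3⟩, hp⟩ := hσ
  obtain ⟨h12, h13, h14⟩ := hp k hk
  obtain ⟨hL, hR⟩ := h.line.lt k hk' hk
  have hop := h.line.op_le k hk' hk
  refine wp_seq (wp_set hC (by simp [r0, h7]; omega) (by simp [r0, h7, h12]; omega)
    fun s2 hs2 => ?_)
  simp [r0, h7, h12]
  refine wp_seq (wp_set hC (by simp [r0, h7]; omega) (by simp [r0, h7, h13]; omega)
    fun s3 hs3 => ?_)
  simp [r0, h7, h13]
  refine wp_set hC (by simp [r0, h7]; omega) (by simp [r0, h7, h14]; omega)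
    fun s4 hs4 => ?_
  simp only [val_get, Expr.val_reg, Expr.val_ofNat]
  refine hQ _ _ rfl (fun i h4 h5 h6 => by simp [h4, h5, h6]) (by simp) (by simp)
    (by simp [r0, h7, h14]) (by omega)

theorem fillTable_spec (h : Parts M B n c kk A sz L R op S) {k : ℕ} (hk : n ≤ k) (hk' : k < kk)
    (hr : σ.reg 7 = k ∧ σ.reg 4 = L k ∧ σ.reg 5 = R k ∧ σ.reg 6 = op k)
    (hσ : Stored n c kk L R op σ) (hf : Filled n c A sz S k σ.mem)
    (h17 : fd n σ.mem 17 k = ∑ v ∈ S k, sz v)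
    (hQ : ∀ ρ s, Stored n c kk L R op ρ → Filled n c A sz S (k + 1) ρ.mem →
      (∀ j < 32, ∀ i < 6 * n, fd n ρ.mem j i = fd n σ.mem j i) → ρ.reg 10 = σ.reg 10 →
      s ≤ t + (c + 1) * ((c + 1) * 3000 + 3000) + 100 → Q ρ s) :
    wp M B fillTable Q σ t := by
  have hC := h.toCtx
  have ⟨_, _, hcells, hbound⟩ := hC
  have hcap := h.cap
  have hkk' := h.le'
  obtain ⟨hL, hR⟩ := h.line.lt k hk hk'
  have hpos : ∀ k < kk, ∀ v ∈ S k, 0 < sz v := fun k hk v hv =>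
    h.pos v (mem_range.1 (h.line.sub k hk hv))
  have hfeas : ∀ m s, Feas A sz (S k) m s ↔
      ∃ s₁, Split A sz (S (L k)) (S (R k)) (op k) m s s₁ := fun m s => by
    rw [h.line.union k hk hk']
    exact feas_union (h.line.nonempty _ (by omega)) (h.line.nonempty _ (by omega))
      (h.line.arcs k hk hk') (hpos _ (by omega)) (hpos _ (by omega))
  -- the entries up to `(b, d)` have been filled
  obtain ⟨H, hH⟩ : ∃ H : ℕ → ℕ → Store → Prop, ∀ b d ρ, H b d ρ ↔
    (ρ.reg 7 = k ∧ ρ.reg 4 = L k ∧ ρ.reg 5 = R k ∧ ρ.reg 6 = op k) ∧ ρ.reg 10 = σ.reg 10 ∧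
    Stored n c kk L R op ρ ∧ Filled n c A sz S k ρ.mem ∧
    (∀ j < 32, ∀ i < 6 * n, fd n ρ.mem j i = fd n σ.mem j i) ∧
    ∀ s ≤ c, ∀ m ≤ 2, s < b ∨ s = b ∧ m < d → tb n c ρ.mem k s m ≤ 1 ∧
      (tb n c ρ.mem k s m ≠ 0 ↔ Feas A sz (S k) m s) := ⟨_, fun _ _ _ => Iff.rfl⟩
  refine wp_for hC (fun b ρ => H b 0 ρ) (c + 1) (3 * ((c + 1) * 1000 + 900) + 100)
    (by omega) ((hH _ _ _).2 ⟨hr, rfl, hσ.set_reg (by omega), hf, fun _ _ _ _ => rfl, by omega⟩)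
    ?_ ?_ ?_
  · intro b ρ _ hρ _
    simpa using ((hH _ _ _).1 hρ).2.2.1.1.2.1
  · intro b ρ s4 hb hρ r11
    obtain ⟨hregs, h10, hst, hfi, hfr, htb⟩ := (hH _ _ _).1 hρ
    refine wp_for hC (fun d ρ => ρ.reg 11 = b ∧ H b d ρ) 3 ((c + 1) * 1000 + 800)
      (by omega) ⟨by simpa using r11, (hH _ _ _).2 ⟨by simpa using hregs, by simpa using h10,
        hst.set_reg (by omega), hfi, hfr, htb⟩⟩ ?_ ?_ ?_
    · intro d ρ _ hρ _
      simp
    · rintro d ρ s5 hd ⟨r11, hρ⟩ r12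
      obtain ⟨⟨q7, q4, q5, q6⟩, h10, hst, hfi, hfr, htb⟩ := (hH _ _ _).1 hρ
      obtain ⟨⟨q0, q1, q3⟩, -⟩ := id hst
      refine wp_seq (search_spec h (b := k) hk'.le hfi q0 q1 q4 q5 q6 r11 r12 hL hR
        (by omega) (by omega) fun υ s6 hmem hreg hno hyes hs6 => ?_)
      have hfd : υ.reg 14 ≠ 0 ↔ Feas A sz (S k) d b := by
        rw [hfeas]
        refine ⟨fun hh => ⟨_, hyes hh⟩, fun ⟨s₁, hs₁⟩ hh => hno hh s₁ hs₁⟩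
      have u0 := (hreg 0 (by omega)).trans q0
      have u1 := (hreg 1 (by omega)).trans q1
      have u7 := (hreg 7 (by omega)).trans q7
      have u11 := (hreg 11 (by omega)).trans r11
      have u12 := (hreg 12 (by omega)).trans r12
      have hstυ : Stored n c kk L R op υ :=
        ⟨⟨u0, u1, (hreg 3 (by omega)).trans q3⟩, hmem ▸ hst.2⟩
      refine wp_tput h u0 u1 rfl rfl (by simp) (by simp [u7, u11, u12]; omega)
        fun s7 hs7 => ?_
      simp [u7, u11, u12, hmem]
      refine ⟨by omega, (hH _ _ _).2 ⟨?_, ?_, ?_, fun k' hkk => ?_, fun j hj i hi => ?_,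
        fun s hs m hm hsm => ?_⟩⟩
      · simp [u7, (hreg 4 (by omega)).trans q4, (hreg 5 (by omega)).trans q5,
          (hreg 6 (by omega)).trans q6]
      · simp [(hreg 10 (by omega)).trans h10]
      · have := (hstυ.tput hkk' (k := k) (s := b) (m := d)
          (v := 1 - if υ.reg 14 = 0 then 1 else 0)).set_reg (i := 12) (v := d + 1) (by omega)
        rwa [hmem] at this
      · obtain ⟨h1, h2⟩ := hfi k' hkk
        rw [fd_tput (by omega) (by omega)]
        refine ⟨h1, fun s hs m hm => ?_⟩
        rw [tb_tput (by omega) hs (by omega) (by omega)]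
        simp only [hkk.ne, false_and, if_false]
        exact h2 s hs m hm
      · rw [fd_tput (by omega) (by omega), hfr j hj i hi]
      · rw [tb_tput (by omega) hs (by omega) (by omega)]
        by_cases hsd : s = b ∧ m = d
        · obtain ⟨rfl, rfl⟩ := hsd
          simp only [and_self, if_true]
          refine ⟨by omega, ?_⟩
          rw [← hfd]
          split_ifs with h14 <;> simp [h14]
        · rw [if_neg (by tauto)]
          exact htb s hs m hm (by omega)
    · rintro ρ s5 ⟨r11, hρ⟩ _ hs5
      obtain ⟨hregs, h10, hst, hfi, hfr, htb⟩ := (hH _ _ _).1 hρ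
      exact ⟨r11, by omega, (hH _ _ _).2 ⟨by simpa using hregs, by simpa using h10,
        hst.set_reg (by omega), hfi, hfr, fun s hs m hm hsm => htb s hs m hm (by omega)⟩⟩
  · intro ρ s4 hρ _ hs4
    obtain ⟨hregs, h10, hst, hfi, hfr, htb⟩ := (hH _ _ _).1 hρ
    refine hQ ρ s4 hst (fun k' hkk => ?_) hfr h10 ?_
    · rcases Nat.lt_or_eq_of_le (Nat.le_of_lt_succ hkk) with hkk | rfl
      · exact hfi k' hkk
      · exact ⟨(hfr 17 (by omega) _ (by omega)).trans h17,
          fun s hs m hm => htb s hs m hm (by omega)⟩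
    · have : 3 * ((c + 1) * 1000 + 900) + 100 + 100 ≤ (c + 1) * 3000 + 3000 := by omega
      exact hs4.trans (Nat.add_le_add_right (Nat.add_le_add_left (Nat.mul_le_mul_left _ this) _) _)

theorem fillParts_spec (h : Parts M B n c kk A sz L R op S) (hσ : Stored n c kk L R op σ)
    (hf : Filled n c A sz S n σ.mem)
    (hQ : ∀ ρ s, Stored n c kk L R op ρ → Filled n c A sz S kk ρ.mem →
      (∀ j < 32, j ≠ 17 → ∀ i < 6 * n, fd n ρ.mem j i = fd n σ.mem j i) →
      s ≤ t + 3 * n * ((c + 1) * ((c + 1) * 3000 + 3000) + 2000) + 100 → Q ρ s) :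
    wp M B fillParts Q σ t := by
  have hC := h.toCtx
  have ⟨_, hnp, hcells, hbound⟩ := hC
  have hcap := h.cap
  have hkk := h.le
  have hkk' := h.le'
  obtain ⟨J, hJ⟩ : ∃ J : ℕ → Store → Prop, ∀ a τ, J a τ ↔ Stored n c kk L R op τ ∧
      Filled n c A sz S (n + a) τ.mem ∧
      ∀ j < 32, j ≠ 17 → ∀ i < 6 * n, fd n τ.mem j i = fd n σ.mem j i := ⟨_, fun _ _ => Iff.rfl⟩
  refine wp_for hC J (kk - n) ((c + 1) * ((c + 1) * 3000 + 3000) + 1500) (by omega)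
    ((hJ _ _).2 ⟨hσ.set_reg (by omega), hf, fun _ _ _ _ _ => rfl⟩) ?_ ?_ ?_
  · intro a τ _ hτ _
    have := ((hJ _ _).1 hτ).1.1
    simp [this.1, this.2.2]
  · intro a τ s ha hτ r10
    obtain ⟨hst, hfi, hfr⟩ := (hJ _ _).1 hτ
    obtain ⟨⟨r0, r1, r3⟩, -⟩ := id hst
    obtain ⟨hL, hR⟩ := h.line.lt (n + a) (by omega) (by omega)
    have harcs := h.line.arcs (n + a) (by omega) (by omega)
    have hun := h.line.union (n + a) (by omega) (by omega)
    have hdisj : Disjoint (S (L (n + a))) (S (R (n + a))) :=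
      disjoint_left.2 fun x hx hy => (harcs x hx x hy).1 rfl
    have hsum : ∑ v ∈ S (L (n + a)), sz v + ∑ v ∈ S (R (n + a)), sz v =
        ∑ v ∈ S (n + a), sz v := by rw [hun, sum_union hdisj]
    have hsumB := h.sum_le (k := n + a) (by omega)
    obtain ⟨htl, -⟩ := hfi _ hL
    obtain ⟨htr, -⟩ := hfi _ hR
    refine wp_seq (wp_set hC (by simp) (by simp [r0, r10]; omega) fun s1 hs1 => ?_)
    simp only [Expr.val_add, Expr.val_reg, r0, r10]
    rw [Nat.add_comm a n]
    refine wp_seq (loadPart_spec h (hst.set_reg (by omega)) (k := n + a) (by omega) (by simp)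
      (by omega) fun ρ s2 hmem hreg h4 h5 h6 hs2 => ?_)
    replace hmem : ρ.mem = τ.mem := hmem
    have q0 : ρ.reg 0 = n := (hreg 0 (by omega) (by omega) (by omega)).trans (by simpa using r0)
    have q1 : ρ.reg 1 = c := (hreg 1 (by omega) (by omega) (by omega)).trans (by simpa using r1)
    have q3 : ρ.reg 3 = kk := (hreg 3 (by omega) (by omega) (by omega)).trans (by simpa using r3)
    have q7 : ρ.reg 7 = n + a := (hreg 7 (by omega) (by omega) (by omega)).trans (by simp)
    have q10 : ρ.reg 10 = a := (hreg 10 (by omega) (by omega) (by omega)).trans (by simpa using r10)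
    have hstρ : Stored n c kk L R op ρ := ⟨⟨q0, q1, q3⟩, hmem ▸ hst.2⟩
    refine wp_seq (wp_put hC (by simp [q0, h4, h5]; omega)
      (by simp [q0, q7, h4, h5, hmem, htl, htr]; omega) fun s3 hs3 => ?_)
    simp [q0, q7, h4, h5, hmem, htl, htr, hsum]
    refine fillTable_spec h (k := n + a) (by omega) (by omega) ⟨q7, h4, h5, h6⟩
      (hmem ▸ hstρ.put (by omega) (by omega)) (fun k hk => ?_) (by simp [fd_upd])
      fun ρ' s4 hst' hfi' hfr' h10' hs4 => ⟨h10'.trans q10, by omega, (hJ _ _).2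
        ⟨hst'.set_reg (by omega), hfi', fun j hj hj' i hi => ?_⟩⟩
    · obtain ⟨h1, h2⟩ := hfi k hk
      simp only [fd_upd (show 17 < 32 by norm_num) (show 17 < 32 by norm_num),
        tb_upd (show 17 < 32 by norm_num) (show n + a < 6 * n by omega), hk.ne, and_false, if_false]
      exact ⟨h1, h2⟩
    · rw [hfr' j hj i hi]
      simp only [fd_upd (show 17 < 32 by norm_num) hj, hj', false_and, if_false]
      exact hfr j hj hj' i hi
  · intro τ s hτ _ hs
    obtain ⟨hst, hfi, hfr⟩ := (hJ _ _).1 hτ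
    rw [show n + (kk - n) = kk by omega] at hfi
    refine hQ τ s hst hfi hfr (hs.trans ?_)
    have : (kk - n) * ((c + 1) * ((c + 1) * 3000 + 3000) + 1500 + 100) ≤
      3 * n * ((c + 1) * ((c + 1) * 3000 + 3000) + 2000) := Nat.mul_le_mul (by omega) (by omega)
    omega

end


/-! ### Reading off an optimal solution -/

/-- Determines the largest total size, at most the capacity, of a feasible solution; the part of all
vertices is in field `11` of the root. The fields `18` and `19` of a part are to hold the mode and
the total size of the solution in this part. -/
def findBest : Program :=
  .assign 8 (get 11 (.reg 0 + 1)) ;; .assign 9 0 ;;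
  forLoop 10 (.reg 1 + 1)
    (.branch (.mem (cell (.reg 8) (.reg 10) 1)) (.assign 9 (.reg 10)) .skip) ;;
  put 18 (.reg 8) 1 ;; put 19 (.reg 8) (.reg 9)

/-- Stores the modes and the total sizes for the two subparts. -/
def assignParts : Program :=
  .assign 13 (.reg 14 - 1) ;; .assign 15 modeL ;; .assign 16 modeR ;;
  put 18 (.reg 4) (.reg 15) ;; put 19 (.reg 4) (.reg 13) ;;
  put 18 (.reg 5) (.reg 16) ;; put 19 (.reg 5) (.reg 11 - .reg 13)

/-- Distributes the modes and the total sizes from the parts to their subparts. -/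
def backtrack : Program :=
  forLoop 10 (.reg 3 - .reg 0)
    (.assign 7 (.reg 3 - 1 - .reg 10) ;; loadPart ;;
    .assign 11 (get 19 (.reg 7)) ;; .assign 12 (get 18 (.reg 7)) ;; search ;;
    assignParts)

/-- Writes the characteristic vector of the solution. -/
def writeOutput : Program :=
  forLoop 10 (.reg 0) (.store (.reg 10) (Expr.lt 0 (get 19 (.reg 10))))

/-- The modes `f` and total sizes `g` of the subparts of `k` are consistent with those of `k`. -/
def Consistent (sz L R op : ℕ → ℕ) (S : ℕ → Finset ℕ) (f g : ℕ → ℕ) (k : ℕ) : Prop :=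
  g (L k) + g (R k) = g k ∧
  f (L k) = childMode (if op k = 2 then 1 else 0)
    (if g (R k) = ∑ v ∈ S (R k), sz v then 1 else 0) (f k) ∧
  f (R k) = childMode (1 - if op k = 0 then 1 else 0)
    (if g (L k) = ∑ v ∈ S (L k), sz v then 1 else 0) (f k)

section

variable {M : Machine} {B n c kk : ℕ} {A : ℕ → ℕ → Prop} {sz L R op : ℕ → ℕ} {S : ℕ → Finset ℕ}
  {Q : Store → ℕ → Prop} {σ : Store} {t : ℕ}

theorem Line.ne (h : Line A n kk L R op S) {k : ℕ} (hk : n ≤ k) (hk' : k < kk) : L k ≠ R k := by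
  intro he
  obtain ⟨hl, -⟩ := h.lt k hk hk'
  obtain ⟨a, ha⟩ := h.nonempty (L k) (by omega)
  exact (h.arcs k hk hk' a ha a (he ▸ ha)).1 rfl

/-- If the modes and total sizes are consistent and possible for the single vertices, then the
vertices of positive total size form a solution that realizes them for all parts. -/
theorem Line.realize (h : Line A n kk L R op S) (hpos : ∀ v < n, 0 < sz v) {f g : ℕ → ℕ}
    {X : Finset ℕ} (hX : ∀ v < n, v ∈ X ↔ 0 < g v)
    (hleaf : ∀ v < n, Feas A sz (S v) (f v) (g v))
    (hcons : ∀ k, n ≤ k → k < kk → Consistent sz L R op S f g k) :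
    ∀ k < kk, ∑ v ∈ X ∩ S k, sz v = g k ∧ Good A (f k) (S k) X := by
  intro k
  induction k using Nat.strong_induction_on with
  | _ k ih =>
    intro hk
    by_cases hkn : k < n
    · obtain ⟨Y, hY, h1, h2⟩ := hleaf k hkn
      rw [h.leaf k hkn] at hY h2 ⊢
      have hk0 := hpos k hkn
      have hiff : k ∈ X ↔ k ∈ Y := by
        rw [hX k hkn, ← h1]
        rcases subset_singleton_iff.1 hY with rfl | rfl
        · simp
        · simp [hk0]
      have hXY : X ∩ {k} = Y := by
        ext v
        rw [mem_inter, mem_singleton]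
        constructor
        · rintro ⟨h3, rfl⟩; exact hiff.1 h3
        · intro h3
          obtain rfl := mem_singleton.1 (hY h3)
          exact ⟨hiff.2 h3, rfl⟩
      refine ⟨by rw [hXY, h1], h2.congr fun v hv => ?_⟩
      obtain rfl := mem_singleton.1 hv
      exact hiff.symm
    · obtain ⟨hl, hr⟩ := h.lt k (by omega) hk
      obtain ⟨h1, h2⟩ := ih _ hl (by omega)
      obtain ⟨h3, h4⟩ := ih _ hr (by omega)
      obtain ⟨c1, c2, c3⟩ := hcons k (by omega) hk
      have harcs := h.arcs k (by omega) hk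
      have hd : Disjoint (S (L k)) (S (R k)) :=
        disjoint_left.2 fun x hx hy => (harcs x hx x hy).1 rfl
      have hp : ∀ k < kk, ∀ v ∈ S k, 0 < sz v := fun k hk v hv =>
        hpos v (mem_range.1 (h.sub k hk hv))
      rw [h.union k (by omega) hk, sum_inter_union hd, good_union (h.nonempty _ (by omega))
        (h.nonempty _ (by omega)) harcs]
      rw [c2, ← h3] at h2
      rw [c3, ← h1] at h4
      simp only [sum_eq_iff (hp _ (show R k < kk by omega))] at h2
      simp only [sum_eq_iff (hp _ (show L k < kk by omega))] at h4
      exact ⟨by omega, h2, h4⟩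

theorem findBest_spec (h : Parts M B n c kk A sz L R op S) (hσ : Stored n c kk L R op σ) {rt : ℕ}
    (hf : Filled n c A sz S kk σ.mem) (hrt : fd n σ.mem 11 (n + 1) = rt) (hrk : rt < kk)
    (hz : ∀ k < kk, fd n σ.mem 18 k = 0 ∧ fd n σ.mem 19 k = 0)
    (hQ : ∀ ρ s b, Stored n c kk L R op ρ → Filled n c A sz S kk ρ.mem →
      (∀ k < kk, fd n ρ.mem 18 k = if k = rt then 1 else 0) →
      (∀ k < kk, fd n ρ.mem 19 k = if k = rt then b else 0) → b ≤ c →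
      Feas A sz (S rt) 1 b → (∀ s ≤ c, Feas A sz (S rt) 1 s → s ≤ b) →
      s ≤ t + (c + 1) * 500 + 1000 → Q ρ s) :
    wp M B findBest Q σ t := by
  have hC := h.toCtx
  have ⟨_, hnp, hcells, hbound⟩ := hC
  have hcap := h.cap
  have hkk' := h.le'
  obtain ⟨-, hT⟩ := hf rt hrk
  obtain ⟨⟨r0, r1, r3⟩, -⟩ := id hσ
  refine wp_seq (wp_set hC (by simp [r0]; omega) (by simp [r0, hrt]; omega) fun s1 hs1 => ?_)
  simp [r0, hrt]
  refine wp_seq (wp_set hC (by simp) (by simp) fun s2 hs2 => ?_)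
  simp
  obtain ⟨J, hJ⟩ : ∃ J : ℕ → Store → Prop, ∀ a τ, J a τ ↔ τ.mem = σ.mem ∧
    Stored n c kk L R op τ ∧ τ.reg 8 = rt ∧ τ.reg 9 ≤ c ∧ Feas A sz (S rt) 1 (τ.reg 9) ∧
    ∀ s < a, Feas A sz (S rt) 1 s → s ≤ τ.reg 9 := ⟨_, fun _ _ => Iff.rfl⟩
  refine wp_seq (wp_for hC J (c + 1) 300 (by omega) ((hJ _ _).2 ⟨rfl, ?_, by simp, by simp,
    by simpa using feas_empty (by omega), by omega⟩) ?_ ?_ ?_)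
  · exact ((hσ.set_reg (by omega)).set_reg (by omega)).set_reg (by omega)
  · intro a τ _ hτ _
    simpa using ((hJ _ _).1 hτ).2.1.1.2.1
  · intro a τ u ha hτ r10
    obtain ⟨hmem, hst, r8, hle, hfe, hmax⟩ := (hJ _ _).1 hτ
    obtain ⟨⟨q0, q1, q3⟩, -⟩ := id hst
    have hcell := h.cell_lt (k := rt) (s := a) (m := 1) (by omega) (by omega) (by omega)
    have htb := (hT a (by omega) 1 (by omega)).2
    rw [tb, ← hmem] at htb
    refine wp_if hC (by simp [cell, q0, q1, r8, r10]; omega) (fun hne s3 hs3 => ?_)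
      (fun heq s3 hs3 => ?_)
    · simp only [Expr.val_mem, val_cell q0 q1, Expr.val_reg, r8, r10, Expr.val_ofNat] at hne
      refine wp_set hC (by simp) (by simp [r10]; omega) fun s4 hs4 => ?_
      simp [r10]
      refine ⟨by omega, (hJ _ _).2 ⟨hmem, (hst.set_reg (by omega)).set_reg (by omega),
        by simpa using r8, by simp; omega, by simpa using htb.1 hne, fun s hs _ => by simp; omega⟩⟩
    · simp only [Expr.val_mem, val_cell q0 q1, Expr.val_reg, r8, r10, Expr.val_ofNat] at heq
      refine wp_skip ⟨r10, by omega, (hJ _ _).2 ⟨hmem, hst.set_reg (by omega), by simpa using r8,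
        by simpa using hle, by simpa using hfe, fun s hs hfs => ?_⟩⟩
      rcases Nat.lt_or_eq_of_le (Nat.le_of_lt_succ hs) with hs | rfl
      · simpa using hmax s hs hfs
      · exact absurd heq (htb.2 hfs)
  · intro τ s3 hτ _ hs3
    obtain ⟨hmem, hst, r8, hle, hfe, hmax⟩ := (hJ _ _).1 hτ
    obtain ⟨⟨q0, q1, q3⟩, -⟩ := id hst
    refine wp_seq (wp_put hC (by simp) (by simp [r8]; omega) fun s4 hs4 => ?_)
    simp [r8]
    refine wp_put hC (by simp) (by simp [r8]; omega) fun s5 hs5 => ?_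
    simp [r8]
    refine hQ _ s5 (τ.reg 9) ((hst.put (by omega) (by omega)).put (by omega) (by omega))
      (fun k hk => ?_) (fun k hk => ?_) (fun k hk => ?_) hle hfe (fun s hs => hmax s (by omega))
      (by omega)
    · obtain ⟨h1, h2⟩ := hf k hk
      rw [← hmem] at h1 h2
      refine ⟨by simp [fd_upd, h1], fun s hs m hm => ?_⟩
      rw [tb_upd (by omega) (by omega), tb_upd (by omega) (by omega)]
      exact h2 s hs m hm
    · simp [fd_upd, hmem, (hz k hk).1]
    · simp [fd_upd, hmem, (hz k hk).2]

theorem assignParts_spec (h : Parts M B n c kk A sz L R op S) {l r o m s s₁ : ℕ}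
    (h0 : σ.reg 0 = n) (h4 : σ.reg 4 = l) (h5 : σ.reg 5 = r) (h6 : σ.reg 6 = o)
    (h11 : σ.reg 11 = s) (h12 : σ.reg 12 = m) (h14 : σ.reg 14 - 1 = s₁) (hl : l < kk) (hr : r < kk)
    (hs : s ≤ c) (hs₁ : s₁ ≤ s) (hm : m ≤ 2) (htl : fd n σ.mem 17 l = ∑ v ∈ S l, sz v)
    (htr : fd n σ.mem 17 r = ∑ v ∈ S r, sz v) {ml mr : ℕ}
    (hml : ml = childMode (if o = 2 then 1 else 0) (if s - s₁ = ∑ v ∈ S r, sz v then 1 else 0) m)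
    (hmr : mr = childMode (1 - if o = 0 then 1 else 0) (if s₁ = ∑ v ∈ S l, sz v then 1 else 0) m)
    (hQ : ∀ ρ u, ρ.mem = upd n (upd n (upd n (upd n σ.mem 18 l ml) 19 l s₁) 18 r mr) 19 r (s - s₁) →
      (∀ i, i < 13 → ρ.reg i = σ.reg i) → u ≤ t + 1200 → Q ρ u) :
    wp M B assignParts Q σ t := by
  have hC := h.toCtx
  have ⟨_, _, hcells, hbound⟩ := hC
  have hcap := h.cap
  have hkk' := h.le'
  have hml2 := childMode_le (z := if o = 2 then 1 else 0)
    (e := if s - s₁ = ∑ v ∈ S r, sz v then 1 else 0) (by split_ifs <;> omega)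
    (by split_ifs <;> omega) hm
  have hmr2 := childMode_le (z := 1 - if o = 0 then 1 else 0)
    (e := if s₁ = ∑ v ∈ S l, sz v then 1 else 0) (by omega) (by split_ifs <;> omega) hm
  rw [← hml] at hml2
  rw [← hmr] at hmr2
  refine wp_seq (wp_set hC (by simp) (by simp; omega) fun s6 hs6 => ?_)
  simp only [Expr.val_sub, Expr.val_reg, Expr.val_ofNat, h14]
  refine wp_seq (wp_set hC (by simp [modeL, h0, h5]; omega)
    (by simp [modeL, h0, h5, h6, h11, h12, htr, ← hml]; omega) fun s7 hs7 => ?_)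
  simp [modeL, h0, h5, h6, h11, h12, htr, ← hml]
  refine wp_seq (wp_set hC (by simp [modeR, h0, h4]; omega)
    (by simp [modeR, h0, h4, h6, h12, htl, ← hmr]; omega) fun s8 hs8 => ?_)
  simp [modeR, h0, h4, h6, h12, htl, ← hmr]
  refine wp_seq (wp_put hC (by simp) (by simp [h4]; omega) fun s9 hs9 => ?_)
  simp [h4]
  refine wp_seq (wp_put hC (by simp) (by simp [h4]; omega) fun s10 hs10 => ?_)
  simp [h4]
  refine wp_seq (wp_put hC (by simp) (by simp [h5]; omega) fun s11 hs11 => ?_)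
  simp [h5]
  refine wp_put hC (by simp) (by simp [h5, h11]; omega)
    fun s12 hs12 => ?_
  simp [h5, h11]
  refine hQ _ _ rfl (fun i hi => ?_) (by omega)
  simp [show i ≠ 13 by omega, show i ≠ 15 by omega, show i ≠ 16 by omega]

/-- Storing the modes and total sizes of the subparts of `k` makes them consistent with those of
`k`, and no other part is affected, as no part is used twice. -/
theorem Line.distribute (h : Line A n kk L R op S) {k s₁ a : ℕ} (hkn : n ≤ k) (hk : kk - (a + 1) = k)
    (ha : a + 1 ≤ kk) {f g f' g' : ℕ → ℕ}
    (hsp : Split A sz (S (L k)) (S (R k)) (op k) (f k) (g k) s₁)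
    (hfeas : ∀ k < kk, f k ≤ 2 ∧ g k ≤ c ∧ Feas A sz (S k) (f k) (g k))
    (hcons : ∀ k, kk - a ≤ k → k < kk → Consistent sz L R op S f g k)
    (hf : ∀ j, f' j = if j = R k then childMode (1 - if op k = 0 then 1 else 0)
        (if s₁ = ∑ v ∈ S (L k), sz v then 1 else 0) (f k) else if j = L k then
      childMode (if op k = 2 then 1 else 0) (if g k - s₁ = ∑ v ∈ S (R k), sz v then 1 else 0) (f k)
      else f j)
    (hg : ∀ j, g' j = if j = R k then g k - s₁ else if j = L k then s₁ else g j) :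
    (∀ k < kk, f' k ≤ 2 ∧ g' k ≤ c ∧ Feas A sz (S k) (f' k) (g' k)) ∧
      ∀ k, kk - (a + 1) ≤ k → k < kk → Consistent sz L R op S f' g' k := by
  have hkk : k < kk := by omega
  obtain ⟨hL, hR⟩ := h.lt k hkn hkk
  have hLR := h.ne hkn hkk
  obtain ⟨g1, g2, g3⟩ := hsp
  obtain ⟨f1, f2, -⟩ := hfeas k hkk
  refine ⟨fun j hj => ?_, fun k' hk' hk2 => ?_⟩
  · rw [hf, hg]
    by_cases h1 : j = R k
    · rw [if_pos h1, if_pos h1, h1]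
      exact ⟨childMode_le (by omega) (by split_ifs <;> omega) f1, by omega, g3⟩
    · rw [if_neg h1, if_neg h1]
      by_cases h2 : j = L k
      · rw [if_pos h2, if_pos h2, h2]
        exact ⟨childMode_le (by split_ifs <;> omega) (by split_ifs <;> omega) f1, by omega, g2⟩
      · rw [if_neg h2, if_neg h2]
        exact hfeas j hj
  · by_cases hkk3 : k' = k
    · subst hkk3
      simp only [Consistent, hf, hg, if_true, hLR, hL.ne', hR.ne', if_false, and_true]
      omega
    · obtain ⟨n1, n2, n3⟩ := h.uniq k k' hkn hkk (by omega) hk2 (Ne.symm hkk3)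
      obtain ⟨-, n4, -⟩ := h.uniq k' k (by omega) hk2 hkn hkk hkk3
      have h1 := hcons k' (by omega) hk2
      simp only [Consistent, hf, hg, n1.symm, n2.symm, n3.symm, n4,
        show k' ≠ L k by omega, show k' ≠ R k by omega, if_false]
      exact h1

theorem backtrack_spec (h : Parts M B n c kk A sz L R op S) (hσ : Stored n c kk L R op σ)
    {rt b : ℕ} (hf : Filled n c A sz S kk σ.mem) (hrk : rt < kk) (hroot : S rt = range n)
    (h18 : ∀ k < kk, fd n σ.mem 18 k = if k = rt then 1 else 0)
    (h19 : ∀ k < kk, fd n σ.mem 19 k = if k = rt then b else 0) (hb : b ≤ c)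
    (hfe : Feas A sz (S rt) 1 b)
    (hQ : ∀ ρ s, Stored n c kk L R op ρ → fd n ρ.mem 18 rt = 1 → fd n ρ.mem 19 rt = b →
      (∀ v < n, Feas A sz (S v) (fd n ρ.mem 18 v) (fd n ρ.mem 19 v)) →
      (∀ k, n ≤ k → k < kk → Consistent sz L R op S (fd n ρ.mem 18) (fd n ρ.mem 19) k) →
      s ≤ t + 3 * n * ((c + 1) * 1000 + 4000) + 100 → Q ρ s) :
    wp M B backtrack Q σ t := by
  have hC := h.toCtx
  have ⟨_, hnp, hcells, hbound⟩ := hC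
  have hcap := h.cap
  have hkk := h.le
  have hkk' := h.le'
  obtain ⟨J, hJ⟩ : ∃ J : ℕ → Store → Prop, ∀ a τ, J a τ ↔ Stored n c kk L R op τ ∧
    Filled n c A sz S kk τ.mem ∧ fd n τ.mem 18 rt = 1 ∧ fd n τ.mem 19 rt = b ∧
    (∀ k < kk, fd n τ.mem 18 k ≤ 2 ∧ fd n τ.mem 19 k ≤ c ∧
      Feas A sz (S k) (fd n τ.mem 18 k) (fd n τ.mem 19 k)) ∧
    ∀ k, kk - a ≤ k → k < kk →
      Consistent sz L R op S (fd n τ.mem 18) (fd n τ.mem 19) k := ⟨_, fun _ _ => Iff.rfl⟩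
  refine wp_for hC J (kk - n) ((c + 1) * 1000 + 3000) (by omega) ((hJ _ _).2
    ⟨hσ.set_reg (by omega), hf, by simp [h18 rt hrk], by simp [h19 rt hrk], fun k hk => ?_,
      by omega⟩) ?_ ?_ ?_
  · rw [h18 k hk, h19 k hk]
    split_ifs with hkr
    · exact ⟨by omega, hb, hkr ▸ hfe⟩
    · exact ⟨by omega, by omega, feas_empty (by omega)⟩
  · intro a τ _ hτ _
    have := ((hJ _ _).1 hτ).1.1
    simp [this.1, this.2.2]
  · intro a τ u ha hτ r10
    obtain ⟨hst, hf, hr18, hr19, hfeas, hcons⟩ := (hJ _ _).1 hτ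
    obtain ⟨⟨r0, r1, r3⟩, -⟩ := id hst
    obtain ⟨k, hk⟩ : ∃ k, k = kk - 1 - a := ⟨_, rfl⟩
    have hkn : n ≤ k := by omega
    have hkk2 : k < kk := by omega
    obtain ⟨hL, hR⟩ := h.line.lt k hkn hkk2
    obtain ⟨f1, f2, f3⟩ := hfeas k hkk2
    obtain ⟨htl, -⟩ := hf (L k) (by omega)
    obtain ⟨htr, -⟩ := hf (R k) (by omega)
    have harcs := h.line.arcs k hkn hkk2
    have hpos : ∀ k < kk, ∀ v ∈ S k, 0 < sz v := fun k hk v hv =>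
      h.pos v (mem_range.1 (h.line.sub k hk hv))
    -- the part of all vertices is not a subpart
    have hroot' : L k ≠ rt ∧ R k ≠ rt := by
      obtain ⟨x, hx⟩ := h.line.nonempty (L k) (by omega)
      obtain ⟨y, hy⟩ := h.line.nonempty (R k) (by omega)
      constructor
      · intro he
        have := hroot ▸ h.line.sub (R k) (by omega) hy
        rw [← he] at this
        exact (harcs y this y hy).1 rfl
      · intro he
        have := hroot ▸ h.line.sub (L k) (by omega) hx
        rw [← he] at this
        exact (harcs x hx x this).1 rfl
    refine wp_seq (wp_set hC (by simp) (by simp [r3, r10]; omega) fun s1 hs1 => ?_)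
    simp only [Expr.val_sub, Expr.val_reg, Expr.val_ofNat, r3, r10, ← hk]
    refine wp_seq (loadPart_spec h (hst.set_reg (by omega)) (k := k) hkk2 (by simp)
      hkn fun ρ s2 hmem hreg h4 h5 h6 hs2 => ?_)
    replace hmem : ρ.mem = τ.mem := hmem
    have q0 : ρ.reg 0 = n := (hreg 0 (by omega) (by omega) (by omega)).trans (by simpa using r0)
    have q1 : ρ.reg 1 = c := (hreg 1 (by omega) (by omega) (by omega)).trans (by simpa using r1)
    have q3 : ρ.reg 3 = kk := (hreg 3 (by omega) (by omega) (by omega)).trans (by simpa using r3)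
    have q7 : ρ.reg 7 = k := (hreg 7 (by omega) (by omega) (by omega)).trans (by simp)
    have q10 : ρ.reg 10 = a := (hreg 10 (by omega) (by omega) (by omega)).trans (by simpa using r10)
    rw [← hmem] at hf hr18 hr19 hfeas hcons f1 f2 f3 htl htr
    have hstρ : Stored n c kk L R op ρ := ⟨⟨q0, q1, q3⟩, hmem ▸ hst.2⟩
    refine wp_seq (wp_set hC (by simp [q0, q7]; omega) (by simp [q0, q7]; omega) fun s3 hs3 => ?_)
    simp [q0, q7]
    refine wp_seq (wp_set hC (by simp [q0, q7]; omega) (by simp [q0, q7]; omega) fun s4 hs4 => ?_)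
    simp [q0, q7]
    refine wp_seq (search_spec h (b := kk) le_rfl (by simpa using hf) (by simpa using q0)
      (by simpa using q1) (by simpa using h4) (by simpa using h5) (by simpa using h6) (by simp)
      (by simp) (by omega) (by omega) f2 f1 fun υ s5 hmem' hreg' hno hyes hs5 => ?_)
    replace hmem' : υ.mem = ρ.mem := hmem'
    have u0 : υ.reg 0 = n := (hreg' 0 (by omega)).trans (by simpa using q0)
    have u1 : υ.reg 1 = c := (hreg' 1 (by omega)).trans (by simpa using q1)
    have u3 : υ.reg 3 = kk := (hreg' 3 (by omega)).trans (by simpa using q3)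
    have u4 : υ.reg 4 = L k := (hreg' 4 (by omega)).trans (by simpa using h4)
    have u5 : υ.reg 5 = R k := (hreg' 5 (by omega)).trans (by simpa using h5)
    have u6 : υ.reg 6 = op k := (hreg' 6 (by omega)).trans (by simpa using h6)
    have u10 : υ.reg 10 = a := (hreg' 10 (by omega)).trans (by simpa using q10)
    have u11 : υ.reg 11 = fd n ρ.mem 19 k := (hreg' 11 (by omega)).trans (by simp)
    have u12 : υ.reg 12 = fd n ρ.mem 18 k := (hreg' 12 (by omega)).trans (by simp)
    have hsp : Split A sz (S (L k)) (S (R k)) (op k) (fd n ρ.mem 18 k) (fd n ρ.mem 19 k)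
        (υ.reg 14 - 1) := by
      refine hyes fun hh => ?_
      have h1 := f3
      rw [h.line.union k hkn hkk2, feas_union (h.line.nonempty _ (by omega))
        (h.line.nonempty _ (by omega)) harcs (hpos _ (by omega)) (hpos _ (by omega))] at h1
      obtain ⟨s₁, hs₁⟩ := h1
      exact hno hh s₁ hs₁
    have hstυ : Stored n c kk L R op υ := ⟨⟨u0, u1, u3⟩, by rw [hmem', hmem]; exact hst.2⟩
    rw [← hmem'] at hf hr18 hr19 hfeas hcons f1 f2 htl htr hsp u11 u12
    refine assignParts_spec h u0 u4 u5 u6 u11 u12 rfl (by omega) (by omega) f2 hsp.1 f1 htl htr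
      rfl rfl fun ω s6 hmω hregω hs6 => ?_
    obtain ⟨d1, d2⟩ := h.line.distribute hkn (a := a) (by omega) (by omega) hsp hfeas hcons
      (f' := fd n ω.mem 18) (g' := fd n ω.mem 19) (fun j => by simp [hmω, fd_upd])
      (fun j => by simp [hmω, fd_upd])
    refine ⟨(hregω 10 (by omega)).trans u10, by linarith, (hJ _ _).2 ⟨?_, fun k' hk' => ?_, ?_, ?_, d1, d2⟩⟩
    · refine Stored.set_reg ⟨⟨(hregω 0 (by omega)).trans u0, (hregω 1 (by omega)).trans u1,
        (hregω 3 (by omega)).trans u3⟩, fun k' hk' => ?_⟩ (by omega)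
      rw [hmω]
      simpa [fd_upd] using hstυ.2 k' hk'
    · obtain ⟨h1, h2⟩ := hf k' hk'
      rw [hmω]
      refine ⟨by simpa [fd_upd] using h1, fun s hs m hm => ?_⟩
      rw [tb_upd (by omega) (by omega), tb_upd (by omega) (by omega), tb_upd (by omega) (by omega),
        tb_upd (by omega) (by omega)]
      exact h2 s hs m hm
    · simp [hmω, fd_upd, hroot'.1.symm, hroot'.2.symm, hr18]
    · simp [hmω, fd_upd, hroot'.1.symm, hroot'.2.symm, hr19]
  · intro τ s hτ _ hs
    obtain ⟨hst, hf, hr18, hr19, hfeas, hcons⟩ := (hJ _ _).1 hτ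
    refine hQ τ s hst hr18 hr19 (fun v hv => (hfeas v (by omega)).2.2)
      (fun k hk => hcons k (by omega)) (hs.trans ?_)
    have : (kk - n) * ((c + 1) * 1000 + 3000 + 100) ≤ 3 * n * ((c + 1) * 1000 + 4000) :=
      Nat.mul_le_mul (by omega) (by omega)
    omega

theorem writeOutput_spec (hC : Ctx M B n) (h0 : σ.reg 0 = n)
    (hQ : ∀ ρ s, (∀ v < n, ρ.mem v = 1 ↔ 0 < fd n σ.mem 19 v) → s ≤ t + n * 400 + 100 → Q ρ s) :
    wp M B writeOutput Q σ t := by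
  have ⟨_, hnp, hcells, hbound⟩ := hC
  obtain ⟨J, hJ⟩ : ∃ J : ℕ → Store → Prop, ∀ a τ, J a τ ↔ τ.reg 0 = n ∧
    (∀ i ≥ n, τ.mem i = σ.mem i) ∧ ∀ v < a, τ.mem v = 1 ↔ 0 < fd n σ.mem 19 v :=
    ⟨_, fun _ _ => Iff.rfl⟩
  refine wp_for hC J n 300 (by omega) ((hJ _ _).2 ⟨by simpa using h0, fun _ _ => rfl,
    by omega⟩) ?_ ?_ ?_
  · intro a τ _ hτ _
    simpa using ((hJ _ _).1 hτ).1
  · intro a τ s ha hτ r10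
    obtain ⟨r0, hmem, hout⟩ := (hJ _ _).1 hτ
    have h19 : fd n τ.mem 19 a = fd n σ.mem 19 a := hmem _ (by omega)
    refine wp_store hC.toEnv rfl rfl (by simp) (by simp [r10]; omega) (by simp [r0, r10]; omega)
      (le_trans (b := 1) (by simp only [Expr.val_lt]; split <;> omega) (by omega)) ?_
    simp [r0, r10, h19]
    refine ⟨by decide, (hJ _ _).2 ⟨by simpa using r0, fun i hi => ?_, fun v hv => ?_⟩⟩
    · simp [show i ≠ a by omega, hmem i hi]
    · by_cases hva : v = a
      · subst hva; simp
      · simp [hva, hout v (by omega)]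
  · intro τ s hτ _ hs
    exact hQ τ s ((hJ _ _).1 hτ).2.2 (by omega)

end


/-! ### The whole program -/

/-- The program for the subset sum problem with weak digraph constraint on directed co-graphs. -/
def solve : Program :=
  buildTree ;; sortVertices ;; climb ;; fillLeaves ;; fillParts ;; findBest ;; backtrack ;;
  writeOutput

theorem InsertInv.congr {δ : ℕ → ℕ → ℕ} {n x nw : ℕ} {C : ℕ → Finset ℕ} {m m' : ℕ → ℕ}
    (h : InsertInv δ n x nw C m) (hm : ∀ j < 10, ∀ a, fd n m' j a = fd n m j a) :
    InsertInv δ n x nw C m' :=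
  ⟨h.state.congr fun j hj => hm j (by omega), h.le, h.le', fun j hj hj' a => by
    rw [hm j (by omega)]; exact h.stamp j hj hj' a⟩

theorem solve_time {n c : ℕ} (hn : 0 < n) (hc : 0 < c) :
    3000 + (n * 2000 + 2000) + (n * 10000 + 1000) + (n * ((c + 1) * 1000 + 1000) + 100) +
      (3 * n * ((c + 1) * ((c + 1) * 3000 + 3000) + 2000) + 100) + ((c + 1) * 500 + 1000) +
      (3 * n * ((c + 1) * 1000 + 4000) + 100) + (n * 400 + 100) ≤ 200000 * (n * c ^ 4) := by
  have h1 : c + 1 ≤ 2 * c := by omega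
  have h2 : c ≤ c ^ 4 := Nat.le_self_pow (by omega) c
  have h3 : c ^ 2 ≤ c ^ 4 := Nat.pow_le_pow_right hc (by omega)
  have e1 : n * c ≤ n * c ^ 4 := Nat.mul_le_mul_left n h2
  have e2 : n * c ^ 2 ≤ n * c ^ 4 := Nat.mul_le_mul_left n h3
  have e3 : n ≤ n * c := Nat.le_mul_of_pos_right n hc
  have e4 : c ≤ n * c := Nat.le_mul_of_pos_left c hn
  nlinarith

theorem solve_spec {M : Machine} {B n c : ℕ} {Q : Store → ℕ → Prop} {t : ℕ} {A : ℕ → ℕ → Prop}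
    {sz : ℕ → ℕ} (hC : Ctx M B n) (hA : Adj M n A)
    (hU : IsUltra (colour A) (range (n + 1))) (hn : M.entry 0 0 = n) (hc : M.entry 0 1 = c)
    (htr : ∀ a b c, A a b → ¬ A b a → A b c → ¬ A c b → A a c ∧ ¬ A c a)
    (hkey : ∀ a b, A a b → ¬ A b a → M.key n a < M.key n b) (hirr : ∀ v, ¬ A v v)
    (hlen : ∀ v < n, (M.row (2 + n + v)).length ≤ n)
    (hsize : ∀ v < n, M.entry 1 v = sz v) (hpos : ∀ v < n, 0 < sz v)
    (htotal : ∑ v ∈ range n, sz v ≤ B) (hroom : 193 * n + 16 * (n * (c + 1)) ≤ M.cells)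
    (hcap : c + 100 ≤ B) (hc0 : 0 < c)
    (hQ : ∀ ρ s, ∀ X ⊆ range n, (∀ v < n, ρ.mem v = 1 ↔ v ∈ X) → ∑ v ∈ X, sz v ≤ c →
      Good A 1 (range n) X → (∀ Y ⊆ range n, ∑ v ∈ Y, sz v ≤ c →
        Good A 1 (range n) Y → ∑ v ∈ Y, sz v ≤ ∑ v ∈ X, sz v) →
      s ≤ t + M.load n n * 41000 + 200000 * (n * c ^ 4) → Q ρ s) :
    wp M B solve Q Store.init t := by
  refine wp_seq (buildTree_spec hC hA hU hn hc fun τ1 s1 nw C p0 p1 hI hz1 hs1 => ?_)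
  refine wp_seq (sortVertices_spec hC p0 hlen (hz1 16 (by omega) (by omega))
    fun τ2 s2 hF2 hord hs2 => ?_)
  have q0 : τ2.reg 0 = n := (hF2.reg 0).trans p0
  have q1 : τ2.reg 1 = c := (hF2.reg 1).trans p1
  have hI2 : InsertInv (colour A) n (n + 1) nw C τ2.mem :=
    hI.congr fun j hj => hF2.2 j (by omega) (by simp; omega)
  refine wp_seq (climb_spec hC q0 hI2 htr (rk := rank n (M.key n))
    (fun a b h1 h2 => rank_lt_rank (hA.lt a b h1).1 (Or.inl (hkey a b h1 h2)))
    (fun u hu v hv => rank_inj hu hv) (fun v => rank_lt) (fun i hi => ?_)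
    (fun a => ((hF2.fd 10) a).trans (hz1 10 (by omega) (by omega) a))
    fun τ3 s3 S hF3 hle hle' hline hrk hroot hs3 => ?_)
  · obtain ⟨v, hv, rfl⟩ := exists_rank_eq (n := n) (key := M.key n) hi
    rw [hord v hv]
    exact ⟨hv, rfl⟩
  have hP : Parts M B n c (τ3.reg 3) A sz (fd n τ3.mem 12) (fd n τ3.mem 13) (fd n τ3.mem 14) S :=
    ⟨hC, hline, hle, hle', hsize, hpos, hirr, htotal, hroom, hcap⟩
  refine wp_seq (fillLeaves_spec hP ⟨⟨(hF3.reg 0).trans q0,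
    (hF3.reg 1).trans q1, rfl⟩, fun k _ => ⟨rfl, rfl, rfl⟩⟩
    fun τ4 s4 hst4 hf4 hfr4 hs4 => ?_)
  refine wp_seq (fillParts_spec hP hst4 hf4 fun τ5 s5 hst5 hf5 hfr5 hs5 => ?_)
  have hz : ∀ j, j = 18 ∨ j = 19 → ∀ k < 4 * n, fd n τ5.mem j k = 0 := by
    intro j hj k hk
    rw [hfr5 j (by omega) (by omega) k (by omega), hfr4 j (by omega) (by omega) k (by omega),
      hF3.2 j (by omega) (by simp; omega), hF2.2 j (by omega) (by simp; omega)]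
    exact hz1 j (by omega) (by omega) k
  refine wp_seq (findBest_spec hP hst5 (rt := fd n τ3.mem 11 (n + 1)) hf5 ?_ hrk
    (fun k hk => ⟨hz 18 (Or.inl rfl) k (by omega), hz 19 (Or.inr rfl) k (by omega)⟩)
    fun τ6 s6 b hst6 hf6 h18 h19 hb hfe hmax hs6 => ?_)
  · have := hC.n_pos
    rw [hfr5 11 (by omega) (by omega) _ (by omega), hfr4 11 (by omega) (by omega) _ (by omega)]
  refine wp_seq (backtrack_spec hP hst6 hf6 hrk hroot h18 h19 hb hfe
    fun τ7 s7 hst7 hr18 hr19 hleaf hcons hs7 => ?_)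
  refine writeOutput_spec hC hst7.1.1 fun ρ s hout hs => ?_
  have hX : ∀ v < n, v ∈ (range n).filter (fun v => 0 < fd n τ7.mem 19 v) ↔
      0 < fd n τ7.mem 19 v := fun v hv => by simp [hv]
  obtain ⟨h1, h2⟩ := hline.realize hpos hX hleaf hcons _ hrk
  rw [hroot] at h1 h2 hmax
  rw [inter_eq_left.2 (filter_subset _ _), hr19] at h1
  rw [hr18] at h2
  refine hQ ρ s _ (filter_subset _ _) (fun v hv => (hout v hv).trans (hX v hv).symm)
    (h1.trans_le hb) h2 (fun Y hY hYc hYg => ?_) ?_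
  · rw [h1]
    exact hmax _ hYc ⟨Y, hY, rfl, hYg⟩
  · have := solve_time hC.n_pos hc0
    omega


/-! ### Instances as machine inputs -/

namespace Instance

variable (I : Instance)

/-- The arcs of the digraph as a relation on natural numbers. -/
def Arc (u v : ℕ) : Prop := ∃ (hu : u < I.n) (hv : v < I.n), (⟨u, hu⟩, ⟨v, hv⟩) ∈ I.graph.arcs

/-- The sizes of the items, extended by `0`. -/
def sizeNat (v : ℕ) : ℕ := if h : v < I.n then I.size ⟨v, h⟩ else 0

variable {I}

theorem arc_iff (u v : Fin I.n) : I.Arc u v ↔ (u, v) ∈ I.graph.arcs :=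
  ⟨fun ⟨_, _, h⟩ => h, fun h => ⟨u.2, v.2, h⟩⟩

theorem mem_verts (v : Fin I.n) : v ∈ I.graph.verts := by rw [I.verts_eq]; exact mem_univ v

theorem colour_eq (u v : Fin I.n) : colour I.Arc (u + 1) (v + 1) = I.graph.col u v := by
  simp only [colour, Nat.succ_ne_zero, or_self, if_false, Nat.add_sub_cancel, arc_iff,
    FinDigraph.col]

theorem exists_fin {a : ℕ} (ha : a ∈ range (I.n + 1)) (h0 : a ≠ 0) :
    ∃ v : Fin I.n, a = v + 1 := by
  rw [mem_range] at ha
  exact ⟨⟨a - 1, by omega⟩, by simp; omega⟩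

theorem colour_zero_left (A : ℕ → ℕ → Prop) (a : ℕ) : colour A 0 a = 3 := by simp [colour]

theorem colour_zero_right (A : ℕ → ℕ → Prop) (a : ℕ) : colour A a 0 = 3 := by simp [colour]

theorem isUltra (hI : I.graph.IsDirectedCograph) :
    IsUltra (colour I.Arc) (range (I.n + 1)) := by
  refine ⟨colour_comm _, ?_, ?_⟩
  · intro a ha b hb c hc hab hbc hac
    by_cases h1 : a = 0
    · subst h1; right; right; rw [colour_zero_left, colour_zero_left]
    by_cases h2 : b = 0
    · subst h2; left; rw [colour_zero_left, colour_zero_right]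
    by_cases h3 : c = 0
    · subst h3; right; left; rw [colour_zero_right, colour_zero_right]
    obtain ⟨u, rfl⟩ := exists_fin ha h1
    obtain ⟨v, rfl⟩ := exists_fin hb h2
    obtain ⟨w, rfl⟩ := exists_fin hc h3
    simp only [colour_eq]
    exact hI.no_rainbow u (mem_verts u) v (mem_verts v) w (mem_verts w) (by rintro rfl; exact hab rfl)
      (by rintro rfl; exact hbc rfl) (by rintro rfl; exact hac rfl)
  · intro a ha b hb c hc d hd s t n1 n2 n3 n4 n5 n6 e1 e2 e3 e4 e5 e6
    by_cases h1 : a = 0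
    · subst h1; rw [← e1, ← e4, colour_zero_left, colour_zero_left]
    by_cases h2 : b = 0
    · subst h2; rw [← e1, ← e5, colour_zero_left, colour_zero_right]
    by_cases h3 : c = 0
    · subst h3; rw [← e2, ← e4, colour_zero_right, colour_zero_right]
    by_cases h4 : d = 0
    · subst h4; rw [← e3, ← e5, colour_zero_right, colour_zero_right]
    obtain ⟨u, rfl⟩ := exists_fin ha h1
    obtain ⟨v, rfl⟩ := exists_fin hb h2
    obtain ⟨w, rfl⟩ := exists_fin hc h3
    obtain ⟨x, rfl⟩ := exists_fin hd h4
    rw [colour_eq] at e1 e2 e3 e4 e5 e6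
    exact hI.no_path u (mem_verts u) v (mem_verts v) w (mem_verts w) x (mem_verts x) s t
      (by rintro rfl; exact n1 rfl) (by rintro rfl; exact n2 rfl) (by rintro rfl; exact n3 rfl)
      (by rintro rfl; exact n4 rfl) (by rintro rfl; exact n5 rfl) (by rintro rfl; exact n6 rfl)
      e1 e2 e3 e4 e5 e6

theorem arc_trans (hI : I.graph.IsDirectedCograph) (a b c : ℕ) (h1 : I.Arc a b) (h2 : ¬ I.Arc b a)
    (h3 : I.Arc b c) (h4 : ¬ I.Arc c b) : I.Arc a c ∧ ¬ I.Arc c a := by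
  obtain ⟨ha, hb, h1⟩ := h1
  obtain ⟨_, hc, h3⟩ := h3
  have e := fun u v => arc_iff (I := I) u v
  have := hI.asym_trans ⟨a, ha⟩ (mem_verts _) ⟨b, hb⟩ (mem_verts _) ⟨c, hc⟩ (mem_verts _) h1
    (fun hh => h2 ⟨_, _, hh⟩) h3 (fun hh => h4 ⟨_, _, hh⟩)
  exact ⟨⟨_, _, this.1⟩, fun ⟨_, _, hh⟩ => this.2 hh⟩

theorem sum_sizeNat (X : Finset (Fin I.n)) :
    ∑ v ∈ X.map Fin.valEmbedding, I.sizeNat v = I.total X := by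
  simp [Instance.total, sizeNat, sum_map]

theorem good_iff_weakDigraph (X : Finset (Fin I.n)) :
    Good I.Arc 1 (range I.n) (X.map Fin.valEmbedding) ↔ I.WeakDigraph X := by
  have hmem : ∀ v : Fin I.n, (v : ℕ) ∈ X.map Fin.valEmbedding ↔ v ∈ X := fun v => by
    simp [Fin.val_inj]
  rw [good_iff one_ne_zero]
  constructor
  · rintro h y ⟨h1, x, hx⟩
    rw [FinDigraph.preds, mem_filter] at hx
    rw [← hmem]
    refine h y (by simp) (Or.inr ⟨x, by simp, (arc_iff x y).2 hx.2⟩) fun z hz hzy => ?_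
    rw [mem_range] at hz
    rw [hmem ⟨z, hz⟩]
    refine h1 (mem_filter.2 ⟨mem_verts _, (arc_iff ⟨z, hz⟩ y).1 hzy⟩)
  · intro h y hy h1 h2
    rw [mem_range] at hy
    rw [hmem ⟨y, hy⟩]
    obtain ⟨x, hx, hxy⟩ := h1.resolve_left (by omega)
    rw [mem_range] at hx
    refine h _ ⟨fun z hz => ?_, ⟨x, hx⟩, ?_⟩
    · rw [FinDigraph.preds, mem_filter] at hz
      exact (hmem z).1 (h2 z (by simp) ((arc_iff z ⟨y, hy⟩).2 hz.2))
    · exact mem_filter.2 ⟨mem_verts _, (arc_iff ⟨x, hx⟩ ⟨y, hy⟩).1 hxy⟩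

section encode

variable {succ pred : Fin I.n → List (Fin I.n)} {M : Machine} (hM : M.input = I.encode succ pred)
include hM

theorem row_zero : M.row 0 = [I.n, I.cap] := by simp [Machine.row, hM, encode]

theorem row_one : M.row 1 = List.ofFn I.size := by simp [Machine.row, hM, encode]

theorem row_succ (v : Fin I.n) : M.row (2 + v) = (succ v).map Fin.val := by
  rw [Machine.row, hM, encode, show 2 + (v : ℕ) = v + 1 + 1 by omega, List.getD_cons_succ,
    List.getD_cons_succ, List.getD_append _ _ _ _ (by simp)]
  simp [List.getD_eq_getElem?_getD]

theorem row_pred (v : Fin I.n) : M.row (2 + I.n + v) = (pred v).map Fin.val := by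
  rw [Machine.row, hM, encode, show 2 + I.n + (v : ℕ) = I.n + v + 1 + 1 by omega,
    List.getD_cons_succ, List.getD_cons_succ, List.getD_append_right _ _ _ _ (by simp)]
  simp [List.getD_eq_getElem?_getD]

theorem row_cases (i : ℕ) : i = 0 ∨ i = 1 ∨ (∃ v : Fin I.n, i = 2 + v) ∨
    (∃ v : Fin I.n, i = 2 + I.n + v) ∨ M.row i = [] := by
  by_cases h1 : i < 2
  · omega
  by_cases h2 : i < 2 + I.n
  · exact Or.inr (Or.inr (Or.inl ⟨⟨i - 2, by omega⟩, by simp; omega⟩))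
  by_cases h3 : i < 2 + I.n + I.n
  · exact Or.inr (Or.inr (Or.inr (Or.inl ⟨⟨i - 2 - I.n, by omega⟩, by simp; omega⟩)))
  · refine Or.inr (Or.inr (Or.inr (Or.inr ?_)))
    rw [Machine.row, hM, encode]
    exact List.getD_eq_default _ _ (by simp; omega)

variable (h : I.AdjacencyLists succ pred)
include h

theorem adj : Adj M I.n I.Arc := by
  refine ⟨fun v hv => ?_, fun v hv u => ?_, fun v hv => ?_, fun v hv u => ?_,
    fun u v ⟨hu, hv, _⟩ => ⟨hu, hv⟩⟩
  · rw [row_succ hM ⟨v, hv⟩]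
    exact (h.succ_nodup _).map Fin.val_injective
  · rw [row_succ hM ⟨v, hv⟩, List.mem_map]
    constructor
    · rintro ⟨w, hw, rfl⟩
      exact ⟨hv, w.2, (h.mem_succ _ w).1 hw⟩
    · rintro ⟨_, hu, hh⟩
      exact ⟨⟨u, hu⟩, (h.mem_succ _ _).2 hh, rfl⟩
  · rw [row_pred hM ⟨v, hv⟩]
    exact (h.pred_nodup _).map Fin.val_injective
  · rw [row_pred hM ⟨v, hv⟩, List.mem_map]
    constructor
    · rintro ⟨w, hw, rfl⟩
      exact ⟨w.2, hv, (h.mem_pred _ w).1 hw⟩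
    · rintro ⟨hu, _, hh⟩
      exact ⟨⟨u, hu⟩, (h.mem_pred _ _).2 hh, rfl⟩

omit hM in
theorem succ_length (v : Fin I.n) :
    (succ v).length = (univ.filter fun u => (v, u) ∈ I.graph.arcs).card := by
  rw [← List.toFinset_card_of_nodup (h.succ_nodup v)]
  congr 1
  ext u
  simp [h.mem_succ]

omit hM in
theorem pred_length (v : Fin I.n) :
    (pred v).length = (univ.filter fun u => (u, v) ∈ I.graph.arcs).card := by
  rw [← List.toFinset_card_of_nodup (h.pred_nodup v)]
  congr 1
  ext u
  simp [h.mem_pred]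

theorem key_lt (hI : I.graph.IsDirectedCograph) (a b : ℕ) (h1 : I.Arc a b) (h2 : ¬ I.Arc b a) :
    M.key I.n a < M.key I.n b := by
  obtain ⟨ha, hb, h1⟩ := h1
  have hlt := hI.bal_lt _ (mem_verts _) _ (mem_verts _) h1 fun hh => h2 ⟨hb, ha, hh⟩
  have hbal : ∀ v : Fin I.n, I.graph.bal v = (succ v).length - (pred v).length := by
    intro v
    rw [FinDigraph.bal, I.verts_eq, sum_sub_distrib, sum_boole, sum_boole,
      succ_length h, pred_length h]
  have hle : ∀ v : Fin I.n, (succ v).length ≤ I.n := by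
    intro v
    rw [succ_length h]
    exact (card_le_univ _).trans (by simp)
  have e1 := hle ⟨a, ha⟩
  have e2 := hle ⟨b, hb⟩
  rw [hbal, hbal] at hlt
  simp only [Machine.key, row_succ hM ⟨a, ha⟩, row_succ hM ⟨b, hb⟩, row_pred hM ⟨a, ha⟩,
    row_pred hM ⟨b, hb⟩, List.length_map]
  omega

theorem load_eq : M.load I.n I.n = 2 * I.m + I.n := by
  have h1 : ∑ v, (succ v).length = I.m := by
    simp only [succ_length h]
    rw [m, card_eq_sum_card_fiberwise (f := Prod.fst) (t := univ) (by simp)]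
    refine sum_congr rfl fun v _ => card_bij (fun u _ => (v, u)) ?_ ?_ ?_
    · simp
    · simp
    · rintro ⟨x, y⟩ hxy
      rw [mem_filter] at hxy
      obtain ⟨hh, rfl⟩ := hxy
      exact ⟨y, by simpa using hh, rfl⟩
  have h2 : ∑ v, (pred v).length = I.m := by
    simp only [pred_length h]
    rw [m, card_eq_sum_card_fiberwise (f := Prod.snd) (t := univ) (by simp)]
    refine sum_congr rfl fun v _ => card_bij (fun u _ => (u, v)) ?_ ?_ ?_
    · simp
    · simp
    · rintro ⟨x, y⟩ hxy
      rw [mem_filter] at hxy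
      obtain ⟨hh, rfl⟩ := hxy
      exact ⟨x, by simpa using hh, rfl⟩
  rw [Machine.load, sum_range]
  simp only [row_succ hM, row_pred hM, List.length_map, sum_add_distrib, h1, h2]
  simp
  omega

omit h in
theorem entry_le (i j : ℕ) : M.entry i j ≤ I.n + I.cap + ∑ v, I.size v := by
  have hx : ∀ l : List (Fin I.n), (l.map Fin.val).getD j 0 ≤ I.n := by
    intro l
    rw [List.getD_eq_getElem?_getD]
    by_cases hj : j < l.length
    · simp [hj, (l[j]).2.le]
    · simp [not_lt.1 hj]
  rw [Machine.entry]
  rcases row_cases hM i with rfl | rfl | ⟨v, rfl⟩ | ⟨v, rfl⟩ | h0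
  · rw [row_zero hM]
    rcases j with _ | _ | j <;> simp <;> omega
  · rw [row_one hM, List.getD_eq_getElem?_getD]
    by_cases hj : j < I.n
    · have := single_le_sum (f := I.size) (fun _ _ => Nat.zero_le _)
        (mem_univ (⟨j, hj⟩ : Fin I.n))
      simp [hj]; omega
    · simp [hj]
  · rw [row_succ hM]; exact (hx _).trans (by omega)
  · rw [row_pred hM]; exact (hx _).trans (by omega)
  · simp [h0]

theorem row_length_le (i : ℕ) : (M.row i).length ≤ I.n + 2 := by
  have e1 : ∀ v, (succ v).length ≤ I.n := fun v => by
    rw [succ_length h]; exact (card_le_univ _).trans (by simp)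
  have e2 : ∀ v, (pred v).length ≤ I.n := fun v => by
    rw [pred_length h]; exact (card_le_univ _).trans (by simp)
  rcases row_cases hM i with rfl | rfl | ⟨v, rfl⟩ | ⟨v, rfl⟩ | h0
  · simp [row_zero hM]
  · simp [row_one hM]
  · rw [row_succ hM, List.length_map]; have := e1 v; omega
  · rw [row_pred hM, List.length_map]; have := e2 v; omega
  · simp [h0]

end encode

end Instance


namespace Instance

/-- A bound for everything that the program stores; as `n + c + ∑ s ≥ 3`, an eighth power leaves room
for the constants. -/
def bound (I : Instance) : ℕ := (I.n + I.cap + ∑ v, I.size v) ^ 8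

theorem two_mul_add_le (I : Instance) : 2 * I.n + I.cap ≤ I.n + I.cap + ∑ v, I.size v := by
  have : ∑ v : Fin I.n, 1 ≤ ∑ v, I.size v := sum_le_sum fun v _ => I.size_pos v
  simp at this
  omega

theorem bound_ge (I : Instance) :
    729 * ((I.n + I.cap + ∑ v, I.size v) * (I.n + I.cap + ∑ v, I.size v)) ≤ I.bound := by
  have h1 := I.two_mul_add_le
  have h2 := I.n_pos
  have h3 := I.cap_pos
  have h : 3 ≤ I.n + I.cap + ∑ v, I.size v := by omega
  rw [bound]
  generalize I.n + I.cap + ∑ v, I.size v = b at h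
  calc 729 * (b * b) = 3 ^ 6 * (b * b) := by norm_num
    _ ≤ b ^ 6 * (b * b) := Nat.mul_le_mul_right _ (Nat.pow_le_pow_left h 6)
    _ = b ^ 8 := by ring

theorem ctx (I : Instance) {succ pred : Fin I.n → List (Fin I.n)}
    (h : I.AdjacencyLists succ pred) {K : ℕ} (hK : 1000 ≤ K) :
    Ctx { input := I.encode succ pred
          cells := K * (I.n * I.cap ^ 2)
          range := (I.n + I.cap + ∑ v, I.size v) ^ K } I.bound I.n := by
  have h1 := I.two_mul_add_le
  have h2 := I.n_pos
  have h3 := I.cap_pos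
  have h4 := I.bound_ge
  have hb : I.n + I.cap + ∑ v, I.size v ≤ (I.n + I.cap + ∑ v, I.size v) *
    (I.n + I.cap + ∑ v, I.size v) := Nat.le_mul_self _
  have hn : I.n * I.n ≤ (I.n + I.cap + ∑ v, I.size v) *
    (I.n + I.cap + ∑ v, I.size v) := Nat.mul_le_mul (by omega) (by omega)
  refine ⟨⟨by omega, ?_, fun i j => (entry_le rfl i j).trans (by omega),
    fun i => (row_length_le rfl h i).trans (by omega)⟩, h2, ?_, by omega⟩
  · rw [bound, ← pow_mul]
    exact Nat.pow_lt_pow_right (by omega) (show 8 * 80 < K by omega)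
  · exact Nat.mul_le_mul (by omega) (Nat.le_mul_of_pos_right _ (by positivity))

theorem map_output {I : Instance} {ρ : Store} {X : Finset ℕ} (hX : X ⊆ range I.n)
    (h : ∀ v < I.n, ρ.mem v = 1 ↔ v ∈ X) : X = (output I ρ).map Fin.valEmbedding := by
  ext v
  simp only [output, mem_map, mem_filter, mem_univ, true_and, Fin.valEmbedding_apply]
  constructor
  · exact fun hv => have hn := mem_range.1 (hX hv); ⟨⟨v, hn⟩, (h v hn).2 hv, rfl⟩
  · rintro ⟨w, hw, rfl⟩
    exact (h w w.2).1 hw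

end Instance

end SSGW

open SSGW Instance Finset in
theorem theorem3p7 :
    ∃ (P : SSGW.Program) (K : ℕ),
      ∀ (I : SSGW.Instance), I.graph.IsDirectedCograph →
        ∀ (succ pred : Fin I.n → List (Fin I.n)), I.AdjacencyLists succ pred →
          ∃ (σ : SSGW.Store) (t : ℕ),
            SSGW.Runs
              { input := I.encode succ pred
                cells := K * (I.n * I.cap ^ 2)
                range := (I.n + I.cap + ∑ v, I.size v) ^ K }
              P SSGW.Store.init σ t ∧
            t ≤ K * (I.n * I.cap ^ 4 + I.m) ∧
            I.Optimal (SSGW.output I σ) := by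
  -- any constant above `640` suffices for the range, the other bounds need a few hundred thousand
  refine ⟨solve, 1000000, fun I hI succ pred h => ?_⟩
  have hC := I.ctx h (K := 1000000) (by norm_num)
  have hcells : 1000000 * (I.n * I.cap ^ 2) ≤ Machine.cells
    { input := I.encode succ pred
      cells := 1000000 * (I.n * I.cap ^ 2)
      range := (I.n + I.cap + ∑ v, I.size v) ^ 1000000 } := le_rfl
  have hM : Machine.input
    { input := I.encode succ pred
      cells := 1000000 * (I.n * I.cap ^ 2)
      range := (I.n + I.cap + ∑ v, I.size v) ^ 1000000 } = I.encode succ pred := rfl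
  generalize ({
    input := I.encode succ pred
    cells := 1000000 * (I.n * I.cap ^ 2)
    range := (I.n + I.cap + ∑ v, I.size v) ^ 1000000 } : Machine) = M at hC hcells hM ⊢
  have hsub : ∀ Y : Finset (Fin I.n), Y.map Fin.valEmbedding ⊆ range I.n := by
    intro Y v hv
    obtain ⟨w, -, rfl⟩ := mem_map.1 hv
    simp
  have hsum : ∑ v ∈ range I.n, I.sizeNat v = ∑ v, I.size v := by
    simp [sum_range, sizeNat]
  have hb := I.bound_ge
  have hb' : I.n + I.cap + ∑ v, I.size v ≤ (I.n + I.cap + ∑ v, I.size v) *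
    (I.n + I.cap + ∑ v, I.size v) := Nat.le_mul_self _
  have h2 := I.n_pos
  have h3 := I.cap_pos
  have key := solve_spec (A := I.Arc) (sz := I.sizeNat) (c := I.cap) (t := 0)
    (Q := fun ρ s => s ≤ 1000000 * (I.n * I.cap ^ 4 + I.m) ∧ I.Optimal (output I ρ))
    hC (adj hM h) (isUltra hI) (by simp [Machine.entry, row_zero hM])
    (by simp [Machine.entry, row_zero hM]) (arc_trans hI) (key_lt hM h hI)
    (fun v ⟨_, _, hv⟩ => I.graph.not_arc_self _ hv) ?_ ?_ ?_ ?_ ?_ ?_ h3 ?_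
  -- initially all registers and cells contain `0`
  · obtain ⟨σ, t, hr, -, ht, ho⟩ := key ⟨fun _ => Nat.zero_le _, fun _ => Nat.zero_le _⟩
    exact ⟨σ, t, hr, by omega, ho⟩
  · intro v hv
    rw [row_pred hM ⟨v, hv⟩, List.length_map, pred_length h]
    exact (card_le_univ _).trans (by simp)
  · intro v hv
    simp [Machine.entry, row_one hM, sizeNat, hv, List.getD_eq_getElem?_getD]
  · intro v hv
    simp [sizeNat, hv, I.size_pos]
  · rw [hsum]; omega
  · have e1 : I.n ≤ I.n * I.cap ^ 2 := Nat.le_mul_of_pos_right _ (by positivity)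
    have e2 : I.n * I.cap ≤ I.n * I.cap ^ 2 :=
      Nat.mul_le_mul_left _ (Nat.le_self_pow (by norm_num) _)
    have e3 : I.n * (I.cap + 1) = I.n * I.cap + I.n := by ring
    omega
  · omega
  · intro ρ s X hX hm hle hg hmax hs
    obtain rfl := map_output hX hm
    rw [sum_sizeNat] at hle hmax
    rw [good_iff_weakDigraph] at hg
    refine ⟨?_, ⟨hle, hg⟩, fun Y hY => ?_⟩
    · have e1 : I.n ≤ I.n * I.cap ^ 4 := Nat.le_mul_of_pos_right _ (by positivity)
      rw [load_eq hM h] at hs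
      omega
    · rw [← sum_sizeNat]
      exact hmax _ (hsub Y) ((sum_sizeNat Y).trans_le hY.1) ((good_iff_weakDigraph Y).2 hY.2)
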